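/- **Conventions.** Chain complexes are complexes of abelian groups, graded by $\mathbb Z$, with differential of degree $-1$; $\mathrm{Ch}$ is the dg-category of chain complexes, and $V[n]_*=V_{*-n}$. A *prop* $\mathcal E$ is a strict symmetric monoidal dg-category with monoid of objects $(\mathbb N,+,0)$; its monoidal product on morphisms is also written $+$. Morphisms compose in diagrammatic order, $f\cdot g\in\mathcal E(n,m)$ for $f\in\mathcal E(n,p)$, $g\in\mathcal E(p,m)$, and act on the right of dg-functors $\Phi:\mathcal E\to\mathrm{Ch}$, written $x\cdot f$, and on the left of dg-functors $\Psi:\mathcal E^{op}\to\mathrm{Ch}$, written $f\cdot x$; all these structure maps are chain maps. An *$A_\infty$-multiplication* $i$ on $\mathcal E$ is a map of props $\mathcal A_\infty\to\mathcal E$, i.e. a choice of elements $m_k\in\mathcal E(k,1)_{k-2}$, $k\ge2$, with $$d\,m_k=-\sum_{r,s\ge 2,\ r+s=k+1}\ \sum_{a=0}^{s-1}(-1)^{(r-1)(a+1)}\,(\mathrm{id}_a+m_r+\mathrm{id}_{s-1-a})\cdot m_s .$$ *$\mathcal E$ has units* if there is moreover a cycle $u\in\mathcal E(0,1)_0$ with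 $(u+\mathrm{id}_1)\cdot m_2=\mathrm{id}_1=(\mathrm{id}_1+u)\cdot m_2$ and $(\mathrm{id}_a+u+\mathrm{id}_{k-1-a})\cdot m_k=0$ for $k>2$, $0\le a\le k-1$. For $n\ge1$ let $T_n\in\mathcal E(n,n)_0$ be $(-1)^{n-1}$ times the cyclic permutation moving the last entry to the front, and for $n>k\ge1$ let $f_{n,k}\in\mathcal E(n,k)_{n-k-1}$ be the Hochschild element $$f_{n,k}=\sum_{s=0}^{n-1}T_n^{s}\cdot(-1)^{n-k+1}(m_{n-k+1}+\mathrm{id}_{k-1})\cdot T_k^{b(s)},\qquad b(s)=0\ \text{if } s\le n-k,\quad b(s)=n-s\ \text{otherwise.}$$ For $\Phi:\mathcal E\to\mathrm{Ch}$ the *Hochschild complex* $C(\Phi):\mathcal E\to\mathrm{Ch}$ is $C(\Phi)(m)=\bigoplus_{n\ge1}\Phi(n+m)\otimes l_n$ with $|l_n|=n-1$, $$d(x\otimes l_n)=dx\otimes l_n+(-1)^{|x|}\sum_{k<n}x\cdot(f_{n,k}+\mathrm{id}_m)\otimes l_k,\qquad (x\otimes l_n)\cdot f=(-1)^{(n-1)|f|}\,x\cdot(\mathrm{id}_n+f)\otimes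 l_n ,$$ and $C(\theta)(x\otimes l_n)=\theta(x)\otimes l_n$ for a morphism $\theta$ of any degree in $\mathrm{Fun}(\mathcal E,\mathrm{Ch})$. For $\Psi:\mathcal E^{op}\to\mathrm{Ch}$ the *coHochschild complex* $D(\Psi):\mathcal E^{op}\to\mathrm{Ch}$ consists in degree $e$ of the families $h=(h(l_n))_{n\ge1}$ with $h(l_n)\in\Psi(n+m)_{n-1+e}$, with $$(dh)(l_n)=(-1)^{n-1}\Big(d(h(l_n))-\sum_{k<n}(f_{n,k}+\mathrm{id}_m)\cdot h(l_k)\Big),\qquad (f\cdot h)(l_n)=(-1)^{(n-1)|f|}(\mathrm{id}_n+f)\cdot h(l_n).$$ If $\mathcal E$ has units, let $u_{n,a}=\mathrm{id}_a+u+\mathrm{id}_{n-1-a}\in\mathcal E(n-1,n)$. The *reduced Hochschild complex* $\overline C(\Phi)$ is the quotient of $C(\Phi)$ by the subcomplex spanned by the elements $x\cdot(u_{n,a}+\mathrm{id}_m)\otimes l_n$, $1\le a\le n-1$, and the *reduced coHochschild complex* $\overline D(\Psi)$ is the subcomplex of the $h\in D(\Psi)$ with $(u_{n,a}+\mathrm{id}_m)\cdot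 h(l_n)=0$ for all $1\le a\le n-1$. The complex of *formal operations* $$\mathrm{Nat}_{\mathcal E}\big((m_1,n_1),(m_2,n_2)\big)$$ is the complex of enriched natural transformations (of all degrees) between the dg-functors $\mathrm{Fun}(\mathcal E,\mathrm{Ch})\to\mathrm{Ch}$, $\Phi\mapsto C^{n_1}(\Phi)(m_1)$ and $\Phi\mapsto C^{n_2}(\Phi)(m_2)$, with differential $(d\nu)(x)=(-1)^{|x|}(d(\nu(x))-\nu(dx))$; $\overline{\mathrm{Nat}}_{\mathcal E}$ is defined in the same way with $\overline C$. Finally $D^{n_1}C^{n_2}\mathcal E(-,-)(m_1,m_2)$ is obtained by applying $D^{n_1}$ to the dg-functor $p\mapsto C^{n_2}(\mathcal E(p,-))(m_2)$ on $\mathcal E^{op}$ and evaluating at $m_1$; similarly for $\overline D^{n_1}\overline C^{n_2}\mathcal E(-,-)(m_1,m_2)$. **Theorem.** Let $(\mathcal E,i)$ be a prop with $A_\infty$-multiplication and $m_1,n_1,m_2,n_2\ge0$. 1. There is an isomorphism of chain complexes $\mathrm{Nat}_{\mathcal E}((m_1,n_1),(m_2,n_2))\cong D^{n_1}C^{n_2}\mathcal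 E(-,-)(m_1,m_2)$. 2. Explicitly, $\mathrm{Nat}_{\mathcal E}((m_1,n_1),(m_2,n_2))$ is isomorphic to the complex $$\prod_{j_1,\dots,j_{n_1}\ge1}\ \bigoplus_{k_1,\dots,k_{n_2}\ge1}\mathcal E(j+m_1,k+m_2)[k-j+n_1-n_2],\qquad j=\sum_s j_s,\ k=\sum_s k_s,$$ with differential $$(dg)_{\underline j}=(-1)^{j-n_1}\Big(d'(g_{\underline j})-\sum_{s=1}^{n_1}\sum_{q=1}^{j_s-1}(-1)^{\left(\sum_{r<s}(j_r-1)\right)(j_s-q)}\,f^{\underline j}_{s,q}\cdot g_{\underline j[s\to q]}\Big),$$ where $\underline j[s\to q]$ is $\underline j$ with $j_s$ replaced by $q$, where $f^{\underline j}_{s,q}=\mathrm{id}_{j_1+\dots+j_{s-1}}+f_{j_s,q}+\mathrm{id}_{j_{s+1}+\dots+j_{n_1}+m_1}$, and where $d'$ sends an element $x\in\mathcal E(j+m_1,k+m_2)$ of the summand $\underline k$ to $d_{\mathcal E}x$ in the same summand plus, for each $s$ and each $1\le q<k_s$, the element $(-1)^{|x|+\left(\sum_{r<s}(k_r-1)\right)(k_s-q)}\,x\cdot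 f^{\underline k}_{s,q}$ in the summand $\underline k[s\to q]$ (here $f^{\underline k}_{s,q}$ is defined with $m_2$ in place of $m_1$, and $|x|$ is the degree of $x$ in $\mathcal E$). 3. If $\mathcal E$ has units, there is an isomorphism of chain complexes $\overline{\mathrm{Nat}}_{\mathcal E}((m_1,n_1),(m_2,n_2))\cong\overline D^{n_1}\overline C^{n_2}\mathcal E(-,-)(m_1,m_2)$, and the complexes $\overline{\mathrm{Nat}}_{\mathcal E}((m_1,n_1),(m_2,n_2))$ and $\mathrm{Nat}_{\mathcal E}((m_1,n_1),(m_2,n_2))$ are quasi-isomorphic, i.e. connected by a zigzag of quasi-isomorphisms. -/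

import Mathlib

universe u v

namespace FormalOps

/-- The Koszul sign `(-1)^a`. -/
def sg (a : ℤ) : ℤ := (a.negOnePow : ℤ)

/-- A chain complex of abelian groups, graded by `ℤ`, with differential of degree `-1`.
The degrees of the differential are given by an equation, so that no transport is needed. -/
structure Cplx : Type (u + 1) where
  X : ℤ → Type u
  [grp : ∀ i, AddCommGroup (X i)]
  d : ∀ {i j : ℤ}, j + 1 = i → X i →+ X j
  d_d : ∀ {i j k : ℤ} (h : j + 1 = i) (h' : k + 1 = j) (x : X i), d h' (d h x) = 0

attribute [instance] Cplx.grp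

/-- A prop in chain complexes: a strict symmetric monoidal dg-category whose monoid of objects is
`(ℕ, +, 0)`. Composition is written in diagrammatic order (morphisms act on the right), so that
`Hom n p ⊗ Hom p m → Hom n m` is a chain map. Sizes and degrees of composites and of monoidal
products are given by equations. -/
structure DGProp : Type (u + 1) where
  Hom : ℕ → ℕ → Cplx.{u}
  id : ∀ n, (Hom n n).X 0
  comp : ∀ {n p m : ℕ} {a b c : ℤ}, a + b = c →
    (Hom n p).X a →+ (Hom p m).X b →+ (Hom n m).X c
  id_comp : ∀ {n m : ℕ} {a : ℤ} (h : 0 + a = a) (f : (Hom n m).X a), comp h (id n) f = f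
  comp_id : ∀ {n m : ℕ} {a : ℤ} (h : a + 0 = a) (f : (Hom n m).X a), comp h f (id m) = f
  comp_assoc : ∀ {n p q m : ℕ} {a b c ab bc abc : ℤ} (h₁ : a + b = ab) (h₂ : ab + c = abc)
    (h₃ : b + c = bc) (h₄ : a + bc = abc)
    (f : (Hom n p).X a) (g : (Hom p q).X b) (k : (Hom q m).X c),
    comp h₂ (comp h₁ f g) k = comp h₄ f (comp h₃ g k)
  d_comp : ∀ {n p m : ℕ} {a b c a' b' c' : ℤ} (h : a + b = c) (ha : a' + 1 = a) (hb : b' + 1 = b)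
    (hc : c' + 1 = c) (h₁ : a' + b = c') (h₂ : a + b' = c')
    (f : (Hom n p).X a) (g : (Hom p m).X b),
    (Hom n m).d hc (comp h f g) =
      comp h₁ ((Hom n p).d ha f) g + sg a • comp h₂ f ((Hom p m).d hb g)
  /-- the monoidal product (written `+` on objects) -/
  tensor : ∀ {n m n' m' N M : ℕ} {a b c : ℤ}, n + n' = N → m + m' = M → a + b = c →
    (Hom n m).X a →+ (Hom n' m').X b →+ (Hom N M).X c
  tensor_id : ∀ {n m N : ℕ} (h : n + m = N) (h₀ : (0 : ℤ) + 0 = 0),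
    tensor h h h₀ (id n) (id m) = id N
  id_tensor : ∀ {n m : ℕ} {a : ℤ} (hn : 0 + n = n) (hm : 0 + m = m) (h : 0 + a = a)
    (f : (Hom n m).X a), tensor hn hm h (id 0) f = f
  tensor_id_zero : ∀ {n m : ℕ} {a : ℤ} (hn : n + 0 = n) (hm : m + 0 = m) (h : a + 0 = a)
    (f : (Hom n m).X a), tensor hn hm h f (id 0) = f
  tensor_assoc : ∀ {n₁ m₁ n₂ m₂ n₃ m₃ n₁₂ m₁₂ n₂₃ m₂₃ N M : ℕ} {a b c ab bc abc : ℤ}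
    (hn₁ : n₁ + n₂ = n₁₂) (hm₁ : m₁ + m₂ = m₁₂) (h₁ : a + b = ab)
    (hn₂ : n₁₂ + n₃ = N) (hm₂ : m₁₂ + m₃ = M) (h₂ : ab + c = abc)
    (hn₃ : n₂ + n₃ = n₂₃) (hm₃ : m₂ + m₃ = m₂₃) (h₃ : b + c = bc)
    (hn₄ : n₁ + n₂₃ = N) (hm₄ : m₁ + m₂₃ = M) (h₄ : a + bc = abc)
    (f : (Hom n₁ m₁).X a) (g : (Hom n₂ m₂).X b) (k : (Hom n₃ m₃).X c),
    tensor hn₂ hm₂ h₂ (tensor hn₁ hm₁ h₁ f g) k = tensor hn₄ hm₄ h₄ f (tensor hn₃ hm₃ h₃ g k)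
  tensor_comp : ∀ {n p m n' p' m' N P M : ℕ} {a b a' b' aa' bb' ab a'b' c : ℤ}
    (hN : n + n' = N) (hP : p + p' = P) (hM : m + m' = M) (haa : a + a' = aa') (hbb : b + b' = bb')
    (hab : a + b = ab) (hab' : a' + b' = a'b') (h₁ : aa' + bb' = c) (h₂ : ab + a'b' = c)
    (f : (Hom n p).X a) (f' : (Hom n' p').X a') (g : (Hom p m).X b) (g' : (Hom p' m').X b'),
    comp h₁ (tensor hN hP haa f f') (tensor hP hM hbb g g') =
      sg (a' * b) • tensor hN hM h₂ (comp hab f g) (comp hab' f' g')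
  d_tensor : ∀ {n m n' m' N M : ℕ} {a b c a' b' c' : ℤ} (hN : n + n' = N) (hM : m + m' = M)
    (h : a + b = c) (ha : a' + 1 = a) (hb : b' + 1 = b)
    (hc : c' + 1 = c) (h₁ : a' + b = c') (h₂ : a + b' = c')
    (f : (Hom n m).X a) (g : (Hom n' m').X b),
    (Hom N M).d hc (tensor hN hM h f g) =
      tensor hN hM h₁ ((Hom n m).d ha f) g + sg a • tensor hN hM h₂ f ((Hom n' m').d hb g)
  /-- the symmetry, exchanging a first block of size `n` and a second block of size `m` -/
  braid : ∀ (n m : ℕ) {N : ℕ}, n + m = N → (Hom N N).X 0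
  d_braid : ∀ {n m N : ℕ} (h : n + m = N) {j : ℤ} (hj : j + 1 = 0),
    (Hom N N).d hj (braid n m h) = 0
  braid_braid : ∀ {n m N : ℕ} (h : n + m = N) (h' : m + n = N) (h₀ : (0 : ℤ) + 0 = 0),
    comp h₀ (braid n m h) (braid m n h') = id N
  braid_zero : ∀ {n : ℕ} (h : n + 0 = n), braid n 0 h = id n
  braid_natural : ∀ {n m n' m' N M : ℕ} {a b c : ℤ} (hN : n + n' = N) (hM : m + m' = M)
    (hN' : n' + n = N) (hM' : m' + m = M) (h : a + b = c) (h' : b + a = c)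
    (hc : c + 0 = c) (hc' : 0 + c = c) (f : (Hom n m).X a) (g : (Hom n' m').X b),
    comp hc (tensor hN hM h f g) (braid m m' hM) =
      sg (a * b) • comp hc' (braid n n' hN) (tensor hN' hM' h' g f)
  hexagon : ∀ {n m p nm mp np N : ℕ} (h₁ : n + m = nm) (h₂ : nm + p = N)
    (h₄ : n + mp = N) (h₅ : n + p = np) (h₆ : m + np = N) (h₀ : (0 : ℤ) + 0 = 0),
    braid n mp h₄ =
      comp h₀ (tensor h₂ h₂ h₀ (braid n m h₁) (id p)) (tensor h₆ h₆ h₀ (id m) (braid n p h₅))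

/-- A dg-functor `E → Ch`, i.e. a right dg-module over `E`: the maps
`X n ⊗ Hom n m → X m` are chain maps. -/
structure RMod (E : DGProp.{u}) : Type (u + 1) where
  X : ℕ → Cplx.{u}
  act : ∀ {n m : ℕ} {a b c : ℤ}, a + b = c → (X n).X a →+ (E.Hom n m).X b →+ (X m).X c
  act_id : ∀ {n : ℕ} {a : ℤ} (h : a + 0 = a) (x : (X n).X a), act h x (E.id n) = x
  act_comp : ∀ {n p m : ℕ} {a b c ab bc abc : ℤ} (h₁ : a + b = ab) (h₂ : ab + c = abc)
    (h₃ : b + c = bc) (h₄ : a + bc = abc)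
    (x : (X n).X a) (f : (E.Hom n p).X b) (g : (E.Hom p m).X c),
    act h₂ (act h₁ x f) g = act h₄ x (E.comp h₃ f g)
  d_act : ∀ {n m : ℕ} {a b c a' b' c' : ℤ} (h : a + b = c) (ha : a' + 1 = a) (hb : b' + 1 = b)
    (hc : c' + 1 = c) (h₁ : a' + b = c') (h₂ : a + b' = c')
    (x : (X n).X a) (f : (E.Hom n m).X b),
    (X m).d hc (act h x f) = act h₁ ((X n).d ha x) f + sg a • act h₂ x ((E.Hom n m).d hb f)

/-- A dg-functor `Eᵒᵖ → Ch`, i.e. a left dg-module over `E`: the maps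
`Hom n m ⊗ X m → X n` are chain maps. -/
structure LMod (E : DGProp.{u}) : Type (u + 1) where
  X : ℕ → Cplx.{u}
  act : ∀ {n m : ℕ} {a b c : ℤ}, a + b = c → (E.Hom n m).X a →+ (X m).X b →+ (X n).X c
  id_act : ∀ {n : ℕ} {a : ℤ} (h : 0 + a = a) (x : (X n).X a), act h (E.id n) x = x
  comp_act : ∀ {n p m : ℕ} {a b c ab bc abc : ℤ} (h₁ : a + b = ab) (h₂ : ab + c = abc)
    (h₃ : b + c = bc) (h₄ : a + bc = abc)
    (f : (E.Hom n p).X a) (g : (E.Hom p m).X b) (x : (X m).X c),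
    act h₂ (E.comp h₁ f g) x = act h₄ f (act h₃ g x)
  d_act : ∀ {n m : ℕ} {a b c a' b' c' : ℤ} (h : a + b = c) (ha : a' + 1 = a) (hb : b' + 1 = b)
    (hc : c' + 1 = c) (h₁ : a' + b = c') (h₂ : a + b' = c')
    (f : (E.Hom n m).X a) (x : (X m).X b),
    (X n).d hc (act h f x) = act h₁ ((E.Hom n m).d ha f) x + sg a • act h₂ f ((X m).d hb x)

/-- The representable functor `E(p, -)`. -/
abbrev rep (E : DGProp.{u}) (p : ℕ) : RMod E where
  X m := E.Hom p m
  act h := E.comp h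
  act_id := E.comp_id
  act_comp := E.comp_assoc
  d_act := E.d_comp

theorem sg_zero : sg 0 = 1 := by simp [sg]

theorem sg_add (a b : ℤ) : sg (a + b) = sg a * sg b := by simp [sg, Int.negOnePow_add]

theorem sg_one : sg 1 = -1 := by simp [sg]

theorem sg_neg (a : ℤ) : sg (-a) = sg a := by simp [sg, Int.negOnePow_neg]

theorem sg_sub (a b : ℤ) : sg (a - b) = sg a * sg b := by rw [sub_eq_add_neg, sg_add, sg_neg]

theorem sg_mul_self (a : ℤ) : sg a * sg a = 1 := by
  simp [sg, ← Units.val_mul]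

theorem sg_congr {a b : ℤ} (h : Even (a - b)) : sg a = sg b := by
  unfold sg
  rw [(Int.negOnePow_eq_iff a b).2 h]

theorem sg_congr_neg {a b : ℤ} (h : Odd (a - b)) : sg a = -sg b := by
  have h1 : sg a = sg (b + 1) := sg_congr (by
    rcases h with ⟨k, hk⟩; exact ⟨k, by linarith⟩)
  rw [h1, sg_add, sg_one]; ring

/-- the transport along an equality of degrees -/
def Cplx.castHom (A : Cplx.{u}) {i j : ℤ} (h : i = j) : A.X i →+ A.X j := by
  subst h; exact AddMonoidHom.id _

/-- Maps of degree `t` between the underlying graded groups of two complexes. -/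
abbrev GrHom (A B : Cplx.{u}) (t : ℤ) : Type u := ∀ i, A.X i →+ B.X (i + t)

/-- The component `A_i → B_j` of a map of degree `t`, where `i + t = j`. -/
def GrHom.ap {A B : Cplx.{u}} {t : ℤ} (f : GrHom A B t) {i j : ℤ} (h : i + t = j) :
    A.X i →+ B.X j := (B.castHom h).comp (f i)

theorem GrHom.ap_add {A B : Cplx.{u}} {t : ℤ} (f g : GrHom A B t) {i j : ℤ} (h : i + t = j)
    (x : A.X i) : GrHom.ap (f + g) h x = GrHom.ap f h x + GrHom.ap g h x := by
  subst h; rfl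

theorem GrHom.ap_zero {A B : Cplx.{u}} {t : ℤ} {i j : ℤ} (h : i + t = j)
    (x : A.X i) : GrHom.ap (0 : GrHom A B t) h x = 0 := by
  subst h; rfl

theorem GrHom.ap_neg {A B : Cplx.{u}} {t : ℤ} (f : GrHom A B t) {i j : ℤ} (h : i + t = j)
    (x : A.X i) : GrHom.ap (-f) h x = -GrHom.ap f h x := by
  subst h; rfl

theorem GrHom.ap_mk {A B : Cplx.{u}} {t : ℤ} (F : ∀ i j : ℤ, i + t = j → (A.X i →+ B.X j))
    {i j : ℤ} (h : i + t = j) (x : A.X i) :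
    GrHom.ap (A := A) (B := B) (t := t) (fun i => F i (i + t) rfl) h x = F i j h x := by
  subst h; rfl

/-- Morphisms of degree `t` from `Φ` to `Φ'` in the dg-category `Fun(E, Ch)`: all natural families of
maps of degree `t`. They are written on the left of their argument, and `E` acts on
the right, so that naturality carries no sign. -/
def natSubgroup {E : DGProp.{u}} (Φ Φ' : RMod E) (t : ℤ) :
    AddSubgroup (∀ n, GrHom (Φ.X n) (Φ'.X n) t) where
  carrier := {θ | ∀ {n m : ℕ} {i j k a b : ℤ} (h₁ : i + a = b) (h₂ : b + t = k) (h₃ : i + t = j)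
    (h₄ : j + a = k) (x : (Φ.X n).X i) (g : (E.Hom n m).X a),
    (θ m).ap h₂ (Φ.act h₁ x g) = Φ'.act h₄ ((θ n).ap h₃ x) g}
  add_mem' := by
    intro θ θ' h h' n m i j k a b h₁ h₂ h₃ h₄ x g
    simp [GrHom.ap_add, h h₁ h₂ h₃ h₄ x g, h' h₁ h₂ h₃ h₄ x g]
  zero_mem' := by intros; simp [GrHom.ap_zero]
  neg_mem' := by
    intro θ h n m i j k a b h₁ h₂ h₃ h₄ x g
    simp [GrHom.ap_neg, h h₁ h₂ h₃ h₄ x g]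

/-- Morphisms of degree `t` in the dg-category `Fun(E, Ch)`. -/
def RHom {E : DGProp.{u}} (Φ Φ' : RMod E) (t : ℤ) : Type u := natSubgroup Φ Φ' t

instance {E : DGProp.{u}} (Φ Φ' : RMod E) (t : ℤ) : AddCommGroup (RHom Φ Φ' t) :=
  inferInstanceAs (AddCommGroup (natSubgroup Φ Φ' t))

namespace RHom

variable {E : DGProp.{u}} {Φ Φ' Φ'' : RMod E}

/-- The component `Φ(n)_i → Φ'(n)_j` of a morphism of degree `t`, where `i + t = j`. -/
def ap {t : ℤ} (θ : RHom Φ Φ' t) {n : ℕ} {i j : ℤ} (h : i + t = j) :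
    (Φ.X n).X i →+ (Φ'.X n).X j := (θ.1 n).ap h

theorem nat {t : ℤ} (θ : RHom Φ Φ' t) {n m : ℕ} {i j k a b : ℤ} (h₁ : i + a = b) (h₂ : b + t = k)
    (h₃ : i + t = j) (h₄ : j + a = k) (x : (Φ.X n).X i) (g : (E.Hom n m).X a) :
    θ.ap h₂ (Φ.act h₁ x g) = Φ'.act h₄ (θ.ap h₃ x) g :=
  θ.2 h₁ h₂ h₃ h₄ x g

theorem ext' {t : ℤ} {θ θ' : RHom Φ Φ' t}
    (H : ∀ (n : ℕ) (i j : ℤ) (h : i + t = j) (x : (Φ.X n).X i), θ.ap h x = θ'.ap h x) :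
    θ = θ' := by
  apply Subtype.ext; funext n i; ext x; exact H n i _ rfl x

theorem ap_add {t : ℤ} (θ θ' : RHom Φ Φ' t) {n : ℕ} {i j : ℤ} (h : i + t = j)
    (x : (Φ.X n).X i) : (θ + θ').ap h x = θ.ap h x + θ'.ap h x := GrHom.ap_add _ _ _ _

theorem ap_zero {t : ℤ} {n : ℕ} {i j : ℤ} (h : i + t = j)
    (x : (Φ.X n).X i) : (0 : RHom Φ Φ' t).ap h x = 0 := GrHom.ap_zero _ _

/-- A morphism of degree `t` from its components. -/
def mk' {t : ℤ} (F : ∀ (n : ℕ) (i j : ℤ), i + t = j → ((Φ.X n).X i →+ (Φ'.X n).X j))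
    (H : ∀ {n m : ℕ} {i j k a b : ℤ} (h₁ : i + a = b) (h₂ : b + t = k) (h₃ : i + t = j)
    (h₄ : j + a = k) (x : (Φ.X n).X i) (g : (E.Hom n m).X a),
    F m b k h₂ (Φ.act h₁ x g) = Φ'.act h₄ (F n i j h₃ x) g) : RHom Φ Φ' t :=
  ⟨fun n i => F n i (i + t) rfl, by
    intro n m i j k a b h₁ h₂ h₃ h₄ x g
    subst h₂ h₃
    exact H h₁ rfl rfl h₄ x g⟩

theorem ap_mk' {t : ℤ} (F : ∀ (n : ℕ) (i j : ℤ), i + t = j → ((Φ.X n).X i →+ (Φ'.X n).X j)) (H)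
    {n : ℕ} {i j : ℤ} (h : i + t = j) (x : (Φ.X n).X i) :
    (mk' (Φ := Φ) (Φ' := Φ') F H).ap h x = F n i j h x := by
  subst h; rfl

/-- The identity morphism. -/
def id (Φ : RMod E) : RHom Φ Φ 0 :=
  mk' (fun n _ _ h => (Φ.X n).castHom (by omega)) (by
    intro n m i j k a b h₁ h₂ h₃ h₄ x g
    obtain rfl : j = i := by omega
    obtain rfl : k = b := by omega
    rfl)

theorem id_ap {n : ℕ} {i : ℤ} (h : i + 0 = i) (x : (Φ.X n).X i) : (id Φ).ap h x = x := by
  unfold id; rw [ap_mk']; rfl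

/-- The composite `θ' ∘ θ`. -/
def comp {s t r : ℤ} (h : s + t = r) (θ' : RHom Φ' Φ'' s) (θ : RHom Φ Φ' t) : RHom Φ Φ'' r :=
  mk' (fun n i j hij => (θ'.ap (by omega)).comp (θ.ap (rfl : i + t = i + t))) (by
    intro n m i j k a b h₁ h₂ h₃ h₄ x g
    simp only [AddMonoidHom.comp_apply]
    rw [θ.nat h₁ rfl rfl (by omega : i + t + a = b + t), θ'.nat _ _ (by omega) h₄])

theorem comp_ap {s t r : ℤ} (h : s + t = r) (θ' : RHom Φ' Φ'' s) (θ : RHom Φ Φ' t)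
    {n : ℕ} {i j k : ℤ} (h₁ : i + r = k) (h₂ : i + t = j) (h₃ : j + s = k) (x : (Φ.X n).X i) :
    (comp h θ' θ).ap h₁ x = θ'.ap h₃ (θ.ap h₂ x) := by
  subst h₂; unfold comp; rw [ap_mk']; rfl

/-- The differential `θ ↦ d ∘ θ - (-1)^|θ| θ ∘ d`. -/
def diff {s t : ℤ} (h : s + 1 = t) (θ : RHom Φ Φ' t) : RHom Φ Φ' s :=
  mk' (fun n i j hij => ((Φ'.X n).d (by omega)).comp (θ.ap (by omega : i + t = j + 1)) -
      sg t • (θ.ap (by omega)).comp ((Φ.X n).d (by omega : i - 1 + 1 = i))) (by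
    intro n m i j k a b h₁ h₂ h₃ h₄ x g
    simp only [AddMonoidHom.sub_apply, AddMonoidHom.comp_apply, map_sub,
      map_zsmul, AddMonoidHom.coe_smul, Pi.smul_apply]
    rw [θ.nat h₁ (by omega) (by omega : i + t = j + 1) (by omega),
      Φ'.d_act (a' := j) (b' := a - 1) _ (by omega) (by omega) (by omega) (by omega) (by omega),
      Φ.d_act (a' := i - 1) (b' := a - 1) (c' := b - 1) _ (by omega) (by omega) (by omega)
        (by omega) (by omega), map_add, map_zsmul,
      θ.nat (j := j) _ _ (by omega) (by omega),
      θ.nat (j := j + 1) _ _ (by omega) (by omega)]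
    have e : sg (j + 1) = sg t * sg i := by rw [← sg_add]; congr 1; omega
    rw [e]
    module)

theorem diff_ap {s t : ℤ} (h : s + 1 = t) (θ : RHom Φ Φ' t) {n : ℕ} {i i' j j' : ℤ}
    (h₁ : i + s = j') (h₂ : i + t = j) (h₃ : j' + 1 = j) (h₄ : i' + 1 = i) (h₅ : i' + t = j')
    (x : (Φ.X n).X i) :
    (diff h θ).ap h₁ x =
      (Φ'.X n).d h₃ (θ.ap h₂ x) - sg t • θ.ap h₅ ((Φ.X n).d h₄ x) := by
  subst h₃
  obtain rfl : i' = i - 1 := by omega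
  unfold diff; rw [ap_mk']; rfl

end RHom

/-- A dg-endofunctor of `Fun(E, Ch)`. -/
structure EndoFun (E : DGProp.{u}) where
  obj : RMod E → RMod E
  map : ∀ {Φ Φ' : RMod E} {t : ℤ}, RHom Φ Φ' t →+ RHom (obj Φ) (obj Φ') t
  map_id : ∀ Φ : RMod E, map (RHom.id Φ) = RHom.id (obj Φ)
  map_comp : ∀ {Φ Φ' Φ'' : RMod E} {s t r : ℤ} (h : s + t = r) (θ' : RHom Φ' Φ'' s)
    (θ : RHom Φ Φ' t), map (RHom.comp h θ' θ) = RHom.comp h (map θ') (map θ)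
  map_diff : ∀ {Φ Φ' : RMod E} {s t : ℤ} (h : s + 1 = t) (θ : RHom Φ Φ' t),
    map (RHom.diff h θ) = RHom.diff h (map θ)

namespace EndoFun

variable {E : DGProp.{u}}

/-- The iterate `F ∘ ⋯ ∘ F` (`n` factors). -/
def iter (F : EndoFun E) : ℕ → EndoFun E
  | 0 => ⟨fun Φ => Φ, AddMonoidHom.id _, fun _ => rfl, fun _ _ _ => rfl, fun _ _ => rfl⟩
  | n + 1 =>
    { obj := fun Φ => F.obj ((F.iter n).obj Φ)
      map := F.map.comp (F.iter n).map
      map_id := fun Φ => by simp [EndoFun.map_id]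
      map_comp := fun h θ' θ => by simp [EndoFun.map_comp]
      map_diff := fun h θ => by simp [EndoFun.map_diff] }

/-- Left multiplication by `f ∈ E(p', p)`, as a morphism `E(p, -) → E(p', -)` of degree `|f|`. -/
def leftMul (p' p : ℕ) (a : ℤ) : (E.Hom p' p).X a →+ RHom (rep E p) (rep E p') a where
  toFun f := RHom.mk' (fun n i j h => E.comp (by omega) f) (by
    intro n m i j k a b h₁ h₂ h₃ h₄ x g
    exact (E.comp_assoc _ _ _ _ _ _ _).symm)
  map_zero' := by
    apply RHom.ext'; intro n i j h x
    rw [RHom.ap_zero]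
    refine (RHom.ap_mk' _ _ h x).trans ?_
    rw [map_zero]; rfl
  map_add' f g := by
    apply RHom.ext'; intro n i j h x
    rw [RHom.ap_add]
    refine (RHom.ap_mk' _ _ h x).trans ?_
    refine Eq.trans ?_ (congrArg₂ (· + ·) (RHom.ap_mk' _ _ h x) (RHom.ap_mk' _ _ h x)).symm
    rw [map_add]; rfl

theorem leftMul_ap {p' p : ℕ} {a : ℤ} (f : (E.Hom p' p).X a) {n : ℕ} {i j : ℤ} (h : i + a = j)
    (h' : a + i = j) (x : ((rep E p).X n).X i) :
    (leftMul p' p a f).ap (n := n) h x = E.comp h' f x := by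
  subst h; rfl

/-- For a dg-endofunctor `F` of `Fun(E, Ch)`, the dg-functor `p ↦ F(E(p, -))(m)` from
`Eᵒᵖ` to `Ch`, with functoriality in `p` induced by that of `E(p, -)`. -/
def onRep (F : EndoFun E) (m : ℕ) : LMod E where
  X p := (F.obj (rep E p)).X m
  act {p' p a b c} h :=
    { toFun := fun f => (F.map (leftMul p' p a f)).ap (by omega)
      map_zero' := by ext x; rw [map_zero, map_zero, RHom.ap_zero]; rfl
      map_add' := fun f g => by ext x; rw [map_add, map_add, RHom.ap_add]; rfl }
  id_act {p a} h x := by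
    have e : leftMul p p 0 (E.id p) = RHom.id (rep E p) := by
      apply RHom.ext'; intro n i j h x
      obtain rfl : j = i := by omega
      rw [RHom.id_ap, leftMul_ap _ _ (by omega)]
      exact E.id_comp (by omega) x
    change (F.map (leftMul p p 0 (E.id p))).ap _ x = x
    rw [e, F.map_id, RHom.id_ap]
  comp_act {n p q a b c ab bc abc} h₁ h₂ h₃ h₄ f g x := by
    have e : leftMul n q ab (E.comp h₁ f g) =
        RHom.comp h₁ (leftMul n p a f) (leftMul p q b g) := by
      apply RHom.ext'; intro n i j h x
      rw [RHom.comp_ap _ _ _ _ rfl (by omega), leftMul_ap _ _ (by omega),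
        leftMul_ap _ _ (by omega), leftMul_ap _ _ (by omega)]
      exact E.comp_assoc _ _ _ _ _ _ _
    change (F.map (leftMul n q ab (E.comp h₁ f g))).ap _ x = _
    rw [e, F.map_comp]
    exact RHom.comp_ap _ _ _ _ _ _ _
  d_act {n p a b c a' b' c'} h ha hb hc h₁ h₂ f x := by
    have e : leftMul n p a' ((E.Hom n p).d ha f) = RHom.diff ha (leftMul n p a f) := by
      apply RHom.ext'; intro q i j h x
      rw [RHom.diff_ap ha (j := i + a) (i' := i - 1) _ _ rfl (by omega) (by omega) (by omega),
        leftMul_ap _ _ (by omega), leftMul_ap _ _ (by omega), leftMul_ap _ _ (by omega)]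
      change E.comp _ _ _ = (E.Hom n q).d _ (E.comp _ f x) - sg a • E.comp _ f ((E.Hom p q).d _ x)
      rw [E.d_comp (a' := a') (b' := i - 1) _ ha (by omega) (by omega) (by omega) (by omega)]
      abel
    change (((F.obj (rep E n)).X m).d hc) ((F.map (leftMul n p a f)).ap _ x) =
      (F.map (leftMul n p a' ((E.Hom n p).d ha f))).ap (by omega) x +
        sg a • (F.map (leftMul n p a f)).ap (by omega) (((F.obj (rep E p)).X m).d hb x)
    rw [e, F.map_diff, RHom.diff_ap ha (j := c) (i' := b') _ _ (by omega) (by omega) (by omega)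
      (by omega)]
    abel

end EndoFun

/-- A dg-functor `Fun(E, Ch) → Ch`. -/
structure ChFun (E : DGProp.{u}) where
  obj : RMod E → Cplx.{u}
  map : ∀ {Φ Φ' : RMod E} {t : ℤ}, RHom Φ Φ' t →+ GrHom (obj Φ) (obj Φ') t
  map_id : ∀ (Φ : RMod E) {i : ℤ} (h : i + 0 = i) (x : (obj Φ).X i),
    (map (RHom.id Φ)).ap h x = x
  map_comp : ∀ {Φ Φ' Φ'' : RMod E} {s t r : ℤ} (h : s + t = r) (θ' : RHom Φ' Φ'' s)
    (θ : RHom Φ Φ' t) {i j k : ℤ} (h₁ : i + r = k) (h₂ : i + t = j) (h₃ : j + s = k)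
    (x : (obj Φ).X i), (map (RHom.comp h θ' θ)).ap h₁ x = (map θ').ap h₃ ((map θ).ap h₂ x)
  map_diff : ∀ {Φ Φ' : RMod E} {s t : ℤ} (h : s + 1 = t) (θ : RHom Φ Φ' t) {i i' j j' : ℤ}
    (h₁ : i + s = j') (h₂ : i + t = j) (h₃ : j' + 1 = j) (h₄ : i' + 1 = i) (h₅ : i' + t = j')
    (x : (obj Φ).X i), (map (RHom.diff h θ)).ap h₁ x =
      (obj Φ').d h₃ ((map θ).ap h₂ x) - sg t • (map θ).ap h₅ ((obj Φ).d h₄ x)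

/-- The composite of a dg-endofunctor of `Fun(E, Ch)` with the evaluation at `m`. -/
def EndoFun.eval {E : DGProp.{u}} (F : EndoFun E) (m : ℕ) : ChFun E where
  obj Φ := (F.obj Φ).X m
  map {Φ Φ' t} :=
    { toFun := fun θ => (F.map θ).1 m
      map_zero' := by rw [map_zero]; rfl
      map_add' := fun θ θ' => by rw [map_add]; rfl }
  map_id Φ i h x := by
    change (F.map (RHom.id Φ)).ap h x = x
    rw [F.map_id, RHom.id_ap]
  map_comp h θ' θ i j k h₁ h₂ h₃ x := by
    change (F.map (RHom.comp h θ' θ)).ap h₁ x = _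
    rw [F.map_comp]; exact RHom.comp_ap _ _ _ _ _ _ _
  map_diff h θ i i' j j' h₁ h₂ h₃ h₄ h₅ x := by
    change (F.map (RHom.diff h θ)).ap h₁ x = _
    rw [F.map_diff]; exact RHom.diff_ap _ _ _ _ _ _ _ _

/-- The (enriched) natural transformations of degree `e` between dg-functors
`F, G : Fun(E, Ch) → Ch`: the families `ν_Φ : F(Φ) → G(Φ)` of maps of degree `e` that are natural for
the morphisms of all degrees in `Fun(E, Ch)`. A transformation `ν` acts on the right of
its argument and the morphisms `θ` of `Fun(E, Ch)` on the left, hence there is no sign in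
`ν(θ x) = θ(ν x)`. -/
def natTransSubgroup {E : DGProp.{u}} (F G : ChFun E) (e : ℤ) :
    AddSubgroup (∀ Φ : RMod E, GrHom (F.obj Φ) (G.obj Φ) e) where
  carrier := {ν | ∀ {Φ Φ' : RMod E} {t : ℤ} (θ : RHom Φ Φ' t) {i j i' j' : ℤ} (h : i + e = j)
    (h' : i' + e = j') (h₁ : i + t = i') (h₂ : j + t = j') (x : (F.obj Φ).X i),
    (ν Φ').ap h' ((F.map θ).ap h₁ x) = (G.map θ).ap h₂ ((ν Φ).ap h x)}
  add_mem' := by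
    intro ν ν' h h' Φ Φ' t θ i j i' j' h₀ h₁ h₂ h₃ x
    simp [GrHom.ap_add, h θ h₀ h₁ h₂ h₃ x, h' θ h₀ h₁ h₂ h₃ x]
  zero_mem' := by intros; simp [GrHom.ap_zero]
  neg_mem' := by
    intro ν h Φ Φ' t θ i j i' j' h₀ h₁ h₂ h₃ x
    simp [GrHom.ap_neg, h θ h₀ h₁ h₂ h₃ x]

/-- Natural transformations of degree `e` between dg-functors `Fun(E, Ch) → Ch`. -/
def NatTrans {E : DGProp.{u}} (F G : ChFun E) (e : ℤ) : Type (u + 1) := natTransSubgroup F G e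

instance {E : DGProp.{u}} (F G : ChFun E) (e : ℤ) : AddCommGroup (NatTrans F G e) :=
  inferInstanceAs (AddCommGroup (natTransSubgroup F G e))

namespace NatTrans

variable {E : DGProp.{u}} {F G : ChFun E}

/-- The component `F(Φ)_i → G(Φ)_j`, where `i + e = j`. -/
def ap {e : ℤ} (ν : NatTrans F G e) (Φ : RMod E) {i j : ℤ} (h : i + e = j) :
    (F.obj Φ).X i →+ (G.obj Φ).X j := (ν.1 Φ).ap h

theorem nat {e : ℤ} (ν : NatTrans F G e) {Φ Φ' : RMod E} {t : ℤ} (θ : RHom Φ Φ' t)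
    {i j i' j' : ℤ} (h : i + e = j)
    (h' : i' + e = j') (h₁ : i + t = i') (h₂ : j + t = j') (x : (F.obj Φ).X i) :
    ν.ap Φ' h' ((F.map θ).ap h₁ x) = (G.map θ).ap h₂ (ν.ap Φ h x) :=
  ν.2 θ h h' h₁ h₂ x

theorem ext' {e : ℤ} {ν ν' : NatTrans F G e}
    (H : ∀ (Φ : RMod E) (i j : ℤ) (h : i + e = j) (x : (F.obj Φ).X i), ν.ap Φ h x = ν'.ap Φ h x) :
    ν = ν' := by
  apply Subtype.ext; funext Φ i; ext x; exact H Φ i _ rfl x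

theorem ap_add {e : ℤ} (ν ν' : NatTrans F G e) (Φ : RMod E) {i j : ℤ} (h : i + e = j)
    (x : (F.obj Φ).X i) : (ν + ν').ap Φ h x = ν.ap Φ h x + ν'.ap Φ h x := GrHom.ap_add _ _ _ _

theorem ap_zero {e : ℤ} (Φ : RMod E) {i j : ℤ} (h : i + e = j)
    (x : (F.obj Φ).X i) : (0 : NatTrans F G e).ap Φ h x = 0 := GrHom.ap_zero _ _

/-- The differential `(dν)(x) = (-1)^|x| (d(ν x) - ν(d x))`. -/
def diff {e e' : ℤ} (he : e' + 1 = e) (ν : NatTrans F G e) : NatTrans F G e' :=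
  ⟨fun Φ i => sg i • (((G.obj Φ).d (by omega)).comp (ν.ap Φ (rfl : i + e = i + e)) -
      (ν.ap Φ (by omega)).comp ((F.obj Φ).d (by omega : i - 1 + 1 = i))), by
    intro Φ Φ' t θ i j i' j' h h' h₁ h₂ x
    subst h h'
    have n1 := ν.nat θ (i := i) (j := i + e) (i' := i') (j' := i' + e) rfl rfl
      h₁ (by omega) x
    have n2 := ν.nat (RHom.diff (s := t - 1) (by omega) θ) (i := i) (j := i + e)
      (i' := i' - 1) (j' := i' + e') (by omega) (by omega) (by omega) (by omega) x
    have n3 := ν.nat θ (i := i - 1) (j := i + e') (i' := i' - 1) (j' := i' + e') (by omega)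
      (by omega) (by omega) (by omega) ((F.obj Φ).d (by omega) x)
    rw [F.map_diff _ θ (i' := i - 1) (j := i') _ h₁ (by omega) (by omega) (by omega),
      G.map_diff _ θ (i' := i + e') (j := i' + e) _ (by omega) (by omega) (by omega)
        (by omega), map_sub, map_zsmul, n3] at n2
    change sg i' • ((G.obj Φ').d _ (ν.ap Φ' _ _) - ν.ap Φ' _ ((F.obj Φ').d _ _)) =
      (G.map θ).ap _ (sg i • ((G.obj Φ).d _ (ν.ap Φ _ x) - ν.ap Φ _ _))
    rw [map_zsmul, map_sub, n1]
    have e1 : sg i' = sg i * sg t := by rw [← sg_add, h₁]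
    have e2 := sg_mul_self t
    rw [sub_eq_iff_eq_add] at n2
    rw [n2, e1]
    match_scalars
    · ring
    · linear_combination sg i * e2
    · linear_combination -sg i * e2⟩

theorem diff_ap {e e' : ℤ} (he : e' + 1 = e) (ν : NatTrans F G e) (Φ : RMod E) {i i' j j' : ℤ}
    (h₁ : i + e' = j') (h₂ : i + e = j) (h₃ : j' + 1 = j) (h₄ : i' + 1 = i) (h₅ : i' + e = j')
    (x : (F.obj Φ).X i) :
    (diff he ν).ap Φ h₁ x =
      sg i • ((G.obj Φ).d h₃ (ν.ap Φ h₂ x) - ν.ap Φ h₅ ((F.obj Φ).d h₄ x)) := by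
  subst h₁ h₂
  obtain rfl : i' = i - 1 := by omega
  rfl

end NatTrans

/-- The chain complex of natural transformations between dg-functors `Fun(E, Ch) → Ch`, with
differential `(dν)(x) = (-1)^|x| (d(ν x) - ν(d x))`. -/
def natCplx {E : DGProp.{u}} (F G : ChFun E) : Cplx.{u + 1} where
  X e := NatTrans F G e
  d {e e'} he :=
    { toFun := NatTrans.diff he
      map_zero' := by
        apply NatTrans.ext'; intro Φ i j h x
        rw [NatTrans.diff_ap he _ _ h (rfl : i + e = i + e) (by omega)
          (by omega : i - 1 + 1 = i) (by omega)]
        simp [NatTrans.ap_zero]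
      map_add' := fun ν ν' => by
        apply NatTrans.ext'; intro Φ i j h x
        simp only [NatTrans.ap_add, NatTrans.diff_ap he _ _ h (rfl : i + e = i + e) (by omega)
          (by omega : i - 1 + 1 = i) (by omega), map_add]
        module }
  d_d {e e' e''} he he' ν := by
    apply NatTrans.ext'; intro Φ i j h x
    change (NatTrans.diff he' (NatTrans.diff he ν)).ap Φ h x = _
    rw [NatTrans.diff_ap he' (ν.diff he) _ h (rfl : i + e' = i + e') (by omega)
          (by omega : i - 1 + 1 = i) (by omega),
      NatTrans.diff_ap he ν _ _ (rfl : i + e = i + e) (by omega)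
          (by omega : i - 1 + 1 = i) (by omega),
      NatTrans.diff_ap he ν (i' := i - 1 - 1) (j := i + e') _ _ (by omega) (by omega) (by omega)
          (by omega), map_zsmul, map_sub, Cplx.d_d, Cplx.d_d, map_zero,
      sg_congr_neg (show Odd (i - (i - 1)) by simp)]
    simp
    exact (NatTrans.ap_zero Φ h x).symm

/-- Auxiliary exponent: how far to rotate back after a multiplication of `p - q + 1` entries out
of `p + 1` entries that have been rotated `i` times. -/
def backRot (p q i : ℕ) : ℕ := if i ≤ p - q then 0 else p + 1 - i

/-- The `j ≤ q` with `backRot p q i + j = k` modulo `q + 1`. -/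
def fwdRot (p q i k : ℕ) : ℕ :=
  if backRot p q i ≤ k then k - backRot p q i else k + (q + 1) - backRot p q i

theorem backRot_pos {p q i : ℕ} (h : p - q < i) : backRot p q i = p + 1 - i :=
  if_neg (by omega)

theorem backRot_zero {p q i : ℕ} (h : i ≤ p - q) : backRot p q i = 0 := if_pos h

theorem fwdRot_of_le {p q i k b : ℕ} (hb : backRot p q i = b) (h : b ≤ k) :
    fwdRot p q i k = k - b := by
  subst hb; exact if_pos h

theorem fwdRot_of_lt {p q i k b : ℕ} (hb : backRot p q i = b) (h : k < b) :
    fwdRot p q i k = k + (q + 1) - b := by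
  subst hb; exact if_neg (by omega)

theorem backRot_disjoint {p r q i k i' : ℕ} (h1 : r < q) (h2 : q < p) (h3 : i < p + 1)
    (h4 : q - r + 1 ≤ k) (h5 : k < q + 1)
    (hi : (p + 1 - k ≤ i ∧ i' = i - (p + 1 - k)) ∨ (i < p + 1 - k ∧ i' = i + k)) :
    backRot (p + r - q) r (fwdRot p (p + r - q) i' (p + 1 - k)) + (q + 1 - k) =
      backRot q r (fwdRot p q i k) ∨
    backRot (p + r - q) r (fwdRot p (p + r - q) i' (p + 1 - k)) + (q + 1 - k) =
      backRot q r (fwdRot p q i k) + (r + 1) := by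
  by_cases hit : i ≤ p - q
  · rw [fwdRot_of_le (backRot_zero hit) (by omega), backRot_pos (p := q) (by omega),
      fwdRot_of_le (p := p) (i := i') (backRot_pos (by omega)) (by omega), backRot_zero (by omega)]
    omega
  · rcases hi with ⟨hi1, hi2⟩ | ⟨hi1, hi2⟩
    · rw [fwdRot_of_le (p := p) (q := q) (i := i) (backRot_pos (by omega)) (by omega)]
      by_cases hit' : i' ≤ q - r
      · rw [backRot_zero (p := q) (by omega), fwdRot_of_le (backRot_zero (by omega)) (by omega),
          backRot_pos (by omega)]
        omega
      · rw [backRot_pos (p := q) (by omega),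
          fwdRot_of_lt (p := p) (i := i') (backRot_pos (by omega)) (by omega),
          backRot_pos (by omega)]
        omega
    · rw [fwdRot_of_lt (p := p) (q := q) (i := i) (backRot_pos (by omega)) (by omega),
        backRot_pos (p := q) (by omega),
        fwdRot_of_le (p := p) (i := i') (backRot_pos (by omega)) (by omega),
        backRot_pos (by omega)]
      omega

/-- Combinatorial cancellation behind the vanishing of the square of the Hochschild differential. -/
theorem cyclic_cancel {M : Type*} [AddCommGroup M] (p r : ℕ) (A : ℕ → ℕ → ℕ → ℕ → M)
    (hL : ∀ i c q k, A (i + (p + 1)) c q k = A i c q k)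
    (hR : ∀ i c q k, A i (c + (r + 1)) q k = A i c q k)
    (hk : ∀ i c q k, A i c q (k + (q + 1)) = A i c q k)
    (hd : ∀ i e q c, r < q → q < p → 1 ≤ c → c ≤ r →
      A i (e + c) q (q + 1 - c) = - A (i + (p + 1 - (c + (p - q)))) e (p + r - q) (c + (p - q))) :
    (∑ q ∈ Finset.Ioo r p, ∑ i ∈ Finset.range (p + 1), ∑ a ∈ Finset.range (q - r + 1),
      A (i + (p + 1 - a)) (backRot p r i) q a) =
    ∑ q ∈ Finset.Ioo r p, ∑ i ∈ Finset.range (p + 1), ∑ j ∈ Finset.range (q + 1),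
      A i (backRot q r j) q (backRot p q i + j) := by
  have step1 : ∀ q ∈ Finset.Ioo r p, ∀ i ∈ Finset.range (p + 1),
      (∑ j ∈ Finset.range (q + 1), A i (backRot q r j) q (backRot p q i + j)) =
      ∑ k ∈ Finset.range (q + 1), A i (backRot q r (fwdRot p q i k)) q k := by
    intro q hq i hi
    rw [Finset.mem_Ioo] at hq
    rw [Finset.mem_range] at hi
    have hc : backRot p q i ≤ q := by unfold backRot; split_ifs <;> omega
    refine Finset.sum_bij' (fun j _ => if backRot p q i + j ≤ q then backRot p q i + j
        else backRot p q i + j - (q + 1)) (fun k _ => fwdRot p q i k) ?_ ?_ ?_ ?_ ?_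
    · intro j hj; rw [Finset.mem_range] at hj ⊢; split_ifs <;> omega
    · intro k hk; rw [Finset.mem_range] at hk ⊢; simp only [fwdRot]; split_ifs <;> omega
    · intro j hj; rw [Finset.mem_range] at hj; simp only [fwdRot]; split_ifs <;> omega
    · intro k hk; rw [Finset.mem_range] at hk; simp only [fwdRot]; split_ifs <;> omega
    · intro j hj
      rw [Finset.mem_range] at hj
      have e : fwdRot p q i (if backRot p q i + j ≤ q then backRot p q i + j
        else backRot p q i + j - (q + 1)) = j := by simp only [fwdRot]; split_ifs <;> omega
      rw [e]
      split_ifs with h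
      · rfl
      · conv_lhs => rw [show backRot p q i + j = backRot p q i + j - (q + 1) + (q + 1) by omega]
        rw [hk]
  have step2 : ∀ q ∈ Finset.Ioo r p, ∀ a ∈ Finset.range (q - r + 1),
      (∑ i ∈ Finset.range (p + 1), A (i + (p + 1 - a)) (backRot p r i) q a) =
      ∑ i ∈ Finset.range (p + 1), A i (backRot q r (fwdRot p q i a)) q a := by
    intro q hq a ha
    rw [Finset.mem_Ioo] at hq
    rw [Finset.mem_range] at ha
    refine Finset.sum_bij' (fun i _ => if a ≤ i then i - a else i + (p + 1) - a)
      (fun i _ => if i + a ≤ p then i + a else i + a - (p + 1)) ?_ ?_ ?_ ?_ ?_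
    · intro i hi; rw [Finset.mem_range] at hi ⊢; split_ifs <;> omega
    · intro i hi; rw [Finset.mem_range] at hi ⊢; split_ifs <;> omega
    · intro i hi; rw [Finset.mem_range] at hi; split_ifs <;> omega
    · intro i hi; rw [Finset.mem_range] at hi; split_ifs <;> omega
    · intro i hi
      rw [Finset.mem_range] at hi
      have e : backRot p r i =
          backRot q r (fwdRot p q (if a ≤ i then i - a else i + (p + 1) - a) a) := by
        simp only [fwdRot, backRot]; split_ifs <;> omega
      rw [← e]
      split_ifs with h
      · rw [show i + (p + 1 - a) = i - a + (p + 1) by omega, hL]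
      · rw [show i + (p + 1 - a) = i + (p + 1) - a by omega]
  have step3 : (∑ q ∈ Finset.Ioo r p, ∑ i ∈ Finset.range (p + 1),
      ∑ k ∈ Finset.Ico (q - r + 1) (q + 1), A i (backRot q r (fwdRot p q i k)) q k) = 0 := by
    simp only [Finset.sum_sigma']
    refine Finset.sum_involution (fun x _ => ⟨p + r - x.1,
      ⟨if p + 1 - x.2.2 ≤ x.2.1 then x.2.1 - (p + 1 - x.2.2) else x.2.1 + x.2.2,
        p + 1 - x.2.2⟩⟩) ?_ ?_ ?_ ?_
    · rintro ⟨q, ⟨i, k⟩⟩ hx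
      simp only [Finset.mem_sigma, Finset.mem_Ioo, Finset.mem_range, Finset.mem_Ico] at hx ⊢
      obtain ⟨⟨h1, h2⟩, h3, h4, h5⟩ := hx
      set i' := (if p + 1 - k ≤ i then i - (p + 1 - k) else i + k) with hi'
      have key := hd i (backRot (p + r - q) r (fwdRot p (p + r - q) i' (p + 1 - k))) q (q + 1 - k)
        h1 h2 (by omega) (by omega)
      rw [show q + 1 - (q + 1 - k) = k by omega, show q + 1 - k + (p - q) = p + 1 - k by omega] at key
      have e1 : A (i + (p + 1 - (p + 1 - k))) (backRot (p + r - q) r (fwdRot p (p + r - q) i' (p + 1 - k)))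
          (p + r - q) (p + 1 - k) = A i' (backRot (p + r - q) r (fwdRot p (p + r - q) i' (p + 1 - k)))
          (p + r - q) (p + 1 - k) := by
        rw [hi']
        split_ifs with h
        · rw [show i + (p + 1 - (p + 1 - k)) = i - (p + 1 - k) + (p + 1) by omega, hL]
        · rw [show i + (p + 1 - (p + 1 - k)) = i + k by omega]
      have e2 := backRot_disjoint (i' := i') h1 h2 h3 h4 h5 (by rw [hi']; split_ifs <;> omega)
      rw [e1] at key
      rcases e2 with e2 | e2
      · rw [e2] at key; rw [key]; simp
      · rw [e2, hR] at key; rw [key]; simp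
    · rintro ⟨q, ⟨i, k⟩⟩ hx _ heq
      simp only [Finset.mem_sigma, Finset.mem_Ioo, Finset.mem_range, Finset.mem_Ico] at hx
      simp only [Sigma.mk.injEq, heq_eq_eq] at heq
      obtain ⟨h1, h2, h3⟩ := heq
      split_ifs at h2 <;> omega
    · rintro ⟨q, ⟨i, k⟩⟩ hx
      simp only [Finset.mem_sigma, Finset.mem_Ioo, Finset.mem_range, Finset.mem_Ico] at hx ⊢
      refine ⟨⟨by omega, by omega⟩, by split_ifs <;> omega, by omega, by omega⟩
    · rintro ⟨q, ⟨i, k⟩⟩ hx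
      simp only [Finset.mem_sigma, Finset.mem_Ioo, Finset.mem_range, Finset.mem_Ico] at hx
      simp only [Sigma.mk.injEq, heq_eq_eq]
      refine ⟨by omega, by split_ifs <;> omega, by omega⟩
  calc _ = ∑ q ∈ Finset.Ioo r p, ∑ i ∈ Finset.range (p + 1), ∑ a ∈ Finset.range (q - r + 1),
        A i (backRot q r (fwdRot p q i a)) q a := by
        refine Finset.sum_congr rfl fun q hq => ?_
        rw [Finset.sum_comm, Finset.sum_congr rfl (step2 q hq), Finset.sum_comm]
    _ = ∑ q ∈ Finset.Ioo r p, ∑ i ∈ Finset.range (p + 1), ∑ k ∈ Finset.range (q + 1),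
        A i (backRot q r (fwdRot p q i k)) q k := by
        rw [← sub_eq_zero, ← neg_eq_zero, ← step3, ← Finset.sum_sub_distrib, ← Finset.sum_neg_distrib]
        refine Finset.sum_congr rfl fun q hq => ?_
        rw [← Finset.sum_sub_distrib, ← Finset.sum_neg_distrib]
        refine Finset.sum_congr rfl fun i hi => ?_
        rw [Finset.sum_Ico_eq_sub _ (by omega)]
        abel
    _ = _ := Finset.sum_congr rfl fun q hq => Finset.sum_congr rfl fun i hi => (step1 q hq i hi).symm

namespace DGProp

variable (E : DGProp.{u})

theorem d_id (n : ℕ) {j : ℤ} (hj : j + 1 = 0) : (E.Hom n n).d hj (E.id n) = 0 := by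
  have h := E.d_comp (n := n) (p := n) (m := n) (c' := j) (add_zero 0) hj hj hj (by omega)
    (by omega) (E.id n) (E.id n)
  rw [E.id_comp] at h
  obtain rfl : j = -1 := by omega
  rw [E.comp_id, E.id_comp, sg_zero, one_smul] at h
  simpa using h

/-- `id_a + f + id_b`. -/
def wh (a b : ℕ) {n m N M : ℕ} {c : ℤ} (hN : a + n + b = N) (hM : a + m + b = M) :
    (E.Hom n m).X c →+ (E.Hom N M).X c :=
  ((E.tensor hN hM (add_zero c)).flip (E.id b)).comp (E.tensor rfl rfl (zero_add c) (E.id a))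

theorem wh_apply (a b : ℕ) {n m N M : ℕ} {c : ℤ} (hN : a + n + b = N) (hM : a + m + b = M)
    (f : (E.Hom n m).X c) : E.wh a b hN hM f =
      E.tensor hN hM (add_zero c) (E.tensor rfl rfl (zero_add c) (E.id a) f) (E.id b) := rfl

theorem wh_id (a b : ℕ) {n N : ℕ} (hN hM : a + n + b = N) :
    E.wh a b hN hM (E.id n) = E.id N := by
  rw [wh_apply, E.tensor_id, E.tensor_id]

theorem wh_comp (a b : ℕ) {n p m N P M : ℕ} {c c' k : ℤ} (hN : a + n + b = N) (hP : a + p + b = P)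
    (hM : a + m + b = M) (h : c + c' = k) (f : (E.Hom n p).X c) (g : (E.Hom p m).X c') :
    E.comp h (E.wh a b hN hP f) (E.wh a b hP hM g) = E.wh a b hN hM (E.comp h f g) := by
  simp only [wh_apply]
  rw [E.tensor_comp (hab := h) (hab' := add_zero 0) (h₂ := by omega),
    E.tensor_comp (hab := add_zero 0) (hab' := h) (h₂ := by omega), E.id_comp, E.id_comp]
  simp [sg_zero]

theorem d_wh (a b : ℕ) {n m N M : ℕ} {c c' : ℤ} (hN : a + n + b = N) (hM : a + m + b = M)
    (h : c' + 1 = c) (f : (E.Hom n m).X c) :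
    (E.Hom N M).d h (E.wh a b hN hM f) = E.wh a b hN hM ((E.Hom n m).d h f) := by
  simp only [wh_apply]
  rw [E.d_tensor (a' := c') (b' := -1) (ha := h) (hb := by omega) (h₁ := by omega)
      (h₂ := by omega),
    E.d_tensor (a' := -1) (b' := c') (ha := by omega) (hb := h) (h₁ := by omega)
      (h₂ := by omega), E.d_id, E.d_id]
  simp [sg_zero]

theorem wh_apply' (a b : ℕ) {n m N M n' m' : ℕ} {c : ℤ} (hN : a + n + b = N) (hM : a + m + b = M)
    (hn : a + n = n') (hm : a + m = m') (hN' : n' + b = N) (hM' : m' + b = M)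
    (f : (E.Hom n m).X c) : E.wh a b hN hM f =
      E.tensor hN' hM' (add_zero c) (E.tensor hn hm (zero_add c) (E.id a) f) (E.id b) := by
  subst hn hm; rfl

theorem wh_wh (a b a' b' A B : ℕ) {n m N M N' M' : ℕ} {c : ℤ} (hN : a + N + b = N')
    (hM : a + M + b = M') (hN' : a' + n + b' = N) (hM' : a' + m + b' = M) (hA : a + a' = A)
    (hB : b' + b = B) (h₁ : A + n + B = N') (h₂ : A + m + B = M') (f : (E.Hom n m).X c) :
    E.wh a b hN hM (E.wh a' b' hN' hM' f) = E.wh A B h₁ h₂ f := by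
  rw [E.wh_apply a b, E.wh_apply a' b',
    ← E.tensor_assoc (hn₁ := (rfl : a + (a' + n) = _)) (hm₁ := (rfl : a + (a' + m) = _))
      (h₁ := zero_add c) (hn₂ := by omega) (hm₂ := by omega) (h₂ := add_zero c),
    ← E.tensor_assoc (hn₁ := hA) (hm₁ := hA)
      (h₁ := zero_add 0) (hn₂ := by omega) (hm₂ := by omega) (h₂ := zero_add c),
    E.tensor_assoc (hn₃ := hB) (hm₃ := hB) (h₃ := zero_add 0) (hn₄ := by omega) (hm₄ := by omega)
      (h₄ := add_zero c), E.tensor_id, E.tensor_id]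
  exact (E.wh_apply' _ _ _ _ _ _ _ _ f).symm

theorem wh_zero_left (b : ℕ) {n m N M : ℕ} {c : ℤ} (hN : 0 + n + b = N) (hM : 0 + m + b = M)
    (hN' : n + b = N) (hM' : m + b = M) (f : (E.Hom n m).X c) :
    E.wh 0 b hN hM f = E.tensor hN' hM' (add_zero c) f (E.id b) := by
  subst hN' hM'
  have : ∀ (n' m' : ℕ) (hn : 0 + n = n') (hm : 0 + m = m') (h1 : n' + b = n + b)
      (h2 : m' + b = m + b), E.tensor h1 h2 (add_zero c)
        (E.tensor hn hm (zero_add c) (E.id 0) f) (E.id b) =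
        E.tensor rfl rfl (add_zero c) f (E.id b) := by
    intro n' m' hn hm h1 h2
    obtain rfl : n' = n := by omega
    obtain rfl : m' = m := by omega
    rw [E.id_tensor]
  exact this _ _ _ _ _ _

theorem wh_zero_right (a : ℕ) {n m N M : ℕ} {c : ℤ} (hN : a + n + 0 = N) (hM : a + m + 0 = M)
    (hN' : a + n = N) (hM' : a + m = M) (f : (E.Hom n m).X c) :
    E.wh a 0 hN hM f = E.tensor hN' hM' (zero_add c) (E.id a) f := by
  subst hN' hM'
  rw [wh_apply, E.tensor_id_zero]

/-- Morphisms placed side by side commute up to the Koszul sign. -/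
theorem wh_disjoint {n m n' m' : ℕ} {a b c : ℤ} (f : (E.Hom n m).X a) (g : (E.Hom n' m').X b)
    {N P Q M b₁ b₂ x y e : ℕ} (h : a + b = c) (h' : b + a = c)
    (h₁ : 0 + n + b₁ = N) (h₂ : 0 + m + b₁ = P) (h₃ : x + n' + e = P) (h₄ : x + m' + e = M)
    (h₅ : y + n' + e = N) (h₆ : y + m' + e = Q) (h₇ : 0 + n + b₂ = Q) (h₈ : 0 + m + b₂ = M)
    (hx : m ≤ x) :
    E.comp h (E.wh 0 b₁ h₁ h₂ f) (E.wh x e h₃ h₄ g) =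
      sg (a * b) • E.comp h' (E.wh y e h₅ h₆ g) (E.wh 0 b₂ h₇ h₈ f) := by
  obtain ⟨z, rfl⟩ := Nat.exists_eq_add_of_le hx
  have e1 : E.wh (m + z) e h₃ h₄ g = E.tensor (n' := b₁) (m' := b₂) (by omega) (by omega)
      (zero_add b) (E.id m) (E.wh z e (by omega) (by omega) g) := by
    rw [← E.wh_zero_right m (by omega) (by omega)]
    exact (E.wh_wh m 0 z e (m + z) e _ _ _ _ rfl (by omega) _ _ g).symm
  have e2 : E.wh y e h₅ h₆ g = E.tensor (n' := b₁) (m' := b₂) (by omega) (by omega)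
      (zero_add b) (E.id n) (E.wh z e (by omega) (by omega) g) := by
    rw [← E.wh_zero_right n (by omega) (by omega)]
    exact (E.wh_wh n 0 z e y e _ _ _ _ (by omega) (by omega) _ _ g).symm
  rw [e1, e2, E.wh_zero_left b₁ _ _ (by omega) (by omega), E.wh_zero_left b₂ _ _ (by omega) (by omega),
    E.tensor_comp (hab := add_zero a) (hab' := zero_add b) (h₂ := h),
    E.tensor_comp (hab := zero_add a) (hab' := add_zero b) (h₂ := h),
    E.comp_id, E.id_comp, E.comp_id, E.id_comp, smul_smul]
  congr 1
  rw [mul_comm b a, sg_mul_self]; simp [sg_zero]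

/-- The rotation of `p + 1` entries which moves the last entry to the front. -/
def rot (p : ℕ) : (E.Hom (p + 1) (p + 1)).X 0 := E.braid p 1 rfl

/-- Its `i`-th power. -/
def rotPow (p : ℕ) : ℕ → (E.Hom (p + 1) (p + 1)).X 0
  | 0 => E.id (p + 1)
  | i + 1 => E.comp (zero_add 0) (rotPow p i) (E.rot p)

theorem braid_zero' {n : ℕ} (h : 0 + n = n) : E.braid 0 n h = E.id n := by
  have := E.braid_braid (n := n) (m := 0) (add_zero n) h (add_zero 0)
  rwa [E.braid_zero, E.id_comp] at this

theorem hexagon' {A B S AB N AS BS : ℕ} (hAB : A + B = AB) (h : AB + S = N) (hBS : B + S = BS)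
    (h₁ : A + BS = N) (hAS : A + S = AS) (h₂ : AS + B = N) :
    E.braid AB S h = E.comp (add_zero 0)
      (E.tensor h₁ h₁ (add_zero 0) (E.id A) (E.braid B S hBS))
      (E.tensor h₂ h₂ (add_zero 0) (E.braid A S hAS) (E.id B)) := by
  set Y := E.comp (add_zero 0)
      (E.tensor h₁ h₁ (add_zero 0) (E.id A) (E.braid B S hBS))
      (E.tensor h₂ h₂ (add_zero 0) (E.braid A S hAS) (E.id B)) with hY
  have key : E.comp (add_zero 0) (E.braid S AB (by omega : S + AB = N)) Y = E.id N := by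
    rw [E.hexagon (n := S) (m := A) (p := B) (nm := AS) (np := BS) (by omega) (by omega)
      (by omega) (by omega) (by omega) (add_zero 0), hY,
      E.comp_assoc (h₃ := add_zero 0) (h₄ := add_zero 0),
      ← E.comp_assoc (h₁ := add_zero 0) (h₂ := add_zero 0) (f := E.tensor _ _ _ (E.id A) _),
      E.tensor_comp (hab := add_zero 0) (hab' := add_zero 0) (h₂ := add_zero 0),
      E.braid_braid, E.id_comp, E.tensor_id]
    simp only [mul_zero, sg_zero, one_smul]
    rw [E.id_comp, E.tensor_comp (hab := add_zero 0) (hab' := add_zero 0) (h₂ := add_zero 0),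
      E.braid_braid, E.id_comp, E.tensor_id]
    simp only [mul_zero, sg_zero, one_smul]
  have := congrArg (E.comp (add_zero 0) (E.braid AB S h)) key
  rw [← E.comp_assoc (h₁ := add_zero 0) (h₂ := add_zero 0), E.braid_braid, E.id_comp,
    E.comp_id] at this
  exact this.symm

theorem braid_mul {A B S N : ℕ} (h₁ : A + B + S = N) (h₂ : S + A + B = N) (h₃ : A + (B + S) = N) :
    E.comp (add_zero 0) (E.braid (A + B) S h₁) (E.braid (S + A) B h₂) = E.braid A (B + S) h₃ := by
  have hnat := E.braid_natural (n := A) (m := A) (n' := B + S) (m' := B + S) (N := N) (M := N)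
    (by omega) (by omega) (by omega) (by omega) (add_zero 0) (add_zero 0) (add_zero 0) (zero_add 0)
    (E.id A) (E.braid B S rfl)
  rw [E.hexagon' (A := A) (B := B) (S := S) rfl h₁ rfl h₃ rfl (by omega),
    E.hexagon' (A := S) (B := A) (S := B) (AS := B + S) rfl h₂ rfl (by omega) (by omega) (by omega),
    E.comp_assoc (h₃ := add_zero 0) (h₄ := add_zero 0),
    ← E.comp_assoc (h₁ := add_zero 0) (h₂ := add_zero 0) (f := E.tensor _ _ _ _ (E.id B)),
    ← E.hexagon (n := A) (m := S) (p := B) (mp := B + S) (h₄ := h₃),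
    ← E.comp_assoc (h₁ := add_zero 0) (h₂ := add_zero 0), hnat]
  simp only [mul_zero, sg_zero, one_smul]
  rw [E.comp_assoc (h₃ := add_zero 0) (h₄ := add_zero 0),
    E.tensor_comp (hab := add_zero 0) (hab' := add_zero 0) (h₂ := add_zero 0),
    E.braid_braid, E.id_comp, E.tensor_id]
  simp only [mul_zero, sg_zero, one_smul]
  rw [E.comp_id]

theorem rotPow_eq_braid (p s : ℕ) : ∀ (A : ℕ) (h : A + s = p + 1),
    E.rotPow p s = E.braid A s h := by
  induction s with
  | zero =>
    intro A h
    obtain rfl : A = p + 1 := by omega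
    rw [E.braid_zero]; rfl
  | succ s ih =>
    intro A h
    have e := E.braid_mul (A := A) (B := 1) (S := s) (N := p + 1) (by omega) (by omega) (by omega)
    change E.comp _ (E.rotPow p s) (E.rot p) = _
    rw [ih (A + 1) (by omega)]
    have : ∀ (x y : ℕ) (hx : x + 1 = p + 1) (hy : A + y = p + 1), x = s + A → y = 1 + s →
        E.comp (add_zero 0) (E.braid (A + 1) s (by omega)) (E.braid x 1 hx) = E.braid A y hy := by
      rintro x y hx hy rfl rfl; exact e
    exact this p (s + 1) rfl h (by omega) (by omega)

theorem rotPow_period (p : ℕ) : E.rotPow p (p + 1) = E.id (p + 1) := by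
  rw [E.rotPow_eq_braid p (p + 1) 0 (by omega), E.braid_zero']

theorem rotPow_add (p i j : ℕ) :
    E.rotPow p (i + j) = E.comp (add_zero 0) (E.rotPow p i) (E.rotPow p j) := by
  induction j with
  | zero => exact (E.comp_id _ _).symm
  | succ j ih =>
    change E.comp _ (E.rotPow p (i + j)) _ = E.comp _ _ (E.comp _ _ _)
    rw [ih, E.comp_assoc]

theorem d_rotPow (p i : ℕ) {j : ℤ} (hj : j + 1 = 0) :
    (E.Hom _ _).d hj (E.rotPow p i) = 0 := by
  induction i with
  | zero => exact E.d_id _ hj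
  | succ i ih =>
    change (E.Hom _ _).d hj (E.comp _ (E.rotPow p i) (E.rot p)) = 0
    rw [E.d_comp (a' := j) (b' := j) _ hj hj hj (by omega) (by omega), ih]
    unfold rot
    rw [E.d_braid]; simp

theorem wh_rot {a b p q n m : ℕ} {c : ℤ} (f : (E.Hom n m).X c) (h₁ : a + n + (b + 1) = p + 1)
    (h₂ : a + m + (b + 1) = q + 1) (h₃ : a + 1 + n + b = p + 1) (h₄ : a + 1 + m + b = q + 1) :
    E.comp (add_zero c) (E.wh a (b + 1) h₁ h₂ f) (E.rot q) =
      E.comp (zero_add c) (E.rot p) (E.wh (a + 1) b h₃ h₄ f) := by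
  have hnat := E.braid_natural (n := p) (m := q) (n' := 1) (m' := 1) rfl rfl
    (by omega : 1 + p = p + 1) (by omega : 1 + q = q + 1) (add_zero c) (zero_add c) (add_zero c)
    (zero_add c) (E.wh a b (by omega : a + n + b = p) (by omega : a + m + b = q) f) (E.id 1)
  rw [← E.wh_zero_left 1 (by omega) (by omega), ← E.wh_zero_right 1 (by omega) (by omega),
    E.wh_wh 0 1 a b a (b + 1) _ _ _ _ (by omega) (by omega) h₁ h₂,
    E.wh_wh 1 0 a b (a + 1) b _ _ _ _ (by omega) (by omega) h₃ h₄] at hnat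
  simp only [mul_zero, sg_zero, one_smul] at hnat
  exact hnat

theorem rotPow_wh {n m : ℕ} {c : ℤ} (f : (E.Hom n m).X c) (p q a : ℕ) :
    ∀ (b s : ℕ) (h₁ : a + n + b = p + 1) (h₂ : a + m + b = q + 1) (h₃ : 0 + n + s = p + 1)
      (h₄ : 0 + m + s = q + 1),
    E.comp (zero_add c) (E.rotPow p a) (E.wh a b h₁ h₂ f) =
      E.comp (add_zero c) (E.wh 0 s h₃ h₄ f) (E.rotPow q a) := by
  induction a with
  | zero =>
    intro b s h₁ h₂ h₃ h₄
    obtain rfl : b = s := by omega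
    exact (E.id_comp _ _).trans (E.comp_id _ _).symm
  | succ a ih =>
    intro b s h₁ h₂ h₃ h₄
    change E.comp _ (E.comp _ _ (E.rot p)) _ = E.comp _ _ (E.comp _ _ (E.rot q))
    rw [E.comp_assoc (h₃ := zero_add c) (h₄ := zero_add c), ← E.wh_rot f (by omega) (by omega),
      ← E.comp_assoc (h₁ := zero_add c) (h₂ := add_zero c), ih _ s _ _ h₃ h₄,
      E.comp_assoc (h₃ := zero_add 0) (h₄ := add_zero c)]

end DGProp


/-- An `A∞`-multiplication on the prop `E`, i.e. a map of props `A∞ → E` which is the identity on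
objects. The prop `A∞` is freely generated, as a prop of graded groups, by the operations
`m_k` with `k ≥ 2` inputs, one output and degree `k - 2`, with differential
`d m_k = Σ ± (id + m_r + id) m_s`, `r + s = k + 1`. Hence such a map is a choice of
the images of the generators subject to these relations. The operation with `t + 1` inputs is
called `m t` here, so that its degree is `t - 1`; there is no operation with one input, and `m 0` is
set to `0`. For example `d m_2 = 0` and `d m_3 = (m_2 + id) m_2 - (id + m_2) m_2`. -/
structure AInfMul (E : DGProp.{u}) where
  m : ∀ (t : ℕ) {c : ℤ}, c + 1 = t → (E.Hom (t + 1) 1).X c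
  m_zero : ∀ {c : ℤ} (h : c + 1 = (0 : ℕ)), m 0 h = 0
  d_m : ∀ (n : ℕ) {c c' : ℤ} (h : c + 1 = n) (h' : c' + 1 = c),
    (E.Hom (n + 1) 1).d h' (m n h) =
      -∑ t : Fin (n + 1), ∑ a : Fin (n - t + 1), sg (t * (a + 1)) •
        E.comp (p := n - t + 1) (a := t - 1) (b := c' - (t - 1)) (by omega)
          (E.wh a (n - t - a) (by omega) (by omega) (m t (by omega)))
          (m (n - t) (by omega))

namespace DGProp

variable (E : DGProp.{u})

/-- The power `T^i` of the signed rotation `T = (-1)^p • rot` of `p + 1` entries. -/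
def srot (p i : ℕ) : (E.Hom (p + 1) (p + 1)).X 0 := sg (p * i) • E.rotPow p i

theorem srot_zero (p : ℕ) : E.srot p 0 = E.id (p + 1) := by
  simp [srot, sg_zero]; rfl

theorem srot_add (p i j : ℕ) :
    E.srot p (i + j) = E.comp (add_zero 0) (E.srot p i) (E.srot p j) := by
  unfold srot
  rw [E.rotPow_add]
  simp only [map_zsmul, AddMonoidHom.coe_smul, Pi.smul_apply, smul_smul]
  congr 1
  rw [← sg_add]; congr 1; push_cast; ring

theorem srot_self (p : ℕ) : E.srot p (p + 1) = E.id (p + 1) := by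
  unfold srot
  rw [E.rotPow_period, sg_congr (b := 0), sg_zero, one_smul]
  simpa using Int.even_mul_succ_self p

theorem srot_period (p i : ℕ) : E.srot p (i + (p + 1)) = E.srot p i := by
  rw [E.srot_add, E.srot_self, E.comp_id]

theorem d_srot (p i : ℕ) {j : ℤ} (hj : j + 1 = 0) :
    (E.Hom _ _).d hj (E.srot p i) = 0 := by
  unfold srot; rw [map_zsmul, E.d_rotPow, smul_zero]

theorem assoc₁ {n₁ n₂ n₃ n₄ n₅ n₆ n₇ : ℕ} {c₁ c₂ c : ℤ} (h : c₁ + c₂ = c)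
    (x : (E.Hom n₁ n₂).X 0) (y : (E.Hom n₂ n₃).X 0) (g : (E.Hom n₃ n₄).X c₁)
    (z : (E.Hom n₄ n₅).X 0) (g' : (E.Hom n₅ n₆).X c₂) (w : (E.Hom n₆ n₇).X 0)
    (h' : c₁ + c₂ = c) :
    E.comp (add_zero c) (E.comp (zero_add c) x
      (E.comp h (E.comp (zero_add _) y g) (E.comp (zero_add _) z g'))) w =
    E.comp h' (E.comp (zero_add _) (E.comp (zero_add 0) x y) g)
      (E.comp (zero_add _) z (E.comp (add_zero _) g' w)) := by
  simp only [E.comp_assoc (h₃ := zero_add _) (h₄ := zero_add _),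
    E.comp_assoc (h₃ := add_zero _) (h₄ := h), E.comp_assoc (h₃ := h) (h₄ := zero_add _),
    E.comp_assoc (h₃ := add_zero _) (h₄ := zero_add _)]

theorem assoc₂ {n₁ n₂ n₃ n₄ n₅ n₆ n₇ : ℕ} {c₁ c₂ c : ℤ} (h : c₁ + c₂ = c)
    (x : (E.Hom n₁ n₂).X 0) (g : (E.Hom n₂ n₃).X c₁) (y : (E.Hom n₃ n₄).X 0)
    (z : (E.Hom n₄ n₅).X 0) (g' : (E.Hom n₅ n₆).X c₂) (w : (E.Hom n₆ n₇).X 0) :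
    E.comp h (E.comp (zero_add _) x g)
      (E.comp (zero_add _) (E.comp (zero_add 0) y z) (E.comp (add_zero _) g' w)) =
    E.comp h (E.comp (add_zero _) (E.comp (zero_add _) x g) y)
      (E.comp (add_zero _) (E.comp (zero_add _) z g') w) := by
  simp only [E.comp_assoc (h₃ := zero_add _) (h₄ := zero_add _),
    E.comp_assoc (h₃ := zero_add _) (h₄ := h), E.comp_assoc (h₃ := h) (h₄ := zero_add _),
    E.comp_assoc (h₃ := add_zero _) (h₄ := zero_add _)]

theorem assoc₃ {n₁ n₂ n₃ n₄ n₅ n₆ n₇ : ℕ} {c₁ c₂ c : ℤ} (h : c₁ + c₂ = c)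
    (x : (E.Hom n₁ n₂).X 0) (g : (E.Hom n₂ n₃).X c₁) (y : (E.Hom n₃ n₄).X 0)
    (g' : (E.Hom n₄ n₅).X c₂) (z : (E.Hom n₅ n₆).X 0) (w : (E.Hom n₆ n₇).X 0) :
    E.comp h (E.comp (zero_add _) x g)
      (E.comp (zero_add _) y (E.comp (add_zero _) g' (E.comp (zero_add 0) z w))) =
    E.comp (add_zero c) (E.comp (zero_add c) x
      (E.comp h g (E.comp (add_zero _) (E.comp (zero_add _) y g') z))) w := by
  simp only [E.comp_assoc (h₃ := zero_add _) (h₄ := zero_add _),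
    E.comp_assoc (h₃ := zero_add _) (h₄ := h), E.comp_assoc (h₃ := h) (h₄ := zero_add _),
    E.comp_assoc (h₃ := add_zero _) (h₄ := zero_add _), E.comp_assoc (h₃ := add_zero _) (h₄ := h),
    E.comp_assoc (h₃ := zero_add _) (h₄ := add_zero _)]

/-- A morphism at position `a` is the conjugate of the same morphism at position `0`. -/
theorem wh_eq_conj {n p q a b s : ℕ} {c : ℤ} (f : (E.Hom n 1).X c)
    (h₁ : a + n + b = p + 1) (h₂ : a + 1 + b = q + 1) (h₃ : 0 + n + s = p + 1)
    (h₄ : 0 + 1 + s = q + 1) :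
    E.wh a b h₁ h₂ f = sg ((p - q) * a) • E.comp (add_zero c)
      (E.comp (zero_add c) (E.srot p (p + 1 - a)) (E.wh 0 s h₃ h₄ f)) (E.srot q a) := by
  have e := E.rotPow_wh f p q a b s h₁ h₂ h₃ h₄
  have ha : a ≤ p + 1 := by omega
  rw [E.comp_assoc (h₃ := add_zero c) (h₄ := zero_add c)]
  unfold srot
  simp only [map_zsmul, AddMonoidHom.coe_smul, Pi.smul_apply, smul_smul]
  rw [← e, ← E.comp_assoc (h₁ := add_zero 0) (h₂ := zero_add c), ← E.rotPow_add,
    show p + 1 - a + a = p + 1 by omega, E.rotPow_period, E.id_comp, ← sg_add, ← sg_add,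
    sg_congr (b := 0), sg_zero, one_smul]
  rw [sub_zero]
  have e2 : ((p + 1 - a : ℕ) : ℤ) = p + 1 - a := by omega
  rw [e2]
  have := Int.even_mul_succ_self p
  convert this using 1
  ring_nf

end DGProp

namespace AInfMul

variable {E : DGProp.{u}} (i : AInfMul E)

/-- The signed operation `(-1)^(t+1) • (m t + id_q)`, where `t = p - q`, as a morphism from `p + 1`
to `q + 1` of degree `p - q - 1`. -/
def g (p q : ℕ) {c : ℤ} (h : c + 1 = p - q) : (E.Hom (p + 1) (q + 1)).X c :=
  if hq : q ≤ p then sg (c + 2) • E.wh 0 q (by omega) (by omega) (i.m (p - q) (by omega)) else 0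

/-- The element `f_{p+1,q+1}` of degree `p - q - 1` of the Hochschild differential
`d l_{p+1} = Σ f_{p+1,q+1} l_{q+1}`: the sum over all ways of multiplying `p - q + 1` cyclically
consecutive entries out of `p + 1` cyclically ordered ones, where the first entry of the
result is the one which contains, or is, the first entry. It vanishes unless `q < p`. -/
def hoch (p q : ℕ) {c : ℤ} (h : c + 1 = p - q) : (E.Hom (p + 1) (q + 1)).X c :=
  ∑ s ∈ Finset.range (p + 1), E.comp (add_zero c)
    (E.comp (zero_add c) (E.srot p s) (i.g p q h)) (E.srot q (backRot p q s))

theorem g_of_le {p q : ℕ} {c : ℤ} (h : c + 1 = p - q) (hq : p ≤ q) : i.g p q h = 0 := by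
  unfold g
  split_ifs with h'
  · obtain rfl : p = q := by omega
    have : ∀ (t : ℕ) (h0 : t = 0) (h1 : c + 1 = t) (h2 : 0 + (t + 1) + p = p + 1),
        E.wh 0 p h2 (by omega : 0 + 1 + p = p + 1) (i.m t h1) = 0 := by
      rintro t rfl h1 h2; rw [i.m_zero, map_zero]
    rw [this _ (by omega), smul_zero]
  · rfl

theorem hoch_of_le {p q : ℕ} {c : ℤ} (h : c + 1 = p - q) (hq : p ≤ q) : i.hoch p q h = 0 := by
  unfold hoch; rw [i.g_of_le h hq]; simp

theorem g_eq {p q t : ℕ} {c : ℤ} (h : c + 1 = p - q) (ht : q + t = p) :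
    i.g p q h = sg (t + 1) • E.wh 0 q (by omega) (by omega) (i.m t (by omega)) := by
  unfold g
  rw [dif_pos (by omega)]
  have : ∀ (s : ℕ) (h0 : s = t) (h1 : c + 1 = s) (h2 : 0 + (s + 1) + q = p + 1),
        E.wh 0 q h2 (by omega : 0 + 1 + q = q + 1) (i.m s h1) =
        E.wh 0 q (by omega) (by omega) (i.m t (by omega)) := by
      rintro s rfl h1 h2; rfl
  rw [this _ (by omega)]
  congr 2; omega

theorem wh_m_eq {p q t a b : ℕ} {c : ℤ} (h : c + 1 = p - q) (ht : q + t = p) (hc : c + 1 = t)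
    (h₁ : a + (t + 1) + b = p + 1) (h₂ : a + 1 + b = q + 1) :
    E.wh a b h₁ h₂ (i.m t hc) = sg (t * a + t + 1) • E.comp (add_zero c)
      (E.comp (zero_add c) (E.srot p (p + 1 - a)) (i.g p q h)) (E.srot q a) := by
  rw [E.wh_eq_conj (i.m t hc) h₁ h₂ (s := q) (by omega) (by omega), i.g_eq h ht]
  simp only [map_zsmul, AddMonoidHom.coe_smul, Pi.smul_apply, smul_smul]
  congr 1
  rw [← sg_add]
  have : ((p : ℤ) - q) = t := by omega
  rw [this]
  exact sg_congr ⟨-(t + 1), by ring⟩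

theorem d_g {p r : ℕ} {c c' : ℤ} (h : c + 1 = p - r) (h' : c' + 1 = c) (hr : r ≤ p) :
    (E.Hom _ _).d h' (i.g p r h) = ∑ q ∈ Finset.Ioo r p, ∑ a ∈ Finset.range (q - r + 1),
      sg (p - q) • E.comp (a := p - q - 1) (b := q - r - 1) (by omega)
        (E.comp (zero_add _) (E.srot p (p + 1 - a)) (i.g p q (by omega)))
        (E.comp (zero_add _) (E.srot q a) (i.g q r (by omega))) := by
  obtain ⟨n, rfl⟩ := Nat.exists_eq_add_of_le hr
  set G : ℕ → ℕ → (E.Hom (r + n + 1) (r + 1)).X c' := fun q a =>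
    sg ((r + n : ℕ) - q) • E.comp (a := (r + n : ℕ) - q - 1) (b := q - r - 1) (by omega)
        (E.comp (zero_add _) (E.srot (r + n) (r + n + 1 - a)) (i.g (r + n) q (by omega)))
        (E.comp (zero_add _) (E.srot q a) (i.g q r (by omega))) with hG
  have G0 : ∀ q a, q ≤ r → G q a = 0 := by
    intro q a hq; simp only [hG]; rw [i.g_of_le (p := q) (q := r) _ hq]; simp
  have G1 : ∀ q a, r + n ≤ q → G q a = 0 := by
    intro q a hq; simp only [hG]; rw [i.g_of_le (p := r + n) (q := q) _ hq]; simp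
  have e1 : (∑ q ∈ Finset.Ioo r (r + n), ∑ a ∈ Finset.range (q - r + 1), G q a) =
      ∑ s ∈ Finset.range (n + 1), ∑ a ∈ Finset.range (s + 1), G (r + s) a := by
    rw [Finset.sum_subset (s₂ := Finset.Ico r (r + n + 1)), Finset.sum_Ico_eq_sum_range,
      show r + n + 1 - r = n + 1 by omega]
    · refine Finset.sum_congr rfl fun s _ => ?_
      rw [show r + s - r + 1 = s + 1 by omega]
    · intro q hq; rw [Finset.mem_Ioo] at hq; rw [Finset.mem_Ico]; omega
    · intro q hq hq'
      rw [Finset.mem_Ico] at hq; rw [Finset.mem_Ioo] at hq'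
      refine Finset.sum_eq_zero fun a _ => ?_
      by_cases hqr : q ≤ r
      · exact G0 q a hqr
      · exact G1 q a (by omega)
  rw [e1, ← Finset.sum_range_reflect, Finset.sum_range, i.g_eq h rfl, map_zsmul, E.d_wh, i.d_m,
    map_neg, map_sum, smul_neg, Finset.smul_sum, ← Finset.sum_neg_distrib]
  refine Finset.sum_congr rfl fun t _ => ?_
  obtain ⟨t, ht⟩ := t
  obtain ⟨s, rfl⟩ : ∃ s, n = t + s := ⟨n - t, by omega⟩
  simp only
  have key : ∀ (s' : ℕ) (_ : s' = s) (a : ℕ) (_ : a < s' + 1) (hh : c' - ((t : ℤ) - 1) + 1 = s')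
      (h1 : a + (t + 1) + (s' - a) = t + s + 1) (h2 : a + 1 + (s' - a) = s' + 1)
      (h3 : 0 + (t + s + 1) + r = r + (t + s) + 1),
      -(sg ((t + s : ℕ) + 1) • E.wh 0 r h3 (by omega : 0 + 1 + r = r + 1) (sg (t * (a + 1)) •
        E.comp (by omega : ((t : ℤ) - 1) + (c' - (t - 1)) = c')
          (E.wh a (s' - a) h1 h2 (i.m t (by omega))) (i.m s' hh))) = G (r + s) a := by
    rintro s' rfl a ha hh h1 h2 h3
    simp only [hG]
    have e2 : ∀ (d₁ d₂ : ℤ) (_ : d₁ = t - 1) (_ : d₂ = c' - (t - 1)) (hd : d₁ + d₂ = c')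
        (q₁ : d₁ + 1 = (r + (t + s') : ℕ) - (r + s' : ℕ)) (q₂ : d₂ + 1 = (r + s' : ℕ) - r),
        -(sg ((t + s' : ℕ) + 1) • E.wh 0 r h3 (by omega : 0 + 1 + r = r + 1) (sg (t * (a + 1)) •
        E.comp (by omega : ((t : ℤ) - 1) + (c' - (t - 1)) = c')
          (E.wh a (s' - a) h1 h2 (i.m t (by omega))) (i.m s' hh))) =
        sg t • E.comp hd
          (E.comp (zero_add _) (E.srot (r + (t + s')) (r + (t + s') + 1 - a))
            (i.g (r + (t + s')) (r + s') q₁))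
          (E.comp (zero_add _) (E.srot (r + s') a) (i.g (r + s') r q₂)) := by
      rintro d₁ d₂ rfl rfl hd q₁ q₂
      rw [map_zsmul, ← E.wh_comp (hP := (by omega : 0 + (s' + 1) + r = r + s' + 1)),
        E.wh_wh 0 r a (s' - a) a (r + s' - a) _ _ _ _ (by omega) (by omega) (by omega) (by omega),
        i.wh_m_eq (p := r + (t + s')) (q := r + s') q₁ (by omega),
        i.g_eq (p := r + s') (q := r) (t := s') _ rfl]
      simp only [map_zsmul, AddMonoidHom.coe_smul, Pi.smul_apply, smul_smul]
      rw [E.comp_assoc (h₃ := zero_add _) (h₄ := hd), ← neg_smul]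
      congr 1
      simp only [← sg_add]
      rw [neg_eq_iff_eq_neg]
      refine sg_congr_neg ⟨t + t * a , ?_⟩
      push_cast
      ring
    rw [e2 ((r + (t + s') : ℕ) - (r + s' : ℕ) - 1) ((r + s' : ℕ) - r - 1) (by omega) (by omega)
      (by omega) (by omega) (by omega)]
    congr 2
    push_cast; ring
  rw [map_sum, Finset.smul_sum, ← Finset.sum_neg_distrib]
  rw [show r + (t + s + 1 - 1 - t) = r + s by omega]
  have e3 : ∀ (s₁ s₂ : ℕ) (F₁ : Fin (s₁ + 1) → (E.Hom (r + (t + s) + 1) (r + 1)).X c')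
      (F₂ : ℕ → (E.Hom (r + (t + s) + 1) (r + 1)).X c'), s₁ = s₂ →
      (∀ a : Fin (s₁ + 1), F₁ a = F₂ a) → ∑ a, F₁ a = ∑ a ∈ Finset.range (s₂ + 1), F₂ a := by
    rintro s₁ s₂ F₁ F₂ rfl hF
    rw [Finset.sum_range]; exact Finset.sum_congr rfl fun a _ => hF a
  refine e3 _ _ _ _ (by omega) fun a => ?_
  exact key _ (by omega) a a.2 _ _ _ _

theorem conj_g {p q t a b : ℕ} {c : ℤ} (h : c + 1 = p - q) (ht : q + t = p) (hc : c + 1 = t)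
    (h₁ : a + (t + 1) + b = p + 1) (h₂ : a + 1 + b = q + 1) :
    E.comp (add_zero c) (E.comp (zero_add c) (E.srot p (p + 1 - a)) (i.g p q h)) (E.srot q a) =
      sg (t * a + t + 1) • E.wh a b h₁ h₂ (i.m t hc) := by
  rw [i.wh_m_eq h ht hc h₁ h₂, smul_smul, sg_mul_self, one_smul]

theorem disjoint {p q r k : ℕ} {c₁ c₂ c : ℤ} (h₁ : c₁ + 1 = p - q) (h₂ : c₂ + 1 = q - r)
    (h : c₁ + c₂ = c) (hr : r < q) (hq : q < p) (hk : 1 ≤ k) (hkr : k ≤ r)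
    {q' : ℕ} (hq' : q' + q = p + r) (h₁' : c₂ + 1 = p - q') (h₂' : c₁ + 1 = q' - r)
    (h' : c₂ + c₁ = c) :
    E.comp h (i.g p q h₁) (E.comp (add_zero _)
      (E.comp (zero_add _) (E.srot q (q + 1 - k)) (i.g q r h₂)) (E.srot r k)) =
    sg (c₁ + c₂ + 1) • E.comp h' (E.comp (zero_add _) (E.srot p (p + 1 - (k + (p - q))))
      (i.g p q' h₁')) (E.comp (zero_add _) (E.srot q' (k + (p - q))) (i.g q' r h₂')) := by
  obtain ⟨s, rfl⟩ := Nat.exists_eq_add_of_le hr.le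
  obtain ⟨t, rfl⟩ := Nat.exists_eq_add_of_le hq.le
  obtain rfl : q' = r + t := by omega
  rw [show k + (r + s + t - (r + s)) = k + t by omega,
    i.conj_g (t := s) (b := r - k) h₂ rfl (by omega) (by omega) (by omega),
    ← E.comp_assoc (h₁ := add_zero _) (h₂ := h'),
    i.conj_g (t := s) (b := r - k) h₁' (by omega) (by omega) (by omega) (by omega),
    i.g_eq (t := t) h₁ rfl, i.g_eq (t := t) h₂' rfl]
  simp only [map_zsmul, AddMonoidHom.coe_smul, Pi.smul_apply, smul_smul]
  rw [E.wh_disjoint (i.m t _) (i.m s _) h h' (Q := r + t + 1) (b₂ := r) (y := k + t) _ _ _ _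
    (by omega) (by omega) (by omega) (by omega) hk, smul_smul]
  congr 1
  simp only [← sg_add]
  obtain rfl : c₁ = t - 1 := by omega
  obtain rfl : c₂ = s - 1 := by omega
  refine sg_congr ⟨-(s + t) + 1, ?_⟩
  push_cast
  ring


/-- The Maurer-Cartan equation of the elements `hoch p q`, which says that the Hochschild
differential squares to zero. -/
theorem d_hoch {p r : ℕ} {c c' : ℤ} (h : c + 1 = p - r) (h' : c' + 1 = c) :
    (E.Hom _ _).d h' (i.hoch p r h) = ∑ q ∈ Finset.Ioo r p,
      sg (p - q) • E.comp (a := p - q - 1) (b := q - r - 1) (by omega)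
        (i.hoch p q (by omega)) (i.hoch q r (by omega)) := by
  by_cases hr : p ≤ r
  · rw [i.hoch_of_le h hr, Finset.Ioo_eq_empty (by omega)]; simp
  set A : ℕ → ℕ → ℕ → ℕ → (E.Hom (p + 1) (r + 1)).X c' := fun s k q a =>
    sg (p - q) • E.comp (a := p - q - 1) (b := q - r - 1) (by omega)
      (E.comp (zero_add _) (E.srot p s) (i.g p q (by omega)))
      (E.comp (zero_add _) (E.srot q a)
        (E.comp (add_zero _) (i.g q r (by omega)) (E.srot r k))) with hA
  have key := cyclic_cancel p r A ?_ ?_ ?_ ?_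
  · have e1 : (E.Hom _ _).d h' (i.hoch p r h) = ∑ q ∈ Finset.Ioo r p,
        ∑ s ∈ Finset.range (p + 1), ∑ a ∈ Finset.range (q - r + 1),
          A (s + (p + 1 - a)) (backRot p r s) q a := by
      unfold hoch
      rw [map_sum, Finset.sum_comm]
      refine Finset.sum_congr rfl fun s hs => ?_
      rw [E.d_comp (a' := c') (b' := -1) (ha := h') (hb := by omega) (h₁ := by omega)
          (h₂ := by omega), E.d_srot,
        E.d_comp (a' := -1) (b' := c') (ha := by omega) (hb := h') (h₁ := by omega)
          (h₂ := by omega), E.d_srot, i.d_g h h' (by omega)]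
      simp only [map_zero, AddMonoidHom.zero_apply, zero_add, smul_zero, add_zero, map_zsmul,
        sg_zero, one_smul, map_sum, AddMonoidHom.finsetSum_apply, AddMonoidHom.coe_smul,
        Pi.smul_apply]
      refine Finset.sum_congr rfl fun q hq => Finset.sum_congr rfl fun a ha => ?_
      simp only [hA]
      congr 1
      rw [E.srot_add]
      exact E.assoc₁ _ _ _ _ _ _ _ _
    rw [e1, key]
    refine Finset.sum_congr rfl fun q hq => ?_
    unfold hoch
    simp only [map_sum, AddMonoidHom.finsetSum_apply, Finset.smul_sum]
    rw [Finset.sum_comm]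
    refine Finset.sum_congr rfl fun s _ => Finset.sum_congr rfl fun k _ => ?_
    simp only [hA]
    congr 1
    rw [E.srot_add]
    exact E.assoc₂ _ _ _ _ _ _ _
  · intro s k q a; simp only [hA, E.srot_period]
  · intro s k q a; simp only [hA, E.srot_period]
  · intro s k q a; simp only [hA, E.srot_period]
  · intro s e q k hrq hqp hk hkr
    have hA' : ∀ (s k q a : ℕ) (d₁ d₂ : ℤ) (q₁ : d₁ + 1 = p - q) (q₂ : d₂ + 1 = q - r)
        (hd : d₁ + d₂ = c'), A s k q a = sg (d₁ + 1) • E.comp hd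
          (E.comp (zero_add _) (E.srot p s) (i.g p q q₁))
          (E.comp (zero_add _) (E.srot q a)
            (E.comp (add_zero _) (i.g q r q₂) (E.srot r k))) := by
      intro s k q a d₁ d₂ q₁ q₂ hd
      obtain rfl : d₁ = p - q - 1 := by omega
      obtain rfl : d₂ = q - r - 1 := by omega
      simp only [hA, sub_add_cancel]
    have D := i.disjoint (p := p) (q := q) (r := r) (k := k) (c₁ := p - q - 1) (c₂ := q - r - 1)
      (c := c') (by omega) (by omega) (by omega) hrq hqp hk hkr (q' := p + r - q) (by omega)
      (by omega) (by omega) (by omega)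
    rw [hA' s _ q _ (p - q - 1) (q - r - 1) (by omega) (by omega) (by omega),
      hA' _ _ (p + r - q) _ (q - r - 1) (p - q - 1) (by omega) (by omega) (by omega),
      E.srot_add p, add_comm e k, E.srot_add r, E.assoc₃, D, map_zsmul, map_zsmul,
      AddMonoidHom.coe_smul, Pi.smul_apply, E.assoc₁ (h' := by omega), smul_smul, ← neg_smul]
    congr 1
    rw [← sg_add]
    refine sg_congr_neg ⟨p - q - 1, ?_⟩
    ring

end AInfMul

namespace DGProp

variable (E : DGProp.{u})

theorem wh_rotPow {n m : ℕ} {c : ℤ} (f : (E.Hom n m).X c) (p q k : ℕ) :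
    ∀ (a b a' b' : ℕ) (h₁ : a + n + b = p + 1) (h₂ : a + m + b = q + 1) (ha : a + k = a')
      (hb : b' + k = b) (h₃ : a' + n + b' = p + 1) (h₄ : a' + m + b' = q + 1),
    E.comp (add_zero c) (E.wh a b h₁ h₂ f) (E.rotPow q k) =
      E.comp (zero_add c) (E.rotPow p k) (E.wh a' b' h₃ h₄ f) := by
  induction k with
  | zero =>
    rintro a b a' b' h₁ h₂ rfl rfl h₃ h₄
    exact (E.comp_id _ _).trans (E.id_comp _ _).symm
  | succ k ih =>
    intro a b a' b' h₁ h₂ ha hb h₃ h₄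
    obtain rfl : a' = a + k + 1 := by omega
    change E.comp _ _ (E.comp _ _ (E.rot q)) = E.comp _ (E.comp _ _ (E.rot p)) _
    rw [E.comp_assoc (h₃ := zero_add c) (h₄ := zero_add c),
      ← E.comp_assoc (h₁ := add_zero c) (h₂ := add_zero c),
      ih a b (a + k) (b' + 1) h₁ h₂ rfl (by omega) (by omega) (by omega),
      E.comp_assoc (h₃ := add_zero c) (h₄ := zero_add c), E.wh_rot f (by omega) (by omega)]

/-- Rotating an element of arity `(0, 1)` from the last position gives it at the first one. -/
theorem wh_rot_last {p : ℕ} (u : (E.Hom 0 1).X 0) (h₁ : p + 0 + 0 = p) (h₂ : p + 1 + 0 = p + 1)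
    (h₃ : 0 + 0 + p = p) (h₄ : 0 + 1 + p = p + 1) :
    E.comp (add_zero 0) (E.wh p 0 (n := 0) (m := 1) h₁ h₂ u) (E.rot p) = E.wh 0 p (n := 0) (m := 1) h₃ h₄ u := by
  have h := E.braid_natural (n := p) (m := p) (n' := 0) (m' := 1) (by omega) rfl
    (by omega) (by omega) (add_zero 0) (add_zero 0) (add_zero 0) (zero_add 0) (E.id p) u
  rw [E.braid_zero, E.id_comp] at h
  rw [E.wh_zero_right p _ _ (by omega) (by omega), E.wh_zero_left p _ _ (by omega) (by omega)]
  simp only [mul_zero, sg_zero, one_smul] at h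
  exact h

/-- `id_j + u + id_(q-j)` -/
def ins (u : (E.Hom 0 1).X 0) (q j : ℕ) (h : j ≤ q) : (E.Hom q (q + 1)).X 0 :=
  E.wh j (q - j) (by omega) (by omega) u

theorem ins_rot_lt (u : (E.Hom 0 1).X 0) (p j k : ℕ) (h : j + k ≤ p + 1) :
    E.comp (add_zero 0) (E.ins u (p + 1) j (by omega)) (E.rotPow (p + 1) k) =
      E.comp (add_zero 0) (E.rotPow p k) (E.ins u (p + 1) (j + k) h) :=
  E.wh_rotPow u p (p + 1) k _ _ _ _ _ _ rfl (by omega) _ _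

theorem ins_rot_ge (u : (E.Hom 0 1).X 0) (p j k l : ℕ) (hj : j ≤ p + 1)
    (h : j + k = p + 2 + l) (hl : l ≤ p + 1) :
    E.comp (add_zero 0) (E.ins u (p + 1) j (by omega)) (E.rotPow (p + 1) k) =
      E.comp (add_zero 0) (E.rotPow p (k - 1)) (E.ins u (p + 1) l hl) := by
  obtain ⟨x, hx⟩ : ∃ x, j + x = p + 1 := ⟨p + 1 - j, by omega⟩
  obtain rfl : k = x + 1 + l := by omega
  have e : E.comp (add_zero 0) (E.ins u (p + 1) (j + x) (by omega)) (E.rot (p + 1)) =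
      E.ins u (p + 1) 0 (by omega) := by
    have : ∀ (y z : ℕ) (h : y = p + 1) (hz : z = 0) (h₁ : y + 0 + z = p + 1)
        (h₂ : y + 1 + z = p + 1 + 1),
        E.comp (add_zero 0) (E.wh y z (n := 0) (m := 1) h₁ h₂ u) (E.rot (p + 1)) =
          E.ins u (p + 1) 0 (by omega) := by
      rintro y z rfl rfl h₁ h₂; exact E.wh_rot_last u _ _ _ _
    exact this _ _ hx (by omega) _ _
  rw [E.rotPow_add, ← E.comp_assoc (h₁ := add_zero 0) (h₂ := add_zero 0)]
  change E.comp _ (E.comp _ _ (E.comp _ _ (E.rot (p + 1)))) _ = _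
  rw [← E.comp_assoc (h₁ := add_zero 0) (h₂ := add_zero 0), E.ins_rot_lt u p j x (by omega),
    E.comp_assoc (h₃ := add_zero 0) (h₄ := add_zero 0) (f := E.rotPow p x) (k := E.rot (p + 1)), e,
    E.comp_assoc (h₃ := add_zero 0) (h₄ := add_zero 0), E.ins_rot_lt u p 0 l (by omega),
    ← E.comp_assoc (h₁ := add_zero 0) (h₂ := add_zero 0), ← E.rotPow_add]
  simp only [zero_add]
  rw [show x + 1 + l - 1 = x + l by omega]

/-- Commuting a unit past an operation applied to the first entries. -/
theorem ins_wh (u : (E.Hom 0 1).X 0) {p q t s : ℕ} {c : ℤ} (f : (E.Hom (t + 1) 1).X c)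
    (hs : s ≤ p + 1) (hts : t < s) (hpq : q + t = p + 1) (h₁ : 0 + (t + 1) + q = p + 2)
    (h₂ : 0 + 1 + q = q + 1) (h₃ : 0 + (t + 1) + (q - 1) = p + 1) (h₄ : 0 + 1 + (q - 1) = q) :
    E.comp (zero_add c) (E.ins u (p + 1) s hs) (E.wh 0 q h₁ h₂ f) =
      E.comp (add_zero c) (E.wh 0 (q - 1) h₃ h₄ f) (E.ins u q (s - t) (by omega)) := by
  have h := E.wh_disjoint f u (N := p + 1) (P := q) (Q := p + 2) (M := q + 1) (b₁ := q - 1)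
    (b₂ := q) (x := s - t) (y := s) (e := p + 1 - s) (add_zero c) (zero_add c) h₃ h₄ (by omega)
    (by omega) (by omega) (by omega) h₁ h₂ (by omega)
  simp only [mul_zero, sg_zero, one_smul] at h
  rw [show E.ins u (p + 1) s hs = E.wh s (p + 1 - s) (by omega) (by omega) u from rfl, ← h]
  have : ∀ (e : ℕ) (he : e = p + 1 - s) (h5 : s - t + 0 + e = q) (h6 : s - t + 1 + e = q + 1),
      E.wh (n := 0) (m := 1) (s - t) e h5 h6 u = E.wh (n := 0) (m := 1) (s - t) (p + 1 - s) (by omega) (by omega) u := by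
    rintro e rfl _ _; rfl
  exact congrArg _ (this (q - (s - t)) (by omega) _ _).symm

theorem ins_wh_le (u : (E.Hom 0 1).X 0) {p q t s : ℕ} {c : ℤ} (f : (E.Hom (t + 1) 1).X c)
    (hs : s ≤ p + 1) (hts : s ≤ t) (hpq : q + t = p + 1) (h₁ : 0 + (t + 1) + q = p + 2)
    (h₂ : 0 + 1 + q = q + 1) (h₃ : 0 + t + q = p + 1) :
    E.comp (zero_add c) (E.ins u (p + 1) s hs) (E.wh 0 q h₁ h₂ f) =
      E.wh 0 q h₃ h₂ (E.comp (zero_add c) (E.ins u t s hts) f) := by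
  rw [← E.wh_comp (hP := h₁)]
  congr 2
  exact (E.wh_wh 0 q s (t - s) s (p + 1 - s) _ _ _ _ (by omega) (by omega) _ _ u).symm

end DGProp

/-- The `A∞`-multiplication has a unit: it extends to the prop of unital `A∞`-algebras, obtained from
`A∞` by adding an operation `u` without inputs that is a strict unit for `m_2` and annihilates
the higher multiplications. -/
structure AInfUnit {E : DGProp.{u}} (i : AInfMul E) where
  u : (E.Hom 0 1).X 0
  d_u : ∀ {j : ℤ} (hj : j + 1 = 0), (E.Hom 0 1).d hj u = 0
  u_m_left : E.comp (zero_add 0) (E.ins u 1 0 (by omega)) (i.m 1 (by simp)) = E.id 1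
  u_m_right : E.comp (zero_add 0) (E.ins u 1 1 (by omega)) (i.m 1 (by simp)) = E.id 1
  u_m : ∀ (t s : ℕ) {c : ℤ} (h : c + 1 = t) (hs : s ≤ t), 2 ≤ t →
    E.comp (zero_add c) (E.ins u t s hs) (i.m t h) = 0

namespace AInfUnit

variable {E : DGProp.{u}} {i : AInfMul E} (η : AInfUnit i)

/-- The elements of `E(p, q + 1)` with a unit inserted in a place other than the first one. -/
def deg (p q : ℕ) (c : ℤ) : AddSubgroup ((E.Hom p (q + 1)).X c) :=
  AddSubgroup.closure {z | ∃ (j : ℕ) (_ : 1 ≤ j) (h : j ≤ q) (y : (E.Hom p q).X c),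
    z = E.comp (add_zero c) y (E.ins η.u q j h)}

theorem mem_deg {p q j : ℕ} {c : ℤ} (y : (E.Hom p q).X c) (h₁ : 1 ≤ j) (h : j ≤ q) :
    E.comp (add_zero c) y (E.ins η.u q j h) ∈ η.deg p q c :=
  AddSubgroup.subset_closure ⟨j, h₁, h, y, rfl⟩

theorem comp_mem_deg {n p q : ℕ} {a b c : ℤ} (h : a + b = c) (x : (E.Hom n p).X a)
    {z : (E.Hom p (q + 1)).X b} (hz : z ∈ η.deg p q b) : E.comp h x z ∈ η.deg n q c := by
  induction hz using AddSubgroup.closure_induction with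
  | mem z hz =>
    obtain ⟨j, h₁, hj, y, rfl⟩ := hz
    rw [← E.comp_assoc (h₁ := h) (h₂ := add_zero c)]
    exact η.mem_deg _ h₁ hj
  | zero => rw [map_zero]; exact zero_mem _
  | add z w _ _ hz hw => rw [map_add]; exact add_mem hz hw
  | neg z _ hz => rw [map_neg]; exact neg_mem hz

/-- The term of index `s` of `hoch`, after insertion of a unit in place `j`. -/
theorem term_mem {p q t j s s' x : ℕ} {c : ℤ} (hc : c + 1 = t) (hpq : q + t = p + 1)
    (ht : 1 ≤ t) (hj : 1 ≤ j) (hj' : j ≤ p + 1) (hs : s ≤ p + 1)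
    (h₁ : 0 + (t + 1) + q = p + 2) (h₂ : 0 + 1 + q = q + 1) (hts : t < s')
    (hs' : s' ≤ p + 1) (hcase : (j + s = s' ∧ x = s) ∨ (j + s = p + 2 + s' ∧ x = s - 1)) :
    E.comp (add_zero c) (E.comp (zero_add c)
      (E.comp (add_zero 0) (E.ins η.u (p + 1) j hj') (E.rotPow (p + 1) s))
      (E.wh 0 q h₁ h₂ (i.m t hc))) (E.rotPow q (backRot (p + 1) q s)) ∈ η.deg (p + 1) q c := by
  have e : E.comp (add_zero 0) (E.ins η.u (p + 1) j hj') (E.rotPow (p + 1) s) =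
      E.comp (add_zero 0) (E.rotPow p x) (E.ins η.u (p + 1) s' hs') := by
    rcases hcase with ⟨rfl, rfl⟩ | ⟨h, rfl⟩
    · exact E.ins_rot_lt _ _ _ _ _
    · exact E.ins_rot_ge _ _ _ _ _ _ h _
  obtain ⟨q, rfl⟩ : ∃ q', q = q' + 1 := ⟨q - 1, by omega⟩
  have e2 : ∀ (b j' : ℕ) (_ : 1 ≤ j') (hj2 : j' ≤ q + 1),
      (s' - t + b = j' ∨ s' - t + b = q + 2 + j') →
      ∃ y, E.comp (add_zero 0) (E.ins η.u (q + 1) (s' - t) (by omega)) (E.rotPow (q + 1) b) =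
        E.comp (add_zero 0) y (E.ins η.u (q + 1) j' hj2) := by
    rintro b j' hj1 hj2 (rfl | h)
    · exact ⟨_, E.ins_rot_lt _ _ _ _ _⟩
    · exact ⟨_, E.ins_rot_ge _ _ _ _ _ _ h _⟩
  obtain ⟨j', hj1, hj2, y, hy⟩ : ∃ (j' : ℕ) (_ : 1 ≤ j') (hj2 : j' ≤ q + 1) (y : _),
      E.comp (add_zero 0) (E.ins η.u (q + 1) (s' - t) (by omega))
        (E.rotPow (q + 1) (backRot (p + 1) (q + 1) s)) =
        E.comp (add_zero 0) y (E.ins η.u (q + 1) j' hj2) := by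
    by_cases hst : s ≤ t
    · rw [backRot_zero (by omega)]
      obtain ⟨y, hy⟩ := e2 0 (s' - t) (by omega) (by omega) (Or.inl rfl)
      exact ⟨_, by omega, _, y, hy⟩
    · rw [backRot_pos (by omega)]
      rcases hcase with ⟨h, -⟩ | ⟨h, -⟩
      · obtain ⟨y, hy⟩ := e2 (p + 1 + 1 - s) j (by omega) (by omega) (Or.inr (by omega))
        exact ⟨_, hj, _, y, hy⟩
      · obtain ⟨y, hy⟩ := e2 (p + 1 + 1 - s) (j - t) (by omega) (by omega) (Or.inl (by omega))
        exact ⟨_, by omega, _, y, hy⟩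
  rw [e, E.comp_assoc (h₃ := zero_add c) (h₄ := zero_add c),
    E.ins_wh η.u (i.m t hc) hs' hts hpq _ _ (by omega) (by omega),
    E.comp_assoc (h₃ := add_zero c) (h₄ := zero_add c),
    E.comp_assoc (h₃ := add_zero 0) (h₄ := add_zero c), hy,
    ← E.comp_assoc (h₁ := add_zero c) (h₂ := add_zero c)]
  exact η.comp_mem_deg _ _ (η.mem_deg _ hj1 hj2)

theorem ins_hoch_mem {p q j : ℕ} {c : ℤ} (h : c + 1 = p - q) (hj : 1 ≤ j) (hj' : j ≤ p) :
    E.comp (zero_add c) (E.ins η.u p j hj') (i.hoch p q h) ∈ η.deg p q c := by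
  by_cases hpq : p ≤ q
  · rw [i.hoch_of_le h hpq, map_zero]; exact zero_mem _
  obtain ⟨p, rfl⟩ : ∃ p', p = p' + 1 := ⟨p - 1, by omega⟩
  obtain ⟨t, ht⟩ := Nat.exists_eq_add_of_le (by omega : q ≤ p + 1)
  set V : ℕ → (E.Hom (p + 1) (q + 1)).X c := fun s => E.comp (add_zero c) (E.comp (zero_add c)
      (E.comp (add_zero 0) (E.ins η.u (p + 1) j hj') (E.rotPow (p + 1) s))
      (E.wh 0 q (by omega) (by omega) (i.m t (by omega)))) (E.rotPow q (backRot (p + 1) q s)) with hV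
  have e1 : E.comp (zero_add c) (E.ins η.u (p + 1) j hj') (i.hoch (p + 1) q h) =
      ∑ s ∈ Finset.range (p + 2),
        sg ((p + 1 : ℕ) * s + (t + 1) + q * backRot (p + 1) q s) • V s := by
    unfold AInfMul.hoch
    rw [map_sum]
    refine Finset.sum_congr rfl fun s _ => ?_
    rw [i.g_eq h ht.symm]
    unfold DGProp.srot
    simp only [map_zsmul, AddMonoidHom.coe_smul, Pi.smul_apply, smul_smul, hV]
    rw [← E.comp_assoc (h₁ := zero_add c) (h₂ := add_zero c),
      ← E.comp_assoc (h₁ := add_zero 0) (h₂ := zero_add c)]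
    congr 1
    simp only [← sg_add]
    congr 1; ring
  have hmem : ∀ s s' x, s ≤ p + 1 → t < s' → s' ≤ p + 1 →
      ((j + s = s' ∧ x = s) ∨ (j + s = p + 2 + s' ∧ x = s - 1)) → V s ∈ η.deg (p + 1) q c :=
    fun s s' x hs hts hs' hcase => η.term_mem _ (by omega) (by omega) hj hj' hs _ _ hts hs' hcase
  have habs : ∀ s s' x, ∀ (_ : s ≤ p + 1) (_ : s' ≤ t) (hs' : s' ≤ p + 1)
      (hst : s' ≤ t), ((j + s = s' ∧ x = s) ∨ (j + s = p + 2 + s' ∧ x = s - 1)) →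
      V s = E.comp (add_zero c) (E.comp (zero_add c) (E.rotPow p x) (E.wh 0 q (by omega)
        (by omega) (E.comp (zero_add c) (E.ins η.u t s' hst) (i.m t (by omega)))))
        (E.rotPow q (backRot (p + 1) q s)) := by
    intro s s' x hs hts hs' hst hcase
    have e : E.comp (add_zero 0) (E.ins η.u (p + 1) j hj') (E.rotPow (p + 1) s) =
        E.comp (add_zero 0) (E.rotPow p x) (E.ins η.u (p + 1) s' hs') := by
      rcases hcase with ⟨rfl, rfl⟩ | ⟨h, rfl⟩
      · exact E.ins_rot_lt _ _ _ _ _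
      · exact E.ins_rot_ge _ _ _ _ _ _ h _
    simp only [hV]
    rw [e, E.comp_assoc (h₃ := zero_add c) (h₄ := zero_add c) (f := E.rotPow p x),
      E.ins_wh_le η.u (i.m t _) hs' hts ht.symm _ _ (by omega)]
  rw [e1]
  have hcase : ∀ s, s ≤ p + 1 → ∃ s' x, s' ≤ p + 1 ∧
      ((j + s = s' ∧ x = s) ∨ (j + s = p + 2 + s' ∧ x = s - 1)) := by
    intro s hs
    by_cases hjs : j + s ≤ p + 1
    · exact ⟨_, _, hjs, Or.inl ⟨rfl, rfl⟩⟩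
    · exact ⟨j + s - (p + 2), _, by omega, Or.inr ⟨by omega, rfl⟩⟩
  by_cases ht2 : 2 ≤ t
  · refine sum_mem fun s hs => zsmul_mem ?_ _
    rw [Finset.mem_range] at hs
    obtain ⟨s', x, hs', hc⟩ := hcase s (by omega)
    by_cases hts : s' ≤ t
    · rw [habs s s' x (by omega) hts hs' hts hc, η.u_m _ _ _ _ ht2]
      simp
    · exact hmem s s' x (by omega) (by omega) hs' hc
  · obtain rfl : t = 1 := by omega
    obtain rfl : p = q := by omega
    obtain rfl : c = 0 := by omega
    have hid : ∀ s s' x, s ≤ p + 1 → s' ≤ 1 → s' ≤ p + 1 →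
      ((j + s = s' ∧ x = s) ∨ (j + s = p + 2 + s' ∧ x = s - 1)) →
      V s = E.rotPow p (x + backRot (p + 1) p s) := by
      intro s s' x hs hs' hs'' hc
      rw [habs s s' x hs hs' hs'' hs' hc]
      have : E.comp (zero_add 0) (E.ins η.u 1 s' hs') (i.m 1 (by omega)) = E.id 1 := by
        obtain rfl | rfl : s' = 0 ∨ s' = 1 := by omega
        · exact η.u_m_left
        · exact η.u_m_right
      rw [this, E.wh_id, E.comp_id, E.rotPow_add]
    have hper : ∀ x, x = 0 ∨ x = p + 1 → E.rotPow p x = E.id (p + 1) := by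
      rintro x (rfl | rfl)
      · rfl
      · exact E.rotPow_period p
    have hb : ∀ s, (s ≤ 1 → backRot (p + 1) p s = 0) ∧
        (2 ≤ s → backRot (p + 1) p s = p + 2 - s) :=
      fun s => ⟨fun hs => backRot_zero (by omega), fun hs => backRot_pos (by omega)⟩
    obtain ⟨s₁, hs₁⟩ : ∃ s₁, j + s₁ = p + 2 := ⟨p + 2 - j, by omega⟩
    obtain ⟨s₂, hs₂⟩ : ∃ s₂, (j = 1 ∧ s₂ = 0) ∨ (2 ≤ j ∧ j + s₂ = p + 3) := by
      by_cases hj1 : j = 1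
      · exact ⟨0, Or.inl ⟨hj1, rfl⟩⟩
      · exact ⟨p + 3 - j, Or.inr ⟨by omega, by omega⟩⟩
    have hv₁ : V s₁ = E.id (p + 1) := by
      rw [hid s₁ 0 (s₁ - 1) (by omega) (by omega) (by omega) (Or.inr ⟨by omega, rfl⟩)]
      apply hper
      have := hb s₁
      omega
    have hv₂ : V s₂ = E.id (p + 1) := by
      rcases hs₂ with ⟨rfl, rfl⟩ | ⟨h2, h3⟩
      · rw [hid 0 1 0 (by omega) (by omega) (by omega) (Or.inl ⟨by omega, rfl⟩)]
        apply hper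
        have := hb 0
        omega
      · rw [hid s₂ 1 (s₂ - 1) (by omega) (by omega) (by omega) (Or.inr ⟨by omega, rfl⟩)]
        apply hper
        have := hb s₂
        omega
    rw [← Finset.add_sum_erase _ _ (show s₁ ∈ Finset.range (p + 2) by
        rw [Finset.mem_range]; omega),
      ← Finset.add_sum_erase _ _ (show s₂ ∈ (Finset.range (p + 2)).erase s₁ by
        rw [Finset.mem_erase, Finset.mem_range]; omega), ← add_assoc, hv₁, hv₂, ← add_smul]
    have hsg : sg ((p + 1 : ℕ) * s₁ + ((1 : ℕ) + 1) + p * backRot (p + 1) p s₁) +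
        sg ((p + 1 : ℕ) * s₂ + ((1 : ℕ) + 1) + p * backRot (p + 1) p s₂) = 0 := by
      have ev : Even ((p : ℤ) * (p + 1)) := Int.even_mul_succ_self p
      have k₁ : sg ((p + 1 : ℕ) * s₁ + ((1 : ℕ) + 1) + p * backRot (p + 1) p s₁) = sg j := by
        apply sg_congr
        have e₁ : (s₁ : ℤ) = p + 2 - j := by omega
        by_cases h1 : s₁ ≤ 1
        · rw [(hb s₁).1 h1]
          obtain rfl : s₁ = 1 := by omega
          obtain rfl : j = p + 1 := by omega
          exact ⟨1, by push_cast; ring⟩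
        · rw [(hb s₁).2 (by omega), show ((p + 2 - s₁ : ℕ) : ℤ) = j by omega, e₁]
          obtain ⟨w, hw⟩ := ev
          exact ⟨w + p + 2 - j, by push_cast; linear_combination hw⟩
      have k₂ : sg ((p + 1 : ℕ) * s₂ + ((1 : ℕ) + 1) + p * backRot (p + 1) p s₂) = -sg j := by
        apply sg_congr_neg
        rcases hs₂ with ⟨rfl, rfl⟩ | ⟨h2, h3⟩
        · rw [(hb 0).1 (by omega)]; exact ⟨0, by simp⟩
        · rw [(hb s₂).2 (by omega), show ((p + 2 - s₂ : ℕ) : ℤ) = j - 1 by omega,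
            show (s₂ : ℤ) = p + 3 - j by omega]
          obtain ⟨w, hw⟩ := ev
          exact ⟨w + p + 2 - j, by push_cast; linear_combination hw⟩
      rw [k₁, k₂]; ring
    rw [hsg, zero_smul, zero_add]
    refine sum_mem fun s hs => zsmul_mem ?_ _
    simp only [Finset.mem_erase, Finset.mem_range] at hs
    obtain ⟨s', x, hs', hc⟩ := hcase s (by omega)
    exact hmem s s' x (by omega) (by omega) hs' hc

end AInfUnit

/-- `id_(p+1) + f` -/
def DGProp.shiftW (E : DGProp.{u}) (p : ℕ) {m m' : ℕ} {b : ℤ} :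
    (E.Hom m m').X b →+ (E.Hom (p + 1 + m) (p + 1 + m')).X b :=
  E.wh (p + 1) 0 (by omega) (by omega)

namespace AInfMul

variable {E : DGProp.{u}} (i : AInfMul E)

/-- `f_{p+1,q+1} + id_m` -/
def hochW (m p q : ℕ) {c : ℤ} (h : c + 1 = p - q) : (E.Hom (p + 1 + m) (q + 1 + m)).X c :=
  E.wh 0 m (by omega) (by omega) (i.hoch p q h)

theorem d_hochW (m : ℕ) {p r : ℕ} {c c' : ℤ} (h : c + 1 = p - r) (h' : c' + 1 = c) :
    (E.Hom _ _).d h' (i.hochW m p r h) = ∑ q ∈ Finset.Ioo r p,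
      sg (p - q) • E.comp (a := p - q - 1) (b := q - r - 1) (by omega)
        (i.hochW m p q (by omega)) (i.hochW m q r (by omega)) := by
  unfold hochW
  rw [E.d_wh, i.d_hoch, map_sum]
  refine Finset.sum_congr rfl fun q _ => ?_
  rw [map_zsmul, E.wh_comp]

theorem hochW_shiftW {m m' p q : ℕ} {a b c : ℤ} (h : a + 1 = p - q) (f : (E.Hom m m').X b)
    (hab : a + b = c) (hba : b + a = c) :
    E.comp hab (i.hochW m p q h) (E.shiftW q f) =
      sg (a * b) • E.comp hba (E.shiftW p f) (i.hochW m' p q h) :=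
  E.wh_disjoint _ _ hab hba _ _ _ _ _ _ _ _ le_rfl

end AInfMul

section HochschildGraded

variable {E : DGProp.{u}}

/-- The degree `n` part of the Hochschild complex, `⊕_{p ≥ 0} Φ(p + 1 + m)_{n-p}`: the direct sum of the
`Φ(p + 1 + m) ⊗ l_{p+1}`, where the generator `l_{p+1}` has degree `p`. -/
abbrev HochGr (Φ : RMod E) (m : ℕ) (n : ℤ) : Type u :=
  DirectSum ℕ fun p => (Φ.X (p + 1 + m)).X (n - p)

namespace HochGr

variable {Φ : RMod E} {m : ℕ} {n : ℤ}

/-- `x ↦ x ⊗ l_{p+1}` -/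
def l (p : ℕ) {a : ℤ} (h : a + p = n) : (Φ.X (p + 1 + m)).X a →+ HochGr Φ m n :=
  (DirectSum.of (fun p : ℕ => (Φ.X (p + 1 + m)).X (n - p)) p).comp
    ((Φ.X (p + 1 + m)).castHom (by omega))

/-- Maps out of the direct sum. -/
def lift {B : Type v} [AddCommGroup B]
    (F : ∀ (p : ℕ) (a : ℤ), a + p = n → ((Φ.X (p + 1 + m)).X a →+ B)) : HochGr Φ m n →+ B :=
  DirectSum.toAddMonoid fun p => F p (n - p) (by omega)

theorem lift_l {B : Type v} [AddCommGroup B]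
    (F : ∀ (p : ℕ) (a : ℤ), a + p = n → ((Φ.X (p + 1 + m)).X a →+ B))
    (p : ℕ) {a : ℤ} (h : a + p = n) (x : (Φ.X (p + 1 + m)).X a) :
    lift F (l p h x) = F p a h x := by
  obtain rfl : a = n - p := by omega
  exact DirectSum.toAddMonoid_of (β := fun p : ℕ => (Φ.X (p + 1 + m)).X (n - p)) _ p x

theorem hom_ext {B : Type v} [AddCommGroup B] {f g : HochGr Φ m n →+ B}
    (H : ∀ (p : ℕ) (a : ℤ) (h : a + p = n) (x : (Φ.X (p + 1 + m)).X a), f (l p h x) = g (l p h x)) :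
    f = g := by
  refine DirectSum.addHom_ext fun p x => ?_
  exact H p (n - p) (by omega) x

theorem hom_ext_apply {B : Type v} [AddCommGroup B] (f g : HochGr Φ m n →+ B)
    (H : ∀ (p : ℕ) (a : ℤ) (h : a + p = n) (x : (Φ.X (p + 1 + m)).X a), f (l p h x) = g (l p h x))
    (x) : f x = g x := by rw [hom_ext H]

end HochGr

end HochschildGraded

namespace AInfMul

variable {E : DGProp.{u}} (i : AInfMul E)

open HochGr

/-- The Hochschild differential
`d(x ⊗ l_{p+1}) = dx ⊗ l_{p+1} + (-1)^|x| Σ_{q < p} x·(f_{p+1,q+1} + id_m) ⊗ l_{q+1}`. -/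
def cD (Φ : RMod E) (m : ℕ) {n n' : ℤ} (h : n' + 1 = n) : HochGr Φ m n →+ HochGr Φ m n' :=
  lift fun p a ha => (l p (a := a - 1) (by omega)).comp ((Φ.X _).d (by omega)) +
    sg a • ∑ q ∈ Finset.range p, (l q (a := a + (p - q - 1)) (by omega)).comp
      ((Φ.act rfl).flip (i.hochW m p q (by omega)))

theorem cD_l (Φ : RMod E) (m : ℕ) {n n' : ℤ} (h : n' + 1 = n) (p : ℕ) {a a' : ℤ} (ha : a + p = n)
    (ha' : a' + 1 = a) (ha₂ : a' + p = n') (x : (Φ.X (p + 1 + m)).X a) :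
    i.cD Φ m h (l p ha x) = l p ha₂ ((Φ.X _).d ha' x) +
      sg a • ∑ q ∈ Finset.range p, l q (a := a + (p - q - 1)) (by omega)
        (Φ.act rfl x (i.hochW m p q (by omega))) := by
  obtain rfl : a' = a - 1 := by omega
  unfold cD
  rw [lift_l]
  simp [AddMonoidHom.finsetSum_apply]

/-- The action `(x ⊗ l_{p+1})·f = (-1)^(p |f|) x·(id_(p+1) + f) ⊗ l_{p+1}`. -/
def cAct (Φ : RMod E) {m m' : ℕ} {a b c : ℤ} (h : a + b = c) :
    HochGr Φ m a →+ (E.Hom m m').X b →+ HochGr Φ m' c :=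
  lift fun p e he => AddMonoidHom.mk'
    (fun x => sg (p * b) • (l p (a := e + b) (by omega)).comp
      ((Φ.act rfl x).comp (E.shiftW p))) (by
    intro x y; ext f; simp)

theorem cAct_l (Φ : RMod E) {m m' : ℕ} {a b c : ℤ} (h : a + b = c) (p : ℕ) {e e' : ℤ}
    (he : e + p = a) (he' : e + b = e') (hc : e' + p = c) (x : (Φ.X (p + 1 + m)).X e)
    (f : (E.Hom m m').X b) :
    cAct Φ h (l p he x) f = sg (p * b) • l p hc (Φ.act he' x (E.shiftW p f)) := by
  subst he'
  unfold cAct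
  rw [lift_l]; rfl

/-- The Hochschild complex `C(Φ)` of a dg-functor `Φ : E → Ch`, again a dg-functor `E → Ch`. -/
def cObj (Φ : RMod E) : RMod E where
  X m :=
    { X := fun n => HochGr Φ m n
      d := fun h => i.cD Φ m h
      d_d := by
        intro n n' n'' h h' x
        refine hom_ext_apply ((i.cD Φ m h').comp (i.cD Φ m h)) 0 (fun p a ha x => ?_) x
        rw [AddMonoidHom.comp_apply, i.cD_l Φ m h p (a' := a - 1) ha (by omega) (by omega), map_add,
          i.cD_l Φ m h' p (a' := a - 1 - 1) (by omega) (by omega) (by omega), Cplx.d_d, map_zsmul,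
          map_sum]
        have e1 : ∀ q ∈ Finset.range p, i.cD Φ m h' (l q (a := a + (p - q - 1)) (by omega)
              (Φ.act rfl x (i.hochW m p q (by omega)))) =
            l q (a := a - 1 + (p - q - 1)) (by omega)
              (Φ.act rfl ((Φ.X _).d (by omega) x) (i.hochW m p q (by omega))) +
            (sg a • l q (a := a - 1 + (p - q - 1)) (by omega)
              (Φ.act (b := p - q - 1 - 1) (by omega) x ((E.Hom _ _).d (by omega)
                (i.hochW m p q (c := p - q - 1) (by omega)))) +
            sg (a + (p - q - 1)) • ∑ r ∈ Finset.range q,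
              l r (a := a + (p - q - 1) + (q - r - 1)) (by omega)
                (Φ.act rfl (Φ.act rfl x (i.hochW m p q (by omega))) (i.hochW m q r (by omega)))) := by
          intro q _
          rw [i.cD_l Φ m h' q (a' := a - 1 + (p - q - 1)) _ (by omega) (by omega),
            Φ.d_act (a' := a - 1) (b' := p - q - 1 - 1) _ (by omega) (by omega) _ (by omega)
              (by omega), map_add, map_zsmul, add_assoc]
        have e2 : ∑ q ∈ Finset.range p, sg a • l q (a := a - 1 + (p - q - 1)) (by omega)
              (Φ.act (b := p - q - 1 - 1) (by omega) x ((E.Hom _ _).d (by omega)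
                (i.hochW m p q (c := p - q - 1) (by omega)))) = 
            -∑ q ∈ Finset.range p, sg (a + (p - q - 1)) • ∑ r ∈ Finset.range q,
              l (n := n'') r (a := a + (p - q - 1) + (q - r - 1)) (by omega)
                (Φ.act rfl (Φ.act rfl x (i.hochW m p q (by omega))) (i.hochW m q r (by omega))) := by
          simp only [Finset.smul_sum]
          rw [Finset.sum_comm' (s' := fun r => Finset.Ioo r p) (t' := Finset.range p) (by
            intro q r; simp only [Finset.mem_range, Finset.mem_Ioo]; omega),
            ← Finset.sum_neg_distrib]
          refine Finset.sum_congr rfl fun r _ => ?_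
          rw [i.d_hochW, map_sum, map_sum, Finset.smul_sum, ← Finset.sum_neg_distrib]
          refine Finset.sum_congr rfl fun q _ => ?_
          have e3 : ∀ (b : ℤ) (hb : b = a - 1 + (p - r - 1)) (h1 h2),
              l (n := n'') r (a := b) h1 (Φ.act h2
                (Φ.act rfl x (i.hochW m p q (c := p - q - 1) (by omega)))
                (i.hochW m q r (c := q - r - 1) (by omega))) =
              l r (a := a - 1 + (p - r - 1)) (by omega) (Φ.act (b := p - r - 1 - 1) (by omega) x
                (E.comp (by omega) (i.hochW m p q (c := p - q - 1) (by omega))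
                (i.hochW m q r (c := q - r - 1) (by omega)))) := by
            rintro b rfl h1 h2
            rw [Φ.act_comp (bc := p - r - 1 - 1) (h₃ := by omega) (h₄ := by omega)]
          rw [e3 _ (by omega), map_zsmul, map_zsmul, smul_smul, ← neg_smul, ← sg_add]
          congr 1
          exact sg_congr_neg ⟨0, by ring⟩
        rw [Finset.sum_congr rfl e1, Finset.sum_add_distrib, Finset.sum_add_distrib, e2,
          neg_add_cancel, add_zero, sg_congr_neg (a := a) (b := a - 1) ⟨0, by ring⟩, map_zero,
          zero_add, neg_smul, add_neg_cancel]
        rfl }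
  act h := cAct Φ h
  act_id := by
    intro n a h x
    refine hom_ext_apply ((cAct Φ h).flip (E.id n)) (AddMonoidHom.id _) (fun p e he x => ?_) x
    rw [AddMonoidHom.flip_apply, cAct_l Φ h p he (add_zero e) he]
    unfold DGProp.shiftW
    rw [E.wh_id, Φ.act_id]
    simp [sg_zero]
  act_comp := by
    intro n p m a b c ab bc abc h₁ h₂ h₃ h₄ x f g
    refine hom_ext_apply (((cAct Φ h₂).flip g).comp ((cAct Φ h₁).flip f))
      ((cAct Φ h₄).flip (E.comp h₃ f g)) (fun q e he x => ?_) x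
    simp only [AddMonoidHom.flip_apply, AddMonoidHom.comp_apply]
    rw [cAct_l Φ h₁ q he rfl (by omega), map_zsmul, AddMonoidHom.coe_smul, Pi.smul_apply,
      cAct_l Φ h₂ q (by omega) (rfl : e + b + c = _) (by omega),
      cAct_l Φ h₄ q he (by omega : e + bc = e + b + c) (by omega),
      Φ.act_comp (h₃ := h₃) (h₄ := by omega)]
    unfold DGProp.shiftW
    rw [E.wh_comp, smul_smul, ← sg_add]
    congr 2; rw [← h₃]; ring
  d_act := by
    intro n m a b c a' b' c' h ha hb hc h₁ h₂ x f
    refine hom_ext_apply ((i.cD Φ m hc).comp ((cAct Φ h).flip f))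
      (((cAct Φ h₁).flip f).comp (i.cD Φ n ha) +
        sg a • (cAct Φ h₂).flip ((E.Hom n m).d hb f)) (fun p e he x => ?_) x
    simp only [AddMonoidHom.flip_apply, AddMonoidHom.comp_apply, AddMonoidHom.add_apply,
      AddMonoidHom.coe_smul, Pi.smul_apply]
    rw [cAct_l Φ h p he rfl (by omega), map_zsmul, cAct_l Φ h₂ p (e' := e + b') he rfl (by omega),
      i.cD_l Φ n ha p (a' := e - 1) he (by omega) (by omega),
      i.cD_l Φ m hc p (a' := e + b') _ (by omega) (by omega),
      Φ.d_act (a' := e - 1) (b' := b') _ (by omega) hb _ (by omega) rfl, map_add, map_add, map_zsmul,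
      map_zsmul, map_sum, AddMonoidHom.add_apply, AddMonoidHom.coe_smul, Pi.smul_apply,
      AddMonoidHom.finsetSum_apply, cAct_l Φ h₁ p (e' := e + b') _ (by omega) (by omega)]
    have e1 : ∑ q ∈ Finset.range p, cAct Φ h₁ (l q (a := e + (p - q - 1)) (by omega)
          (Φ.act rfl x (i.hochW n p q (by omega)))) f =
        sg (p * b + b) • ∑ q ∈ Finset.range p, l (n := c') q (a := e + b + (p - q - 1)) (by omega)
          (Φ.act rfl (Φ.act rfl x (E.shiftW p f)) (i.hochW m p q (by omega))) := by
      rw [Finset.smul_sum]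
      refine Finset.sum_congr rfl fun q _ => ?_
      rw [cAct_l Φ h₁ q (e' := e + b + (p - q - 1)) _ (by omega) (by omega),
        Φ.act_comp (h₃ := rfl) (h₄ := by omega), Φ.act_comp (h₃ := add_comm _ _) (h₄ := by omega),
        i.hochW_shiftW _ f rfl (add_comm _ _), map_zsmul, map_zsmul, smul_smul, ← sg_add]
      congr 1
      exact sg_congr ⟨-b, by ring⟩
    rw [e1]
    have s1 : sg a * sg (p * b') = sg (p * b) * sg e := by
      rw [← sg_add, ← sg_add]; apply sg_congr; subst he hb; exact ⟨0, by ring⟩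
    have s2 : sg e * sg (p * b + b) = sg (p * b) * sg (e + b) := by
      rw [← sg_add, ← sg_add]; congr 1; ring
    have dS : (E.Hom _ _).d hb (E.shiftW p f) = E.shiftW p ((E.Hom _ _).d hb f) := E.d_wh _ _ _ _ _ _
    rw [dS]
    match_scalars
    · ring
    · linear_combination -s1
    · linear_combination -s2

/-- The functoriality of the Hochschild complex, `C(θ)(x ⊗ l_{p+1}) = θ(x) ⊗ l_{p+1}`. -/
def cMapGr {Φ Φ' : RMod E} {t : ℤ} (θ : RHom Φ Φ' t) (m : ℕ) {n n' : ℤ} (h : n + t = n') :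
    HochGr Φ m n →+ HochGr Φ' m n' :=
  lift fun p a ha => (l p (a := a + t) (by omega)).comp (θ.ap rfl)

theorem cMapGr_l {Φ Φ' : RMod E} {t : ℤ} (θ : RHom Φ Φ' t) (m : ℕ) {n n' : ℤ} (h : n + t = n')
    (p : ℕ) {a a' : ℤ} (ha : a + p = n) (ha' : a + t = a') (h' : a' + p = n')
    (x : (Φ.X (p + 1 + m)).X a) :
    cMapGr θ m h (l p ha x) = l p h' (θ.ap ha' x) := by
  subst ha'
  unfold cMapGr
  rw [lift_l]; rfl

/-- `C(θ)` as a morphism of dg-functors. -/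
def cMap {Φ Φ' : RMod E} {t : ℤ} (θ : RHom Φ Φ' t) : RHom (i.cObj Φ) (i.cObj Φ') t :=
  RHom.mk' (fun m _ _ h => cMapGr θ m h) (by
    intro n m k j k' a b h₁ h₂ h₃ h₄ x g
    refine hom_ext_apply ((cMapGr θ m h₂).comp ((cAct Φ h₁).flip g))
      (((cAct Φ' h₄).flip g).comp (cMapGr θ n h₃)) (fun p e he x => ?_) x
    simp only [AddMonoidHom.flip_apply, AddMonoidHom.comp_apply]
    rw [cAct_l Φ h₁ p he rfl (by omega), map_zsmul,
      cMapGr_l θ m h₂ p (a' := e + t + a) _ (by omega) (by omega),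
      cMapGr_l θ n h₃ p he rfl (by omega), cAct_l Φ' h₄ p _ rfl (by omega),
      θ.nat rfl (by omega) rfl rfl])

theorem cMap_ap {Φ Φ' : RMod E} {t : ℤ} (θ : RHom Φ Φ' t) {m : ℕ} {n n' : ℤ} (h : n + t = n')
    (x : ((i.cObj Φ).X m).X n) : (i.cMap θ).ap h x = cMapGr θ m h x := by
  subst h; rfl

/-- The Hochschild complex construction `C`, as a dg-endofunctor of `Fun(E, Ch)`. -/
def C : EndoFun E where
  obj := i.cObj
  map {Φ Φ' t} :=
    { toFun := i.cMap
      map_zero' := by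
        apply RHom.ext'; intro m n n' h x
        rw [i.cMap_ap, RHom.ap_zero]
        refine hom_ext_apply (cMapGr (0 : RHom Φ Φ' t) m h) 0 (fun p e he x => ?_) x
        rw [cMapGr_l _ m h p he rfl (by omega), RHom.ap_zero, map_zero]; rfl
      map_add' := fun θ θ' => by
        apply RHom.ext'; intro m n n' h x
        rw [RHom.ap_add, i.cMap_ap, i.cMap_ap, i.cMap_ap]
        refine hom_ext_apply (cMapGr (θ + θ') m h) (cMapGr θ m h + cMapGr θ' m h)
          (fun p e he x => ?_) x
        rw [AddMonoidHom.add_apply, cMapGr_l _ m h p he rfl (by omega),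
          cMapGr_l _ m h p he rfl (by omega), cMapGr_l _ m h p he rfl (by omega),
          RHom.ap_add, map_add] }
  map_id Φ := by
    apply RHom.ext'; intro m n n' h x
    obtain rfl : n' = n := by omega
    rw [RHom.id_ap]
    change (i.cMap (RHom.id Φ)).ap h x = x
    rw [i.cMap_ap]
    refine hom_ext_apply (cMapGr (RHom.id Φ) m h) (AddMonoidHom.id _) (fun p e he x => ?_) x
    rw [cMapGr_l _ m h p he (add_zero e) (by omega), RHom.id_ap]; rfl
  map_comp {Φ Φ' Φ'' s t r} h θ' θ := by
    apply RHom.ext'; intro m n n' h₁ x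
    rw [RHom.comp_ap _ _ _ _ rfl (by omega)]
    change (i.cMap (RHom.comp h θ' θ)).ap h₁ x = (i.cMap θ').ap _ ((i.cMap θ).ap _ x)
    rw [i.cMap_ap, i.cMap_ap, i.cMap_ap]
    refine hom_ext_apply (cMapGr (RHom.comp h θ' θ) m h₁)
      ((cMapGr θ' m (by omega)).comp (cMapGr θ m rfl)) (fun p e he x => ?_) x
    rw [AddMonoidHom.comp_apply, cMapGr_l _ m h₁ p (a' := e + t + s) he (by omega) (by omega),
      cMapGr_l _ m _ p he rfl (by omega), cMapGr_l _ m _ p _ rfl (by omega),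
      RHom.comp_ap _ _ _ _ rfl rfl]
  map_diff {Φ Φ' s t} h θ := by
    apply RHom.ext'; intro m n n' h₁ x
    rw [RHom.diff_ap h _ h₁ (rfl : n + t = n + t) (by omega) (by omega : n - 1 + 1 = n) (by omega)]
    refine (i.cMap_ap _ _ _).trans (Eq.trans ?_ (congrArg₂ (fun a b => a - sg t • b)
      (congrArg _ (i.cMap_ap θ _ x)) (i.cMap_ap θ _ _)).symm)
    refine hom_ext_apply (cMapGr (RHom.diff h θ) m h₁)
      ((i.cD Φ' m (by omega)).comp (cMapGr θ m rfl) -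
        sg t • (cMapGr θ m (by omega)).comp (i.cD Φ m (by omega : n - 1 + 1 = n)))
      (fun p e he x => ?_) x
    simp only [AddMonoidHom.sub_apply, AddMonoidHom.comp_apply, AddMonoidHom.coe_smul,
      Pi.smul_apply]
    rw [cMapGr_l _ m h₁ p (a' := e + s) he (by omega) (by omega), cMapGr_l _ m _ p he rfl (by omega),
      i.cD_l Φ' m _ p (a' := e + s) _ (by omega) (by omega),
      i.cD_l Φ m _ p (a' := e - 1) _ (by omega) (by omega), map_add, map_zsmul, map_sum,
      cMapGr_l _ m _ p (a' := e + s) _ (by omega) (by omega),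
      RHom.diff_ap h _ _ rfl (by omega) (by omega : e - 1 + 1 = e) (by omega), map_sub, map_zsmul]
    have e1 : ∑ q ∈ Finset.range p, cMapGr θ m (n := n - 1) (by omega) (l q (a := e + (p - q - 1)) (by omega)
          (Φ.act rfl x (i.hochW m p q (by omega)))) =
        ∑ q ∈ Finset.range p, l (n := n') q (a := e + t + (p - q - 1)) (by omega)
          (Φ'.act rfl (θ.ap rfl x) (i.hochW m p q (by omega))) := by
      refine Finset.sum_congr rfl fun q _ => ?_
      rw [cMapGr_l _ m _ q (a' := e + t + (p - q - 1)) _ (by omega) (by omega),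
        θ.nat rfl (by omega) rfl rfl]
    rw [e1, sg_add]
    module

end AInfMul

section CoHochschildGraded

variable {E : DGProp.{u}}

/-- The degree `n` part of the coHochschild complex, `∏_{p ≥ 0} Ψ(p + 1 + m)_{p+n}`: the maps of degree `n`
from the free graded group on the `l_{p+1}`, of degree `p`, whose value on `l_{p+1}` lies in
`Ψ(p + 1 + m)`. -/
abbrev CohochGr (Ψ : LMod E) (m : ℕ) (n : ℤ) : Type u :=
  ∀ p : ℕ, (Ψ.X (p + 1 + m)).X (p + n)

namespace CohochGr

variable {Ψ : LMod E} {m : ℕ} {n : ℤ}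

/-- The value `h(l_{p+1})`. -/
def ev (p : ℕ) {a : ℤ} (h : p + n = a) : CohochGr Ψ m n →+ (Ψ.X (p + 1 + m)).X a :=
  ((Ψ.X (p + 1 + m)).castHom h).comp (Pi.evalAddMonoidHom _ p)

/-- Maps into the product. -/
def pair {B : Type v} [AddCommGroup B]
    (F : ∀ (p : ℕ) (a : ℤ), p + n = a → (B →+ (Ψ.X (p + 1 + m)).X a)) : B →+ CohochGr Ψ m n :=
  AddMonoidHom.mk' (fun x p => F p (p + n) rfl x) (by intro x y; funext p; simp)

theorem ev_pair {B : Type v} [AddCommGroup B]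
    (F : ∀ (p : ℕ) (a : ℤ), p + n = a → (B →+ (Ψ.X (p + 1 + m)).X a)) (p : ℕ) {a : ℤ}
    (h : p + n = a) (x : B) : ev p h (pair F x) = F p a h x := by
  subst h; rfl

theorem ev_ext {h h' : CohochGr Ψ m n} (H : ∀ (p : ℕ) (a : ℤ) (ha : p + n = a),
    ev p ha h = ev p ha h') : h = h' := by
  funext p; exact H p _ rfl

end CohochGr

end CoHochschildGraded

namespace AInfMul

variable {E : DGProp.{u}} (i : AInfMul E)

open CohochGr

/-- The coHochschild differential
`(dh)(l_{p+1}) = (-1)^p (d(h(l_{p+1})) - Σ_{q < p} (f_{p+1,q+1} + id_m)·h(l_{q+1}))`. -/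
def dD (Ψ : LMod E) (m : ℕ) {n n' : ℤ} (h : n' + 1 = n) : CohochGr Ψ m n →+ CohochGr Ψ m n' :=
  pair fun p a ha => sg p • (((Ψ.X _).d (by omega)).comp (ev p (a := a + 1) (by omega)) -
    ∑ q ∈ Finset.range p, (Ψ.act (a := p - q - 1) (by omega) (i.hochW m p q (by omega))).comp
      (ev q rfl))

theorem dD_ev (Ψ : LMod E) (m : ℕ) {n n' : ℤ} (h : n' + 1 = n) (x : CohochGr Ψ m n) (p : ℕ)
    {a a' : ℤ} (ha : p + n = a) (ha' : p + n' = a') (haa : a' + 1 = a) :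
    ev p ha' (i.dD Ψ m h x) = sg p • ((Ψ.X _).d haa (ev p ha x) -
      ∑ q ∈ Finset.range p, Ψ.act (a := p - q - 1) (b := q + n) (by omega)
        (i.hochW m p q (by omega)) (ev q rfl x)) := by
  subst haa
  unfold dD
  rw [ev_pair]
  simp [AddMonoidHom.finsetSum_apply]

/-- The action `(f·h)(l_{p+1}) = (-1)^(p |f|) (id_(p+1) + f)·h(l_{p+1})`. -/
def dAct (Ψ : LMod E) {m m' : ℕ} {a b c : ℤ} (h : a + b = c) :
    (E.Hom m m').X a →+ CohochGr Ψ m' b →+ CohochGr Ψ m c :=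
  AddMonoidHom.mk' (fun f => pair fun p e he => sg (p * a) •
    (Ψ.act (by omega) (E.shiftW p f)).comp (ev p rfl)) (by
    intro f g
    ext x : 1
    apply ev_ext
    intro p e he
    rw [ev_pair, AddMonoidHom.add_apply, (ev p he).map_add, ev_pair, ev_pair]
    simp)

theorem dAct_ev (Ψ : LMod E) {m m' : ℕ} {a b c : ℤ} (h : a + b = c) (f : (E.Hom m m').X a)
    (x : CohochGr Ψ m' b) (p : ℕ) {e e' : ℤ} (he : p + b = e) (he' : p + c = e') (hae : a + e = e') :
    ev p he' (dAct Ψ h f x) = sg (p * a) • Ψ.act hae (E.shiftW p f) (ev p he x) := by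
  subst he
  unfold dAct
  exact ev_pair _ p he' x

/-- The coHochschild complex `D(Ψ)` of a dg-functor `Ψ : Eᵒᵖ → Ch`, again a dg-functor
`Eᵒᵖ → Ch`. -/
def D (Ψ : LMod E) : LMod E where
  X m :=
    { X := fun n => CohochGr Ψ m n
      d := fun h => i.dD Ψ m h
      d_d := by
        intro n n' n'' h h' x
        apply ev_ext
        intro p a ha
        rw [i.dD_ev Ψ m h' _ p (a := a + 1) (by omega) ha (by omega),
          i.dD_ev Ψ m h _ p (a := a + 1 + 1) (by omega) _ (by omega), map_zsmul, map_sub, Cplx.d_d,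
          map_sum]
        have e1 : ∀ q ∈ Finset.range p, (Ψ.X (p + 1 + m)).d (by omega : a + 1 = a + 1)
              (Ψ.act (a := p - q - 1) (b := q + n) (by omega)
                (i.hochW m p q (by omega)) (ev q rfl x)) =
            Ψ.act (a := p - q - 1 - 1) (b := q + n) (by omega)
              ((E.Hom _ _).d (by omega) (i.hochW m p q (c := p - q - 1) (by omega))) (ev q rfl x) +
            sg (p - q - 1) • Ψ.act (a := p - q - 1) (b := q + n') (by omega)
              (i.hochW m p q (by omega)) ((Ψ.X _).d (by omega) (ev q rfl x)) := by
          intro q _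
          exact Ψ.d_act _ (by omega) (by omega) _ (by omega) (by omega) _ _
        have e2 : ∀ q ∈ Finset.range p, Ψ.act (a := p - q - 1) (b := q + n') (c := a) (by omega)
              (i.hochW m p q (by omega)) (ev q rfl (i.dD Ψ m h x)) =
            sg q • Ψ.act (a := p - q - 1) (b := q + n') (by omega)
              (i.hochW m p q (by omega)) ((Ψ.X _).d (by omega) (ev q rfl x)) -
            sg q • ∑ r ∈ Finset.range q, Ψ.act (a := p - q - 1) (b := q + n') (by omega)
              (i.hochW m p q (by omega)) (Ψ.act (a := q - r - 1) (b := r + n) (by omega)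
              (i.hochW m q r (by omega)) (ev r rfl x)) := by
          intro q _
          rw [i.dD_ev Ψ m h _ q rfl rfl (by omega), map_zsmul, map_sub, smul_sub, map_sum]
        have e3 : ∑ q ∈ Finset.range p, Ψ.act (a := p - q - 1 - 1) (b := q + n) (by omega)
              ((E.Hom _ _).d (by omega) (i.hochW m p q (c := p - q - 1) (by omega))) (ev q rfl x) =
            sg p • ∑ q ∈ Finset.range p, sg q • ∑ r ∈ Finset.range q,
              Ψ.act (a := p - q - 1) (b := q + n') (c := a) (by omega)
              (i.hochW m p q (by omega)) (Ψ.act (a := q - r - 1) (b := r + n) (by omega)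
              (i.hochW m q r (by omega)) (ev r rfl x)) := by
          simp only [Finset.smul_sum]
          rw [Finset.sum_comm' (s' := fun r => Finset.Ioo r p) (t' := Finset.range p) (by
            intro q r; simp only [Finset.mem_range, Finset.mem_Ioo]; omega)]
          refine Finset.sum_congr rfl fun r _ => ?_
          rw [i.d_hochW, map_sum, AddMonoidHom.finsetSum_apply]
          refine Finset.sum_congr rfl fun q _ => ?_
          rw [map_zsmul, AddMonoidHom.coe_smul, Pi.smul_apply,
            Ψ.comp_act (bc := q + n') (h₃ := by omega) (h₄ := by omega), smul_smul, sg_sub]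
        have e4 : ∑ q ∈ Finset.range p, sg (p - q - 1) • Ψ.act (a := p - q - 1) (b := q + n')
              (c := a) (by omega) (i.hochW m p q (by omega)) ((Ψ.X _).d (by omega) (ev q rfl x)) =
            -(sg p • ∑ q ∈ Finset.range p, sg q • Ψ.act (a := p - q - 1) (b := q + n') (by omega)
              (i.hochW m p q (by omega)) ((Ψ.X _).d (by omega) (ev q rfl x))) := by
          rw [Finset.smul_sum, ← Finset.sum_neg_distrib]
          refine Finset.sum_congr rfl fun q _ => ?_
          rw [smul_smul, ← neg_smul, sg_sub, sg_sub, sg_one, mul_neg, mul_one]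
        rw [Finset.sum_congr rfl e1, Finset.sum_congr rfl e2, Finset.sum_add_distrib,
          Finset.sum_sub_distrib, e3, e4]
        have e5 := sg_mul_self p
        rw [map_zero]
        match_scalars
        · linear_combination -sg p * e5
        · linear_combination sg p * e5 }
  act h := dAct Ψ h
  id_act := by
    intro m a h x
    apply ev_ext
    intro p e he
    change ev p he (dAct Ψ h (E.id m) x) = ev p he x
    rw [dAct_ev Ψ h _ x p he he (zero_add e)]
    unfold DGProp.shiftW
    rw [E.wh_id, Ψ.id_act]
    simp [sg_zero]
  comp_act := by
    intro n p m a b c ab bc abc h₁ h₂ h₃ h₄ f g x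
    apply ev_ext
    intro q e he
    change ev q he (dAct Ψ h₂ (E.comp h₁ f g) x) = ev q he (dAct Ψ h₄ f (dAct Ψ h₃ g x))
    rw [dAct_ev Ψ h₂ _ x q rfl he (by omega),
      dAct_ev Ψ h₄ _ _ q (e := b + (q + c)) (by omega) he (by omega),
      dAct_ev Ψ h₃ _ _ q rfl (by omega) rfl, map_zsmul,
      ← Ψ.comp_act (h₁ := h₁) (h₂ := by omega), smul_smul, ← sg_add]
    unfold DGProp.shiftW
    rw [E.wh_comp]
    congr 2; rw [← h₁]; ring
  d_act := by
    intro n m a b c a' b' c' h ha hb hc h₁ h₂ f x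
    apply ev_ext
    intro p e he
    change ev p he (i.dD Ψ n hc (dAct Ψ h f x)) = ev p he (dAct Ψ h₁ ((E.Hom n m).d ha f) x +
      sg a • dAct Ψ h₂ f (i.dD Ψ m hb x))
    rw [map_add, map_zsmul, i.dD_ev Ψ n hc _ p (a := e + 1) (by omega) he rfl,
      dAct_ev Ψ h f x p rfl _ (by omega), dAct_ev Ψ h₁ _ x p rfl he (by omega),
      dAct_ev Ψ h₂ f _ p (rfl : p + b' = _) he (by omega),
      i.dD_ev Ψ m hb _ p rfl rfl (by omega), map_zsmul, map_zsmul, map_sub, map_sum,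
      Ψ.d_act (a' := a') (b' := p + b') _ ha (by omega) _ (by omega) (by omega)]
    have dS : (E.Hom _ _).d ha (E.shiftW p f) = E.shiftW p ((E.Hom _ _).d ha f) := E.d_wh _ _ _ _ _ _
    have e1 : ∑ q ∈ Finset.range p, Ψ.act (a := p - q - 1) (b := q + c) (c := e) (by omega)
          (i.hochW n p q (by omega)) (ev q rfl (dAct Ψ h f x)) =
        sg (p * a + a) • ∑ q ∈ Finset.range p, Ψ.act (a := a) (b := p + b') (by omega)
          (E.shiftW p f) (Ψ.act (a := p - q - 1) (b := q + b) (by omega) (i.hochW m p q (by omega))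
            (ev q rfl x)) := by
      rw [Finset.smul_sum]
      refine Finset.sum_congr rfl fun q _ => ?_
      rw [dAct_ev Ψ h f x q rfl rfl (by omega), map_zsmul,
        ← Ψ.comp_act (h₁ := rfl) (h₂ := by omega), ← Ψ.comp_act (h₁ := add_comm _ _) (h₂ := by omega),
        i.hochW_shiftW _ f rfl (add_comm _ _), map_zsmul, AddMonoidHom.coe_smul, Pi.smul_apply,
        smul_smul, ← sg_add]
      congr 1
      exact sg_congr ⟨-a, by ring⟩
    rw [dS, e1]
    have s1 : sg (p * a') = sg p * sg (p * a) := by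
      rw [← sg_add]; apply sg_congr; subst ha; exact ⟨-p, by ring⟩
    have s2 : sg (p * a + a) = sg (p * a) * sg a := sg_add _ _
    rw [s1, s2]
    module

end AInfMul

/-- A dg-subfunctor of a dg-functor `E → Ch`. -/
structure RMod.Sub {E : DGProp.{u}} (Φ : RMod E) where
  S : ∀ (n : ℕ) (k : ℤ), AddSubgroup ((Φ.X n).X k)
  d_mem : ∀ {n : ℕ} {k k' : ℤ} (h : k' + 1 = k) {x}, x ∈ S n k → (Φ.X n).d h x ∈ S n k'
  act_mem : ∀ {n m : ℕ} {a b c : ℤ} (h : a + b = c) {x} (f : (E.Hom n m).X b), x ∈ S n a →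
    Φ.act h x f ∈ S m c

/-- The quotient of a dg-functor `E → Ch` by a dg-subfunctor. -/
def RMod.quot {E : DGProp.{u}} (Φ : RMod E) (S : Φ.Sub) : RMod E where
  X n :=
    { X := fun k => (Φ.X n).X k ⧸ S.S n k
      d := fun h => QuotientAddGroup.map _ _ ((Φ.X n).d h) (fun _ hx => S.d_mem h hx)
      d_d := by
        intro k k' k'' h h' x
        induction x using QuotientAddGroup.induction_on with
        | H x =>
          exact congrArg (QuotientAddGroup.mk' (S.S n k'')) ((Φ.X n).d_d h h' x) }
  act {n m a b c} h := AddMonoidHom.flip (AddMonoidHom.mk'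
    (fun f => QuotientAddGroup.map _ _ ((Φ.act h).flip f) (fun _ hx => S.act_mem h f hx)) (by
      intro f g
      ext x
      exact congrArg (QuotientAddGroup.mk' (S.S m c)) ((Φ.act h x).map_add f g)))
  act_id := by
    intro n a h x
    induction x using QuotientAddGroup.induction_on with
    | H x => exact congrArg _ (Φ.act_id h x)
  act_comp := by
    intro n p m a b c ab bc abc h₁ h₂ h₃ h₄ x f g
    induction x using QuotientAddGroup.induction_on with
    | H x => exact congrArg _ (Φ.act_comp h₁ h₂ h₃ h₄ x f g)
  d_act := by
    intro n m a b c a' b' c' h ha hb hc h₁ h₂ x f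
    induction x using QuotientAddGroup.induction_on with
    | H x =>
      refine (congrArg (QuotientAddGroup.mk' (S.S m c')) (Φ.d_act h ha hb hc h₁ h₂ x f)).trans ?_
      rw [map_add, map_zsmul]; rfl

/-- The morphism of quotients induced by a morphism of dg-functors. -/
def RMod.quotMap {E : DGProp.{u}} {Φ Φ' : RMod E} (S : Φ.Sub) (S' : Φ'.Sub) {t : ℤ} (θ : RHom Φ Φ' t)
    (H : ∀ {n : ℕ} {k k' : ℤ} (h : k + t = k') {x}, x ∈ S.S n k → θ.ap h x ∈ S'.S n k') :
    RHom (Φ.quot S) (Φ'.quot S') t :=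
  RHom.mk' (fun n k k' h => QuotientAddGroup.map (S.S n k) (S'.S n k') (θ.ap h)
    (fun _ hx => H h hx)) (by
    intro n m k j k' a b h₁ h₂ h₃ h₄ x g
    induction x using QuotientAddGroup.induction_on with
    | H x => exact congrArg _ (θ.nat h₁ h₂ h₃ h₄ x g))

theorem RMod.quotMap_ap {E : DGProp.{u}} {Φ Φ' : RMod E} (S : Φ.Sub) (S' : Φ'.Sub) {t : ℤ}
    (θ : RHom Φ Φ' t) (H) {n : ℕ} {k k' : ℤ} (h : k + t = k') (x : (Φ.X n).X k) :
    (RMod.quotMap S S' θ H).ap (n := n) h (QuotientAddGroup.mk x) =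
      QuotientAddGroup.mk (θ.ap h x) := by
  subst h; rfl

/-- A dg-subfunctor of a dg-functor `Eᵒᵖ → Ch`. -/
structure LMod.Sub {E : DGProp.{u}} (Ψ : LMod E) where
  S : ∀ (n : ℕ) (k : ℤ), AddSubgroup ((Ψ.X n).X k)
  d_mem : ∀ {n : ℕ} {k k' : ℤ} (h : k' + 1 = k) {x}, x ∈ S n k → (Ψ.X n).d h x ∈ S n k'
  act_mem : ∀ {n m : ℕ} {a b c : ℤ} (h : a + b = c) (f : (E.Hom n m).X a) {x}, x ∈ S m b →
    Ψ.act h f x ∈ S n c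

/-- A dg-subfunctor as a dg-functor `Eᵒᵖ → Ch`. -/
def LMod.sub {E : DGProp.{u}} (Ψ : LMod E) (S : Ψ.Sub) : LMod E where
  X n :=
    { X := fun k => S.S n k
      d := fun {k k'} h => ((((Ψ.X n).d h).comp (S.S n k).subtype).codRestrict (S.S n k')
        (fun x => S.d_mem h x.2))
      d_d := fun h h' x => Subtype.ext ((Ψ.X n).d_d h h' x.1) }
  act {n m a b c} h := AddMonoidHom.mk' (fun f =>
    (((Ψ.act h f).comp (S.S m b).subtype).codRestrict (S.S n c) (fun x => S.act_mem h f x.2))) (by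
      intro f g
      ext x
      simp)
  id_act h x := Subtype.ext (Ψ.id_act h x.1)
  comp_act h₁ h₂ h₃ h₄ f g x := Subtype.ext (Ψ.comp_act h₁ h₂ h₃ h₄ f g x.1)
  d_act h ha hb hc h₁ h₂ f x := Subtype.ext (Ψ.d_act h ha hb hc h₁ h₂ f x.1)

namespace AInfUnit

variable {E : DGProp.{u}} {i : AInfMul E} (η : AInfUnit i)

/-- `id_j + u + id_(p-j) + id_m`: the unit inserted in place `j` (counting from `0`) of the
first `p + 1` entries. -/
def insW (m p j : ℕ) (h : j ≤ p) : (E.Hom (p + m) (p + 1 + m)).X 0 :=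
  E.wh 0 m (by omega) (by omega) (E.ins η.u p j h)

theorem d_insW (m p j : ℕ) (h : j ≤ p) {k : ℤ} (hk : k + 1 = 0) :
    (E.Hom _ _).d hk (η.insW m p j h) = 0 := by
  unfold insW DGProp.ins
  rw [E.d_wh, E.d_wh, η.d_u, map_zero, map_zero]

theorem insW_shiftW {m m' p j : ℕ} {b : ℤ} (h : j ≤ p) (f : (E.Hom m m').X b) :
    E.comp (zero_add b) (η.insW m p j h) (E.shiftW p f) =
      E.comp (add_zero b) (E.wh p 0 (by omega : p + m + 0 = p + m) (by omega : p + m' + 0 = p + m') f)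
        (η.insW m' p j h) := by
  have := E.wh_disjoint (E.ins η.u p j h) f (N := p + m) (P := p + 1 + m) (Q := p + m')
    (M := p + 1 + m') (b₁ := m) (b₂ := m') (x := p + 1) (y := p) (e := 0) (zero_add b) (add_zero b)
    (by omega) (by omega) (by omega) (by omega) (by omega) (by omega) (by omega) (by omega) le_rfl
  rw [zero_mul, sg_zero, one_smul] at this
  exact this

/-- A unit inserted in one of the places `2, …, p + 1` remains in one of the places `2, …, q + 1` under the
Hochschild differential, up to cancelling terms. -/
theorem insW_hochW_mem {m p q j : ℕ} {c : ℤ} (h : c + 1 = p - q) (hj : 1 ≤ j) (hj' : j ≤ p) :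
    E.comp (zero_add c) (η.insW m p j hj') (i.hochW m p q h) ∈
      AddSubgroup.closure {z : (E.Hom (p + m) (q + 1 + m)).X c |
        ∃ (j' : ℕ) (_ : 1 ≤ j') (h' : j' ≤ q) (y : (E.Hom (p + m) (q + m)).X c),
          z = E.comp (add_zero c) y (η.insW m q j' h')} := by
  have key := η.ins_hoch_mem h hj hj'
  have e : E.comp (zero_add c) (η.insW m p j hj') (i.hochW m p q h) =
      E.wh 0 m (by omega : 0 + p + m = p + m) (by omega : 0 + (q + 1) + m = q + 1 + m)
        (E.comp (zero_add c) (E.ins η.u p j hj') (i.hoch p q h)) := by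
    rw [← E.wh_comp (hP := (by omega : 0 + (p + 1) + m = p + 1 + m))]; rfl
  rw [e]
  revert key
  generalize E.comp _ (E.ins η.u p j hj') (i.hoch p q h) = w
  intro key
  unfold deg at key
  induction key using AddSubgroup.closure_induction with
  | mem z hz =>
    obtain ⟨j', h₁, hj₂, y, rfl⟩ := hz
    refine AddSubgroup.subset_closure ⟨j', h₁, hj₂, E.wh 0 m (by omega) (by omega) y, ?_⟩
    rw [← E.wh_comp (hP := (by omega : 0 + q + m = q + m))]; rfl
  | zero => rw [map_zero]; exact zero_mem _
  | add z w _ _ hz hw => rw [map_add]; exact add_mem hz hw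
  | neg z _ hz => rw [map_neg]; exact neg_mem hz

open HochGr CohochGr

/-- The subgroup of the Hochschild complex spanned by the elements `x·(u_j + id_m) ⊗ l_{p+1}`, where
`u_j` inserts the unit in one of the places `2, …, p + 1`, that is, after `1 ≤ j ≤ p` entries. -/
def degS (Φ : RMod E) (m : ℕ) (n : ℤ) : AddSubgroup (HochGr Φ m n) :=
  AddSubgroup.closure {z | ∃ (p j : ℕ) (_ : 1 ≤ j) (hj : j ≤ p) (a : ℤ) (h : a + p = n)
    (x : (Φ.X (p + m)).X a), z = l p h (Φ.act (add_zero a) x (η.insW m p j hj))}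

theorem mem_degS (Φ : RMod E) {m p j : ℕ} {n a : ℤ} (h : a + p = n) (hj : 1 ≤ j) (hj' : j ≤ p)
    (x : (Φ.X (p + m)).X a) : l p h (Φ.act (add_zero a) x (η.insW m p j hj')) ∈ η.degS Φ m n :=
  AddSubgroup.subset_closure ⟨p, j, hj, hj', a, h, x, rfl⟩

theorem degS_hom (Φ : RMod E) {m : ℕ} {n : ℤ} {B : Type u} [AddCommGroup B]
    (f : HochGr Φ m n →+ B) (T : AddSubgroup B) (H : ∀ (p j : ℕ) (_ : 1 ≤ j) (hj : j ≤ p) (a : ℤ)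
      (h : a + p = n) (x : (Φ.X (p + m)).X a),
      f (l p h (Φ.act (add_zero a) x (η.insW m p j hj))) ∈ T) {z} (hz : z ∈ η.degS Φ m n) :
    f z ∈ T := by
  have : η.degS Φ m n ≤ T.comap f := by
    unfold degS
    rw [AddSubgroup.closure_le]
    rintro _ ⟨p, j, hj, hj', a, h, x, rfl⟩
    exact H p j hj hj' a h x
  exact this hz

/-- The degenerate subfunctor of the Hochschild complex. -/
def degSub (Φ : RMod E) : (i.cObj Φ).Sub where
  S m n := η.degS Φ m n
  d_mem {m n n'} h z hz := by
    refine η.degS_hom Φ (i.cD Φ m h) (η.degS Φ m n') (fun p j hj hj' a ha x => ?_) hz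
    rw [i.cD_l Φ m h p (a' := a - 1) ha (by omega) (by omega),
      Φ.d_act (a' := a - 1) (b' := -1) _ (by omega) (by omega) _ (by omega) (by omega), η.d_insW]
    simp only [map_zero, smul_zero, add_zero]
    refine add_mem (η.mem_degS Φ _ hj hj' _) (zsmul_mem (sum_mem fun q _ => ?_) _)
    rw [Φ.act_comp (h₃ := zero_add _) (h₄ := rfl)]
    have hm := η.insW_hochW_mem (m := m) (p := p) (q := q) (c := p - q - 1) (by omega) hj hj'
    revert hm
    generalize E.comp _ (η.insW m p j hj') (i.hochW m p q _) = w
    intro hm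
    induction hm using AddSubgroup.closure_induction with
    | mem z hz =>
      obtain ⟨j', h₁, hj₂, y, rfl⟩ := hz
      rw [← Φ.act_comp (h₁ := rfl) (h₂ := add_zero _)]
      exact η.mem_degS Φ _ h₁ hj₂ _
    | zero => rw [map_zero, map_zero]; exact zero_mem _
    | add z w _ _ hz hw => rw [map_add, map_add]; exact add_mem hz hw
    | neg z _ hz => rw [map_neg, map_neg]; exact neg_mem hz
  act_mem {n m a b c} h z f hz := by
    refine η.degS_hom Φ ((AInfMul.cAct Φ h).flip f) (η.degS Φ m c) (fun p j hj hj' e he x => ?_) hz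
    rw [AddMonoidHom.flip_apply, AInfMul.cAct_l Φ h p he rfl (by omega),
      Φ.act_comp (h₃ := zero_add b) (h₄ := rfl), η.insW_shiftW,
      ← Φ.act_comp (h₁ := rfl) (h₂ := add_zero _)]
    exact zsmul_mem (η.mem_degS Φ _ hj hj' _) _

theorem cMap_mem {Φ Φ' : RMod E} {t : ℤ} (θ : RHom Φ Φ' t) {m : ℕ} {n n' : ℤ} (h : n + t = n')
    {z : ((i.cObj Φ).X m).X n} (hz : z ∈ (η.degSub Φ).S m n) :
    (i.cMap θ).ap h z ∈ (η.degSub Φ').S m n' := by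
  rw [i.cMap_ap]
  refine η.degS_hom Φ (AInfMul.cMapGr θ m h) (η.degS Φ' m n') (fun p j hj hj' e he x => ?_) hz
  rw [AInfMul.cMapGr_l θ m h p he rfl (by omega), θ.nat (add_zero e) rfl rfl (add_zero _)]
  exact η.mem_degS Φ' _ hj hj' _

/-- The reduced Hochschild complex construction, as a dg-endofunctor of `Fun(E, Ch)`. -/
def C : EndoFun E where
  obj Φ := (i.cObj Φ).quot (η.degSub Φ)
  map {Φ Φ' t} := AddMonoidHom.mk' (fun θ => RMod.quotMap _ _ (i.cMap θ) (η.cMap_mem θ)) (by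
    intro θ θ'
    apply RHom.ext'; intro m n n' h x
    rw [RHom.ap_add]
    induction x using QuotientAddGroup.induction_on with
    | H x =>
      rw [RMod.quotMap_ap, RMod.quotMap_ap, RMod.quotMap_ap]
      refine congrArg QuotientAddGroup.mk ?_
      change (i.C.map (θ + θ')).ap h x = _
      rw [map_add]; exact RHom.ap_add _ _ _ _)
  map_id Φ := by
    apply RHom.ext'; intro m n n' h x
    obtain rfl : n' = n := by omega
    rw [RHom.id_ap]
    induction x using QuotientAddGroup.induction_on with
    | H x =>
      refine (RMod.quotMap_ap _ _ _ _ _ _).trans ?_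
      refine congrArg QuotientAddGroup.mk ?_
      change (i.C.map (RHom.id Φ)).ap h x = _
      rw [i.C.map_id]; exact RHom.id_ap _ _
  map_comp {Φ Φ' Φ'' s t r} h θ' θ := by
    apply RHom.ext'; intro m n n' h₁ x
    rw [RHom.comp_ap _ _ _ _ rfl (by omega)]
    induction x using QuotientAddGroup.induction_on with
    | H x =>
      refine (RMod.quotMap_ap _ _ _ _ _ _).trans (Eq.trans ?_ (congrArg _
        (RMod.quotMap_ap _ _ _ _ _ _)).symm)
      refine Eq.trans ?_ (RMod.quotMap_ap _ _ _ _ _ _).symm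
      refine congrArg QuotientAddGroup.mk ?_
      change (i.C.map (RHom.comp h θ' θ)).ap h₁ x = _
      rw [i.C.map_comp]
      exact RHom.comp_ap _ _ _ _ _ _ _
  map_diff {Φ Φ' s t} h θ := by
    apply RHom.ext'; intro m n n' h₁ x
    rw [RHom.diff_ap h _ h₁ (rfl : n + t = n + t) (by omega) (by omega : n - 1 + 1 = n) (by omega)]
    induction x using QuotientAddGroup.induction_on with
    | H x =>
      refine (RMod.quotMap_ap _ _ _ _ _ _).trans (Eq.trans ?_ (congrArg₂ (fun a b => a - sg t • b)
        (congrArg _ (RMod.quotMap_ap _ _ _ _ _ _)) (RMod.quotMap_ap _ _ _ _ _ _)).symm)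
      refine congrArg QuotientAddGroup.mk ?_
      change (i.C.map (RHom.diff h θ)).ap h₁ x = _
      rw [i.C.map_diff]
      exact RHom.diff_ap _ _ _ _ _ _ _ _

/-- The reduced coHochschild complex: the elements `h` of the coHochschild complex such that every
value `h(l_{p+1})` is annihilated by the insertions of the unit in the places `2, …, p + 1`. -/
def normS (Ψ : LMod E) (m : ℕ) (n : ℤ) : AddSubgroup (CohochGr Ψ m n) where
  carrier := {h | ∀ (p j : ℕ) (_ : 1 ≤ j) (hj : j ≤ p),
    Ψ.act (zero_add _) (η.insW m p j hj) (ev p (rfl : p + n = p + n) h) = 0}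
  add_mem' := by
    intro x y hx hy p j hj hj'
    rw [map_add, map_add, hx p j hj hj', hy p j hj hj', add_zero]
  zero_mem' := by intro p j hj hj'; rw [map_zero, map_zero]
  neg_mem' := by
    intro x hx p j hj hj'
    rw [map_neg, map_neg, hx p j hj hj', neg_zero]

theorem mem_normS (Ψ : LMod E) {m : ℕ} {n : ℤ} {h : CohochGr Ψ m n} (hh : h ∈ η.normS Ψ m n)
    {p j : ℕ} (hj : 1 ≤ j) (hj' : j ≤ p) {a : ℤ} (ha : p + n = a) :
    Ψ.act (zero_add a) (η.insW m p j hj') (ev p ha h) = 0 := by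
  subst ha; exact hh p j hj hj'

/-- The normalized subfunctor of the coHochschild complex. -/
def normSub (Ψ : LMod E) : (i.D Ψ).Sub where
  S m n := η.normS Ψ m n
  d_mem {m n n'} h x hx := by
    intro p j hj hj'
    change Ψ.act _ _ (ev p _ (i.dD Ψ m h x)) = 0
    rw [i.dD_ev Ψ m h x p rfl rfl (by omega), map_zsmul, map_sub, map_sum]
    have e1 : Ψ.act (zero_add (p + n')) (η.insW m p j hj')
        ((Ψ.X _).d (by omega) (ev p (rfl : p + n = p + n) x)) = 0 := by
      have := Ψ.d_act (a' := -1) (b' := p + n') (zero_add (p + n)) (by omega) (by omega) (by omega)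
        (by omega) (zero_add _) (η.insW m p j hj') (ev p rfl x)
      rw [η.mem_normS Ψ hx hj hj' rfl, η.d_insW] at this
      simpa [sg_zero] using this.symm
    rw [e1, Finset.sum_eq_zero, sub_zero, smul_zero]
    intro q _
    rw [← Ψ.comp_act (h₁ := zero_add _) (h₂ := by omega)]
    have hm := η.insW_hochW_mem (m := m) (p := p) (q := q) (c := p - q - 1) (by omega) hj hj'
    revert hm
    generalize E.comp _ (η.insW m p j hj') (i.hochW m p q _) = w
    intro hm
    induction hm using AddSubgroup.closure_induction with
    | mem z hz =>
      obtain ⟨j', h₁, hj₂, y, rfl⟩ := hz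
      rw [Ψ.comp_act (h₃ := zero_add _) (h₄ := by omega), η.mem_normS Ψ hx h₁ hj₂, map_zero]
    | zero => rw [map_zero]; rfl
    | add z w _ _ hz hw => rw [map_add, AddMonoidHom.add_apply, hz, hw, add_zero]
    | neg z _ hz => rw [map_neg, AddMonoidHom.neg_apply, hz, neg_zero]
  act_mem {n m a b c} h f x hx := by
    intro p j hj hj'
    change Ψ.act _ _ (ev p _ (AInfMul.dAct Ψ h f x)) = 0
    rw [AInfMul.dAct_ev Ψ h f x p rfl rfl (by omega), map_zsmul,
      ← Ψ.comp_act (h₁ := zero_add a) (h₂ := by omega), η.insW_shiftW,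
      Ψ.comp_act (h₃ := zero_add _) (h₄ := by omega), η.mem_normS Ψ hx hj hj', map_zero, smul_zero]

/-- The reduced coHochschild complex of a dg-functor `Eᵒᵖ → Ch`. -/
def D (Ψ : LMod E) : LMod E := (i.D Ψ).sub (η.normSub Ψ)

end AInfUnit

/-- Two complexes are isomorphic. -/
def Cplx.Isomorphic (A : Cplx.{u}) (B : Cplx.{v}) : Prop :=
  ∃ φ : ∀ k : ℤ, A.X k ≃+ B.X k,
    ∀ {k k' : ℤ} (h : k' + 1 = k) (x : A.X k), φ k' (A.d h x) = B.d h (φ k x)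

/-- There is a quasi-isomorphism from `A` to `B`: a chain map which is injective and
surjective on homology in every degree. -/
def Cplx.QIso (A B : Cplx.{u}) : Prop :=
  ∃ f : ∀ k : ℤ, A.X k →+ B.X k,
    (∀ {k k' : ℤ} (h : k' + 1 = k) (x : A.X k), f k' (A.d h x) = B.d h (f k x)) ∧
    (∀ {k₁ k k₀ : ℤ} (h₁ : k + 1 = k₁) (h₀ : k₀ + 1 = k) (x : A.X k), A.d h₀ x = 0 →
      (∃ y : B.X k₁, B.d h₁ y = f k x) → ∃ z : A.X k₁, A.d h₁ z = x) ∧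
    (∀ {k₁ k k₀ : ℤ} (h₁ : k + 1 = k₁) (h₀ : k₀ + 1 = k) (y : B.X k), B.d h₀ y = 0 →
      ∃ (x : A.X k) (w : B.X k₁), A.d h₀ x = 0 ∧ f k x = y + B.d h₁ w)

/-- Two complexes are quasi-isomorphic: they are connected by a zigzag of quasi-isomorphisms. -/
def Cplx.QuasiIsomorphic (A B : Cplx.{u}) : Prop := Relation.EqvGen Cplx.QIso A B

namespace AInfMul

variable {E : DGProp.{u}} (i : AInfMul E)

/-- The complex `Nat_E((m₁,n₁),(m₂,n₂))` of formal operations: the natural transformations from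
`Φ ↦ C^{n₁}(Φ)(m₁)` to `Φ ↦ C^{n₂}(Φ)(m₂)`, where `Φ` runs over all dg-functors `E → Ch`. -/
def NatOps (m₁ n₁ m₂ n₂ : ℕ) : Cplx.{u + 1} :=
  natCplx ((i.C.iter n₁).eval m₁) ((i.C.iter n₂).eval m₂)

/-- The complex `D^{n₁} C^{n₂} E(-,-)(m₁, m₂)`: the iterated Hochschild construction is applied to the
dg-functors `E(p, -)` and evaluated at `m₂`, then the iterated coHochschild construction is applied
to the resulting dg-functor of `p` and evaluated at `m₁`. -/
def DC (m₁ n₁ m₂ n₂ : ℕ) : Cplx.{u} := (i.D^[n₁] ((i.C.iter n₂).onRep m₂)).X m₁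

end AInfMul

namespace AInfUnit

variable {E : DGProp.{u}} {i : AInfMul E} (η : AInfUnit i)

/-- The complex of reduced formal operations. -/
def NatOps (m₁ n₁ m₂ n₂ : ℕ) : Cplx.{u + 1} :=
  natCplx ((η.C.iter n₁).eval m₁) ((η.C.iter n₂).eval m₂)

/-- The reduced iterated coHochschild-Hochschild complex. -/
def DC (m₁ n₁ m₂ n₂ : ℕ) : Cplx.{u} := (η.D^[n₁] ((η.C.iter n₂).onRep m₂)).X m₁

end AInfUnit

section Explicit

/-- `(k₁ + 1) + ⋯ + (k_n + 1)` -/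
abbrev tot {n : ℕ} (k : Fin n → ℕ) : ℕ := ∑ s, (k s + 1)

theorem tot_split {n : ℕ} (k : Fin n → ℕ) (s : Fin n) (q m : ℕ) :
    ∑ r ∈ Finset.Iio s, (k r + 1) + (q + 1) + (∑ r ∈ Finset.Ioi s, (k r + 1) + m) =
      tot (Function.update k s q) + m := by
  have h : ∀ f : Fin n → ℕ, ∑ r, f r = ∑ r ∈ Finset.Iio s, f r + f s + ∑ r ∈ Finset.Ioi s, f r := by
    intro f
    have e : (Finset.univ : Finset (Fin n)) = (Finset.Iio s ∪ {s}) ∪ Finset.Ioi s := by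
      ext r; simp only [Finset.mem_univ, Finset.mem_union, Finset.mem_Iio, Finset.mem_singleton,
        Finset.mem_Ioi, true_iff]; omega
    rw [e, Finset.sum_union, Finset.sum_union, Finset.sum_singleton]
    · simp
    · rw [Finset.disjoint_left]; intro r
      simp only [Finset.mem_union, Finset.mem_Iio, Finset.mem_singleton, Finset.mem_Ioi]; omega
  have h1 : ∑ r ∈ Finset.Iio s, (Function.update k s q r + 1) = ∑ r ∈ Finset.Iio s, (k r + 1) :=
    Finset.sum_congr rfl fun r hr => by
      rw [Function.update_of_ne (Finset.mem_Iio.1 hr).ne]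
  have h2 : ∑ r ∈ Finset.Ioi s, (Function.update k s q r + 1) = ∑ r ∈ Finset.Ioi s, (k r + 1) :=
    Finset.sum_congr rfl fun r hr => by
      rw [Function.update_of_ne (Finset.mem_Ioi.1 hr).ne']
  unfold tot
  rw [h fun r => Function.update k s q r + 1, h1, h2, Function.update_self]; omega

theorem tot_split_self {n : ℕ} (k : Fin n → ℕ) (s : Fin n) (m : ℕ) :
    ∑ r ∈ Finset.Iio s, (k r + 1) + (k s + 1) + (∑ r ∈ Finset.Ioi s, (k r + 1) + m) =
      tot k + m := by
  rw [tot_split, Function.update_eq_self]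

/-- `k₁ + ⋯ + k_n` as an integer -/
abbrev deg {n : ℕ} (k : Fin n → ℕ) : ℤ := ∑ s, (k s : ℤ)

theorem deg_update {n : ℕ} (k : Fin n → ℕ) (s : Fin n) (q : ℕ) :
    deg (Function.update k s q) = deg k - k s + q := by
  have h : deg (Function.update k s q) + k s = deg k + q := by
    unfold deg
    rw [← Finset.add_sum_erase _ _ (Finset.mem_univ s),
      ← Finset.add_sum_erase (a := s) _ (fun r => (k r : ℤ)) (Finset.mem_univ s),
      Function.update_self]
    rw [Finset.sum_congr rfl (g := fun r => (k r : ℤ)) fun r hr => by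
      rw [Function.update_of_ne (Finset.ne_of_mem_erase hr)]]
    ring
  omega

/-- The Koszul sign of a morphism of degree `k_s - q` which passes the generators
`l_{k_r + 1}`, `r < s`. -/
def koszul {n : ℕ} (k : Fin n → ℕ) (s : Fin n) (q : ℕ) : ℤ :=
  sg ((∑ r ∈ Finset.Iio s, (k r : ℤ)) * (k s - q))

namespace AInfMul

variable {E : DGProp.{u}} (i : AInfMul E)

/-- `id + f_{k_s+1,q+1} + id`, where `f` acts on the `s`-th of the `n` blocks of sizes `k_r + 1`. -/
def hochAt {n : ℕ} (m : ℕ) (k : Fin n → ℕ) (s : Fin n) (q : ℕ) :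
    (E.Hom (tot k + m) (tot (Function.update k s q) + m)).X (k s - q - 1) :=
  E.wh (∑ r ∈ Finset.Iio s, (k r + 1)) (∑ r ∈ Finset.Ioi s, (k r + 1) + m)
    (tot_split_self k s m) (tot_split k s q m) (i.hoch (k s) q (by omega))

/-- `⊕_{k_1, …, k_n ≥ 0} E(N, Σ(k_s + 1) + m)_{a - Σ k_s}` -/
abbrev Row (E : DGProp.{u}) (N n m : ℕ) (a : ℤ) : Type u :=
  DirectSum (Fin n → ℕ) fun k => (E.Hom N (tot k + m)).X (a - deg k)

/-- The differential of `E` plus the multi-Hochschild differential: it sends `x`, in the summand of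
index `k`, to `dx` in the same summand plus the sum over `s` and `q < k_s` of
`± x·(id + f_{k_s+1,q+1} + id)` in the summand where `k_s` is replaced by `q`. -/
def rowD (N n m : ℕ) {a a' : ℤ} (h : a' + 1 = a) : Row E N n m a →+ Row E N n m a' :=
  DirectSum.toAddMonoid fun k =>
    (DirectSum.of (fun k : Fin n → ℕ => (E.Hom N (tot k + m)).X (a' - deg k)) k).comp
      ((E.Hom N (tot k + m)).d (by omega)) +
    ∑ s : Fin n, ∑ q ∈ Finset.range (k s), (sg (a - deg k) * koszul k s q) •
      (DirectSum.of (fun k : Fin n → ℕ => (E.Hom N (tot k + m)).X (a' - deg k))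
        (Function.update k s q)).comp
        ((E.comp (by rw [deg_update]; omega)).flip (i.hochAt m k s q))

/-- Left multiplication by an element of `E(N', N)`. -/
def rowMul {N' N : ℕ} (n m : ℕ) {a b c : ℤ} (h : a + b = c) (f : (E.Hom N' N).X a) :
    Row E N n m b →+ Row E N' n m c :=
  DirectSum.toAddMonoid fun k =>
    (DirectSum.of (fun k : Fin n → ℕ => (E.Hom N' (tot k + m)).X (c - deg k)) k).comp
      (E.comp (by omega) f)

/-- The degree `e` part of the graded group
`∏_j ⊕_k E(Σ(j_s + 1) + m₁, Σ(k_s + 1) + m₂)[Σ k_s - Σ j_s]`, where `j` and `k` run over all tuples of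
`n₁` and `n₂` natural numbers. -/
abbrev ExplGr (E : DGProp.{u}) (m₁ n₁ m₂ n₂ : ℕ) (e : ℤ) : Type u :=
  ∀ j : Fin n₁ → ℕ, Row E (tot j + m₁) n₂ m₂ (e + deg j)

/-- The differential of `E` plus the multi-Hochschild and the multi-coHochschild differential:
`(dg)_j = (-1)^(Σ j_s) (d(g_j) - Σ_{s, q < j_s} ± (id + f_{j_s+1,q+1} + id)·g_{j'})`, where `j'` is `j`
with `j_s` replaced by `q`, and where `d(g_j)` includes the multi-Hochschild terms. -/
def explD (m₁ n₁ m₂ n₂ : ℕ) {e e' : ℤ} (h : e' + 1 = e) (g : ExplGr E m₁ n₁ m₂ n₂ e) :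
    ExplGr E m₁ n₁ m₂ n₂ e' := fun j =>
  sg (deg j) • (i.rowD (tot j + m₁) n₂ m₂ (by omega) (g j) -
    ∑ s : Fin n₁, ∑ q ∈ Finset.range (j s), koszul j s q •
      rowMul n₂ m₂ (by rw [deg_update]; omega) (i.hochAt m₁ j s q) (g (Function.update j s q)))

end AInfMul

end Explicit

end FormalOps

universe w

/-! By the enriched Yoneda lemma a natural transformation from `Φ ↦ Φ(m)` to a dg-functor `K` is
determined by its value at the identity in `E(m, -)(m)`, so these transformations form the complex
`K(E(m, -))`. The Hochschild complex is a direct sum of shifted copies of `Φ(p + 1 + m)`, and a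
transformation out of a direct sum is an arbitrary family of transformations out of the summands.
Hence each `C` applied in the source replaces the representing object `Ψ` by the product `D(Ψ)`.
Under the pairing `⟨x ⊗ l, h⟩ = ⟨x, h(l)⟩` the Hochschild elements acting on `x` are adjoint to the
same elements acting on the values of `h`, so the differentials correspond. A quotient of the source
is represented by the annihilator of its kernel, and the annihilator of the degenerate elements is
the reduced coHochschild complex. `Represents` collects what this induction needs; the steps are
`Represents.yoneda`, `Represents.hoch` and `Represents.redHoch`.

The explicit formula unwinds the iteration: every `D` adds an index to a product and every `C` adds
one to a direct sum (`CoExpansion.cohoch`, `Expansion.hoch`). The newest construction owns the last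
block of entries, and its Hochschild element has to pass the generators of the earlier blocks, which
produces the Koszul sign.

For the comparison with the reduced complexes, both are related to the transformations from the
unreduced source to the reduced target. Two facts are needed: `C` and `D` preserve
quasi-isomorphisms, and the maps between reduced and unreduced complexes are quasi-isomorphisms. The
first holds because both differentials are triangular with the internal differential on the
diagonal. A corrected solution is built one coefficient at a time, finitely often for the sum and in
infinitely many stabilizing steps for the product (`HochGr.cMapGr_cone`, `LMap.cohoch_cone`).

For the second, degeneracies are filtered by the place of the inserted unit. Let `h_k` insert a unit
in place `k`. On elements that already have a unit in place `k`, the operator `d h_k + h_k d` is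
`-(-1)^k` times the identity, up to units in earlier places. Indeed the summands of the Hochschild
element away from the unit cancel in the commutator, those that absorb it vanish or cancel because
the unit is strict, and one summand remains, in which the unit is the first factor of `m_2`
(`AInfUnit.ins_hochComm_sub_mem`, `AInfUnit.ins_hochComm_add_mem`). So units are removed one place
at a time. In the direct sum finitely many places occur (`AInfUnit.degLTC_acyclic`). In the product
the correction for the place `k` leaves all values before the index `k - 1` unchanged, so the
corrections have a limit (`AInfUnit.exists_normS`). -/

namespace FormalOps

/-! ### Representing natural transformations: Yoneda and Hochschild pairings. -/

/-- The dg-functor `m ↦ Ψ(m)` represents the complexes of natural transformations from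
`Φ ↦ F(Φ)(m)` to `Φ ↦ K(Φ)(m₂)`: there is a pairing of `Ψ(m)` and `F(Φ)(m)` with values in `K(Φ)(m₂)`,
compatible with the differentials and the action of `E`, for which `Ψ(m)` is the
group of all natural transformations. Here `F` is given by its values on objects
and on morphisms. -/
structure Represents {E : DGProp.{u}} (F : RMod E → RMod E)
    (Fm : ∀ {Φ Φ' : RMod E} {t : ℤ}, RHom Φ Φ' t → RHom (F Φ) (F Φ') t)
    (K : EndoFun E) (m₂ : ℕ) (Ψ : LMod E) where
  pr : ∀ {m : ℕ} {e : ℤ} (Φ : RMod E) {i j : ℤ}, i + e = j →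
    (Ψ.X m).X e →+ ((F Φ).X m).X i →+ ((K.obj Φ).X m₂).X j
  pr_nat : ∀ {m : ℕ} {e : ℤ} (y : (Ψ.X m).X e) {Φ Φ' : RMod E} {t : ℤ} (θ : RHom Φ Φ' t)
    {i j i' j' : ℤ} (h : i + e = j) (h' : i' + e = j') (h₁ : i + t = i') (h₂ : j + t = j')
    (x : ((F Φ).X m).X i), pr Φ' h' y ((Fm θ).ap h₁ x) = (K.map θ).ap h₂ (pr Φ h y x)
  pr_d : ∀ {m : ℕ} {e e' : ℤ} (he : e' + 1 = e) (y : (Ψ.X m).X e) (Φ : RMod E) {i i' j j' : ℤ}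
    (h₁ : i + e' = j') (h₂ : i + e = j) (h₃ : j' + 1 = j) (h₄ : i' + 1 = i) (h₅ : i' + e = j')
    (x : ((F Φ).X m).X i), pr Φ h₁ ((Ψ.X m).d he y) x =
      sg i • (((K.obj Φ).X m₂).d h₃ (pr Φ h₂ y x) - pr Φ h₅ y (((F Φ).X m).d h₄ x))
  pr_act : ∀ {m m' : ℕ} {a b c : ℤ} (h : a + b = c) (f : (E.Hom m m').X a)
    (y : (Ψ.X m').X b) (Φ : RMod E) {i j k : ℤ} (h₁ : i + c = k) (h₂ : i + a = j)
    (h₃ : j + b = k) (x : ((F Φ).X m).X i),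
    pr Φ h₁ (Ψ.act h f y) x = pr Φ h₃ y ((F Φ).act h₂ x f)
  inj : ∀ {m : ℕ} {e : ℤ} (y : (Ψ.X m).X e), (∀ (Φ : RMod E) {i j : ℤ} (h : i + e = j)
    (x : ((F Φ).X m).X i), pr Φ h y x = 0) → y = 0
  surj : ∀ {m : ℕ} {e : ℤ} (c : ∀ (Φ : RMod E) {i j : ℤ}, i + e = j →
      ((F Φ).X m).X i →+ ((K.obj Φ).X m₂).X j),
    (∀ {Φ Φ' : RMod E} {t : ℤ} (θ : RHom Φ Φ' t) {i j i' j' : ℤ} (h : i + e = j)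
      (h' : i' + e = j') (h₁ : i + t = i') (h₂ : j + t = j') (x : ((F Φ).X m).X i),
      c Φ' h' ((Fm θ).ap h₁ x) = (K.map θ).ap h₂ (c Φ h x)) →
    ∃ y : (Ψ.X m).X e, ∀ (Φ : RMod E) {i j : ℤ} (h : i + e = j) (x : ((F Φ).X m).X i),
      pr Φ h y x = c Φ h x

namespace RMod

variable {E : DGProp.{u}} (Φ : RMod E)

/-- The morphism `E(m, -) → Φ` of degree `|x|` which corresponds to `x ∈ Φ(m)`. -/
def elt (m : ℕ) (i : ℤ) : (Φ.X m).X i →+ RHom (rep E m) Φ i :=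
  AddMonoidHom.mk' (fun x => RHom.mk' (fun n a b h => Φ.act (by omega) x) (by
    intro n p a j k b c h₁ h₂ h₃ h₄ f g
    exact (Φ.act_comp _ _ _ _ _ _ _).symm)) (by
    intro x y
    apply RHom.ext'; intro n a b h f
    rw [RHom.ap_add]
    refine (RHom.ap_mk' _ _ h f).trans ?_
    refine Eq.trans ?_ (congrArg₂ (· + ·) (RHom.ap_mk' _ _ h f) (RHom.ap_mk' _ _ h f)).symm
    rw [map_add]; rfl)

theorem elt_ap {m : ℕ} {i : ℤ} (x : (Φ.X m).X i) {n : ℕ} {a b : ℤ} (h : a + i = b)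
    (h' : i + a = b) (f : ((rep E m).X n).X a) : (Φ.elt m i x).ap (n := n) h f = Φ.act h' x f := by
  subst h; rfl

/-- This and the next two lemmas say that the Yoneda correspondence respects morphisms, the action
of `E` and differentials. No signs occur because morphisms act from the left and `E` from the right.
-/
theorem comp_elt {Φ' : RMod E} {m : ℕ} {i t j : ℤ} (h : t + i = j) (h' : i + t = j)
    (θ : RHom Φ Φ' t) (x : (Φ.X m).X i) :
    RHom.comp h θ (Φ.elt m i x) = Φ'.elt m j (θ.ap h' x) := by
  apply RHom.ext'; intro n a b h₁ f
  rw [RHom.comp_ap _ _ _ _ (rfl : a + i = _) (by omega), Φ.elt_ap _ _ (by omega),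
    Φ'.elt_ap _ _ (by omega)]
  exact θ.nat _ _ _ _ _ _

theorem elt_leftMul {m m' : ℕ} {i a j : ℤ} (h : i + a = j) (x : (Φ.X m).X i)
    (f : (E.Hom m m').X a) :
    RHom.comp h (Φ.elt m i x) (EndoFun.leftMul m m' a f) = Φ.elt m' j (Φ.act h x f) := by
  apply RHom.ext'; intro n b c h₁ g
  rw [RHom.comp_ap _ _ _ _ (rfl : b + a = _) (by omega), Φ.elt_ap _ _ (by omega),
    Φ.elt_ap _ _ (by omega), EndoFun.leftMul_ap _ _ (by omega)]
  exact (Φ.act_comp _ _ _ _ _ _ _).symm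

theorem diff_elt {m : ℕ} {i i' : ℤ} (h : i' + 1 = i) (x : (Φ.X m).X i) :
    RHom.diff h (Φ.elt m i x) = Φ.elt m i' ((Φ.X m).d h x) := by
  apply RHom.ext'; intro n a b h₁ f
  rw [RHom.diff_ap h _ h₁ (rfl : a + i = _) (by omega) (by omega : a - 1 + 1 = a) (by omega),
    Φ.elt_ap _ _ (by omega), Φ.elt_ap _ _ (by omega), Φ.elt_ap _ _ (by omega)]
  rw [Φ.d_act (a' := i') (b' := a - 1) _ h (by omega) (by omega) (by omega) (by omega)]
  exact add_sub_cancel_right _ _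

theorem elt_id {m : ℕ} {i : ℤ} (h : 0 + i = i) (x : (Φ.X m).X i) :
    (Φ.elt m i x).ap (n := m) h (E.id m) = x := by
  rw [Φ.elt_ap _ _ (by omega)]; exact Φ.act_id _ _

/-- The identity corresponds to the identity morphism. -/
theorem elt_rep_id (E : DGProp.{u}) (m : ℕ) : (rep E m).elt m 0 (E.id m) = RHom.id (rep E m) := by
  apply RHom.ext'; intro n a b h f
  obtain rfl : b = a := by omega
  rw [RMod.elt_ap _ _ _ (by omega), RHom.id_ap]
  exact E.id_comp _ _

end RMod

namespace Represents

variable {E : DGProp.{u}}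

/-- The enriched Yoneda lemma. -/
def yoneda (K : EndoFun E) (m₂ : ℕ) :
    Represents (fun Φ => Φ) (fun θ => θ) K m₂ (K.onRep m₂) where
  pr {m e} Φ i j h := AddMonoidHom.flip (AddMonoidHom.mk'
    (fun x : (Φ.X m).X i => ((K.map (Φ.elt m i x)).ap (by omega) :
      ((K.obj (rep E m)).X m₂).X e →+ _)) (by
      intro x x'
      ext y
      rw [map_add, map_add, RHom.ap_add]; rfl))
  pr_nat {m e} y Φ Φ' t θ i j i' j' h h' h₁ h₂ x := by
    change (K.map (Φ'.elt m i' (θ.ap h₁ x))).ap _ _ =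
          (K.map θ).ap _ ((K.map (Φ.elt m i x)).ap (by omega) _)
    rw [← Φ.comp_elt (by omega) h₁, K.map_comp]
    exact RHom.comp_ap _ _ _ _ _ _ _
  pr_d {m e e'} he y Φ i i' j j' h₁ h₂ h₃ h₄ h₅ x := by
    have key : ∀ y : ((K.obj (rep E m)).X m₂).X e,
        (K.map (Φ.elt m i x)).ap (by omega) (((K.obj (rep E m)).X m₂).d he y) = sg i •
        (((K.obj Φ).X m₂).d h₃ ((K.map (Φ.elt m i x)).ap (by omega) y) -
          (K.map (Φ.elt m i' ((Φ.X m).d h₄ x))).ap (by omega) y) := by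
      intro y
      -- The morphism `K(elt x)` has degree `|x|`, so `d ∘ K(elt x)` and `K(elt (dx))` differ by
      -- `(-1)^|x|` times `K(elt x) ∘ d`. Multiplying by the same sign isolates the last term.
      rw [← Φ.diff_elt, K.map_diff, RHom.diff_ap _ _ _ (by omega : e + i = j) (by omega) he
        (by omega), sub_sub_cancel, smul_smul, sg_mul_self, one_smul]
    exact key y
  pr_act {m m' a b c} h f y Φ i j k h₁ h₂ h₃ x := by
    change (K.map (Φ.elt m i x)).ap _ ((K.map (EndoFun.leftMul m m' a f)).ap _ _) =
      (K.map (Φ.elt m' j (Φ.act h₂ x f))).ap (by omega) _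
    rw [← Φ.elt_leftMul, K.map_comp]
    exact (RHom.comp_ap _ _ _ _ _ _ _).symm
  inj {m e} y H := by
    -- Pairing `y` with the identity of `m`, taken in `Φ = E(m, -)`, returns `y` itself.
    have h := H (rep E m) (zero_add e) (E.id m)
    change (K.map ((rep E m).elt m 0 (E.id m))).ap _ _ = _ at h
    rw [RMod.elt_rep_id, K.map_id] at h
    exact (RHom.id_ap _ _).symm.trans h
  surj {m e} c hc := by
    -- The representing element must be the value at the universal element. Naturality for the
    -- morphism `E(m, -) → Φ` given by `x` then recovers the value at `x`.
    refine ⟨c (rep E m) (zero_add e) (E.id m), fun Φ i j h x => ?_⟩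
    have := hc (Φ.elt m i x) (zero_add e) h (zero_add i) (by omega) (E.id m)
    refine Eq.trans ?_ (this.symm.trans (congrArg _ (Φ.elt_id _ x)))
    rfl

open HochGr CohochGr

variable {F : RMod E → RMod E} {Fm : ∀ {Φ Φ' : RMod E} {t : ℤ}, RHom Φ Φ' t → RHom (F Φ) (F Φ') t}
  {K : EndoFun E} {m₂ : ℕ} {Ψ : LMod E}

/-- The pairing of the Hochschild complex with the coHochschild complex,
`⟨x ⊗ l_{p+1}, h⟩ = ⟨x, h(l_{p+1})⟩`. -/
def hochPair (R : Represents F Fm K m₂ Ψ) {m : ℕ} {e : ℤ} (Φ : RMod E) {i j : ℤ}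
    (h : i + e = j) : CohochGr Ψ m e →+ HochGr (F Φ) m i →+ ((K.obj Φ).X m₂).X j :=
  AddMonoidHom.mk' (fun y => lift fun p _ _ =>
    R.pr (e := p + e) Φ (by omega) (ev p rfl y)) (by
    intro y y'
    refine hom_ext fun p a h x => ?_
    rw [AddMonoidHom.add_apply, lift_l, lift_l, lift_l, map_add, map_add]; rfl)

theorem hochPair_l (R : Represents F Fm K m₂ Ψ) {m : ℕ} {e : ℤ} (y : CohochGr Ψ m e) (Φ : RMod E)
    {i j : ℤ} (h : i + e = j) (p : ℕ) {a c : ℤ} (ha : a + p = i) (hc : p + e = c) (hj : a + c = j)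
    (x : ((F Φ).X (p + 1 + m)).X a) :
    R.hochPair Φ h y (l p ha x) = R.pr Φ hj (ev p hc y) x := by
  subst hc
  exact lift_l _ p ha x

theorem hochPair_nat (R : Represents F Fm K m₂ Ψ) {m : ℕ} {e : ℤ} (y : CohochGr Ψ m e)
    {Φ Φ' : RMod E} {t : ℤ} (θ : RHom Φ Φ' t)
    {i j i' j' : ℤ} (h : i + e = j) (h' : i' + e = j') (h₁ : i + t = i') (h₂ : j + t = j')
    (x : HochGr (F Φ) m i) : R.hochPair Φ' h' y (AInfMul.cMapGr (Fm θ) m h₁ x) =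
      (K.map θ).ap h₂ (R.hochPair Φ h y x) := by
  refine hom_ext_apply ((R.hochPair Φ' h' y).comp (AInfMul.cMapGr (Fm θ) m h₁))
    (((K.map θ).ap h₂).comp (R.hochPair Φ h y)) (fun p a ha x => ?_) x
  rw [AddMonoidHom.comp_apply, AddMonoidHom.comp_apply,
    AInfMul.cMapGr_l _ m h₁ p ha rfl (by omega), R.hochPair_l _ _ _ p ha rfl (by omega),
    R.hochPair_l _ _ _ p _ rfl (by omega)]
  exact R.pr_nat _ θ _ _ _ _ x

/-- The two sums over `q` are adjoint by `pr_act`, and the internal differentials match by `pr_d`.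
The factor `(-1)^p` of the coHochschild differential is there because `x ⊗ l_{p+1}` has degree `|x|
+ p` rather than `|x|`. -/
theorem hochPair_d (i : AInfMul E) (R : Represents F Fm K m₂ Ψ) {m : ℕ} {e e' : ℤ}
    (he : e' + 1 = e) (y : CohochGr Ψ m e) (Φ : RMod E) {n n' j j' : ℤ}
    (h₁ : n + e' = j') (h₂ : n + e = j) (h₃ : j' + 1 = j) (h₄ : n' + 1 = n) (h₅ : n' + e = j')
    (x : HochGr (F Φ) m n) : R.hochPair Φ h₁ (i.dD Ψ m he y) x =
      sg n • (((K.obj Φ).X m₂).d h₃ (R.hochPair Φ h₂ y x) -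
        R.hochPair Φ h₅ y (i.cD (F Φ) m h₄ x)) := by
  refine hom_ext_apply (R.hochPair Φ h₁ (i.dD Ψ m he y)) (sg n • ((((K.obj Φ).X m₂).d h₃).comp
    (R.hochPair Φ h₂ y) - (R.hochPair Φ h₅ y).comp (i.cD (F Φ) m h₄))) (fun p a ha x => ?_) x
  simp only [AddMonoidHom.coe_smul, Pi.smul_apply, AddMonoidHom.sub_apply,
    AddMonoidHom.comp_apply]
  rw [R.hochPair_l _ _ _ p ha rfl (by omega), R.hochPair_l _ _ _ p ha rfl (by omega),
    i.dD_ev Ψ m he y p rfl rfl (by omega),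
    i.cD_l _ m _ p (a' := a - 1) ha (by omega) (by omega), map_add, map_zsmul (R.hochPair Φ h₅ y),
    map_sum (R.hochPair Φ h₅ y), R.hochPair_l _ _ _ p _ rfl (by omega), map_zsmul, map_sub, map_sum]
  have e1 : ∀ q ∈ Finset.range p, R.hochPair Φ (i := n') (j := j') (by omega) y
      (l q (a := a + (p - q - 1)) (by omega)
        ((F Φ).act rfl x (i.hochW m p q (by omega)))) =
      R.pr (e := p + e') Φ (by omega) (Ψ.act (a := p - q - 1) (b := q + e) (by omega)
        (i.hochW m p q (by omega)) (ev q rfl y)) x := by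
    intro q _
    rw [R.hochPair_l _ _ _ q _ rfl (by omega), R.pr_act _ _ _ Φ _ rfl (by omega)]
  rw [Finset.sum_congr rfl e1, AddMonoidHom.coe_smul, Pi.smul_apply, AddMonoidHom.sub_apply,
    AddMonoidHom.finsetSum_apply, R.pr_d _ _ Φ _ (by omega : a + (p + e) = j)
    (by omega) (by omega : a - 1 + 1 = a) (by omega)]
  have s1 : sg n = sg p * sg a := by rw [← sg_add]; congr 1; omega
  rw [s1]
  have s2 := sg_mul_self a
  match_scalars
  · ring
  · ring
  · linear_combination sg p * s2

theorem hochPair_act (R : Represents F Fm K m₂ Ψ) {m m' : ℕ} {a b c : ℤ} (h : a + b = c)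
    (f : (E.Hom m m').X a) (y : CohochGr Ψ m' b) (Φ : RMod E) {i j k : ℤ} (h₁ : i + c = k)
    (h₂ : i + a = j) (h₃ : j + b = k) (x : HochGr (F Φ) m i) :
    R.hochPair Φ h₁ (AInfMul.dAct Ψ h f y) x =
      R.hochPair Φ h₃ y (AInfMul.cAct (F Φ) h₂ x f) := by
  refine hom_ext_apply (R.hochPair Φ h₁ (AInfMul.dAct Ψ h f y)) ((R.hochPair Φ h₃ y).comp
    ((AInfMul.cAct (F Φ) h₂).flip f)) (fun p e he x => ?_) x
  rw [AddMonoidHom.comp_apply, AddMonoidHom.flip_apply, AInfMul.cAct_l _ h₂ p he rfl (by omega),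
    map_zsmul, R.hochPair_l _ _ _ p he rfl (by omega), R.hochPair_l _ _ _ p _ rfl (by omega),
    AInfMul.dAct_ev Ψ h f y p rfl rfl (by omega), map_zsmul,
    AddMonoidHom.coe_smul, Pi.smul_apply, R.pr_act _ (E.shiftW p f) (ev p rfl y) Φ _ rfl (by omega)]

theorem hochPair_inj (R : Represents F Fm K m₂ Ψ) {m : ℕ} {e : ℤ} (y : CohochGr Ψ m e)
    (H : ∀ (Φ : RMod E) {i j : ℤ} (h : i + e = j) (x : HochGr (F Φ) m i),
      R.hochPair Φ h y x = 0) : y = 0 := by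
  apply ev_ext; intro p c hc
  rw [map_zero]
  refine R.inj _ fun Φ i j h x => ?_
  rw [← R.hochPair_l y Φ (i := i + p) (by omega) p rfl hc h]
  exact H _ _ _

/-- A transformation out of a direct sum is the same as a family of transformations out of the
summands. Each member is represented by hypothesis, and no finiteness restricts the family, which is
why the representing object is a product. -/
theorem hochPair_surj (R : Represents F Fm K m₂ Ψ) {m : ℕ} {e : ℤ}
    (c : ∀ (Φ : RMod E) {i j : ℤ}, i + e = j → HochGr (F Φ) m i →+ ((K.obj Φ).X m₂).X j)
    (hc : ∀ {Φ Φ' : RMod E} {t : ℤ} (θ : RHom Φ Φ' t) {i j i' j' : ℤ} (h : i + e = j)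
      (h' : i' + e = j') (h₁ : i + t = i') (h₂ : j + t = j') (x : HochGr (F Φ) m i),
      c Φ' h' (AInfMul.cMapGr (Fm θ) m h₁ x) = (K.map θ).ap h₂ (c Φ h x)) :
    ∃ y : CohochGr Ψ m e, ∀ (Φ : RMod E) {i j : ℤ} (h : i + e = j) (x : HochGr (F Φ) m i),
      R.hochPair Φ h y x = c Φ h x := by
  have key : ∀ p : ℕ, ∃ y : (Ψ.X (p + 1 + m)).X (p + e), ∀ (Φ : RMod E) {i j : ℤ}
      (h : i + (p + e) = j) (x : ((F Φ).X (p + 1 + m)).X i),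
      R.pr Φ h y x = c Φ (by omega : i + p + e = j) (l p rfl x) := by
    intro p
    refine R.surj (fun Φ i j h => (c Φ (by omega : i + p + e = j)).comp (l p rfl)) ?_
    intro Φ Φ' t θ i j i' j' h h' h₁ h₂ x
    rw [AddMonoidHom.comp_apply, AddMonoidHom.comp_apply,
      ← hc θ _ _ (by omega : i + p + t = i' + p) h₂, AInfMul.cMapGr_l _ m _ p rfl h₁ rfl]
  choose y hy using key
  refine ⟨y, fun Φ i j h x => ?_⟩
  refine hom_ext_apply (R.hochPair Φ h y) (c Φ h) (fun p a ha z => ?_) x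
  rw [R.hochPair_l y Φ h p ha rfl (by omega)]
  subst ha
  exact hy p Φ _ z

/-- If `Ψ` represents the transformations out of `F` then `D(Ψ)` represents those out of `C ∘ F`. -/
def hoch (i : AInfMul E) (R : Represents F Fm K m₂ Ψ) :
    Represents (fun Φ => i.C.obj (F Φ)) (fun θ => i.C.map (Fm θ)) K m₂ (i.D Ψ) where
  pr {m e} Φ n j h := R.hochPair Φ h
  pr_nat y Φ Φ' t θ n j n' j' h h' h₁ h₂ x :=
    (congrArg _ (i.cMap_ap _ _ _)).trans (R.hochPair_nat y θ h h' h₁ h₂ x)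
  pr_d he y Φ _ _ _ _ h₁ h₂ h₃ h₄ h₅ x := R.hochPair_d i he y Φ h₁ h₂ h₃ h₄ h₅ x
  pr_act h f y Φ _ _ _ h₁ h₂ h₃ x := R.hochPair_act h f y Φ h₁ h₂ h₃ x
  inj y H := R.hochPair_inj y H
  surj c hc := R.hochPair_surj c (by
    intro Φ Φ' t θ n j n' j' h h' h₁ h₂ x
    exact (congrArg _ (i.cMap_ap _ _ _)).symm.trans (hc θ h h' h₁ h₂ x))

/-- Passing to a quotient of `F` corresponds to passing to the dg-subfunctor of the elements that
vanish on its kernel. -/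
def quot (R : Represents F Fm K m₂ Ψ) (S : ∀ Φ, (F Φ).Sub)
    (hS : ∀ {Φ Φ' : RMod E} {t : ℤ} (θ : RHom Φ Φ' t) {n : ℕ} {k k' : ℤ} (h : k + t = k')
      {x : ((F Φ).X n).X k}, x ∈ (S Φ).S n k → (Fm θ).ap h x ∈ (S Φ').S n k')
    (T : Ψ.Sub) (hT : ∀ {m : ℕ} {e : ℤ} (y : (Ψ.X m).X e), y ∈ T.S m e ↔
      ∀ (Φ : RMod E) {i j : ℤ} (h : i + e = j) (x : ((F Φ).X m).X i), x ∈ (S Φ).S m i →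
        R.pr Φ h y x = 0) :
    Represents (fun Φ => (F Φ).quot (S Φ)) (fun θ => RMod.quotMap _ _ (Fm θ) (hS θ)) K m₂
      (Ψ.sub T) where
  pr {m e} Φ i j h := AddMonoidHom.mk'
    (fun y : T.S m e => QuotientAddGroup.lift ((S Φ).S m i) (R.pr Φ h y.1)
      (fun x hx => (hT y.1).1 y.2 Φ h x hx)) (by
    intro y y'
    refine QuotientAddGroup.addMonoidHom_ext _ (AddMonoidHom.ext fun x => ?_)
    change R.pr Φ h (y.1 + y'.1) x = R.pr Φ h y.1 x + R.pr Φ h y'.1 x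
    rw [map_add]; rfl)
  pr_nat y Φ Φ' t θ i j i' j' h h' h₁ h₂ x := by
    induction x using QuotientAddGroup.induction_on with
    | H x =>
      refine (congrArg _ (RMod.quotMap_ap _ _ _ _ _ _)).trans ?_
      exact R.pr_nat y.1 θ h h' h₁ h₂ x
  pr_d he y Φ _ _ _ _ h₁ h₂ h₃ h₄ h₅ x := by
    induction x using QuotientAddGroup.induction_on with
    | H x => exact R.pr_d he y.1 Φ h₁ h₂ h₃ h₄ h₅ x
  pr_act h f y Φ _ _ _ h₁ h₂ h₃ x := by
    induction x using QuotientAddGroup.induction_on with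
    | H x => exact R.pr_act h f y.1 Φ h₁ h₂ h₃ x
  inj y H := Subtype.ext (R.inj y.1 fun Φ _ _ h x => H Φ h (QuotientAddGroup.mk x))
  surj {m e} c hc := by
    -- A transformation out of the quotient is one out of `F` that vanishes on the kernel, and `hT`
    -- then places its representative in `T`.
    obtain ⟨y, hy⟩ := R.surj (fun Φ i j h => (c Φ h).comp (QuotientAddGroup.mk' ((S Φ).S m i))) (by
      intro Φ Φ' t θ i j i' j' h h' h₁ h₂ x
      refine Eq.trans ?_ (hc θ h h' h₁ h₂ (QuotientAddGroup.mk x))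
      exact congrArg (c Φ' h') (RMod.quotMap_ap _ _ _ _ _ _).symm)
    refine ⟨⟨y, (hT y).2 fun Φ i j h x hx => ?_⟩, fun Φ i j h x => ?_⟩
    · exact (hy Φ h x).trans ((congrArg (c Φ h) ((QuotientAddGroup.eq_zero_iff x).2 hx)).trans
        (map_zero (c Φ h)))
    · induction x using QuotientAddGroup.induction_on with
      | H x => exact hy Φ h x

/-- The elements of `D(Ψ)` which pair to zero with the degenerate elements are the normalized
ones. -/
theorem hoch_normS_iff {i : AInfMul E} (η : AInfUnit i) (R : Represents F Fm K m₂ Ψ) {m : ℕ} {e : ℤ}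
    (y : CohochGr Ψ m e) : y ∈ η.normS Ψ m e ↔ ∀ (Φ : RMod E) {n j : ℤ} (h : n + e = j)
      (x : HochGr (F Φ) m n), x ∈ η.degS (F Φ) m n → R.hochPair Φ h y x = 0 := by
  constructor
  · intro hy Φ n j h x hx
    refine η.degS_hom (F Φ) (R.hochPair Φ h y) ⊥ (fun p q hq hq' a ha x => ?_) hx
    rw [AddSubgroup.mem_bot, R.hochPair_l y Φ h p ha rfl (by omega),
      ← R.pr_act (zero_add _) (η.insW m p q hq') _ Φ (by omega), η.mem_normS Ψ hy hq hq',
      map_zero]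
    rfl
  · intro H p q hq hq'
    -- By injectivity of the pairing it suffices that all `⟨x, u·h(l)⟩ = ⟨x·u ⊗ l, h⟩` vanish, and
    -- these are the pairings with the generators of the degenerate part.
    refine R.inj _ fun Φ a j h x => ?_
    rw [R.pr_act _ _ _ Φ _ (add_zero a) h,
      ← R.hochPair_l y Φ (i := a + p) (by omega) p rfl rfl]
    exact H Φ _ _ (η.mem_degS (F Φ) rfl hq hq' x)

/-- If `Ψ` represents the transformations out of `F` then the reduced coHochschild complex of `Ψ`
represents those out of the reduced Hochschild complex of `F`. -/
def redHoch {i : AInfMul E} (η : AInfUnit i) (R : Represents F Fm K m₂ Ψ) :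
    Represents (fun Φ => η.C.obj (F Φ)) (fun θ => η.C.map (Fm θ)) K m₂ (η.D Ψ) :=
  (R.hoch i).quot (fun Φ => η.degSub (F Φ)) (fun θ => η.cMap_mem (Fm θ)) (η.normSub Ψ)
    (fun y => R.hoch_normS_iff η y)

/-- The group of natural transformations is the representing one. -/
noncomputable def equiv (L K : EndoFun E) (m₁ m₂ : ℕ)
    (R : Represents L.obj (fun θ => L.map θ) K m₂ Ψ) (e : ℤ) :
    NatTrans (L.eval m₁) (K.eval m₂) e ≃+ (Ψ.X m₁).X e :=
  AddEquiv.symm (AddEquiv.ofBijective (AddMonoidHom.mk' (fun y : (Ψ.X m₁).X e =>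
      (⟨fun Φ i => R.pr Φ rfl y, by
        intro Φ Φ' t θ i j i' j' h h' h₁ h₂ x
        subst h h'
        exact R.pr_nat y θ rfl rfl h₁ h₂ x⟩ : NatTrans (L.eval m₁) (K.eval m₂) e)) (by
      intro y y'
      apply Subtype.ext; funext Φ i
      exact (R.pr Φ rfl).map_add y y')) (by
    constructor
    · refine (injective_iff_map_eq_zero _).2 fun y hy => ?_
      refine R.inj y fun Φ i j h x => ?_
      subst h
      exact DFunLike.congr_fun (congrFun (congrFun (congrArg Subtype.val hy) Φ) i) x
    · intro ν
      obtain ⟨y, hy⟩ := R.surj (m := m₁) (fun Φ i j h => ν.ap Φ h) (fun θ => ν.nat θ)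
      refine ⟨y, ?_⟩
      apply Subtype.ext; funext Φ i; ext x
      exact hy Φ rfl x))

theorem equiv_d (L K : EndoFun E) (m₁ m₂ : ℕ) (R : Represents L.obj (fun θ => L.map θ) K m₂ Ψ)
    {e e' : ℤ} (h : e' + 1 = e) (ν : NatTrans (L.eval m₁) (K.eval m₂) e) :
    R.equiv L K m₁ m₂ e' (ν.diff h) = (Ψ.X m₁).d h (R.equiv L K m₁ m₂ e ν) := by
  obtain ⟨y, rfl⟩ := (R.equiv L K m₁ m₂ e).symm.surjective ν
  rw [AddEquiv.apply_symm_apply, ← AddEquiv.eq_symm_apply]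
  apply NatTrans.ext'; intro Φ i j h' x
  rw [NatTrans.diff_ap h _ Φ h' (rfl : i + e = _) (by omega) (by omega : i - 1 + 1 = i)
      (by omega)]
  have ap : ∀ {e : ℤ} (y : (Ψ.X m₁).X e) {i j : ℤ} (h : i + e = j) (x : ((L.obj Φ).X m₁).X i),
      ((R.equiv L K m₁ m₂ e).symm y).ap Φ h x = R.pr Φ h y x := by
    intro e y i j h x; subst h; rfl
  refine Eq.trans ?_ (ap _ _ x).symm
  refine Eq.trans (congrArg₂ (fun a b => sg i • (a - b)) (congrArg _ (ap _ _ x)) (ap _ _ _)) ?_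
  exact (R.pr_d h y Φ h' rfl _ _ _ x).symm

end Represents

/-! ### Iterating the constructions, and the isomorphisms with `D^{n₁} C^{n₂}`. -/

namespace LMod

variable {E : DGProp.{u}}

/-- The iterates of a construction on dg-functors `Eᵒᵖ → Ch`, where the last application is the outer one. -/
def iter (T : LMod E → LMod E) : ℕ → LMod E → LMod E
  | 0, Ψ => Ψ
  | n + 1, Ψ => T (iter T n Ψ)

/-- `T^[n]` unfolds by definition at the innermost application, while all inductions here peel off
the outermost one. -/
theorem iterate_eq_iter (T : LMod E → LMod E) (n : ℕ) (Ψ : LMod E) : T^[n] Ψ = iter T n Ψ := by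
  induction n with
  | zero => rfl
  | succ n ih => rw [Function.iterate_succ_apply', ih]; rfl

end LMod

namespace Represents

variable {E : DGProp.{u}}

/-- The iterated coHochschild complex represents the transformations out of the iterated Hochschild
complex. -/
def iterHoch (i : AInfMul E) (K : EndoFun E) (m₂ : ℕ) : ∀ n : ℕ,
    Represents (i.C.iter n).obj (fun θ => (i.C.iter n).map θ) K m₂ (LMod.iter i.D n (K.onRep m₂))
  | 0 => yoneda K m₂
  | n + 1 => (iterHoch i K m₂ n).hoch i

/-- The iterated reduced coHochschild complex represents the transformations out of the iterated
reduced Hochschild complex. -/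
def iterRedHoch {i : AInfMul E} (η : AInfUnit i) (K : EndoFun E) (m₂ : ℕ) : ∀ n : ℕ,
    Represents (η.C.iter n).obj (fun θ => (η.C.iter n).map θ) K m₂ (LMod.iter η.D n (K.onRep m₂))
  | 0 => yoneda K m₂
  | n + 1 => (iterRedHoch η K m₂ n).redHoch η

end Represents

theorem AInfMul.natOps_isomorphic_DC {E : DGProp.{u}} (i : AInfMul E) (m₁ n₁ m₂ n₂ : ℕ) :
    (i.NatOps m₁ n₁ m₂ n₂).Isomorphic (i.DC m₁ n₁ m₂ n₂) := by
  unfold AInfMul.DC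
  rw [LMod.iterate_eq_iter]
  exact ⟨(Represents.iterHoch i (i.C.iter n₂) m₂ n₁).equiv _ _ m₁ m₂,
    fun h x => Represents.equiv_d _ _ _ _ _ h x⟩

theorem AInfUnit.natOps_isomorphic_DC {E : DGProp.{u}} {i : AInfMul E} (η : AInfUnit i)
    (m₁ n₁ m₂ n₂ : ℕ) : (η.NatOps m₁ n₁ m₂ n₂).Isomorphic (η.DC m₁ n₁ m₂ n₂) := by
  unfold AInfUnit.DC
  rw [LMod.iterate_eq_iter]
  exact ⟨(Represents.iterRedHoch η (η.C.iter n₂) m₂ n₁).equiv _ _ m₁ m₂,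
    fun h x => Represents.equiv_d _ _ _ _ _ h x⟩

/-! ### Summands of the Hochschild element in the presence of a unit. -/

namespace AInfMul

variable {E : DGProp.{u}} (i : AInfMul E)

/-- The summand of index `s` of the Hochschild element `f_{p+1,q+1}`. -/
def hochTerm (p q s : ℕ) {c : ℤ} (h : c + 1 = p - q) : (E.Hom (p + 1) (q + 1)).X c :=
  E.comp (add_zero c) (E.comp (zero_add c) (E.srot p s) (i.g p q h)) (E.srot q (backRot p q s))

theorem hoch_eq_sum (p q : ℕ) {c : ℤ} (h : c + 1 = p - q) :
    i.hoch p q h = ∑ s ∈ Finset.range (p + 1), i.hochTerm p q s h := rfl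

theorem hochTerm_of_le {p q : ℕ} (s : ℕ) {c : ℤ} (h : c + 1 = p - q) (hq : p ≤ q) :
    i.hochTerm p q s h = 0 := by
  unfold hochTerm; rw [i.g_of_le h hq]; simp

/-- The exponent collects the signs of `T^s`, of the operation and of the back rotation. Giving `t`
by an equation keeps natural subtraction out of the arity of `m t`. -/
theorem hochTerm_eq {p q t : ℕ} (s : ℕ) {c : ℤ} (h : c + 1 = p - q) (ht : q + t = p)
    (h₁ : 0 + (t + 1) + q = p + 1) (h₂ : 0 + 1 + q = q + 1) (h₃ : c + 1 = t) :
    i.hochTerm p q s h = sg (p * s + (t + 1) + q * backRot p q s) • E.comp (add_zero c)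
      (E.comp (zero_add c) (E.rotPow p s) (E.wh 0 q h₁ h₂ (i.m t h₃)))
      (E.rotPow q (backRot p q s)) := by
  unfold hochTerm
  rw [i.g_eq h ht]
  unfold DGProp.srot
  simp only [map_zsmul, AddMonoidHom.coe_smul, Pi.smul_apply, smul_smul]
  congr 1
  simp only [← sg_add]
  congr 1; ring

end AInfMul

namespace AInfUnit

variable {E : DGProp.{u}} {i : AInfMul E} (η : AInfUnit i)

/-- The elements of `E(N, q + 1)` with a unit inserted in one of the places `2, …, k`, that is, after
`j` entries with `1 ≤ j < k`. -/
def degLT (k N q : ℕ) (c : ℤ) : AddSubgroup ((E.Hom N (q + 1)).X c) :=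
  AddSubgroup.closure {z | ∃ (j : ℕ) (_ : 1 ≤ j) (_ : j < k) (h : j ≤ q) (y : (E.Hom N q).X c),
    z = E.comp (add_zero c) y (E.ins η.u q j h)}

theorem mem_degLT {k N q j : ℕ} {c : ℤ} (y : (E.Hom N q).X c) (h₁ : 1 ≤ j) (h₂ : j < k)
    (h : j ≤ q) : E.comp (add_zero c) y (E.ins η.u q j h) ∈ η.degLT k N q c :=
  AddSubgroup.subset_closure ⟨j, h₁, h₂, h, y, rfl⟩

theorem comp_mem_degLT {k n p q : ℕ} {a b c : ℤ} (h : a + b = c) (x : (E.Hom n p).X a)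
    {z : (E.Hom p (q + 1)).X b} (hz : z ∈ η.degLT k p q b) : E.comp h x z ∈ η.degLT k n q c := by
  induction hz using AddSubgroup.closure_induction with
  | mem z hz =>
    obtain ⟨j, h₁, h₂, hj, y, rfl⟩ := hz
    rw [← E.comp_assoc (h₁ := h) (h₂ := add_zero c)]
    exact η.mem_degLT _ h₁ h₂ hj
  | zero => rw [map_zero]; exact zero_mem _
  | add z w _ _ hz hw => rw [map_add]; exact add_mem hz hw
  | neg z _ hz => rw [map_neg]; exact neg_mem hz

/-- A unit in place `j`, followed by a rotation and an operation on the first entries which does not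
meet it. -/
theorem ins_term_free {p q t j s s' x : ℕ} {c : ℤ} (hc : c + 1 = t) (hpq : q + 1 + t = p + 1)
    (hj : j ≤ p + 1) (h₁ : 0 + (t + 1) + (q + 1) = p + 2) (h₂ : 0 + 1 + (q + 1) = q + 1 + 1)
    (h₃ : 0 + (t + 1) + q = p + 1) (h₄ : 0 + 1 + q = q + 1)
    (hts : t < s') (hs' : s' ≤ p + 1)
    (hcase : (j + s = s' ∧ x = s) ∨ (j + s = p + 2 + s' ∧ x = s - 1)) (b : ℕ) :
    E.comp (zero_add c) (E.ins η.u (p + 1) j hj) (E.comp (add_zero c)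
      (E.comp (zero_add c) (E.rotPow (p + 1) s) (E.wh 0 (q + 1) h₁ h₂ (i.m t hc)))
      (E.rotPow (q + 1) b)) =
    E.comp (add_zero c) (E.comp (zero_add c) (E.rotPow p x) (E.wh 0 q h₃ h₄ (i.m t hc)))
      (E.comp (add_zero 0) (E.ins η.u (q + 1) (s' - t) (by omega)) (E.rotPow (q + 1) b)) := by
  have e : E.comp (add_zero 0) (E.ins η.u (p + 1) j hj) (E.rotPow (p + 1) s) =
      E.comp (add_zero 0) (E.rotPow p x) (E.ins η.u (p + 1) s' hs') := by
    rcases hcase with ⟨rfl, rfl⟩ | ⟨h, rfl⟩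
    · exact E.ins_rot_lt _ _ _ _ _
    · exact E.ins_rot_ge _ _ _ _ _ _ h _
  rw [← E.comp_assoc (h₁ := zero_add c) (h₂ := add_zero c),
    ← E.comp_assoc (h₁ := add_zero 0) (h₂ := zero_add c), e,
    E.comp_assoc (h₃ := zero_add c) (h₄ := zero_add c),
    E.ins_wh η.u (i.m t hc) hs' hts hpq _ _ (by omega) (by omega),
    ← E.comp_assoc (h₁ := zero_add c) (h₂ := add_zero c),
    E.comp_assoc (h₃ := add_zero 0) (h₄ := add_zero c)]
  rfl

/-- A unit in place `j`, followed by a rotation and an operation on the first entries which involves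
it. -/
theorem ins_term_absorb {p q t j s s' x : ℕ} {c : ℤ} (hc : c + 1 = t) (hpq : q + t = p + 1)
    (hj : j ≤ p + 1) (h₁ : 0 + (t + 1) + q = p + 2) (h₂ : 0 + 1 + q = q + 1)
    (h₃ : 0 + t + q = p + 1) (hts : s' ≤ t)
    (hcase : (j + s = s' ∧ x = s) ∨ (j + s = p + 2 + s' ∧ x = s - 1)) (b : ℕ) :
    E.comp (zero_add c) (E.ins η.u (p + 1) j hj) (E.comp (add_zero c)
      (E.comp (zero_add c) (E.rotPow (p + 1) s) (E.wh 0 q h₁ h₂ (i.m t hc))) (E.rotPow q b)) =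
    E.comp (add_zero c) (E.comp (zero_add c) (E.rotPow p x) (E.wh 0 q h₃ h₂
      (E.comp (zero_add c) (E.ins η.u t s' hts) (i.m t hc)))) (E.rotPow q b) := by
  have hs' : s' ≤ p + 1 := by omega
  have e : E.comp (add_zero 0) (E.ins η.u (p + 1) j hj) (E.rotPow (p + 1) s) =
      E.comp (add_zero 0) (E.rotPow p x) (E.ins η.u (p + 1) s' hs') := by
    rcases hcase with ⟨rfl, rfl⟩ | ⟨h, rfl⟩
    · exact E.ins_rot_lt _ _ _ _ _
    · exact E.ins_rot_ge _ _ _ _ _ _ h _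
  rw [← E.comp_assoc (h₁ := zero_add c) (h₂ := add_zero c),
    ← E.comp_assoc (h₁ := add_zero 0) (h₂ := zero_add c), e,
    E.comp_assoc (h₃ := zero_add c) (h₄ := zero_add c) (f := E.rotPow p x),
    E.ins_wh_le η.u (i.m t hc) hs' hts hpq _ _ h₃]

/-- The summands of the Hochschild element which multiply entries after the `j`-th one commute with
the insertion of a unit in place `j`, up to a sign. -/
theorem ins_hochTerm_of_mem {p q j s : ℕ} {c : ℤ} (h : c + 1 = (p + 1 : ℕ) - (q + 1 : ℕ))
    (h' : c + 1 = p - q) (hqp : q < p) (hj : 1 ≤ j) (hj' : j ≤ p + 1) (hjq : j ≤ q + 1)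
    (hs₁ : p - q ≤ s) (hs₂ : s + j ≤ p + 1) :
    E.comp (zero_add c) (E.ins η.u (p + 1) j hj') (i.hochTerm (p + 1) (q + 1) s h) =
      sg (p - q) • E.comp (add_zero c) (i.hochTerm p q s h') (E.ins η.u (q + 1) j hjq) := by
  obtain ⟨t, rfl⟩ := Nat.exists_eq_add_of_le hqp.le
  rw [i.hochTerm_eq s h (by omega : q + 1 + t = q + t + 1) (by omega) (by omega) (by omega),
    i.hochTerm_eq s h' rfl (by omega) (by omega) (by omega)]
  simp only [map_zsmul, AddMonoidHom.coe_smul, Pi.smul_apply, smul_smul]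
  rw [η.ins_term_free (s' := j + s) (x := s) (by omega) (by omega) hj' (by omega) (by omega)
    (by omega) (by omega) (by omega) (by omega) (Or.inl ⟨rfl, rfl⟩)]
  -- For `s = t` the multiplied block ends with the entry `0`, so neither side is rotated back and
  -- the unit lands in place `j + s - t = j`. For `s > t` the back rotation carries the unit once
  -- past the end and returns it to place `j`.
  by_cases hst : s = t
  · subst hst
    rw [backRot_zero (p := q + s + 1) (by omega), backRot_zero (p := q + s) (by omega)]
    change _ • E.comp _ _ (E.comp _ _ (E.id _)) = _ • E.comp _ (E.comp _ _ (E.id _)) _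
    rw [E.comp_id, E.comp_id, ← sg_add]
    simp only [Nat.add_sub_cancel]
    congr 1
    exact sg_congr ⟨0, by push_cast; ring⟩
  · rw [backRot_pos (p := q + t + 1) (by omega), backRot_pos (p := q + t) (by omega),
      E.ins_rot_ge η.u q (j + s - t) (q + t + 1 + 1 - s) j (by omega) (by omega) hjq,
      E.comp_assoc (h₃ := add_zero 0) (h₄ := add_zero c),
      show q + t + 1 + 1 - s - 1 = q + t + 1 - s by omega, ← sg_add]
    congr 1
    apply sg_congr
    rw [show ((q + t + 1 + 1 - s : ℕ) : ℤ) = q + t + 2 - s by omega,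
      show ((q + t + 1 - s : ℕ) : ℤ) = q + t + 1 - s by omega]
    exact ⟨q + 1, by push_cast; ring⟩

/-- After `p + 2 - j` rotations the unit stands in front, hence is the first input of an operation
with at least three inputs, which it annihilates. -/
theorem ins_hochTerm_first_of_two_le {p q j : ℕ} {c : ℤ} (h : c + 1 = (p + 1 : ℕ) - q)
    (hqp : q + 2 ≤ p + 1) (hj' : j ≤ p + 1) :
    E.comp (zero_add c) (E.ins η.u (p + 1) j hj') (i.hochTerm (p + 1) q (p + 2 - j) h) = 0 := by
  obtain ⟨t, ht⟩ := Nat.exists_eq_add_of_le (by omega : q ≤ p + 1)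
  rw [i.hochTerm_eq _ h ht.symm (by omega) (by omega) (by omega), map_zsmul,
    η.ins_term_absorb (s' := 0) (x := p + 2 - j - 1) (by omega) ht.symm hj' (by omega) (by omega)
    (by omega) (by omega) (Or.inr ⟨by omega, rfl⟩), η.u_m _ _ _ _ (by omega)]
  simp

theorem rotPow_eq_id (E : DGProp.{u}) {p x : ℕ} (h : x = 0 ∨ x = p + 1) :
    E.rotPow p x = E.id (p + 1) := by
  rcases h with rfl | rfl
  · rfl
  · exact E.rotPow_period p

/-- Once `m_2` has absorbed the unit only rotations are left, and `hx` says that they amount to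
nothing or to a full turn. -/
theorem ins_hochTerm_absorb_one {p j s s' x : ℕ} (h : (0 : ℤ) + 1 = (p + 1 : ℕ) - p)
    (hj' : j ≤ p + 1) (hs' : s' ≤ 1)
    (hcase : (j + s = s' ∧ x = s) ∨ (j + s = p + 2 + s' ∧ x = s - 1))
    (hx : x + backRot (p + 1) p s = 0 ∨ x + backRot (p + 1) p s = p + 1) :
    E.comp (zero_add 0) (E.ins η.u (p + 1) j hj') (i.hochTerm (p + 1) p s h) =
      sg ((p + 1 : ℕ) * s + p * backRot (p + 1) p s) • E.id (p + 1) := by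
  rw [i.hochTerm_eq _ h rfl (by omega) (by omega) (by omega), map_zsmul,
    η.ins_term_absorb (s' := s') (x := x) (by omega) rfl hj' (by omega) (by omega)
    (by omega) hs' hcase]
  have : E.comp (zero_add 0) (E.ins η.u 1 s' hs') (i.m 1 (by omega)) = E.id 1 := by
    obtain rfl | rfl : s' = 0 ∨ s' = 1 := by omega
    · exact η.u_m_left
    · exact η.u_m_right
  rw [this, E.wh_id, E.comp_id, ← E.rotPow_add, rotPow_eq_id E hx]
  congr 1
  exact sg_congr ⟨1, by push_cast; ring⟩

/-- The unit is the first factor of `m_2`. This summand cancels against the one of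
`ins_hochTerm_last`, and it is also the one that survives in the commutator below. -/
theorem ins_hochTerm_first {p j : ℕ} (h : (0 : ℤ) + 1 = (p + 1 : ℕ) - p)
    (hj : 1 ≤ j) (hj' : j ≤ p + 1) :
    E.comp (zero_add 0) (E.ins η.u (p + 1) j hj') (i.hochTerm (p + 1) p (p + 2 - j) h) =
      sg j • E.id (p + 1) := by
  have hb : (j = p + 1 ∧ backRot (p + 1) p (p + 2 - j) = 0) ∨
      (j ≤ p ∧ backRot (p + 1) p (p + 2 - j) = j) := by
    unfold backRot; split_ifs <;> omega
  rw [η.ins_hochTerm_absorb_one h hj' (s' := 0) (x := p + 2 - j - 1) (by omega)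
    (Or.inr ⟨by omega, rfl⟩) (by omega)]
  congr 1
  apply sg_congr
  rw [show ((p + 2 - j : ℕ) : ℤ) = p + 2 - j by omega]
  -- After substituting the rotation numbers the exponent contains `p (p + 1)`, which does not
  -- affect the sign.
  obtain ⟨w, hw⟩ := Int.even_mul_succ_self p
  rcases hb with ⟨h1, h2⟩ | ⟨h1, h2⟩
  · rw [h2, h1]; exact ⟨0, by push_cast; ring⟩
  · rw [h2]; exact ⟨w + p + 1 - j, by push_cast; linear_combination hw⟩

/-- Here the rotation brings the unit to the second place of `m_2`. With `j = 1` it stands there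
already, hence the exceptional value `s = 0`. -/
theorem ins_hochTerm_last {p j s : ℕ} (h : (0 : ℤ) + 1 = (p + 1 : ℕ) - p)
    (hj : 1 ≤ j) (hj' : j ≤ p + 1) (hs : (j = 1 ∧ s = 0) ∨ (2 ≤ j ∧ j + s = p + 3)) :
    E.comp (zero_add 0) (E.ins η.u (p + 1) j hj') (i.hochTerm (p + 1) p s h) =
      -(sg j • E.id (p + 1)) := by
  have hb : (j = 1 ∧ s = 0 ∧ backRot (p + 1) p s = 0) ∨
      (2 ≤ j ∧ j + s = p + 3 ∧ backRot (p + 1) p s + 1 = j) := by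
    unfold backRot; split_ifs <;> omega
  rw [η.ins_hochTerm_absorb_one h hj' (s' := 1) (x := s - 1) (by omega) (by omega) (by omega),
    ← neg_smul]
  congr 1
  apply sg_congr_neg
  obtain ⟨w, hw⟩ := Int.even_mul_succ_self p
  rcases hb with ⟨rfl, rfl, h2⟩ | ⟨h0, h1, h2⟩
  · rw [h2]; exact ⟨-1, by simp⟩
  · rw [show (backRot (p + 1) p s : ℤ) = j - 1 by omega, show (s : ℤ) = p + 3 - j by omega]
    exact ⟨w + p + 1 - j, by push_cast; linear_combination hw⟩

/-- The other summands which do not involve the unit move it to the front. -/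
theorem ins_hochTerm_mem {p q j s s' : ℕ} {c : ℤ} (h : c + 1 = (p + 1 : ℕ) - q)
    (hqp : q < p + 1) (hj : 1 ≤ j) (hj' : j ≤ p + 1) (hs : s ≤ p + 1)
    (hns : s < p + 1 - q ∨ p + 1 < s + j) (hts : p + 1 - q < s') (hs' : s' ≤ p + 1)
    (hcase : j + s = s' ∨ j + s = p + 2 + s') :
    E.comp (zero_add c) (E.ins η.u (p + 1) j hj') (i.hochTerm (p + 1) q s h) ∈
      η.degLT j (p + 1) q c := by
  obtain ⟨q, rfl⟩ : ∃ q', q = q' + 1 := ⟨q - 1, by omega⟩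
  obtain ⟨t, ht⟩ := Nat.exists_eq_add_of_le (by omega : q + 1 ≤ p + 1)
  have e2 : ∀ (b j' : ℕ) (_ : 1 ≤ j') (hj2 : j' ≤ q + 1),
      (s' - t + b = j' ∨ s' - t + b = q + 2 + j') →
      ∃ y, E.comp (add_zero 0) (E.ins η.u (q + 1) (s' - t) (by omega)) (E.rotPow (q + 1) b) =
        E.comp (add_zero 0) y (E.ins η.u (q + 1) j' hj2) := by
    rintro b j' hj1 hj2 (rfl | h)
    · exact ⟨_, E.ins_rot_lt _ _ _ _ _⟩
    · exact ⟨_, E.ins_rot_ge _ _ _ _ _ _ h _⟩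
  obtain ⟨j', hj1, hjj, hj2, y, hy⟩ : ∃ (j' : ℕ) (_ : 1 ≤ j') (_ : j' < j) (hj2 : j' ≤ q + 1)
      (y : _), E.comp (add_zero 0) (E.ins η.u (q + 1) (s' - t) (by omega))
        (E.rotPow (q + 1) (backRot (p + 1) (q + 1) s)) =
        E.comp (add_zero 0) y (E.ins η.u (q + 1) j' hj2) := by
    -- Without back rotation the unit ends in place `s' - t`; with it, since the unit has wrapped
    -- around, in place `j - t`. By `hns` and `t ≥ 1` both come before `j`.
    by_cases hst : s ≤ t
    · rw [backRot_zero (by omega)]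
      obtain ⟨y, hy⟩ := e2 0 (s' - t) (by omega) (by omega) (Or.inl rfl)
      exact ⟨_, by omega, by omega, _, y, hy⟩
    · rw [backRot_pos (by omega)]
      rcases hcase with h | h
      · omega
      · obtain ⟨y, hy⟩ := e2 (p + 1 + 1 - s) (j - t) (by omega) (by omega) (Or.inl (by omega))
        exact ⟨_, by omega, by omega, _, y, hy⟩
  rw [i.hochTerm_eq s h ht.symm (by omega) (by omega) (by omega), map_zsmul,
    η.ins_term_free (s' := s') (x := if j + s = s' then s else s - 1) (by omega) ht.symm hj'
      (by omega) (by omega) (by omega) (by omega) (by omega) hs' (by split_ifs <;> omega), hy,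
    ← E.comp_assoc (h₁ := add_zero c) (h₂ := add_zero c)]
  exact zsmul_mem (η.mem_degLT _ hj1 hjj hj2) _

/-- Up to terms with a unit in an earlier place, only the summands which multiply entries
after the `j`-th one contribute to the Hochschild element with a unit in place `j`. -/
theorem ins_hoch_sub_mem {p q j : ℕ} {c : ℤ} (h : c + 1 = p - q) (hj : 1 ≤ j) (hj' : j ≤ p) :
    E.comp (zero_add c) (E.ins η.u p j hj') (i.hoch p q h) -
      ∑ s ∈ Finset.Icc (p - q) (p - j), E.comp (zero_add c) (E.ins η.u p j hj')
        (i.hochTerm p q s h) ∈ η.degLT j p q c := by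
  by_cases hpq : p ≤ q
  · rw [i.hoch_of_le h hpq, map_zero, zero_sub, Finset.sum_eq_zero, neg_zero]
    · exact zero_mem _
    · intro s _; rw [i.hochTerm_of_le s h hpq, map_zero]
  obtain ⟨p, rfl⟩ : ∃ p', p = p' + 1 := ⟨p - 1, by omega⟩
  have hcase : ∀ s, s ≤ p + 1 → ∃ s', s' ≤ p + 1 ∧ (j + s = s' ∨ j + s = p + 2 + s') := by
    intro s hs
    by_cases hjs : j + s ≤ p + 1
    · exact ⟨_, hjs, Or.inl rfl⟩
    · exact ⟨j + s - (p + 2), by omega, Or.inr (by omega)⟩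
  have hsub : Finset.Icc (p + 1 - q) (p + 1 - j) ⊆ Finset.range (p + 1 + 1) := by
    intro s hs; rw [Finset.mem_Icc] at hs; rw [Finset.mem_range]; omega
  rw [i.hoch_eq_sum, map_sum, ← Finset.sum_sdiff hsub, add_sub_cancel_right]
  -- A unit kills every operation with at least three inputs that it enters. For binary operations
  -- exactly two summands absorb it, once as either factor, and their values `± id` cancel.
  by_cases ht2 : q + 2 ≤ p + 1
  · refine sum_mem fun s hs => ?_
    simp only [Finset.mem_sdiff, Finset.mem_Icc, Finset.mem_range] at hs
    obtain ⟨s', hs', hc⟩ := hcase s (by omega)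
    by_cases hts : s' ≤ p + 1 - q
    · obtain ⟨t, ht⟩ := Nat.exists_eq_add_of_le (by omega : q ≤ p + 1)
      rw [i.hochTerm_eq _ h ht.symm (by omega) (by omega) (by omega), map_zsmul,
        η.ins_term_absorb (s' := s') (x := if j + s = s' then s else s - 1) (by omega) ht.symm hj'
          (by omega) (by omega) (by omega) (by omega) (by split_ifs <;> omega),
        η.u_m _ _ _ _ (by omega)]
      simp
    · exact η.ins_hochTerm_mem h (by omega) hj hj' (by omega) (by omega) (by omega) hs' hc
  · obtain rfl : p = q := by omega
    obtain rfl : c = 0 := by omega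
    -- `p + 2 - j` rotations bring the unit to place `0`, and `s₂` rotations bring it to place `1`.
    obtain ⟨s₂, hs₂⟩ : ∃ s₂, (j = 1 ∧ s₂ = 0) ∨ (2 ≤ j ∧ j + s₂ = p + 3) := by
      by_cases hj1 : j = 1
      · exact ⟨0, Or.inl ⟨hj1, rfl⟩⟩
      · exact ⟨p + 3 - j, Or.inr ⟨by omega, by omega⟩⟩
    rw [← Finset.add_sum_erase _ _ (show p + 2 - j ∈ Finset.range (p + 1 + 1) \
        Finset.Icc (p + 1 - p) (p + 1 - j) by
        simp only [Finset.mem_sdiff, Finset.mem_range, Finset.mem_Icc]; omega),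
      ← Finset.add_sum_erase _ _ (show s₂ ∈ (Finset.range (p + 1 + 1) \
        Finset.Icc (p + 1 - p) (p + 1 - j)).erase (p + 2 - j) by
        simp only [Finset.mem_erase, Finset.mem_sdiff, Finset.mem_range, Finset.mem_Icc]; omega),
      ← add_assoc, η.ins_hochTerm_first h hj hj', η.ins_hochTerm_last h hj hj' hs₂,
      add_neg_cancel, zero_add]
    refine sum_mem fun s hs => ?_
    simp only [Finset.mem_erase, Finset.mem_sdiff, Finset.mem_range, Finset.mem_Icc] at hs
    obtain ⟨s', hs', hc⟩ := hcase s (by omega)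
    exact η.ins_hochTerm_mem h (by omega) hj hj' (by omega) (by omega) (by omega) hs' hc

end AInfUnit

/-- Units inserted in different places can be inserted in either order. -/
theorem DGProp.ins_ins (E : DGProp.{u}) (u : (E.Hom 0 1).X 0) {p j k : ℕ} (hjk : j ≤ k) (hk : k ≤ p)
    (hj : j ≤ p) (hk' : k + 1 ≤ p + 1) (hj' : j ≤ p + 1) :
    E.comp (add_zero 0) (E.ins u p j hj) (E.ins u (p + 1) (k + 1) hk') =
      E.comp (add_zero 0) (E.ins u p k hk) (E.ins u (p + 1) j hj') := by
  have key := E.wh_disjoint (E.ins u j j le_rfl) u (N := p) (P := p + 1) (Q := p + 1) (M := p + 1 + 1)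
    (b₁ := p - j) (b₂ := p - j + 1) (x := k + 1) (y := k) (e := p - k) (add_zero 0) (add_zero 0)
    (by omega) (by omega) (by omega) (by omega) (by omega) (by omega) (by omega) (by omega)
    (by omega)
  simp only [mul_zero, sg_zero, one_smul] at key
  have e₁ : ∀ (b N M : ℕ) (hN : 0 + j + b = N) (hM : 0 + (j + 1) + b = M) (h₁ : j + 0 + b = N)
      (h₂ : j + 1 + b = M),
      E.wh 0 b hN hM (E.ins u j j le_rfl) = E.wh (n := 0) (m := 1) j b h₁ h₂ u := by
    intro b N M hN hM h₁ h₂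
    exact E.wh_wh 0 b j (j - j) j b _ _ _ _ (by omega) (by omega) _ _ u
  rw [e₁ (p - j) p (p + 1) _ _ (by omega) (by omega),
    e₁ (p - j + 1) (p + 1) (p + 1 + 1) _ _ (by omega) (by omega)] at key
  have e₂ : ∀ (x q b : ℕ) (hx : x ≤ q) (h₁ : x + 0 + b = q) (h₂ : x + 1 + b = q + 1),
      E.wh (n := 0) (m := 1) x b h₁ h₂ u = E.ins u q x hx := by
    intro x q b hx h₁ h₂
    obtain rfl : b = q - x := by omega
    rfl
  rwa [e₂ j p _ hj, e₂ (k + 1) (p + 1) _ hk', e₂ k p _ hk, e₂ j (p + 1) _ hj'] at key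

/-! ### The commutator of the Hochschild differential with the insertion of a unit. -/

namespace AInfUnit

variable {E : DGProp.{u}} {i : AInfMul E} (η : AInfUnit i)

theorem degLT_mono {k k' N q : ℕ} {c : ℤ} (h : k ≤ k') : η.degLT k N q c ≤ η.degLT k' N q c := by
  unfold degLT
  rw [AddSubgroup.closure_le]
  rintro _ ⟨j, h₁, h₂, hj, y, rfl⟩
  exact η.mem_degLT y h₁ (by omega) hj

/-- An insertion in place `k` commutes past a unit in an earlier place `j`, becoming an insertion in
place `k - 1` before it. The unit in place `j` is thus still the last one inserted. -/
theorem degLT_comp_ins {k N q : ℕ} {c : ℤ} {z : (E.Hom N (q + 1)).X c} (hz : z ∈ η.degLT k N q c)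
    (hk : k ≤ q + 1) : E.comp (add_zero c) z (E.ins η.u (q + 1) k hk) ∈ η.degLT k N (q + 1) c := by
  induction hz using AddSubgroup.closure_induction with
  | mem z hz =>
    obtain ⟨j, h₁, h₂, hj, y, rfl⟩ := hz
    obtain ⟨k, rfl⟩ : ∃ k', k = k' + 1 := ⟨k - 1, by omega⟩
    rw [E.comp_assoc (h₃ := add_zero 0) (h₄ := add_zero c),
      E.ins_ins η.u (k := k) (by omega) (by omega) hj hk (by omega),
      ← E.comp_assoc (h₁ := add_zero c) (h₂ := add_zero c)]
    exact η.mem_degLT _ h₁ h₂ _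
  | zero => rw [map_zero]; exact zero_mem _
  | add z w _ _ hz hw => rw [map_add]; exact add_mem hz hw
  | neg z _ hz => rw [map_neg]; exact neg_mem hz

/-- The Hochschild differential does not move a unit to a later place. -/
theorem ins_hoch_mem_degLT {p q j : ℕ} {c : ℤ} (h : c + 1 = p - q) (hj : 1 ≤ j) (hj' : j ≤ p) :
    E.comp (zero_add c) (E.ins η.u p j hj') (i.hoch p q h) ∈ η.degLT (j + 1) p q c := by
  rw [← sub_add_cancel (E.comp (zero_add c) (E.ins η.u p j hj') (i.hoch p q h))
    (∑ s ∈ Finset.Icc (p - q) (p - j), E.comp (zero_add c) (E.ins η.u p j hj') (i.hochTerm p q s h))]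
  refine add_mem (η.degLT_mono (by omega) (η.ins_hoch_sub_mem h hj hj')) ?_
  refine sum_mem fun s hs => ?_
  rw [Finset.mem_Icc] at hs
  by_cases hpq : p ≤ q
  · rw [i.hochTerm_of_le s h hpq, map_zero]; exact zero_mem _
  obtain ⟨p, rfl⟩ : ∃ p', p = p' + 1 := ⟨p - 1, by omega⟩
  obtain ⟨q, rfl⟩ : ∃ q', q = q' + 1 := ⟨q - 1, by omega⟩
  rw [η.ins_hochTerm_of_mem h (by omega) (by omega) hj hj' (by omega) (by omega) (by omega)]
  exact zsmul_mem (η.mem_degLT _ hj (by omega) _) _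

/-- The insertion of a unit in place `k` where this is possible, and `0` otherwise. -/
def insZ (p k : ℕ) : (E.Hom p (p + 1)).X 0 := if h : k ≤ p then E.ins η.u p k h else 0

theorem insZ_of_le {p k : ℕ} (h : k ≤ p) : η.insZ p k = E.ins η.u p k h := dif_pos h

theorem insZ_of_lt {p k : ℕ} (h : p < k) : η.insZ p k = 0 := dif_neg (by omega)

/-- The commutator of the Hochschild differential with the insertion of a unit in place `k`. -/
def hochComm (k p q : ℕ) {c : ℤ} (h : c + 1 = p - q) : (E.Hom (p + 1) (q + 1 + 1)).X c :=
  E.comp (zero_add c) (η.insZ (p + 1) k) (i.hoch (p + 1) (q + 1) (by push_cast; omega)) +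
    sg c • E.comp (add_zero c) (i.hoch p q h) (η.insZ (q + 1) k)

/-- After exchanging the two insertions the unit in place `j` comes last, and the Hochschild element
does not move it beyond `j`, which is less than `k`. -/
theorem ins_insZ_hoch_mem {j k p q : ℕ} {c : ℤ} (h : c + 1 = (p + 1 : ℕ) - q) (hj : 1 ≤ j)
    (hjk : j < k) (hj' : j ≤ p) :
    E.comp (zero_add c) (E.ins η.u p j hj') (E.comp (zero_add c) (η.insZ (p + 1) k)
      (i.hoch (p + 1) q h)) ∈ η.degLT k p q c := by
  by_cases hk : k ≤ p + 1
  · obtain ⟨k, rfl⟩ : ∃ k', k = k' + 1 := ⟨k - 1, by omega⟩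
    rw [η.insZ_of_le hk, ← E.comp_assoc (h₁ := add_zero 0) (h₂ := zero_add c),
      E.ins_ins η.u (k := k) (by omega) (by omega) hj' hk (by omega),
      E.comp_assoc (h₃ := zero_add c) (h₄ := zero_add c)]
    exact η.comp_mem_degLT _ _ (η.degLT_mono (by omega) (η.ins_hoch_mem_degLT h hj _))
  · rw [η.insZ_of_lt (by omega)]; simp

theorem ins_hochComm_mem_of_lt {j k p q : ℕ} {c : ℤ} (h : c + 1 = p - q) (hj : 1 ≤ j)
    (hjk : j < k) (hj' : j ≤ p) :
    E.comp (zero_add c) (E.ins η.u p j hj') (η.hochComm k p q h) ∈ η.degLT k p (q + 1) c := by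
  unfold hochComm
  rw [map_add, map_zsmul]
  refine add_mem (η.ins_insZ_hoch_mem _ hj hjk hj') (zsmul_mem ?_ _)
  rw [← E.comp_assoc (h₁ := zero_add c) (h₂ := add_zero c)]
  by_cases hk : k ≤ q + 1
  · rw [η.insZ_of_le hk]
    exact η.degLT_comp_ins (η.degLT_mono (by omega) (η.ins_hoch_mem_degLT h hj hj')) hk
  · rw [η.insZ_of_lt (by omega)]; simp

/-- As `q < k`, the range of summands excepted in `ins_hoch_sub_mem` is empty. -/
theorem ins_insZ_hoch_zero_mem {k p q : ℕ} {c : ℤ} (h : c + 1 = (p + 1 : ℕ) - q) (hk : 1 ≤ k)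
    (hqk : q < k) (hk' : k ≤ p) :
    E.comp (zero_add c) (E.ins η.u p k hk') (E.comp (zero_add c) (η.insZ (p + 1) k)
      (i.hoch (p + 1) q h)) ∈ η.degLT k p q c := by
  rw [η.insZ_of_le (by omega)]
  refine η.comp_mem_degLT _ _ ?_
  have := η.ins_hoch_sub_mem h hk (by omega : k ≤ p + 1)
  rwa [Finset.Icc_eq_empty (by omega), Finset.sum_empty, sub_zero] at this

/-- The commutator with a unit in place `k`, up to units in earlier places. -/
theorem ins_hochComm_sub_mem {k p q : ℕ} {c : ℤ} (h : c + 1 = p - q) (hqp : q < p) (hk : 1 ≤ k)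
    (hkq : k ≤ q + 1) (hk' : k ≤ p) :
    E.comp (zero_add c) (E.ins η.u p k hk') (η.hochComm k p q h) -
      sg (p - q) • E.comp (add_zero c) (E.comp (zero_add c) (E.ins η.u p k hk')
        (i.hochTerm p q (p + 1 - k) h)) (E.ins η.u (q + 1) k hkq) ∈ η.degLT k p (q + 1) c := by
  -- Modulo units in earlier places, both halves of the commutator are sums of the same expressions
  -- with opposite signs, starting at `s = p - q`. The first half runs up to `s = p + 1 - k`, the
  -- second only up to `s = p - k`, so a single summand survives.
  have m₁ := η.comp_mem_degLT (zero_add c) (E.ins η.u p k hk') (η.ins_hoch_sub_mem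
    (p := p + 1) (q := q + 1) (c := c) (by push_cast; omega) hk (by omega : k ≤ p + 1))
  have m₂ := η.degLT_comp_ins (η.ins_hoch_sub_mem h hk hk') hkq
  have hs : ∑ s ∈ Finset.Icc (p + 1 - (q + 1)) (p + 1 - k), E.comp (zero_add c)
      (E.ins η.u (p + 1) k (by omega)) (i.hochTerm (p + 1) (q + 1) s (by push_cast; omega)) =
      sg (p - q) • ∑ s ∈ Finset.Icc (p - q) (p + 1 - k), E.comp (add_zero c) (i.hochTerm p q s h)
        (E.ins η.u (q + 1) k hkq) := by
    rw [Finset.smul_sum, show p + 1 - (q + 1) = p - q by omega]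
    refine Finset.sum_congr rfl fun s hs => ?_
    rw [Finset.mem_Icc] at hs
    exact η.ins_hochTerm_of_mem _ h hqp hk _ hkq hs.1 (by omega)
  have hI : Finset.Icc (p - q) (p + 1 - k) = insert (p + 1 - k) (Finset.Icc (p - q) (p - k)) := by
    ext s; simp only [Finset.mem_Icc, Finset.mem_insert]; omega
  rw [hs, hI, Finset.sum_insert (by rw [Finset.mem_Icc]; omega), map_sub, map_zsmul, map_add,
    map_sum] at m₁
  rw [map_sub, AddMonoidHom.sub_apply, map_sum, AddMonoidHom.finsetSum_apply] at m₂
  have m₃ := add_mem m₁ (zsmul_mem m₂ (sg c))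
  convert m₃ using 1
  unfold hochComm
  rw [η.insZ_of_le hkq, η.insZ_of_le (by omega : k ≤ p + 1), map_add, map_zsmul]
  have s1 : sg (p - q) = -sg c := by rw [← h, sg_add, sg_one]; ring
  simp only [← E.comp_assoc (h₁ := zero_add c) (h₂ := add_zero c)]
  rw [s1]
  module

/-- In the surviving summand of `ins_hochComm_sub_mem` the unit is the first input of an operation
with at least three inputs. If `k > q + 1`, there is no place `k` in the target, and `insZ` makes
the second half of the commutator zero. -/
theorem ins_hochComm_mem {k p q : ℕ} {c : ℤ} (h : c + 1 = p - q) (hqp : q + 1 < p) (hk : 1 ≤ k)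
    (hk' : k ≤ p) :
    E.comp (zero_add c) (E.ins η.u p k hk') (η.hochComm k p q h) ∈ η.degLT k p (q + 1) c := by
  by_cases hkq : k ≤ q + 1
  · have := η.ins_hochComm_sub_mem h (by omega) hk hkq hk'
    obtain ⟨p, rfl⟩ : ∃ p', p = p' + 1 := ⟨p - 1, by omega⟩
    rwa [η.ins_hochTerm_first_of_two_le h (by omega) hk', map_zero, AddMonoidHom.zero_apply,
      smul_zero, sub_zero] at this
  · unfold hochComm
    rw [map_add, η.insZ_of_lt (p := q + 1) (by omega), map_zero, smul_zero, map_zero, add_zero]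
    exact η.ins_insZ_hoch_zero_mem _ hk (by omega) hk'

/-- The surviving summand is now `m_2` with the unit as first factor, that is `(-1)^k id`. This is
the term that allows a unit in place `k` to be traded for units in earlier places. -/
theorem ins_hochComm_add_mem {k q : ℕ} (h : (0 : ℤ) + 1 = (q + 1 : ℕ) - q) (hk : 1 ≤ k)
    (hk' : k ≤ q + 1) :
    E.comp (zero_add 0) (E.ins η.u (q + 1) k hk') (η.hochComm k (q + 1) q h) +
      sg k • E.ins η.u (q + 1) k hk' ∈ η.degLT k (q + 1) (q + 1) 0 := by
  have := η.ins_hochComm_sub_mem h (by omega) hk hk' hk'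
  rw [show q + 1 + 1 - k = q + 2 - k by omega, η.ins_hochTerm_first h hk hk', map_zsmul,
    AddMonoidHom.coe_smul, Pi.smul_apply, E.id_comp, ← h, zero_add, sg_one, neg_smul, one_smul,
    sub_neg_eq_add] at this
  exact this

section Whiskered

variable (m : ℕ)

/-- The elements of `E(N, q + 1 + m)` with a unit inserted after `j` entries, `1 ≤ j < k`, `j ≤ q`. -/
def degLTW (k N q : ℕ) (c : ℤ) : AddSubgroup ((E.Hom N (q + 1 + m)).X c) :=
  AddSubgroup.closure {z | ∃ (j : ℕ) (_ : 1 ≤ j) (_ : j < k) (h : j ≤ q) (y : (E.Hom N (q + m)).X c),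
    z = E.comp (add_zero c) y (η.insW m q j h)}

theorem wh_mem_degLTW {k N q : ℕ} {c : ℤ} {z : (E.Hom N (q + 1)).X c} (hz : z ∈ η.degLT k N q c)
    (h₁ : 0 + N + m = N + m) (h₂ : 0 + (q + 1) + m = q + 1 + m) :
    E.wh 0 m h₁ h₂ z ∈ η.degLTW m k (N + m) q c := by
  induction hz using AddSubgroup.closure_induction with
  | mem z hz =>
    obtain ⟨j, hj₁, hj₂, hj, y, rfl⟩ := hz
    refine AddSubgroup.subset_closure ⟨j, hj₁, hj₂, hj, E.wh 0 m (by omega) (by omega) y, ?_⟩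
    rw [← E.wh_comp (hP := (by omega : 0 + q + m = q + m))]; rfl
  | zero => rw [map_zero]; exact zero_mem _
  | add z w _ _ hz hw => rw [map_add]; exact add_mem hz hw
  | neg z _ hz => rw [map_neg]; exact neg_mem hz

/-- The insertion of a unit in place `k` of the first entries where this is possible, and `0` otherwise. -/
def insZW (p k : ℕ) : (E.Hom (p + m) (p + 1 + m)).X 0 :=
  E.wh 0 m (by omega) (by omega) (η.insZ p k)

theorem insZW_of_le {p k : ℕ} (h : k ≤ p) : η.insZW m p k = η.insW m p k h := by
  unfold insZW insW; rw [η.insZ_of_le h]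

theorem insZW_of_lt {p k : ℕ} (h : p < k) : η.insZW m p k = 0 := by
  unfold insZW; rw [η.insZ_of_lt h, map_zero]

theorem d_insZW (p k : ℕ) {j : ℤ} (hj : j + 1 = 0) :
    (E.Hom _ _).d hj (η.insZW m p k) = 0 := by
  by_cases h : k ≤ p
  · rw [η.insZW_of_le m h, η.d_insW]
  · rw [η.insZW_of_lt m (by omega), map_zero]

/-- The commutator of the Hochschild differential with the insertion of a unit in place `k` of the
first entries. -/
def hochCommW (k p q : ℕ) {c : ℤ} (h : c + 1 = p - q) :
    (E.Hom (p + 1 + m) (q + 1 + 1 + m)).X c :=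
  E.comp (zero_add c) (η.insZW m (p + 1) k) (i.hochW m (p + 1) (q + 1) (by push_cast; omega)) +
    sg c • E.comp (add_zero c) (i.hochW m p q h) (η.insZW m (q + 1) k)

theorem hochCommW_eq (k p q : ℕ) {c : ℤ} (h : c + 1 = p - q) :
    η.hochCommW m k p q h = E.wh 0 m (by omega) (by omega) (η.hochComm k p q h) := by
  unfold hochCommW hochComm insZW AInfMul.hochW
  rw [map_add, map_zsmul, E.wh_comp, E.wh_comp]

/-- The target `l_1` needs separate treatment: in the homotopy formulas its term has no partner with
which to form a commutator. -/
theorem insW_insZW_hochW_mem {j k p : ℕ} {c : ℤ} (h : c + 1 = (p + 1 : ℕ) - (0 : ℕ)) (hj : 1 ≤ j)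
    (hjk : j ≤ k) (hj' : j ≤ p) :
    E.comp (zero_add c) (η.insW m p j hj') (E.comp (zero_add c) (η.insZW m (p + 1) k)
      (i.hochW m (p + 1) 0 h)) ∈ η.degLTW m k (p + m) 0 c := by
  unfold insW insZW AInfMul.hochW
  rw [E.wh_comp, E.wh_comp]
  refine η.wh_mem_degLTW m ?_ _ _
  rcases hjk.lt_or_eq with hlt | rfl
  · exact η.ins_insZ_hoch_mem h hj hlt hj'
  · exact η.ins_insZ_hoch_zero_mem h hj hj hj'

theorem insW_hochCommW_mem {j k p q : ℕ} {c : ℤ} (h : c + 1 = p - q) (hj : 1 ≤ j) (hj' : j ≤ p)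
    (hjk : j < k ∨ j = k ∧ q + 1 < p) :
    E.comp (zero_add c) (η.insW m p j hj') (η.hochCommW m k p q h) ∈
      η.degLTW m k (p + m) (q + 1) c := by
  rw [η.hochCommW_eq]
  unfold insW
  rw [E.wh_comp]
  refine η.wh_mem_degLTW m ?_ _ _
  rcases hjk with hlt | ⟨rfl, hq⟩
  · exact η.ins_hochComm_mem_of_lt h hj hlt hj'
  · exact η.ins_hochComm_mem h hq hj hj'

theorem insW_hochCommW_add_mem {k q : ℕ} (h : (0 : ℤ) + 1 = (q + 1 : ℕ) - q) (hk : 1 ≤ k)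
    (hk' : k ≤ q + 1) :
    E.comp (zero_add 0) (η.insW m (q + 1) k hk') (η.hochCommW m k (q + 1) q h) +
      sg k • η.insW m (q + 1) k hk' ∈ η.degLTW m k (q + 1 + m) (q + 1) 0 := by
  rw [η.hochCommW_eq]
  unfold insW
  rw [E.wh_comp, ← map_zsmul, ← map_add]
  exact η.wh_mem_degLTW m (η.ins_hochComm_add_mem h hk hk') _ _

end Whiskered

end AInfUnit

/-! ### Quasi-isomorphisms as maps with acyclic cone, and limits of approximations. -/

/-- A chain map whose mapping cone is acyclic. -/
structure Cplx.IsQuasi {A : Cplx.{u}} {B : Cplx.{v}} (f : ∀ k : ℤ, A.X k →+ B.X k) : Prop where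
  comm : ∀ {k k' : ℤ} (h : k' + 1 = k) (x : A.X k), f k' (A.d h x) = B.d h (f k x)
  cone : ∀ {k₂ k₁ k k₀ : ℤ} (h₂ : k₁ + 1 = k₂) (h₁ : k + 1 = k₁) (h₀ : k₀ + 1 = k) (a : A.X k)
    (b : B.X k₁), A.d h₀ a = 0 → B.d h₁ b = f k a →
    ∃ (a' : A.X k₁) (b' : B.X k₂), A.d h₁ a' = a ∧ b = f k₁ a' + B.d h₂ b'

namespace Cplx.IsQuasi

/-- Surjectivity on homology is the case `a = 0` of the cone condition, and injectivity is what
remains of it when `b'` is forgotten. -/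
theorem qIso {A B : Cplx.{u}} {f : ∀ k : ℤ, A.X k →+ B.X k} (hf : IsQuasi f) : A.QIso B := by
  refine ⟨f, hf.comm, ?_, ?_⟩
  · rintro k₁ k k₀ h₁ h₀ x hx ⟨y, hy⟩
    obtain ⟨a', -, h, -⟩ := hf.cone rfl h₁ h₀ x y hx hy
    exact ⟨a', h⟩
  · intro k₁ k k₀ h₁ h₀ y hy
    obtain ⟨a', b', h, h'⟩ := hf.cone h₁ h₀ (by omega : k₀ - 1 + 1 = k₀) 0 y (map_zero _)
      (hy.trans (map_zero _).symm)
    exact ⟨a', -b', h, by rw [h', map_neg]; abel⟩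

/-- A solution for the cone of `g` provides the element of `B` that is needed as input for the cone
of `f`. -/
theorem comp {A : Cplx.{u}} {B : Cplx.{v}} {C : Cplx.{w}} {f : ∀ k : ℤ, A.X k →+ B.X k}
    {g : ∀ k : ℤ, B.X k →+ C.X k} (hg : IsQuasi g) (hf : IsQuasi f) :
    IsQuasi fun k => (g k).comp (f k) where
  comm h x := by rw [AddMonoidHom.comp_apply, hf.comm, hg.comm]; rfl
  cone h₂ h₁ h₀ a c ha hc := by
    obtain ⟨b', c', hb', hc'⟩ := hg.cone h₂ h₁ h₀ _ c
      (by rw [← hf.comm, ha, map_zero]) hc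
    obtain ⟨a', b'', ha', hb''⟩ := hf.cone h₂ h₁ h₀ a b' ha hb'
    refine ⟨a', g _ b'' + c', ha', ?_⟩
    rw [hc', hb'', map_add, map_add, hg.comm, add_assoc]; rfl

theorem of_addEquiv {A : Cplx.{u}} {B : Cplx.{v}} (φ : ∀ k : ℤ, A.X k ≃+ B.X k)
    (hφ : ∀ {k k' : ℤ} (h : k' + 1 = k) (x : A.X k), φ k' (A.d h x) = B.d h (φ k x)) :
    IsQuasi fun k => (φ k : A.X k →+ B.X k) where
  comm := hφ
  cone {k₂ k₁ k k₀} h₂ h₁ h₀ a b ha hb := by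
    refine ⟨(φ k₁).symm b, 0, (φ k).injective ?_, ?_⟩
    · rw [hφ, AddEquiv.apply_symm_apply]; exact hb
    · rw [map_zero, add_zero]; exact ((φ k₁).apply_symm_apply b).symm

theorem addEquiv_symm {A : Cplx.{u}} {B : Cplx.{v}} (φ : ∀ k : ℤ, A.X k ≃+ B.X k)
    (hφ : ∀ {k k' : ℤ} (h : k' + 1 = k) (x : A.X k), φ k' (A.d h x) = B.d h (φ k x)) :
    IsQuasi fun k => ((φ k).symm : B.X k →+ A.X k) :=
  of_addEquiv (fun k => (φ k).symm) (by
    intro k k' h x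
    rw [AddEquiv.symm_apply_eq, hφ, AddEquiv.apply_symm_apply])

theorem id (A : Cplx.{u}) : IsQuasi fun k => AddMonoidHom.id (A.X k) :=
  of_addEquiv (fun k => AddEquiv.refl (A.X k)) (fun _ _ => rfl)

end Cplx.IsQuasi

/-- A sequence of approximations which stabilizes in every place has a limit. -/
theorem exists_limit {X : ℕ → Type v} (P : ℕ → (∀ p, X p) → Prop) {x₀ : ∀ p, X p} (h₀ : P 0 x₀)
    (step : ∀ n x, P n x → ∃ x', P (n + 1) x' ∧ ∀ q < n, x' q = x q) :
    ∃ x : ∀ p, X p, ∀ n, ∃ x', P n x' ∧ ∀ q < n, x' q = x q := by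
  choose f hf hf' using step
  let s : ∀ n, {x // P n x} := fun n =>
    Nat.rec ⟨x₀, h₀⟩ (fun n x => ⟨f n x.1 x.2, hf n x.1 x.2⟩) n
  -- Place `q` does not change after stage `q + 1`, so the diagonal is the limit.
  have hs : ∀ q n, q < n → (s n).1 q = (s (q + 1)).1 q := by
    intro q n hn
    induction n, hn using Nat.le_induction with
    | base => rfl
    | succ n hn ih => rw [← ih]; exact hf' n (s n).1 (s n).2 q hn
  exact ⟨fun p => (s (p + 1)).1 p, fun n => ⟨(s n).1, (s n).2, fun q hq => hs q n hq⟩⟩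

/-! ### The coHochschild complex preserves quasi-isomorphisms. -/

/-- A morphism of dg-functors `Eᵒᵖ → Ch` of degree `0` which commutes with the differentials. -/
structure LMap {E : DGProp.{u}} (Ψ Ψ' : LMod E) where
  app : ∀ (n : ℕ) (k : ℤ), (Ψ.X n).X k →+ (Ψ'.X n).X k
  app_d : ∀ {n : ℕ} {k k' : ℤ} (h : k' + 1 = k) (x : (Ψ.X n).X k),
    app n k' ((Ψ.X n).d h x) = (Ψ'.X n).d h (app n k x)
  app_act : ∀ {n m : ℕ} {a b c : ℤ} (h : a + b = c) (f : (E.Hom n m).X a) (x : (Ψ.X m).X b),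
    app n c (Ψ.act h f x) = Ψ'.act h f (app m b x)

namespace LMap

variable {E : DGProp.{u}} {Ψ Ψ' Ψ'' : LMod E}

/-- The composite of two morphisms. -/
def comp (g : LMap Ψ' Ψ'') (f : LMap Ψ Ψ') : LMap Ψ Ψ'' where
  app n k := (g.app n k).comp (f.app n k)
  app_d h x := by rw [AddMonoidHom.comp_apply, f.app_d, g.app_d]; rfl
  app_act h a x := by rw [AddMonoidHom.comp_apply, f.app_act, g.app_act]; rfl

/-- The identity morphism. -/
def id (Ψ : LMod E) : LMap Ψ Ψ where
  app _ _ := AddMonoidHom.id _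
  app_d _ _ := rfl
  app_act _ _ _ := rfl

/-- The morphism is a quasi-isomorphism at every object. -/
def IsQuasi (f : LMap Ψ Ψ') : Prop := ∀ n, Cplx.IsQuasi (f.app n)

theorem IsQuasi.comp {g : LMap Ψ' Ψ''} {f : LMap Ψ Ψ'} (hg : g.IsQuasi) (hf : f.IsQuasi) :
    (g.comp f).IsQuasi := fun n => (hg n).comp (hf n)

open CohochGr

/-- The map of coHochschild complexes induced by a morphism. -/
def cohoch (f : LMap Ψ Ψ') (m : ℕ) (n : ℤ) : CohochGr Ψ m n →+ CohochGr Ψ' m n :=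
  pair fun p _ ha => (f.app _ _).comp (ev p ha)

theorem cohoch_ev (f : LMap Ψ Ψ') (m : ℕ) (n : ℤ) (x : CohochGr Ψ m n) (p : ℕ) {a : ℤ}
    (ha : p + n = a) : ev p ha (f.cohoch m n x) = f.app _ _ (ev p ha x) := ev_pair _ p ha x

theorem cohoch_d (i : AInfMul E) (f : LMap Ψ Ψ') (m : ℕ) {n n' : ℤ} (h : n' + 1 = n)
    (x : CohochGr Ψ m n) : f.cohoch m n' (i.dD Ψ m h x) = i.dD Ψ' m h (f.cohoch m n x) := by
  apply ev_ext; intro p a ha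
  rw [f.cohoch_ev, i.dD_ev Ψ m h x p rfl ha (by omega), i.dD_ev Ψ' m h _ p rfl ha (by omega),
    map_zsmul, map_sub, map_sum, f.cohoch_ev, f.app_d]
  congr 2
  refine Finset.sum_congr rfl fun q _ => ?_
  rw [f.cohoch_ev, f.app_act]

theorem cohoch_act (f : LMap Ψ Ψ') {n m : ℕ} {a b c : ℤ} (h : a + b = c) (g : (E.Hom n m).X a)
    (x : CohochGr Ψ m b) :
    f.cohoch n c (AInfMul.dAct Ψ h g x) = AInfMul.dAct Ψ' h g (f.cohoch m b x) := by
  apply ev_ext; intro p e he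
  rw [f.cohoch_ev, AInfMul.dAct_ev Ψ h g x p rfl he (by omega),
    AInfMul.dAct_ev Ψ' h g _ p rfl he (by omega), map_zsmul, f.app_act, f.cohoch_ev]

/-- The functoriality of the coHochschild complex. -/
def D (i : AInfMul E) (f : LMap Ψ Ψ') : LMap (i.D Ψ) (i.D Ψ') where
  app m n := f.cohoch m n
  app_d h x := f.cohoch_d i _ h x
  app_act h g x := f.cohoch_act h g x

/-- The place `p` of the coHochschild differential depends only on the places up to `p`. -/
theorem dD_congr (i : AInfMul E) {m : ℕ} {n n' : ℤ} (h : n' + 1 = n) {x y : CohochGr Ψ m n} {p : ℕ}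
    (hxy : ∀ q ≤ p, x q = y q) {a : ℤ} (ha : p + n' = a) :
    ev p ha (i.dD Ψ m h x) = ev p ha (i.dD Ψ m h y) := by
  have e : ∀ q ≤ p, ∀ (b : ℤ) (hb : q + n = b), ev q hb x = ev q hb y := by
    intro q hq b hb; subst hb; exact hxy q hq
  rw [i.dD_ev Ψ m h x p rfl ha (by omega), i.dD_ev Ψ m h y p rfl ha (by omega), e p le_rfl]
  congr 2
  refine Finset.sum_congr rfl fun q hq => ?_
  rw [e q (Finset.mem_range.1 hq).le]

/-- The differential is triangular in the place, so at the first place that may be nonzero only the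
internal differential is seen. -/
theorem dD_of_vanish (i : AInfMul E) {m : ℕ} {n n' : ℤ} (h : n' + 1 = n) {x : CohochGr Ψ m n} {p : ℕ}
    (hx : ∀ q < p, x q = 0) {a a' : ℤ} (ha : p + n' = a') (ha' : p + n = a) (haa : a' + 1 = a) :
    ev p ha (i.dD Ψ m h x) = sg p • (Ψ.X _).d haa (ev p ha' x) := by
  rw [i.dD_ev Ψ m h x p ha' ha haa, Finset.sum_eq_zero, sub_zero]
  intro q hq
  have : ev q rfl x = 0 := hx q (Finset.mem_range.1 hq)
  rw [this, map_zero]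

/-- The element with a single nonzero value. -/
def single (m : ℕ) (n : ℤ) (p : ℕ) : (Ψ.X (p + 1 + m)).X (p + n) →+ CohochGr Ψ m n :=
  AddMonoidHom.single (fun p : ℕ => (Ψ.X (p + 1 + m)).X (p + n)) p

theorem single_of_ne {m : ℕ} {n : ℤ} {p q : ℕ} (h : q ≠ p) (x : (Ψ.X (p + 1 + m)).X (p + n)) :
    single m n p x q = 0 :=
  Pi.single_eq_of_ne (M := fun p : ℕ => (Ψ.X (p + 1 + m)).X (p + n)) h x

theorem single_same {m : ℕ} {n : ℤ} {p : ℕ} (x : (Ψ.X (p + 1 + m)).X (p + n)) :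
    ev p rfl (single m n p x) = x :=
  Pi.single_eq_same (M := fun p : ℕ => (Ψ.X (p + 1 + m)).X (p + n)) p x

/-- Since the differential is triangular, with the internal differential up to sign on the diagonal,
the cone equations can be solved one place after another. The infinitely many corrections are
allowed because the complex is a product. -/
theorem cohoch_cone (i : AInfMul E) {f : LMap Ψ Ψ'} (hf : f.IsQuasi) (m : ℕ) {k₂ k₁ k k₀ : ℤ}
    (h₂ : k₁ + 1 = k₂) (h₁ : k + 1 = k₁) (h₀ : k₀ + 1 = k) (a : CohochGr Ψ m k)
    (b : CohochGr Ψ' m k₁) (ha : i.dD Ψ m h₀ a = 0) (hb : i.dD Ψ' m h₁ b = f.cohoch m k a) :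
    ∃ (a' : CohochGr Ψ m k₁) (b' : CohochGr Ψ' m k₂), i.dD Ψ m h₁ a' = a ∧
      b = f.cohoch m k₁ a' + i.dD Ψ' m h₂ b' := by
  have dd : ∀ x : CohochGr Ψ m k₁, i.dD Ψ m h₀ (i.dD Ψ m h₁ x) = 0 :=
    fun x => ((i.D Ψ).X m).d_d h₁ h₀ x
  have dd' : ∀ x : CohochGr Ψ' m k₂, i.dD Ψ' m h₁ (i.dD Ψ' m h₂ x) = 0 :=
    fun x => ((i.D Ψ').X m).d_d h₂ h₁ x
  obtain ⟨z, hz⟩ := exists_limit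
    (X := fun p => (Ψ.X (p + 1 + m)).X (p + k₁) × (Ψ'.X (p + 1 + m)).X (p + k₂))
    (fun n z => ∀ q < n, (a - i.dD Ψ m h₁ fun p => (z p).1) q = 0 ∧
      (b - f.cohoch m k₁ (fun p => (z p).1) - i.dD Ψ' m h₂ fun p => (z p).2) q = 0)
    (x₀ := fun _ => 0) (by simp) (by
    intro p z hz
    set x : CohochGr Ψ m k₁ := fun p => (z p).1 with hx
    set y : CohochGr Ψ' m k₂ := fun p => (z p).2 with hy
    set w := a - i.dD Ψ m h₁ x with hw
    set v := b - f.cohoch m k₁ x - i.dD Ψ' m h₂ y with hv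
    -- The defects `w` and `v` satisfy the cone equations themselves. They vanish before place `p`,
    -- so at `p` these become cone equations for `f` at the object `p + 1 + m`.
    have dw : i.dD Ψ m h₀ w = 0 := by rw [hw, map_sub, ha, dd, sub_zero]
    have dv : i.dD Ψ' m h₁ v = f.cohoch m k w := by
      rw [hv, hw, map_sub, map_sub, hb, dd', map_sub, f.cohoch_d i, sub_zero]
    have e₁ := dD_of_vanish i h₀ (fun q hq => (hz q hq).1) rfl rfl (by omega) (p := p)
    have e₂ := dD_of_vanish i h₁ (fun q hq => (hz q hq).2) rfl rfl (by omega) (p := p)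
    rw [dw, map_zero] at e₁
    rw [dv, f.cohoch_ev] at e₂
    have sp := sg_mul_self p
    -- Multiplying `w` by `(-1)^p` removes the sign in front of the coHochschild differential. For
    -- the same reason `β` enters the correction with this sign.
    obtain ⟨α, β, hα, hβ⟩ := (hf (p + 1 + m)).cone (k₂ := p + k₂) (k₁ := p + k₁) (k := p + k)
      (k₀ := p + k₀) (by omega) (by omega) (by omega) (sg p • ev p rfl w) (ev p rfl v)
      (by rw [map_zsmul, ← e₁]) (by rw [map_zsmul, e₂, smul_smul, sp, one_smul])
    let x' : CohochGr Ψ m k₁ := x + single m k₁ p α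
    let y' : CohochGr Ψ' m k₂ := y + single m k₂ p (sg p • β)
    have sx : ∀ q < p, single (Ψ := Ψ) m k₁ p α q = 0 := fun q hq => single_of_ne hq.ne _
    have sy : ∀ q < p, single (Ψ := Ψ') m k₂ p (sg p • β) q = 0 :=
      fun q hq => single_of_ne hq.ne _
    have ex : ev p rfl (single (Ψ := Ψ) m k₁ p α) = α := single_same _
    have ey : ev p rfl (single (Ψ := Ψ') m k₂ p (sg p • β)) = sg p • β := single_same _
    refine ⟨fun q => (x' q, y' q), ?_, fun q hq => ?_⟩
    · intro q hq
      change ev q rfl (a - i.dD Ψ m h₁ x') = 0 ∧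
        ev q rfl (b - f.cohoch m k₁ x' - i.dD Ψ' m h₂ y') = 0
      have r₁ : a - i.dD Ψ m h₁ x' = w - i.dD Ψ m h₁ (single m k₁ p α) := by
        simp only [x', hw, map_add]; abel
      have r₂ : b - f.cohoch m k₁ x' - i.dD Ψ' m h₂ y' = v - f.cohoch m k₁ (single m k₁ p α) -
          i.dD Ψ' m h₂ (single m k₂ p (sg p • β)) := by
        simp only [x', y', hv, map_add]; abel
      rw [r₁, r₂]
      clear_value w v
      rw [map_sub, map_sub, map_sub, f.cohoch_ev]
      rcases Nat.lt_succ_iff_lt_or_eq.1 hq with hq | rfl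
      · have t₁ : ev q rfl w = 0 := (hz q hq).1
        have t₂ : ev q rfl v = 0 := (hz q hq).2
        have t₃ : ev q rfl (single (Ψ := Ψ) m k₁ p α) = 0 := sx q hq
        have t₄ : ev q rfl (single (Ψ := Ψ') m k₂ p (sg p • β)) = 0 := sy q hq
        rw [t₁, t₂, t₃, dD_of_vanish i h₁ (fun r hr => sx r (by omega)) rfl rfl (by omega),
          dD_of_vanish i h₂ (fun r hr => sy r (by omega)) rfl rfl (by omega), t₃, t₄]
        simp
      · rw [dD_of_vanish i h₁ sx rfl rfl (by omega), dD_of_vanish i h₂ sy rfl rfl (by omega),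
          ex, ey, hα, map_zsmul, smul_smul, smul_smul, sp, one_smul, one_smul, hβ]
        simp
    · have t₃ := sx q hq
      have t₄ := sy q hq
      exact Prod.ext ((congrArg (x q + ·) t₃).trans (add_zero _))
        ((congrArg (y q + ·) t₄).trans (add_zero _)))
  -- Both equations at place `p` involve only places up to `p`, where the limit agrees with stage `p
  -- + 1`.
  refine ⟨fun p => (z p).1, fun p => (z p).2, ?_, ?_⟩
  · apply ev_ext; intro p c hc
    obtain ⟨z', hz', hzz⟩ := hz (p + 1)
    rw [← dD_congr i h₁ (x := fun p => (z' p).1) (fun q hq => by rw [hzz q (by omega)]) hc]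
    subst hc
    exact (sub_eq_zero.1 (hz' p (by omega)).1).symm
  · apply ev_ext; intro p c hc
    obtain ⟨z', hz', hzz⟩ := hz (p + 1)
    have e₁ : ev p hc (f.cohoch m k₁ fun p => (z p).1) =
        ev p hc (f.cohoch m k₁ fun p => (z' p).1) := by
      subst hc
      exact congrArg (fun t => f.app _ _ t.1) (hzz p (by omega)).symm
    rw [map_add, ← dD_congr i h₂ (x := fun p => (z' p).2) (fun q hq => by rw [hzz q (by omega)]) hc,
      e₁]
    subst hc
    have := (hz' p (by omega)).2
    change ev p rfl (b - f.cohoch m k₁ (fun p => (z' p).1) - i.dD Ψ' m h₂ (fun p => (z' p).2)) = 0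
      at this
    rw [map_sub, map_sub, sub_sub, sub_eq_zero] at this
    exact this

/-- The coHochschild complex preserves quasi-isomorphisms. -/
theorem IsQuasi.D (i : AInfMul E) {f : LMap Ψ Ψ'} (hf : f.IsQuasi) : (f.D i).IsQuasi := fun m =>
  { comm := fun h x => f.cohoch_d i m h x
    cone := fun h₂ h₁ h₀ a b ha hb => cohoch_cone i hf m h₂ h₁ h₀ a b ha hb }

end LMap

/-! ### The inclusion of the reduced coHochschild complex is a quasi-isomorphism. -/

namespace AInfUnit

variable {E : DGProp.{u}} {i : AInfMul E} (η : AInfUnit i)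

open CohochGr

/-- The elements of the coHochschild complex annihilated by the insertions of the unit after `j`
entries, `1 ≤ j < k`. -/
def NormLT (Ψ : LMod E) {m : ℕ} {n : ℤ} (k : ℕ) (y : CohochGr Ψ m n) : Prop :=
  ∀ (p j : ℕ) (_ : 1 ≤ j) (_ : j < k) (hj : j ≤ p) (a : ℤ) (ha : p + n = a),
    Ψ.act (zero_add a) (η.insW m p j hj) (ev p ha y) = 0

variable {Ψ : LMod E} {m : ℕ} {n : ℤ}

theorem NormLT.act {k : ℕ} {y : CohochGr Ψ m n} (hy : η.NormLT Ψ k y) {N q : ℕ} {a b c : ℤ}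
    (ha : q + n = a) (h : c + a = b) {w : (E.Hom N (q + 1 + m)).X c} (hw : w ∈ η.degLTW m k N q c) :
    Ψ.act h w (ev q ha y) = 0 := by
  induction hw using AddSubgroup.closure_induction with
  | mem z hz =>
    obtain ⟨j, h₁, h₂, hj, z, rfl⟩ := hz
    rw [Ψ.comp_act (h₃ := zero_add _) (h₄ := h), hy q j h₁ h₂ hj a ha, map_zero]
  | zero => rw [map_zero]; rfl
  | add z w _ _ hz hw => rw [map_add, AddMonoidHom.add_apply, hz, hw, add_zero]
  | neg z _ hz => rw [map_neg, AddMonoidHom.neg_apply, hz, neg_zero]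

/-- This lemma and the next two identify terms whose degrees are the same integer written in
different ways. -/
theorem act_ev_congr {N q : ℕ} {a a' b c : ℤ} (ha : q + n = a) (ha' : q + n = a') (h : c + a = b)
    (h' : c + a' = b) (w : (E.Hom N (q + 1 + m)).X c) (y : CohochGr Ψ m n) :
    Ψ.act h w (ev q ha y) = Ψ.act h' w (ev q ha' y) := by
  subst ha ha'; rfl

theorem act_hochW_congr {N p q : ℕ} {a b c c' : ℤ} (h : c + 1 = p - q) (h' : c' + 1 = p - q)
    (hc : c + a = b) (hc' : c' + a = b) (w : (E.Hom N (p + 1 + m)).X 0)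
    (z : (Ψ.X (q + 1 + m)).X a) :
    Ψ.act hc (E.comp (zero_add c) w (i.hochW m p q h)) z =
      Ψ.act hc' (E.comp (zero_add c') w (i.hochW m p q h')) z := by
  obtain rfl : c = c' := by omega
  rfl

theorem act_hochCommW_congr {k p q : ℕ} {a a' b c c' : ℤ} (h : c + 1 = p - q) (h' : c' + 1 = p - q)
    (ha : (q + 1 : ℕ) + n = a) (ha' : (q + 1 : ℕ) + n = a') (hc : c + a = b) (hc' : c' + a' = b)
    (y : CohochGr Ψ m n) :
    Ψ.act hc (η.hochCommW m k p q h) (ev (q + 1) ha y) =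
      Ψ.act hc' (η.hochCommW m k p q h') (ev (q + 1) ha' y) := by
  obtain rfl : c = c' := by omega
  obtain rfl : a = a' := by omega
  rfl

/-- The insertion of the unit after `k` entries, as an operator on the coHochschild complex. -/
def coIns (Ψ : LMod E) (m k : ℕ) {n n' : ℤ} (h : n + 1 = n') : CohochGr Ψ m n →+ CohochGr Ψ m n' :=
  pair fun p a ha => sg p • (Ψ.act (zero_add a) (η.insZW m (p + 1) k)).comp
    (ev (p + 1) (by push_cast; omega))

theorem coIns_ev (k : ℕ) {n' : ℤ} (h : n + 1 = n') (y : CohochGr Ψ m n) (p : ℕ) {a : ℤ}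
    (ha : p + n' = a) (ha' : (p + 1 : ℕ) + n = a) :
    ev p ha (η.coIns Ψ m k h y) =
      sg p • Ψ.act (zero_add a) (η.insZW m (p + 1) k) (ev (p + 1) ha' y) := ev_pair _ p ha y

/-- There is no room for a unit in place `k` at these indices. This is what makes the corrections in
`exists_normS` stabilize. -/
theorem coIns_of_lt {k : ℕ} {n' : ℤ} (h : n + 1 = n') (y : CohochGr Ψ m n) {p : ℕ} (hp : p + 1 < k) :
    η.coIns Ψ m k h y p = 0 := by
  have := η.coIns_ev k h y p rfl (by push_cast; omega)
  rw [η.insZW_of_lt m hp, map_zero, AddMonoidHom.zero_apply, smul_zero] at this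
  exact this

/-- Serves to drop the term `h_k (d y)` of the homotopy formula when `d y` is normalized. -/
theorem coIns_of_normS {k : ℕ} (hk : 1 ≤ k) {n' : ℤ} (h : n + 1 = n') {y : CohochGr Ψ m n}
    (hy : y ∈ η.normS Ψ m n) : η.coIns Ψ m k h y = 0 := by
  apply ev_ext; intro p a ha
  rw [η.coIns_ev k h y p ha (by push_cast; omega), map_zero]
  by_cases hp : k ≤ p + 1
  · rw [η.insZW_of_le m hp, η.mem_normS Ψ hy hk hp, smul_zero]
  · rw [η.insZW_of_lt m (by omega), map_zero, AddMonoidHom.zero_apply, smul_zero]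

/-- The homotopy formula for the insertion of a unit. -/
theorem dD_coIns_add (k : ℕ) {n₀ n₁ : ℤ} (h₁ : n + 1 = n₁) (h₀ : n₀ + 1 = n) (y : CohochGr Ψ m n)
    (p : ℕ) {a : ℤ} (ha : p + n = a) :
    ev p ha (i.dD Ψ m h₁ (η.coIns Ψ m k h₁ y) + η.coIns Ψ m k h₀ (i.dD Ψ m h₀ y)) =
      Ψ.act (a := p) (b := (0 : ℕ) + n) (by push_cast; omega) (E.comp (zero_add _)
        (η.insZW m (p + 1) k) (i.hochW m (p + 1) 0 (by push_cast; omega))) (ev 0 rfl y) +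
      ∑ q ∈ Finset.range p, Ψ.act (a := p - q - 1) (b := (q + 1 : ℕ) + n) (by push_cast; omega)
        (η.hochCommW m k p q (by omega)) (ev (q + 1) rfl y) := by
  rw [map_add, i.dD_ev Ψ m h₁ _ p (a := a + 1) (by omega) ha rfl,
    η.coIns_ev k h₁ y p (a := a + 1) (by omega) (by push_cast; omega),
    η.coIns_ev k h₀ _ p ha (by push_cast; omega),
    i.dD_ev Ψ m h₀ y (p + 1) (a := a + 1) (by push_cast; omega) _ rfl]
  -- Units are cycles, so the internal differential commutes with their insertion. The two
  -- occurrences carry the signs `(-1)^p (-1)^p` and `(-1)^p (-1)^(p+1)` and cancel.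
  have e₁ := Ψ.d_act (a' := -1) (b' := a) (zero_add (a + 1)) (by omega) rfl rfl
    (by omega) (zero_add _) (η.insZW m (p + 1) k) (ev (p + 1) (by push_cast; omega) y)
  rw [η.d_insZW, map_zero, AddMonoidHom.zero_apply, zero_add, sg_zero, one_smul] at e₁
  have e₂ : ∀ q ∈ Finset.range p, Ψ.act (a := p - q - 1) (b := q + n₁) (c := a) (by omega)
      (i.hochW m p q (by omega)) (ev q rfl (η.coIns Ψ m k h₁ y)) =
      sg q • Ψ.act (a := p - q - 1) (b := (q + 1 : ℕ) + n) (by push_cast; omega)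
        (E.comp (add_zero _) (i.hochW m p q (by omega)) (η.insZW m (q + 1) k))
          (ev (q + 1) rfl y) := by
    intro q _
    rw [η.coIns_ev k h₁ y q rfl (by push_cast; omega), map_zsmul,
      ← Ψ.comp_act (h₁ := add_zero _) (h₂ := by omega)]
    rw [act_ev_congr]
  have e₃ : ∀ q ∈ Finset.range (p + 1), Ψ.act (zero_add a) (η.insZW m (p + 1) k)
      (Ψ.act (a := (p + 1 : ℕ) - q - 1) (b := q + n) (by push_cast; omega)
        (i.hochW m (p + 1) q (by omega)) (ev q rfl y)) =
      Ψ.act (a := (p + 1 : ℕ) - q - 1) (b := q + n) (by push_cast; omega) (E.comp (zero_add _)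
        (η.insZW m (p + 1) k) (i.hochW m (p + 1) q (by omega))) (ev q rfl y) := by
    intro q _
    rw [Ψ.comp_act]
  -- The value at index `0` is split off. The one at `q + 1` pairs with the term `q` of `e₂` and
  -- forms the commutator with it.
  rw [map_zsmul, map_zsmul, e₁, Finset.sum_congr rfl e₂, map_sub, map_sum, Finset.sum_congr rfl e₃,
    Finset.sum_range_succ', smul_sub, smul_smul, sg_mul_self, one_smul, smul_smul,
    show sg p * sg (p + 1 : ℕ) = -1 by
      rw [Nat.cast_succ, sg_add, sg_one]; linear_combination -sg_mul_self p,
    act_hochW_congr _ (by push_cast; omega) (c' := p) (q := 0) _ (by push_cast; omega)]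
  have e₄ : ∀ q ∈ Finset.range p, Ψ.act (a := p - q - 1) (b := (q + 1 : ℕ) + n) (c := a)
        (by push_cast; omega) (η.hochCommW m k p q (by omega)) (ev (q + 1) rfl y) =
      Ψ.act (a := (p + 1 : ℕ) - (q + 1 : ℕ) - 1) (b := (q + 1 : ℕ) + n) (by push_cast; omega)
        (E.comp (zero_add _) (η.insZW m (p + 1) k) (i.hochW m (p + 1) (q + 1) (by omega)))
        (ev (q + 1) rfl y) -
      sg p • sg q • Ψ.act (a := p - q - 1) (b := (q + 1 : ℕ) + n) (by push_cast; omega)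
        (E.comp (add_zero _) (i.hochW m p q (by omega)) (η.insZW m (q + 1) k))
          (ev (q + 1) rfl y) := by
    intro q _
    unfold hochCommW
    rw [map_add, map_zsmul, AddMonoidHom.add_apply, AddMonoidHom.coe_smul, Pi.smul_apply, sg_sub,
      sg_sub, sg_one, act_hochW_congr (c := (p + 1 : ℕ) - (q + 1 : ℕ) - 1) _ (by push_cast; omega)
        (c' := p - q - 1) _ (by push_cast; omega)]
    module
  rw [Finset.sum_congr rfl e₄, Finset.sum_sub_distrib, ← Finset.smul_sum]
  module

/-- Adding a boundary makes an element annihilated by one more insertion of the unit. -/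
theorem NormLT.succ {k : ℕ} (hk : 1 ≤ k) {n₀ n₁ : ℤ} (h₁ : n + 1 = n₁) (h₀ : n₀ + 1 = n)
    {y : CohochGr Ψ m n} (hy : η.NormLT Ψ k y) (hdy : i.dD Ψ m h₀ y ∈ η.normS Ψ m n₀) :
    η.NormLT Ψ (k + 1) (y + sg k • i.dD Ψ m h₁ (η.coIns Ψ m k h₁ y)) := by
  intro p j hj hjk hjp a ha
  -- Since `d y` is normalized, `coIns` kills it and the homotopy formula computes the added
  -- boundary.
  have e := η.dD_coIns_add k h₁ h₀ y p ha
  rw [η.coIns_of_normS hk h₀ hdy, add_zero] at e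
  rw [map_add, map_zsmul, e, map_add, map_zsmul, map_add, map_sum,
    ← Ψ.comp_act (h₁ := zero_add _) (h₂ := by push_cast; omega),
    hy.act η _ _ (η.insW_insZW_hochW_mem m _ hj (by omega) hjp), zero_add]
  have e' : ∀ q ∈ Finset.range p, (j < k ∨ j = k ∧ q + 1 < p) →
      Ψ.act (zero_add a) (η.insW m p j hjp)
        (Ψ.act (a := p - q - 1) (b := (q + 1 : ℕ) + n) (by push_cast; omega)
          (η.hochCommW m k p q (by omega)) (ev (q + 1) rfl y)) = 0 := by
    intro q _ hq
    rw [← Ψ.comp_act (h₁ := zero_add _) (h₂ := by push_cast; omega)]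
    exact hy.act η _ _ (η.insW_hochCommW_mem m _ hj hjp hq)
  rcases Nat.lt_succ_iff_lt_or_eq.1 hjk with hjk | rfl
  · rw [Finset.sum_eq_zero fun q hq => e' q hq (.inl hjk), smul_zero, add_zero,
      hy p j hj hjk hjp a ha]
  -- For `j = k` the only commutator not annihilated is the one lowering the index by one. It
  -- contributes `-(-1)^k` times the insertion of the unit, which cancels the contribution of `y`
  -- itself.
  · obtain ⟨p, rfl⟩ : ∃ p', p = p' + 1 := ⟨p - 1, by omega⟩
    have t := hy.act η ha (zero_add a) (η.insW_hochCommW_add_mem m (q := p) (by push_cast; omega)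
      hj hjp)
    rw [map_add, map_zsmul, AddMonoidHom.add_apply, AddMonoidHom.coe_smul, Pi.smul_apply,
      Ψ.comp_act (h₃ := zero_add _) (h₄ := zero_add _),
      act_hochCommW_congr η (c' := (p + 1 : ℕ) - p - 1) (a' := (p + 1 : ℕ) + n) _
        (by push_cast; omega) ha rfl _ (by push_cast; omega)] at t
    rw [Finset.sum_range_succ, Finset.sum_eq_zero (s := Finset.range p), zero_add,
      eq_neg_of_add_eq_zero_left t, smul_neg, smul_smul, sg_mul_self, one_smul, add_neg_cancel]
    intro q hq
    rw [Finset.mem_range] at hq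
    exact e' q (Finset.mem_range.2 (by omega)) (.inr ⟨rfl, by omega⟩)

/-- At index `p` units are inserted after at most `p` entries, so there it is enough to agree with
an element normalized up to that place. -/
theorem mem_normS_of_normLT {y : CohochGr Ψ m n}
    (hy : ∀ p, ∃ y', η.NormLT Ψ (p + 1) y' ∧ ev p (rfl : p + n = p + n) y = ev p rfl y') :
    y ∈ η.normS Ψ m n := by
  intro p j hj hjp
  obtain ⟨y', hy', e⟩ := hy p
  rw [e]
  exact hy' p j hj (by omega) hjp _ rfl

/-- Boundaries are subtracted so as to normalize one more place at each stage. Stage `k` uses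
`coIns` in place `k + 1`, which does not change the values at indices below `k`, and the sum of all
corrections makes sense in the product. -/
theorem exists_normS {n₂ n₁ n₀ : ℤ} (h₂ : n₁ + 1 = n₂) (h₁ : n₀ + 1 = n₁) (b : CohochGr Ψ m n₁)
    (hb : i.dD Ψ m h₁ b ∈ η.normS Ψ m n₀) :
    ∃ b' : CohochGr Ψ m n₂, b - i.dD Ψ m h₂ b' ∈ η.normS Ψ m n₁ := by
  have dd : ∀ x : CohochGr Ψ m n₂, i.dD Ψ m h₁ (i.dD Ψ m h₂ x) = 0 :=
    fun x => ((i.D Ψ).X m).d_d h₂ h₁ x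
  obtain ⟨b', hb'⟩ := exists_limit (X := fun p : ℕ => (Ψ.X (p + 1 + m)).X (p + n₂))
    (fun k (b' : CohochGr Ψ m n₂) => η.NormLT Ψ (k + 1) (b - i.dD Ψ m h₂ b')) (x₀ := fun _ => 0)
    -- At the start nothing is required, as no `j` satisfies `1 ≤ j < 1`.
    (fun p j hj hj' => by omega) (by
      intro k (b' : CohochGr Ψ m n₂) hb'
      have hs := NormLT.succ η (by omega) h₂ h₁ hb' (by rwa [map_sub, dd, sub_zero])
      refine ⟨(b' - sg (k + 1 : ℕ) • η.coIns Ψ m (k + 1) h₂ (b - i.dD Ψ m h₂ b') :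
        CohochGr Ψ m n₂), ?_, fun q hq => ?_⟩
      · rw [map_sub, map_zsmul]
        convert hs using 1
        abel
      · have t := η.coIns_of_lt (k := k + 1) h₂ (b - i.dD Ψ m h₂ b') (p := q) (by omega)
        exact (congrArg (fun z => b' q - sg (k + 1 : ℕ) • z) t).trans (by rw [smul_zero, sub_zero]))
  refine ⟨b', η.mem_normS_of_normLT fun p => ?_⟩
  obtain ⟨b'', hn, he⟩ := hb' (p + 1)
  refine ⟨b - i.dD Ψ m h₂ b'', fun q j hj hj' => hn q j hj (by omega), ?_⟩
  rw [map_sub, map_sub, LMap.dD_congr i h₂ (y := b') fun q hq => he q (by omega)]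

/-- The inclusion of the reduced coHochschild complex. -/
def incl (Ψ : LMod E) : LMap (η.D Ψ) (i.D Ψ) where
  app m n := (η.normS Ψ m n).subtype
  app_d _ _ := rfl
  app_act _ _ _ := rfl

theorem incl_isQuasi (Ψ : LMod E) : (η.incl Ψ).IsQuasi := fun m =>
  { comm := fun _ _ => rfl
    cone := fun {k₂ k₁ k k₀} h₂ h₁ h₀ a (b : CohochGr Ψ m k₁) ha hb => by
      have hb : i.dD Ψ m h₁ b = a.1 := hb
      -- The boundary of `b` is reduced, so subtracting a boundary from `b` makes it reduced without
      -- changing `d b`.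
      obtain ⟨b', hb'⟩ := η.exists_normS h₂ h₁ b (by rw [hb]; exact a.2)
      refine ⟨⟨b - i.dD Ψ m h₂ b', hb'⟩, b', Subtype.ext ?_, (sub_add_cancel _ _).symm⟩
      refine Eq.trans ?_ hb
      refine ((i.dD Ψ m h₁).map_sub _ _).trans ?_
      rw [show i.dD Ψ m h₁ (i.dD Ψ m h₂ b') = 0 from ((i.D Ψ).X m).d_d h₂ h₁ b', sub_zero] }

/-- The comparison of the iterated reduced and unreduced coHochschild complexes. -/
def iterIncl (Ψ : LMod E) : ∀ n, LMap (LMod.iter η.D n Ψ) (LMod.iter i.D n Ψ)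
  | 0 => LMap.id Ψ
  -- Only the unreduced `D` is applied to the previous comparison, so it is not needed that the
  -- reduced one preserves quasi-isomorphisms.
  | n + 1 => ((iterIncl Ψ n).D i).comp (η.incl _)

theorem iterIncl_isQuasi (Ψ : LMod E) : ∀ n, (η.iterIncl Ψ n).IsQuasi
  | 0 => fun _ => Cplx.IsQuasi.id _
  | n + 1 => ((iterIncl_isQuasi Ψ n).D i).comp (η.incl_isQuasi _)

end AInfUnit

namespace LMap

variable {E : DGProp.{u}} {Ψ Ψ' : LMod E}

/-- The functoriality of the iterated coHochschild complex. -/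
def iterD (i : AInfMul E) (f : LMap Ψ Ψ') : ∀ n, LMap (LMod.iter i.D n Ψ) (LMod.iter i.D n Ψ')
  | 0 => f
  | n + 1 => (iterD i f n).D i

theorem IsQuasi.iterD (i : AInfMul E) {f : LMap Ψ Ψ'} (hf : f.IsQuasi) :
    ∀ n, (f.iterD i n).IsQuasi
  | 0 => hf
  | n + 1 => (IsQuasi.iterD i hf n).D i

end LMap

open HochGr

/-! ### The Hochschild complex preserves quasi-isomorphisms. -/

namespace RHom

variable {E : DGProp.{u}} {Φ Φ' Φ'' : RMod E}

/-- A morphism of degree `0` is a quasi-isomorphism at every object. -/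
def IsQuasi (θ : RHom Φ Φ' 0) : Prop :=
  ∀ m, Cplx.IsQuasi (A := Φ.X m) (B := Φ'.X m) fun k => θ.ap (add_zero k)

theorem IsQuasi.comp {θ' : RHom Φ' Φ'' 0} {θ : RHom Φ Φ' 0} (h' : θ'.IsQuasi) (h : θ.IsQuasi) :
    (RHom.comp (zero_add 0) θ' θ).IsQuasi := by
  intro m
  convert (h' m).comp (h m) using 2 with k
  ext x
  exact comp_ap _ _ _ _ _ _ _

theorem id_isQuasi (Φ : RMod E) : (RHom.id Φ).IsQuasi := by
  intro m
  convert Cplx.IsQuasi.id (Φ.X m) using 2 with k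
  ext x
  exact id_ap _ x

end RHom

namespace HochGr

variable {E : DGProp.{u}} (Φ : RMod E) (m : ℕ) (n : ℤ)

/-- The elements `Σ x_p ⊗ l_{p+1}` with `p < N`. -/
def filt (N : ℕ) : AddSubgroup (HochGr Φ m n) :=
  AddSubgroup.closure {z | ∃ (p : ℕ) (_ : p < N) (a : ℤ) (h : a + p = n) (x : (Φ.X (p + 1 + m)).X a),
    z = l p h x}

/-- The coefficient of `l_{p+1}`. -/
def coeff (p : ℕ) : HochGr Φ m n →+ (Φ.X (p + 1 + m)).X (n - p) :=
  DFinsupp.evalAddMonoidHom (β := fun p : ℕ => (Φ.X (p + 1 + m)).X (n - p)) p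

variable {Φ m n}

theorem coeff_l (p : ℕ) (h : n - p + p = n) (x : (Φ.X (p + 1 + m)).X (n - p)) :
    coeff Φ m n p (l p h x) = x :=
  DirectSum.of_eq_same (β := fun p : ℕ => (Φ.X (p + 1 + m)).X (n - p)) p x

theorem coeff_l_of_ne {p q : ℕ} (hqp : q ≠ p) {a : ℤ} (h : a + q = n)
    (x : (Φ.X (q + 1 + m)).X a) : coeff Φ m n p (l q h x) = 0 :=
  DirectSum.of_eq_of_ne (β := fun p : ℕ => (Φ.X (p + 1 + m)).X (n - p)) q p _ hqp.symm

theorem l_mem_filt {N p : ℕ} (hp : p < N) {a : ℤ} (h : a + p = n) (x : (Φ.X (p + 1 + m)).X a) :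
    l p h x ∈ filt Φ m n N :=
  AddSubgroup.subset_closure ⟨p, hp, a, h, x, rfl⟩

theorem filt_hom {B : Type v} [AddCommGroup B] (f : HochGr Φ m n →+ B) (T : AddSubgroup B) {N : ℕ}
    (H : ∀ (p : ℕ) (_ : p < N) (a : ℤ) (h : a + p = n) (x : (Φ.X (p + 1 + m)).X a), f (l p h x) ∈ T)
    {z} (hz : z ∈ filt Φ m n N) : f z ∈ T := by
  have : filt Φ m n N ≤ T.comap f := by
    unfold filt
    rw [AddSubgroup.closure_le]
    rintro _ ⟨p, hp, a, h, x, rfl⟩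
    exact H p hp a h x
  exact this hz

theorem filt_mono {N M : ℕ} (h : N ≤ M) : filt Φ m n N ≤ filt Φ m n M := fun _ hz =>
  filt_hom (AddMonoidHom.id _) _ (fun _ hp _ h' x => l_mem_filt (by omega) h' x) hz

theorem exists_filt (z : HochGr Φ m n) : ∃ N, z ∈ filt Φ m n N := by
  induction z using DirectSum.induction_on with
  | zero => exact ⟨0, zero_mem _⟩
  | of p x => exact ⟨p + 1, l_mem_filt (Nat.lt_succ_self p) (by omega : n - p + p = n) x⟩
  | add z w hz hw =>
    obtain ⟨N, hz⟩ := hz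
    obtain ⟨M, hw⟩ := hw
    exact ⟨max N M, add_mem (filt_mono (le_max_left _ _) hz) (filt_mono (le_max_right _ _) hw)⟩

theorem coeff_filt {N : ℕ} {z : HochGr Φ m n} (hz : z ∈ filt Φ m n N) : coeff Φ m n N z = 0 := by
  have := filt_hom (coeff Φ m n N) ⊥ (fun p hp a h x => ?_) hz
  · exact this
  · exact coeff_l_of_ne hp.ne h x

theorem filt_succ {N : ℕ} {z : HochGr Φ m n} (hz : z ∈ filt Φ m n (N + 1)) :
    ∃ (x : (Φ.X (N + 1 + m)).X (n - N)) (z' : HochGr Φ m n), z' ∈ filt Φ m n N ∧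
      z = l N (by omega) x + z' := by
  induction hz using AddSubgroup.closure_induction with
  | mem z hz =>
    obtain ⟨p, hp, a, h, x, rfl⟩ := hz
    rcases Nat.lt_succ_iff_lt_or_eq.1 hp with hp | rfl
    · exact ⟨0, _, l_mem_filt hp h x, by rw [map_zero, zero_add]⟩
    · obtain rfl : a = n - p := by omega
      exact ⟨x, 0, zero_mem _, (add_zero _).symm⟩
  | zero => exact ⟨0, 0, zero_mem _, by rw [map_zero, zero_add]⟩
  | add z w _ _ hz hw =>
    obtain ⟨x, z', hz', rfl⟩ := hz
    obtain ⟨y, w', hw', rfl⟩ := hw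
    exact ⟨x + y, z' + w', add_mem hz' hw', by rw [map_add]; abel⟩
  | neg z _ hz =>
    obtain ⟨x, z', hz', rfl⟩ := hz
    exact ⟨-x, -z', neg_mem hz', by rw [map_neg]; abel⟩

theorem cD_mem_filt (i : AInfMul E) {n' : ℤ} (h : n' + 1 = n) {N : ℕ} {z : HochGr Φ m n}
    (hz : z ∈ filt Φ m n N) : i.cD Φ m h z ∈ filt Φ m n' N := by
  refine filt_hom (i.cD Φ m h) _ (fun p hp a ha x => ?_) hz
  rw [i.cD_l Φ m h p (a' := a - 1) ha (by omega) (by omega)]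
  exact add_mem (l_mem_filt hp _ _) (zsmul_mem (sum_mem fun q hq =>
    l_mem_filt ((Finset.mem_range.1 hq).trans hp) _ _) _)

/-- The Hochschild differential is triangular for the filtration by `p`, with the internal
differential, without sign, on the diagonal. -/
theorem cD_l_filt (i : AInfMul E) {n' : ℤ} (h : n' + 1 = n) (p : ℕ) {a a' : ℤ} (ha : a + p = n)
    (ha' : a' + 1 = a) (ha₂ : a' + p = n') (x : (Φ.X (p + 1 + m)).X a) :
    ∃ w ∈ filt Φ m n' p, i.cD Φ m h (l p ha x) = l p ha₂ ((Φ.X _).d ha' x) + w :=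
  ⟨_, zsmul_mem (sum_mem fun _ hq => l_mem_filt (Finset.mem_range.1 hq) _ _) _,
    i.cD_l Φ m h p ha ha' ha₂ x⟩

theorem cMapGr_mem_filt {Φ' : RMod E} (θ : RHom Φ Φ' 0) {n' : ℤ} (h : n + 0 = n') {N : ℕ}
    {z : HochGr Φ m n} (hz : z ∈ filt Φ m n N) : AInfMul.cMapGr θ m h z ∈ filt Φ' m n' N := by
  refine filt_hom (AInfMul.cMapGr θ m h) _ (fun p hp a ha x => ?_) hz
  rw [AInfMul.cMapGr_l θ m h p ha (add_zero a) (by omega)]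
  exact l_mem_filt hp _ _

/-- A morphism of degree `0` in `Fun(E, Ch)` need not commute with differentials; this comes from
the `comm` part of `hθ`. -/
theorem cMapGr_d (i : AInfMul E) {Φ' : RMod E} {θ : RHom Φ Φ' 0} (hθ : θ.IsQuasi) {n' : ℤ}
    (h : n' + 1 = n) (z : HochGr Φ m n) :
    AInfMul.cMapGr θ m (add_zero n') (i.cD Φ m h z) =
      i.cD Φ' m h (AInfMul.cMapGr θ m (add_zero n) z) := by
  refine hom_ext_apply ((AInfMul.cMapGr θ m (add_zero n')).comp (i.cD Φ m h))
    ((i.cD Φ' m h).comp (AInfMul.cMapGr θ m (add_zero n))) (fun p a ha x => ?_) z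
  rw [AddMonoidHom.comp_apply, AddMonoidHom.comp_apply,
    i.cD_l Φ m h p (a' := a - 1) ha (by omega) (by omega),
    AInfMul.cMapGr_l θ m _ p ha (add_zero a) ha, i.cD_l Φ' m h p (a' := a - 1) ha (by omega)
    (by omega), map_add, map_zsmul, map_sum, AInfMul.cMapGr_l θ m _ p _ (add_zero _) (by omega),
    (hθ _).comm]
  congr 2
  refine Finset.sum_congr rfl fun q _ => ?_
  rw [AInfMul.cMapGr_l θ m _ q _ (add_zero _) (by omega), θ.nat _ _ (add_zero _) rfl]

/-- Every element of the direct sum has a top coefficient. The cone equations are solved for it at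
the object `N + 1 + m`, and what remains lies in a smaller filtration step, so a finite induction
suffices. -/
theorem cMapGr_cone (i : AInfMul E) {Φ' : RMod E} {θ : RHom Φ Φ' 0} (hθ : θ.IsQuasi)
    {k₂ k₁ k k₀ : ℤ} (h₂ : k₁ + 1 = k₂) (h₁ : k + 1 = k₁) (h₀ : k₀ + 1 = k) (N : ℕ) :
    ∀ (a : HochGr Φ m k) (b : HochGr Φ' m k₁), a ∈ filt Φ m k N → b ∈ filt Φ' m k₁ N →
    i.cD Φ m h₀ a = 0 → i.cD Φ' m h₁ b = AInfMul.cMapGr θ m (add_zero k) a →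
    ∃ (a' : HochGr Φ m k₁) (b' : HochGr Φ' m k₂), i.cD Φ m h₁ a' = a ∧
      b = AInfMul.cMapGr θ m (add_zero k₁) a' + i.cD Φ' m h₂ b' := by
  have dd : ∀ x : HochGr Φ m k₁, i.cD Φ m h₀ (i.cD Φ m h₁ x) = 0 :=
    fun x => ((i.cObj Φ).X m).d_d h₁ h₀ x
  have dd' : ∀ x : HochGr Φ' m k₂, i.cD Φ' m h₁ (i.cD Φ' m h₂ x) = 0 :=
    fun x => ((i.cObj Φ').X m).d_d h₂ h₁ x
  induction N with
  | zero =>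
    have hz : ∀ {Φ : RMod E} {k : ℤ} {z : HochGr Φ m k}, z ∈ filt Φ m k 0 → z = 0 := fun hz =>
      filt_hom (AddMonoidHom.id _) ⊥ (fun p hp => absurd hp p.not_lt_zero) hz
    intro a b ha hb _ _
    exact ⟨0, 0, by rw [map_zero, hz ha], by rw [map_zero, map_zero, add_zero, hz hb]⟩
  | succ N ih =>
    intro a b ha hb hda hdb
    obtain ⟨x, a₀, ha₀, rfl⟩ := filt_succ ha
    obtain ⟨y, b₀, hb₀, rfl⟩ := filt_succ hb
    -- Comparing top coefficients leaves only the internal differentials, so `x` and `y` satisfy the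
    -- cone equations of `θ`.
    have ex : (Φ.X (N + 1 + m)).d (by omega : k₀ - N + 1 = k - N) x = 0 := by
      obtain ⟨w, hw, e⟩ := cD_l_filt i h₀ N (by omega) (by omega) (by omega : k₀ - N + N = k₀) x
      rw [map_add, e] at hda
      have := congrArg (coeff Φ m k₀ N) hda
      rwa [map_add, map_add, coeff_l, coeff_filt hw, coeff_filt (cD_mem_filt i h₀ ha₀), map_zero,
        add_zero, add_zero] at this
    have ey : (Φ'.X (N + 1 + m)).d (by omega : k - N + 1 = k₁ - N) y = θ.ap (add_zero _) x := by
      obtain ⟨w, hw, e⟩ := cD_l_filt i h₁ N (by omega) (by omega) (by omega : k - N + N = k) y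
      rw [map_add, e, map_add, AInfMul.cMapGr_l θ m _ N _ (add_zero _) (by omega)] at hdb
      have := congrArg (coeff Φ' m k N) hdb
      rwa [map_add, map_add, map_add, coeff_l, coeff_l, coeff_filt hw,
        coeff_filt (cD_mem_filt i h₁ hb₀), coeff_filt (cMapGr_mem_filt θ _ ha₀), add_zero, add_zero,
        add_zero] at this
    obtain ⟨x', y', hx', hy'⟩ := (hθ (N + 1 + m)).cone (k₂ := k₂ - N) (by omega) (by omega) (by omega)
      x y ex ey
    obtain ⟨w, hw, ew⟩ := cD_l_filt i h₁ N (by omega) (by omega) (by omega : k - N + N = k) x'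
    obtain ⟨v, hv, ev⟩ := cD_l_filt i h₂ N (by omega) (by omega) (by omega : k₁ - N + N = k₁) y'
    -- Subtracting the boundary, in the cone, of `x' ⊗ l` and `y' ⊗ l` cancels the top coefficients.
    obtain ⟨a', b', ea, eb⟩ := ih (l N (by omega) x + a₀ - i.cD Φ m h₁ (l N (by omega) x'))
      (l N (by omega) y + b₀ - AInfMul.cMapGr θ m (add_zero k₁) (l N (by omega) x') -
        i.cD Φ' m h₂ (l N (by omega) y'))
      (by rw [ew, hx', add_sub_add_left_eq_sub]; exact sub_mem ha₀ hw)
      (by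
        rw [ev, AInfMul.cMapGr_l θ m _ N _ (add_zero _) (by omega), hy', map_add]
        convert sub_mem hb₀ hv using 1
        abel)
      (by rw [map_sub, hda, dd, sub_zero])
      (by rw [map_sub, map_sub, map_sub, hdb, dd', sub_zero, cMapGr_d i hθ])
    refine ⟨a' + l N (by omega) x', b' + l N (by omega) y', ?_, ?_⟩
    · rw [map_add, ea, sub_add_cancel]
    · rw [map_add, map_add]
      rw [sub_eq_iff_eq_add, sub_eq_iff_eq_add] at eb
      rw [eb]
      abel

end HochGr

/-- The Hochschild complex preserves quasi-isomorphisms. -/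
theorem RHom.IsQuasi.hoch {E : DGProp.{u}} (i : AInfMul E) {Φ Φ' : RMod E} {θ : RHom Φ Φ' 0}
    (hθ : θ.IsQuasi) : (i.C.map θ).IsQuasi := fun m =>
  { comm := fun h x => by
      refine (i.cMap_ap θ _ _).trans (Eq.trans ?_ (congrArg _ (i.cMap_ap θ _ _).symm))
      exact cMapGr_d i hθ h x
    cone := fun {k₂ k₁ k k₀} h₂ h₁ h₀ a b ha hb => by
      obtain ⟨N, hN⟩ := exists_filt (Φ := Φ) (m := m) (n := k) a
      obtain ⟨M, hM⟩ := exists_filt (Φ := Φ') (m := m) (n := k₁) b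
      obtain ⟨a', b', ea, eb⟩ := cMapGr_cone i hθ h₂ h₁ h₀ (max N M) a b
        (filt_mono (le_max_left _ _) hN) (filt_mono (le_max_right _ _) hM) ha
        (hb.trans (i.cMap_ap θ _ _))
      exact ⟨a', b', ea, eb.trans (congrArg (· + i.cD Φ' m h₂ b') (i.cMap_ap θ _ _).symm)⟩ }

/-! ### The projection to the reduced Hochschild complex is a quasi-isomorphism. -/

/-- The projection to a quotient. -/
def RMod.proj {E : DGProp.{u}} (Φ : RMod E) (S : Φ.Sub) : RHom Φ (Φ.quot S) 0 :=
  RHom.mk' (fun n k k' h => (QuotientAddGroup.mk' (S.S n k')).comp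
    ((Φ.X n).castHom ((add_zero k).symm.trans h))) (by
    intro n m i j k a b h₁ h₂ h₃ h₄ x g
    obtain rfl : j = i := by omega
    obtain rfl : k = b := by omega
    rfl)

theorem RMod.proj_ap {E : DGProp.{u}} (Φ : RMod E) (S : Φ.Sub) {n : ℕ} {k : ℤ} (h : k + 0 = k)
    (x : (Φ.X n).X k) : (Φ.proj S).ap h x = QuotientAddGroup.mk x := RHom.ap_mk' _ _ h x

/-- The projection to the quotient by an acyclic subfunctor is a quasi-isomorphism. -/
theorem RMod.proj_isQuasi {E : DGProp.{u}} (Φ : RMod E) (S : Φ.Sub)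
    (hS : ∀ (n : ℕ) {k₁ k k₀ : ℤ} (h₁ : k + 1 = k₁) (h₀ : k₀ + 1 = k) (x : (Φ.X n).X k), x ∈ S.S n k →
      (Φ.X n).d h₀ x = 0 → ∃ y ∈ S.S n k₁, (Φ.X n).d h₁ y = x) : (Φ.proj S).IsQuasi := fun n =>
  { comm := fun h x => by
      refine (Φ.proj_ap S _ _).trans (Eq.trans ?_ (congrArg _ (Φ.proj_ap S _ _).symm))
      rfl
    cone := fun {k₂ k₁ k k₀} h₂ h₁ h₀ a b ha hb => by
      revert hb
      induction b using QuotientAddGroup.induction_on with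
      | H b =>
      intro hb
      have hb : (QuotientAddGroup.mk ((Φ.X n).d h₁ b) : (Φ.X n).X k ⧸ S.S n k) =
        QuotientAddGroup.mk a := hb.trans (Φ.proj_ap S _ _)
      rw [QuotientAddGroup.eq] at hb
      -- The boundary of the lifted `b` equals `a` up to an element of `S`. That element is a cycle,
      -- hence the boundary of an element of `S`, by which the lift may be corrected.
      obtain ⟨y, hy, e⟩ := hS n h₁ h₀ _ hb (by
        rw [map_add, map_neg, (Φ.X n).d_d, ha, neg_zero, add_zero])
      refine ⟨b + y, 0, ?_, ?_⟩
      · rw [map_add, e, add_neg_cancel_left]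
      · rw [map_zero, add_zero]
        refine Eq.trans ?_ (Φ.proj_ap S _ _).symm
        exact (QuotientAddGroup.mk_add_of_mem b hy).symm }

open HochGr

namespace AInfUnit

variable {E : DGProp.{u}} {i : AInfMul E} (η : AInfUnit i)

/-- The span of the elements of the Hochschild complex with a unit inserted after `j` entries,
`1 ≤ j < k`. -/
def degLTC (Φ : RMod E) (m : ℕ) (n : ℤ) (k : ℕ) : AddSubgroup (HochGr Φ m n) :=
  AddSubgroup.closure {z | ∃ (p j : ℕ) (_ : 1 ≤ j) (_ : j < k) (hj : j ≤ p) (a : ℤ) (h : a + p = n)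
    (x : (Φ.X (p + m)).X a), z = l p h (Φ.act (add_zero a) x (η.insW m p j hj))}

variable {Φ : RMod E} {m : ℕ} {n : ℤ}

theorem l_insW_mem_degLTC {k p j : ℕ} (hj : 1 ≤ j) (hjk : j < k) (hj' : j ≤ p) {a : ℤ} (h : a + p = n)
    (x : (Φ.X (p + m)).X a) :
    l p h (Φ.act (add_zero a) x (η.insW m p j hj')) ∈ η.degLTC Φ m n k :=
  AddSubgroup.subset_closure ⟨p, j, hj, hjk, hj', a, h, x, rfl⟩

theorem l_act_mem_degLTC {k N q : ℕ} {a b c : ℤ} (h : a + c = b) (hb : b + q = n)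
    (x : (Φ.X N).X a) {w : (E.Hom N (q + 1 + m)).X c} (hw : w ∈ η.degLTW m k N q c) :
    l q hb (Φ.act h x w) ∈ η.degLTC Φ m n k := by
  induction hw using AddSubgroup.closure_induction with
  | mem z hz =>
    obtain ⟨j, h₁, h₂, hj, z, rfl⟩ := hz
    rw [← Φ.act_comp (h₁ := h) (h₂ := add_zero _)]
    exact η.l_insW_mem_degLTC h₁ h₂ hj hb _
  | zero => rw [map_zero, map_zero]; exact zero_mem _
  | add z w _ _ hz hw => rw [map_add, map_add]; exact add_mem hz hw
  | neg z _ hz => rw [map_neg, map_neg]; exact neg_mem hz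

theorem degLTC_hom {B : Type v} [AddCommGroup B] {k : ℕ} (f : HochGr Φ m n →+ B)
    (T : AddSubgroup B) (H : ∀ (p j : ℕ) (_ : 1 ≤ j) (_ : j < k) (hj : j ≤ p) (a : ℤ)
      (h : a + p = n) (x : (Φ.X (p + m)).X a),
      f (l p h (Φ.act (add_zero a) x (η.insW m p j hj))) ∈ T) {z} (hz : z ∈ η.degLTC Φ m n k) :
    f z ∈ T := by
  have : η.degLTC Φ m n k ≤ T.comap f := by
    unfold degLTC
    rw [AddSubgroup.closure_le]
    rintro _ ⟨p, j, hj, hjk, hj', a, h, x, rfl⟩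
    exact H p j hj hjk hj' a h x
  exact this hz

theorem degLTC_mono {k k' : ℕ} (h : k ≤ k') : η.degLTC Φ m n k ≤ η.degLTC Φ m n k' := fun _ hz =>
  η.degLTC_hom (AddMonoidHom.id _) _ (fun _ _ hj hjk hj' _ h' x =>
    η.l_insW_mem_degLTC hj (hjk.trans_le h) hj' h' x) hz

/-- An element is a combination of finitely many generators, so the filtration by the place of the
unit is exhaustive and the induction in `degLTC_acyclic` applies. -/
theorem exists_degLTC {z : HochGr Φ m n} (hz : z ∈ η.degS Φ m n) :
    ∃ k, z ∈ η.degLTC Φ m n (k + 1) := by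
  induction hz using AddSubgroup.closure_induction with
  | mem z hz =>
    obtain ⟨p, j, hj, hj', a, h, x, rfl⟩ := hz
    exact ⟨j, η.l_insW_mem_degLTC hj j.lt_succ_self hj' h x⟩
  | zero => exact ⟨0, zero_mem _⟩
  | add z w _ _ hz hw =>
    obtain ⟨k, hz⟩ := hz
    obtain ⟨k', hw⟩ := hw
    exact ⟨max k k', add_mem (η.degLTC_mono (by omega) hz) (η.degLTC_mono (by omega) hw)⟩
  | neg z _ hz =>
    obtain ⟨k, hz⟩ := hz
    exact ⟨k, neg_mem hz⟩

/-- The insertion of the unit after `k` entries, as an operator on the Hochschild complex. -/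
def hochIns (Φ : RMod E) (m k : ℕ) {n n' : ℤ} (h : n + 1 = n') : HochGr Φ m n →+ HochGr Φ m n' :=
  lift fun p a ha => sg a • (l (p + 1) (by push_cast; omega)).comp
    ((Φ.act (add_zero a)).flip (η.insZW m (p + 1) k))

theorem hochIns_l (k : ℕ) {n' : ℤ} (h : n + 1 = n') (p : ℕ) {a : ℤ} (ha : a + p = n)
    (ha' : a + (p + 1 : ℕ) = n') (x : (Φ.X (p + 1 + m)).X a) :
    η.hochIns Φ m k h (l p ha x) =
      sg a • l (p + 1) ha' (Φ.act (add_zero a) x (η.insZW m (p + 1) k)) := lift_l _ p ha x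

/-- Ensures that the bounding elements found in `degLTC_acyclic` are degenerate. -/
theorem hochIns_mem_degS {k : ℕ} (hk : 1 ≤ k) {n' : ℤ} (h : n + 1 = n') (z : HochGr Φ m n) :
    η.hochIns Φ m k h z ∈ η.degS Φ m n' := by
  obtain ⟨N, hN⟩ := exists_filt z
  refine filt_hom (η.hochIns Φ m k h) _ (fun p _ a ha x => ?_) hN
  rw [η.hochIns_l k h p ha (by push_cast; omega)]
  refine zsmul_mem ?_ _
  by_cases hp : k ≤ p + 1
  · rw [η.insZW_of_le m hp]; exact η.mem_degS Φ _ hk hp x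
  · rw [η.insZW_of_lt m (by omega), map_zero, map_zero]; exact zero_mem _

/-- Changes the degree of a morphism along a propositional equality; `F` records how the morphism
depends on its degree. -/
theorem l_act_congr {N q : ℕ} {a b b' c c' : ℤ} (hc : c = c') (h : a + c = b) (hcb : a + c' = b')
    (hb : b + q = n) (hb' : b' + q = n) (x : (Φ.X N).X a)
    (F : ∀ c₀, c₀ = c → (E.Hom N (q + 1 + m)).X c₀) :
    l q hb (Φ.act h x (F c rfl)) = l q hb' (Φ.act hcb x (F c' hc.symm)) := by
  subst hc h hcb; rfl

/-- The homotopy formula for the insertion of a unit. -/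
theorem cD_hochIns_add (k : ℕ) {n₀ n₁ : ℤ} (h₁ : n + 1 = n₁) (h₀ : n₀ + 1 = n) (p : ℕ) {a : ℤ}
    (ha : a + p = n) (x : (Φ.X (p + 1 + m)).X a) :
    i.cD Φ m h₁ (η.hochIns Φ m k h₁ (l p ha x)) + η.hochIns Φ m k h₀ (i.cD Φ m h₀ (l p ha x)) =
      l 0 (a := a + p) (by push_cast; omega) (Φ.act rfl x (E.comp (zero_add _)
        (η.insZW m (p + 1) k) (i.hochW m (p + 1) 0 (by push_cast; omega)))) +
      ∑ q ∈ Finset.range p, l (q + 1) (a := a + (p - q - 1)) (by push_cast; omega)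
        (Φ.act rfl x (η.hochCommW m k p q (by omega))) := by
  rw [η.hochIns_l k h₁ p ha (by push_cast; omega), map_zsmul,
    i.cD_l Φ m h₁ (p + 1) (a' := a - 1) _ (by omega) (by push_cast; omega),
    i.cD_l Φ m h₀ p (a' := a - 1) ha (by omega) (by omega), map_add, map_zsmul, map_sum,
    η.hochIns_l k h₀ p _ (by push_cast; omega)]
  -- The unit is a cycle, and the sign `(-1)^|x|` in `hochIns` makes the two internal differentials
  -- cancel.
  have e₁ := Φ.d_act (a' := a - 1) (b' := -1) (add_zero a) (by omega) (by omega) (by omega)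
    (add_zero _) (by omega) x (η.insZW m (p + 1) k)
  rw [η.d_insZW, map_zero, smul_zero, add_zero] at e₁
  have e₂ : ∀ q ∈ Finset.range p, η.hochIns Φ m k h₀ (l q (a := a + (p - q - 1)) (by omega)
        (Φ.act rfl x (i.hochW m p q (by omega)))) =
      (sg a * sg (p - q - 1)) • l (q + 1) (a := a + (p - q - 1)) (by push_cast; omega)
        (Φ.act rfl x (E.comp (add_zero _) (i.hochW m p q (by omega)) (η.insZW m (q + 1) k))) := by
    intro q _
    rw [η.hochIns_l k h₀ q _ (by push_cast; omega), sg_add,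
      Φ.act_comp (h₃ := add_zero _) (h₄ := rfl)]
  have e₃ : ∀ q ∈ Finset.range p, l (q + 1) (a := a + ((p + 1 : ℕ) - (q + 1 : ℕ) - 1)) (n := n)
        (by push_cast; omega) (Φ.act rfl (Φ.act (add_zero a) x (η.insZW m (p + 1) k))
          (i.hochW m (p + 1) (q + 1) (by omega))) =
      l (q + 1) (a := a + (p - q - 1)) (by push_cast; omega)
        (Φ.act rfl x (E.comp (zero_add _) (η.insZW m (p + 1) k)
          (i.hochW m (p + 1) (q + 1) (by push_cast; omega)))) := by
    intro q _
    rw [Φ.act_comp (h₃ := zero_add _) (h₄ := rfl)]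
    exact l_act_congr (by push_cast; ring) _ _ _ _ x fun c₀ hc => E.comp (zero_add _)
      (η.insZW m (p + 1) k) (i.hochW m (p + 1) (q + 1) (by push_cast at hc ⊢; omega))
  have e₄ : l 0 (a := a + ((p + 1 : ℕ) - (0 : ℕ) - 1)) (n := n) (by push_cast; omega)
        (Φ.act rfl (Φ.act (add_zero a) x (η.insZW m (p + 1) k))
          (i.hochW m (p + 1) 0 (by omega))) =
      l 0 (a := a + p) (by push_cast; omega) (Φ.act rfl x (E.comp (zero_add _)
        (η.insZW m (p + 1) k) (i.hochW m (p + 1) 0 (by push_cast; omega)))) := by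
    rw [Φ.act_comp (h₃ := zero_add _) (h₄ := rfl)]
    exact l_act_congr (by push_cast; ring) _ _ _ _ x fun c₀ hc => E.comp (zero_add _)
      (η.insZW m (p + 1) k) (i.hochW m (p + 1) 0 (by push_cast at hc ⊢; omega))
  rw [e₁, Finset.sum_congr rfl e₂, Finset.sum_range_succ', Finset.sum_congr rfl e₃, e₄]
  have e₅ : ∀ q ∈ Finset.range p, l (q + 1) (a := a + (p - q - 1)) (n := n) (by push_cast; omega)
        (Φ.act rfl x (η.hochCommW m k p q (by omega))) =
      l (q + 1) (a := a + (p - q - 1)) (by push_cast; omega)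
        (Φ.act rfl x (E.comp (zero_add _) (η.insZW m (p + 1) k)
          (i.hochW m (p + 1) (q + 1) (by push_cast; omega)))) +
      sg a • (sg a * sg (p - q - 1)) • l (q + 1) (a := a + (p - q - 1)) (by push_cast; omega)
        (Φ.act rfl x (E.comp (add_zero _) (i.hochW m p q (by omega)) (η.insZW m (q + 1) k))) := by
    intro q _
    unfold hochCommW
    rw [map_add, map_add, map_zsmul, map_zsmul, smul_smul, ← mul_assoc, sg_mul_self, one_mul]
  rw [Finset.sum_congr rfl e₅, Finset.sum_add_distrib, ← Finset.smul_sum, sg_sub, sg_one]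
  have := sg_mul_self a
  rw [smul_add, smul_smul, this, one_smul]
  module

/-- Up to a homotopy, an element with a unit inserted after `k` entries is a sum of elements with
a unit in an earlier place. -/
theorem homotopy_mem {k : ℕ} {n₀ n₁ : ℤ} (h₁ : n + 1 = n₁) (h₀ : n₀ + 1 = n) {z : HochGr Φ m n}
    (hz : z ∈ η.degLTC Φ m n (k + 1)) :
    i.cD Φ m h₁ (η.hochIns Φ m k h₁ z) + η.hochIns Φ m k h₀ (i.cD Φ m h₀ z) + sg k • z ∈
      η.degLTC Φ m n k := by
  refine η.degLTC_hom ((i.cD Φ m h₁).comp (η.hochIns Φ m k h₁) +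
    (η.hochIns Φ m k h₀).comp (i.cD Φ m h₀) + sg k • AddMonoidHom.id _) _
    (fun p j hj hjk hjp a ha x => ?_) hz
  simp only [AddMonoidHom.add_apply, AddMonoidHom.comp_apply, AddMonoidHom.coe_smul, Pi.smul_apply,
    AddMonoidHom.id_apply]
  rw [η.cD_hochIns_add k h₁ h₀ p ha, add_assoc]
  refine add_mem ?_ ?_
  · rw [Φ.act_comp (h₃ := zero_add _) (h₄ := rfl)]
    exact η.l_act_mem_degLTC _ _ _ (η.insW_insZW_hochW_mem m _ hj (by omega) hjp)
  have e' : ∀ q ∈ Finset.range p, (j < k ∨ j = k ∧ q + 1 < p) →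
      l (q + 1) (a := a + (p - q - 1)) (by push_cast; omega) (Φ.act rfl
        (Φ.act (add_zero a) x (η.insW m p j hjp)) (η.hochCommW m k p q (by omega))) ∈
        η.degLTC Φ m n k := by
    intro q _ hq
    rw [Φ.act_comp (h₃ := zero_add _) (h₄ := rfl)]
    exact η.l_act_mem_degLTC _ _ _ (η.insW_hochCommW_mem m _ hj hjp hq)
  -- For `j < k` every term, including the multiple of the element itself, has a unit in an earlier
  -- place. For `j = k` the commutator lowering the index by one gives `-(-1)^k` times the element
  -- up to earlier units, and the added multiple cancels it.
  rcases Nat.lt_succ_iff_lt_or_eq.1 hjk with hjk | rfl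
  · exact add_mem (sum_mem fun q hq => e' q hq (.inl hjk)) (zsmul_mem
      (η.l_insW_mem_degLTC hj hjk hjp ha x) _)
  · obtain ⟨p, rfl⟩ : ∃ p', p = p' + 1 := ⟨p - 1, by omega⟩
    rw [Finset.sum_range_succ, add_assoc]
    refine add_mem (sum_mem fun q hq => ?_) ?_
    · rw [Finset.mem_range] at hq
      exact e' q (Finset.mem_range.2 (by omega)) (.inr ⟨rfl, by omega⟩)
    · have := η.l_act_mem_degLTC (add_zero a) ha x (η.insW_hochCommW_add_mem m (q := p)
        (by push_cast; omega) hj hjp)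
      rw [map_add, map_zsmul, map_add, map_zsmul] at this
      convert this using 2
      rw [Φ.act_comp (h₃ := zero_add _) (h₄ := rfl)]
      exact l_act_congr (by push_cast; ring) _ _ _ _ x fun c₀ hc => E.comp (zero_add _)
        (η.insW m (p + 1) j hjp) (η.hochCommW m j (p + 1) p (by push_cast at hc ⊢; omega))

/-- By `homotopy_mem`, a degenerate cycle is, up to sign and a boundary of a degenerate element, a
cycle with units in earlier places only. When no places are left it is zero. -/
theorem degLTC_acyclic {n₀ n₁ : ℤ} (h₁ : n + 1 = n₁) (h₀ : n₀ + 1 = n) (k : ℕ) :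
    ∀ z : HochGr Φ m n, z ∈ η.degLTC Φ m n (k + 1) → i.cD Φ m h₀ z = 0 →
      ∃ y ∈ η.degS Φ m n₁, i.cD Φ m h₁ y = z := by
  induction k with
  | zero =>
    intro z hz _
    have : z = 0 := η.degLTC_hom (AddMonoidHom.id _) ⊥ (fun p j hj hj' => by omega) hz
    exact ⟨0, zero_mem _, by rw [this, map_zero]⟩
  | succ k ih =>
    intro z hz hdz
    have hm := η.homotopy_mem h₁ h₀ hz
    rw [hdz, map_zero, add_zero] at hm
    have dd : ∀ x : HochGr Φ m n₁, i.cD Φ m h₀ (i.cD Φ m h₁ x) = 0 :=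
      fun x => ((i.cObj Φ).X m).d_d h₁ h₀ x
    obtain ⟨y, hy, e⟩ := ih _ hm (by rw [map_add, map_zsmul, hdz, dd, smul_zero, add_zero])
    refine ⟨sg (k + 1 : ℕ) • (y - η.hochIns Φ m (k + 1) h₁ z),
      zsmul_mem (sub_mem hy (η.hochIns_mem_degS (by omega) h₁ z)) _, ?_⟩
    rw [map_zsmul, map_sub, e, add_sub_cancel_left, smul_smul, sg_mul_self, one_smul]

/-- The projection from the Hochschild complex to the reduced Hochschild complex is a
quasi-isomorphism. -/
theorem proj_isQuasi (Φ : RMod E) : ((i.cObj Φ).proj (η.degSub Φ)).IsQuasi :=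
  RMod.proj_isQuasi _ _ fun _ _ _ _ h₁ h₀ x hx hdx => by
    obtain ⟨k, hk⟩ := η.exists_degLTC hx
    exact η.degLTC_acyclic h₁ h₀ k x hk hdx

end AInfUnit

/-! ### Reduced and unreduced formal operations are quasi-isomorphic. -/

/-- A natural morphism of degree `0` between dg-endofunctors of `Fun(E, Ch)`. -/
structure EndoMap {E : DGProp.{u}} (F G : EndoFun E) where
  app : ∀ Φ : RMod E, RHom (F.obj Φ) (G.obj Φ) 0
  nat : ∀ {Φ Φ' : RMod E} {t : ℤ} (θ : RHom Φ Φ' t),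
    RHom.comp (zero_add t) (app Φ') (F.map θ) = RHom.comp (add_zero t) (G.map θ) (app Φ)

namespace EndoMap

variable {E : DGProp.{u}} {F G : EndoFun E}

/-- The morphism is a quasi-isomorphism everywhere. -/
def IsQuasi (τ : EndoMap F G) : Prop := ∀ Φ, (τ.app Φ).IsQuasi

/-- The morphism of dg-functors `Eᵒᵖ → Ch` induced by evaluation at the representable functors. -/
def onRep (τ : EndoMap F G) (hτ : τ.IsQuasi) (m : ℕ) : LMap (F.onRep m) (G.onRep m) where
  app p k := (τ.app (rep E p)).ap (add_zero k)
  -- Naturality alone does not make a morphism of degree `0` a chain map, so the hypothesis `hτ`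
  -- enters already here.
  app_d h x := (hτ _ m).comm h x
  app_act {p' p a b c} h f x := by
    have e := congrArg (fun θ => RHom.ap θ (n := m) (by omega : b + a = c) x)
      (τ.nat (EndoFun.leftMul p' p a f))
    exact (RHom.comp_ap _ _ _ _ _ _ _).symm.trans (e.trans (RHom.comp_ap _ _ _ _ _ _ _))

theorem onRep_isQuasi (τ : EndoMap F G) (hτ : τ.IsQuasi) (m : ℕ) : (τ.onRep hτ m).IsQuasi :=
  fun p => hτ (rep E p) m

end EndoMap

namespace AInfUnit

variable {E : DGProp.{u}} {i : AInfMul E} (η : AInfUnit i)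

theorem proj_nat {Φ Φ' : RMod E} {t : ℤ} (θ : RHom Φ Φ' t) {m : ℕ} {k k' : ℤ} (h : k + t = k')
    (x : ((i.cObj Φ).X m).X k) :
    ((i.cObj Φ').proj (η.degSub Φ')).ap (add_zero k') ((i.C.map θ).ap h x) =
      (η.C.map θ).ap h (((i.cObj Φ).proj (η.degSub Φ)).ap (add_zero k) x) :=
  (RMod.proj_ap _ _ _ _).trans (((congrArg _ (RMod.proj_ap _ _ _ _)).trans
    (RMod.quotMap_ap (η.degSub Φ) (η.degSub Φ') (i.cMap θ) (η.cMap_mem θ) h x)).symm)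

/-- The comparison of the iterated Hochschild complex with its reduced version. -/
def iterProj : ∀ n, EndoMap (i.C.iter n) (η.C.iter n)
  | 0 =>
    { app := fun Φ => RHom.id Φ
      nat := by
        intro Φ Φ' t θ
        apply RHom.ext'; intro m k k' h x
        refine (RHom.comp_ap (Φ := Φ) (zero_add t) (RHom.id Φ') θ h h (add_zero _) x).trans
          (Eq.trans ?_ (RHom.comp_ap (Φ := Φ) (add_zero t) θ (RHom.id Φ) h (add_zero _) h x).symm)
        exact (RHom.id_ap _ _).trans (congrArg (θ.ap h) (RHom.id_ap (Φ := Φ) _ _).symm) }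
  | n + 1 =>
    -- The unreduced `C` is applied to the previous comparison before projecting, so it is enough
    -- that `C` itself preserves quasi-isomorphisms.
    { app := fun Φ => RHom.comp (zero_add 0)
        ((i.cObj ((η.C.iter n).obj Φ)).proj (η.degSub ((η.C.iter n).obj Φ)))
        (i.C.map ((iterProj n).app Φ))
      nat := by
        intro Φ Φ' t θ
        apply RHom.ext'; intro m k k' h x
        rw [RHom.comp_ap _ _ _ _ h (add_zero _), RHom.comp_ap _ _ _ _ (add_zero _) h]
        refine (RHom.comp_ap _ _ _ _ (add_zero _) (add_zero _) _).trans (Eq.trans ?_ (congrArg _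
          (RHom.comp_ap _ _ _ _ (add_zero _) (add_zero _) _)).symm)
        refine Eq.trans (congrArg _ ?_) (η.proj_nat ((η.C.iter n).map θ) h _)
        have e := congrArg (fun ϑ => (i.C.map ϑ).ap (n := m) h x) ((iterProj n).nat θ)
        simp only [EndoFun.map_comp] at e
        exact (RHom.comp_ap _ _ _ _ _ _ _).symm.trans (e.trans (RHom.comp_ap _ _ _ _ _ _ _)) }

theorem iterProj_isQuasi : ∀ n, (η.iterProj n).IsQuasi
  | 0 => fun Φ => RHom.id_isQuasi Φ
  | n + 1 => fun Φ => (η.proj_isQuasi _).comp ((iterProj_isQuasi n Φ).hoch i)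

/-- The complexes of reduced and of unreduced formal operations are quasi-isomorphic. -/
theorem natOps_quasiIsomorphic (m₁ n₁ m₂ n₂ : ℕ) :
    (η.NatOps m₁ n₁ m₂ n₂).QuasiIsomorphic (i.NatOps m₁ n₁ m₂ n₂) := by
  let K := i.C.iter n₂
  let K' := η.C.iter n₂
  let R := Represents.iterHoch i K m₂ n₁
  let R' := Represents.iterHoch i K' m₂ n₁
  let R'' := Represents.iterRedHoch η K' m₂ n₁
  -- The complex in the middle has the reduced target and the unreduced source. The representing
  -- complexes live in a smaller universe than the complexes of transformations, so each comparison
  -- passes through them and returns.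
  let mid : Cplx.{u + 1} := natCplx ((i.C.iter n₁).eval m₁) (K'.eval m₂)
  have t : ∀ {L : EndoFun E} {K : EndoFun E} {Ψ : LMod E}
      (R : Represents L.obj (fun θ => L.map θ) K m₂ Ψ) {e e' : ℤ} (h : e' + 1 = e)
      (x : (natCplx (L.eval m₁) (K.eval m₂)).X e),
      R.equiv L K m₁ m₂ e' ((natCplx (L.eval m₁) (K.eval m₂)).d h x) =
        (Ψ.X m₁).d h (R.equiv L K m₁ m₂ e x) := fun R _ _ h x => R.equiv_d _ _ m₁ m₂ h x
  -- Changes the source: the reduced iterated coHochschild complex is included in the unreduced one,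
  -- with the reduced target fixed.
  have q₁ : Cplx.QIso (η.NatOps m₁ n₁ m₂ n₂) mid :=
    ((Cplx.IsQuasi.addEquiv_symm (A := mid) (R'.equiv _ _ m₁ m₂) (t R')).comp
      ((η.iterIncl_isQuasi (K'.onRep m₂) n₁ m₁).comp
      (Cplx.IsQuasi.of_addEquiv (A := η.NatOps m₁ n₁ m₂ n₂) (R''.equiv _ _ m₁ m₂) (t R'')))).qIso
  -- Changes the target: the iterated coHochschild complex is applied to the projection onto the
  -- reduced iterated Hochschild complex.
  have q₂ : Cplx.QIso (i.NatOps m₁ n₁ m₂ n₂) mid :=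
    ((Cplx.IsQuasi.addEquiv_symm (A := mid) (R'.equiv _ _ m₁ m₂) (t R')).comp
      ((((η.iterProj n₂).onRep_isQuasi (η.iterProj_isQuasi n₂) m₂).iterD i n₁ m₁).comp
      (Cplx.IsQuasi.of_addEquiv (A := i.NatOps m₁ n₁ m₂ n₂) (R.equiv _ _ m₁ m₂) (t R)))).qIso
  exact .trans _ _ _ (.rel _ _ q₁) (.symm _ _ (.rel _ _ q₂))

end AInfUnit

/-! ### Splitting off the last entry of a tuple of block sizes. -/

section Tuples

theorem tot_zero (j : Fin 0 → ℕ) : tot j = 0 := Fin.sum_univ_zero _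

theorem deg_zero (j : Fin 0 → ℕ) : deg j = 0 := Fin.sum_univ_zero _

variable {n : ℕ} (j : Fin (n + 1) → ℕ)

theorem tot_init : tot j = tot (Fin.init j) + (j (Fin.last n) + 1) := Fin.sum_univ_castSucc _

theorem deg_init : deg j = deg (Fin.init j) + j (Fin.last n) := Fin.sum_univ_castSucc _

theorem sum_Iio_castSucc {M : Type*} [AddCommMonoid M] (g : Fin (n + 1) → M) (s : Fin n) :
    ∑ r ∈ Finset.Iio s.castSucc, g r = ∑ r ∈ Finset.Iio s, g r.castSucc := by
  rw [← Finset.filter_gt_eq_Iio, ← Finset.filter_gt_eq_Iio, Finset.sum_filter, Finset.sum_filter,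
    Fin.sum_univ_castSucc]
  simp [(Fin.castSucc_lt_last s).not_gt]

theorem sum_Ioi_castSucc {M : Type*} [AddCommMonoid M] (g : Fin (n + 1) → M) (s : Fin n) :
    ∑ r ∈ Finset.Ioi s.castSucc, g r = ∑ r ∈ Finset.Ioi s, g r.castSucc + g (Fin.last n) := by
  rw [← Finset.filter_lt_eq_Ioi, ← Finset.filter_lt_eq_Ioi, Finset.sum_filter, Finset.sum_filter,
    Fin.sum_univ_castSucc]
  simp [Fin.castSucc_lt_last]

theorem sum_Iio_last {M : Type*} [AddCommMonoid M] (g : Fin (n + 1) → M) :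
    ∑ r ∈ Finset.Iio (Fin.last n), g r = ∑ r, g (Fin.castSucc r) := by
  rw [← Finset.filter_gt_eq_Iio, Finset.sum_filter, Fin.sum_univ_castSucc]
  simp [Fin.castSucc_lt_last]

theorem sum_Ioi_last {M : Type*} [AddCommMonoid M] (g : Fin (n + 1) → M) :
    ∑ r ∈ Finset.Ioi (Fin.last n), g r = 0 := by
  rw [← Finset.filter_lt_eq_Ioi, Finset.sum_filter]
  exact Finset.sum_eq_zero fun r _ => if_neg (Fin.le_last r).not_gt

/-- The outermost construction owns the last block, so the sign at an earlier block does not see it.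
-/
theorem koszul_castSucc (s : Fin n) (q : ℕ) : koszul j s.castSucc q = koszul (Fin.init j) s q := by
  unfold koszul; rw [sum_Iio_castSucc]; rfl

theorem koszul_last (q : ℕ) :
    koszul j (Fin.last n) q = sg (deg (Fin.init j) * (j (Fin.last n) - q)) := by
  unfold koszul; rw [sum_Iio_last]; rfl

theorem init_update_castSucc (s : Fin n) (q : ℕ) :
    Fin.init (Function.update j s.castSucc q) = Function.update (Fin.init j) s q := by
  simp

theorem update_castSucc_last (s : Fin n) (q : ℕ) :
    Function.update j s.castSucc q (Fin.last n) = j (Fin.last n) :=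
  Function.update_of_ne (Fin.castSucc_lt_last s).ne' _ _

end Tuples

/-! ### The iterated coHochschild complex as a product over tuples. -/

/-- The transport along equalities of objects and of degrees. -/
def LMod.castX {E : DGProp.{u}} (Ψ : LMod E) {N N' : ℕ} {a a' : ℤ} (hN : N = N') (ha : a = a') :
    (Ψ.X N).X a →+ (Ψ.X N').X a' := by
  subst hN ha; exact AddMonoidHom.id _

/-- `Θ(m)` is identified with the product of the `Ψ((j₁ + 1) + ⋯ + (j_n + 1) + m)`, where the action of `E`
and the differential are those of the `n`-fold coHochschild complex. -/
structure CoExpansion {E : DGProp.{u}} (i : AInfMul E) (n : ℕ) (Θ Ψ : LMod E) where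
  ev : ∀ {m : ℕ} {e : ℤ} (j : Fin n → ℕ) {N : ℕ} {a : ℤ}, tot j + m = N → e + deg j = a →
    (Θ.X m).X e →+ (Ψ.X N).X a
  ev_act : ∀ {m m' : ℕ} {a b c : ℤ} (h : a + b = c) (f : (E.Hom m m').X a) (y : (Θ.X m').X b)
    (j : Fin n → ℕ) {N M : ℕ} {b' c' : ℤ} (hN : tot j + m = N) (hM : tot j + m' = M)
    (hb : b + deg j = b') (hc : c + deg j = c') (h' : a + b' = c'),
    ev j hN hc (Θ.act h f y) = sg (deg j * a) • Ψ.act h' (E.wh (tot j) 0 hN hM f) (ev j hM hb y)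
  ev_d : ∀ {m : ℕ} {e e' : ℤ} (h : e' + 1 = e) (y : (Θ.X m).X e) (j : Fin n → ℕ) {N : ℕ} {a a' : ℤ}
    (hN : tot j + m = N) (ha : e + deg j = a) (ha' : e' + deg j = a') (haa : a' + 1 = a),
    ev j hN ha' ((Θ.X m).d h y) = sg (deg j) • ((Ψ.X N).d haa (ev j hN ha y) -
      ∑ s : Fin n, ∑ q ∈ Finset.range (j s), koszul j s q •
        Ψ.act (a := j s - q - 1) (b := e + deg (Function.update j s q))
          (by rw [deg_update]; omega)
          (E.wh (∑ r ∈ Finset.Iio s, (j r + 1)) (∑ r ∈ Finset.Ioi s, (j r + 1) + m)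
            ((tot_split_self j s m).trans hN) (tot_split j s q m) (i.hoch (j s) q (by omega)))
          (ev (Function.update j s q) rfl rfl y))
  inj : ∀ {m : ℕ} {e : ℤ} (y : (Θ.X m).X e), (∀ j : Fin n → ℕ, ev j rfl rfl y = 0) → y = 0
  surj : ∀ {m : ℕ} {e : ℤ} (g : ∀ (j : Fin n → ℕ) (N : ℕ) (a : ℤ), tot j + m = N → e + deg j = a →
      (Ψ.X N).X a), ∃ y : (Θ.X m).X e, ∀ (j : Fin n → ℕ) (N : ℕ) (a : ℤ) (hN : tot j + m = N)
      (ha : e + deg j = a), ev j hN ha y = g j N a hN ha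

namespace CoExpansion

variable {E : DGProp.{u}} {i : AInfMul E} {n : ℕ} {Θ Ψ : LMod E}

/-- The trivial expansion. -/
def refl (i : AInfMul E) (Ψ : LMod E) : CoExpansion i 0 Ψ Ψ where
  ev j _ _ hN ha := Ψ.castX (by rw [tot_zero] at hN; omega) (by rw [deg_zero] at ha; omega)
  ev_act {m m' a b c} h f y j N M b' c' hN hM hb hc h' := by
    obtain rfl : m = N := by rw [tot_zero] at hN; omega
    obtain rfl : m' = M := by rw [tot_zero] at hM; omega
    obtain rfl : b = b' := by rw [deg_zero] at hb; omega
    obtain rfl : c = c' := by rw [deg_zero] at hc; omega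
    have e : E.wh (tot j) 0 hN hM f = f := by
      rw [E.wh_zero_right _ _ _ hN hM]
      -- `tot j` is `0` only by a proof, so it is generalized before being eliminated.
      have : ∀ t (ht : t = 0) (hN : t + m = m) (hM : t + m' = m'),
          E.tensor hN hM (zero_add a) (E.id t) f = f := by
        rintro _ rfl hN hM; exact E.id_tensor _ _ _ f
      exact this _ (tot_zero j) _ _
    have hs : sg (deg j * a) = 1 := by rw [deg_zero, zero_mul, sg_zero]
    rw [e, hs, one_smul]
    rfl
  ev_d {m e e'} h y j N a a' hN ha ha' haa := by
    obtain rfl : m = N := by rw [tot_zero] at hN; omega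
    obtain rfl : e = a := by rw [deg_zero] at ha; omega
    obtain rfl : e' = a' := by rw [deg_zero] at ha'; omega
    have hs : sg (deg j) = 1 := by rw [deg_zero, sg_zero]
    rw [Fin.sum_univ_zero, hs, one_smul, sub_zero]
    rfl
  inj {m e} y hy := by
    have := hy Fin.elim0
    have t : ∀ {N : ℕ} {a : ℤ} (hN : m = N) (ha : e = a), Ψ.castX hN ha y = 0 → y = 0 := by
      intro N a hN ha h; subst hN ha; exact h
    exact t _ _ this
  surj {m e} g := by
    refine ⟨g Fin.elim0 m e (by rw [tot_zero]; omega) (by rw [deg_zero]; omega), fun j N a hN ha => ?_⟩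
    obtain rfl : m = N := by rw [tot_zero] at hN; omega
    obtain rfl : e = a := by rw [deg_zero] at ha; omega
    obtain rfl : j = Fin.elim0 := Subsingleton.elim _ _
    rfl

/-- The value at a tuple, for an element of the coHochschild complex of `Θ`. -/
def cohochEv (R : CoExpansion i n Θ Ψ) {m : ℕ} {e : ℤ} (j : Fin (n + 1) → ℕ) {N : ℕ} {a : ℤ}
    (hN : tot j + m = N) (ha : e + deg j = a) : CohochGr Θ m e →+ (Ψ.X N).X a :=
  (R.ev (Fin.init j) (by rw [← hN, tot_init]; omega) (by rw [← ha, deg_init]; omega)).comp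
    (CohochGr.ev (j (Fin.last n)) rfl)

/-- With `Fin.init j` and the last entry given by equations, values can be compared at updated or
extended tuples, where these are known only after rewriting. -/
theorem cohochEv_eq (R : CoExpansion i n Θ Ψ) {m : ℕ} {e e₁ : ℤ} {j : Fin (n + 1) → ℕ}
    {j₁ : Fin n → ℕ} {p : ℕ} (hj : Fin.init j = j₁) (hp : j (Fin.last n) = p) {N : ℕ} {a : ℤ}
    (hN : tot j + m = N) (ha : e + deg j = a) (he : p + e = e₁) (hN' : tot j₁ + (p + 1 + m) = N)
    (ha' : e₁ + deg j₁ = a) (y : CohochGr Θ m e) :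
    R.cohochEv j hN ha y = R.ev j₁ hN' ha' (CohochGr.ev p he y) := by
  subst hj hp he; rfl

theorem act_wh_ev_congr (R : CoExpansion i n Θ Ψ) {m : ℕ} {e : ℤ} (y : (Θ.X m).X e)
    (j : Fin n → ℕ) {A A' B B' N M M' p q : ℕ} {b b' c t : ℤ} (hA : A = A') (hB : B = B')
    (h₁ : A + p + B = N) (h₂ : A + q + B = M) (h₁' : A' + p + B' = N) (h₂' : A' + q + B' = M')
    (hM : tot j + m = M) (hM' : tot j + m = M') (hb : e + deg j = b) (hb' : e + deg j = b')
    (ht : c + b = t) (ht' : c + b' = t) (f : (E.Hom p q).X c) :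
    Ψ.act ht (E.wh A B h₁ h₂ f) (R.ev j hM hb y) =
      Ψ.act ht' (E.wh A' B' h₁' h₂' f) (R.ev j hM' hb' y) := by
  subst hA hB hM hM' hb hb'; rfl

/-- The new block contributes `p |f|` to the exponent of the sign and the former blocks contribute
`deg (Fin.init j) |f|`; these add up to `deg j |f|`. -/
theorem cohochEv_act (R : CoExpansion i n Θ Ψ) {m m' : ℕ} {a b c : ℤ} (h : a + b = c)
    (f : (E.Hom m m').X a) (y : CohochGr Θ m' b) (j : Fin (n + 1) → ℕ) {N M : ℕ} {b' c' : ℤ}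
    (hN : tot j + m = N) (hM : tot j + m' = M) (hb : b + deg j = b') (hc : c + deg j = c')
    (h' : a + b' = c') : R.cohochEv j hN hc (AInfMul.dAct Θ h f y) =
      sg (deg j * a) • Ψ.act h' (E.wh (tot j) 0 hN hM f) (R.cohochEv j hM hb y) := by
  have t := tot_init j
  have t' := deg_init j
  rw [R.cohochEv_eq rfl rfl hN hc rfl (by omega) (by omega), R.cohochEv_eq rfl rfl hM hb rfl
    (by omega) (by omega), AInfMul.dAct_ev Θ h f y _ rfl rfl (by omega), map_zsmul,
    R.ev_act (hM := (by omega : _ = M)) (hb := (by omega : _ = b')) (h' := h'), smul_smul,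
    ← sg_add, DGProp.shiftW, E.wh_wh (A := tot j) (B := 0) (hA := t.symm) (hB := rfl) (h₁ := hN) (h₂ := hM)]
  congr 2
  rw [t']; ring

/-- The earlier blocks contribute through the differential of `Θ` and the last one through the outer
coHochschild differential. The Hochschild element of the latter has to pass the earlier blocks,
which is measured by `ev_act`. -/
theorem cohochEv_d (R : CoExpansion i n Θ Ψ) {m : ℕ} {e e' : ℤ} (h : e' + 1 = e)
    (y : CohochGr Θ m e) (j : Fin (n + 1) → ℕ) {N : ℕ} {a a' : ℤ} (hN : tot j + m = N)
    (ha : e + deg j = a) (ha' : e' + deg j = a') (haa : a' + 1 = a) :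
    R.cohochEv j hN ha' (i.dD Θ m h y) = sg (deg j) • ((Ψ.X N).d haa (R.cohochEv j hN ha y) -
      ∑ s : Fin (n + 1), ∑ q ∈ Finset.range (j s), koszul j s q •
        Ψ.act (a := j s - q - 1) (b := e + deg (Function.update j s q))
          (by rw [deg_update]; omega)
          (E.wh (∑ r ∈ Finset.Iio s, (j r + 1)) (∑ r ∈ Finset.Ioi s, (j r + 1) + m)
            ((tot_split_self j s m).trans hN) (tot_split j s q m) (i.hoch (j s) q (by omega)))
          (R.cohochEv (Function.update j s q) rfl rfl y)) := by
  have t := tot_init j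
  have t' := deg_init j
  rw [R.cohochEv_eq rfl rfl hN ha' rfl (by omega) (by omega),
    R.cohochEv_eq rfl rfl hN ha rfl (by omega) (by omega),
    i.dD_ev Θ m h y _ rfl rfl (by omega), map_zsmul, map_sub, map_sum,
    R.ev_d (a := a) (ha := by omega) (haa := haa), Fin.sum_univ_castSucc,
    show sg (deg j) = sg (deg (Fin.init j)) * sg (j (Fin.last n)) by rw [t', sg_add]]
  have e₁ : ∀ s : Fin n, ∀ q ∈ Finset.range (j s.castSucc), koszul j s.castSucc q •
        Ψ.act (a := j s.castSucc - q - 1) (b := e + deg (Function.update j s.castSucc q)) (c := a')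
          (by rw [deg_update]; omega)
          (E.wh (∑ r ∈ Finset.Iio s.castSucc, (j r + 1))
            (∑ r ∈ Finset.Ioi s.castSucc, (j r + 1) + m)
            ((tot_split_self j s.castSucc m).trans hN) (tot_split j s.castSucc q m)
            (i.hoch (j s.castSucc) q (by omega)))
          (R.cohochEv (Function.update j s.castSucc q) rfl rfl y) =
      koszul (Fin.init j) s q • Ψ.act (a := Fin.init j s - q - 1)
          (b := j (Fin.last n) + e + deg (Function.update (Fin.init j) s q))
          (by rw [deg_update]; omega)
          (E.wh (∑ r ∈ Finset.Iio s, (Fin.init j r + 1))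
            (∑ r ∈ Finset.Ioi s, (Fin.init j r + 1) + (j (Fin.last n) + 1 + m))
            ((tot_split_self (Fin.init j) s _).trans (by omega)) (tot_split (Fin.init j) s q _)
            (i.hoch (Fin.init j s) q (by omega)))
          (R.ev (Function.update (Fin.init j) s q) rfl rfl
            (CohochGr.ev (j (Fin.last n)) rfl y)) := by
    intro s q _
    have u := tot_init (Function.update j s.castSucc q)
    have u' := deg_init (Function.update j s.castSucc q)
    rw [init_update_castSucc, update_castSucc_last] at u u'
    rw [koszul_castSucc, R.cohochEv_eq (init_update_castSucc j s q) (update_castSucc_last j s q)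
      rfl rfl rfl (by omega) (by omega)]
    refine congrArg _ ?_
    exact R.act_wh_ev_congr _ _ (sum_Iio_castSucc _ s)
      (by rw [sum_Ioi_castSucc]; unfold Fin.init; omega) _ _ _ _ _ _ _ _ _ _ _
  -- The Hochschild element has degree `p - q - 1` with `p` the last entry, whereas the Koszul sign
  -- uses `p - q`. The discrepancy is the factor `sg (deg (Fin.init j))`, which later cancels
  -- against the overall sign.
  have e₂ : ∀ q ∈ Finset.range (j (Fin.last n)), koszul j (Fin.last n) q •
        Ψ.act (a := j (Fin.last n) - q - 1) (b := e + deg (Function.update j (Fin.last n) q))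
          (c := a') (by rw [deg_update]; omega)
          (E.wh (∑ r ∈ Finset.Iio (Fin.last n), (j r + 1))
            (∑ r ∈ Finset.Ioi (Fin.last n), (j r + 1) + m)
            ((tot_split_self j (Fin.last n) m).trans hN) (tot_split j (Fin.last n) q m)
            (i.hoch (j (Fin.last n)) q (by omega)))
          (R.cohochEv (Function.update j (Fin.last n) q) rfl rfl y) =
      sg (deg (Fin.init j)) • R.ev (N := N) (a := a') (Fin.init j) (by omega) (by omega)
        (Θ.act (a := j (Fin.last n) - q - 1) (b := q + e) (c := j (Fin.last n) + e') (by omega)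
          (i.hochW m (j (Fin.last n)) q (by omega)) (CohochGr.ev q rfl y)) := by
    intro q _
    have hi : Fin.init (Function.update j (Fin.last n) q) = Fin.init j := Fin.init_update_last _ _
    have hl : Function.update j (Fin.last n) q (Fin.last n) = q := Function.update_self _ _ _
    have u := tot_init (Function.update j (Fin.last n) q)
    have u' := deg_init (Function.update j (Fin.last n) q)
    rw [hi, hl] at u u'
    rw [koszul_last, R.cohochEv_eq hi hl rfl rfl rfl (by omega) (by omega),
      R.ev_act (M := tot (Fin.init j) + (q + 1 + m)) (b' := q + e + deg (Fin.init j)) (hM := rfl)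
        (hb := rfl) (h' := by omega), smul_smul, ← sg_add, AInfMul.hochW,
      E.wh_wh (A := tot (Fin.init j)) (B := m) (hA := rfl) (hB := rfl) (h₁ := by omega)
        (h₂ := by omega)]
    refine congrArg₂ (· • ·) (sg_congr ⟨0, by ring⟩) ?_
    exact R.act_wh_ev_congr _ _ (sum_Iio_last _) (by rw [sum_Ioi_last, zero_add])
      _ _ _ _ _ _ _ _ _ _ _
  rw [Finset.sum_congr rfl fun s _ => Finset.sum_congr rfl (e₁ s), Finset.sum_congr rfl e₂,
    ← Finset.smul_sum]
  -- The two sums over the earlier blocks are definitionally equal but not syntactically the same;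
  -- they are named and then identified.
  generalize h₁ : ∑ s : Fin n, (_ : (Ψ.X N).X a') = S₁
  generalize h₂ : ∑ s : Fin n, (_ : (Ψ.X N).X a') = S₁'
  obtain rfl : S₁ = S₁' := h₁.symm.trans h₂
  generalize ∑ q ∈ _, (_ : (Ψ.X N).X a') = S₂
  have := sg_mul_self (deg (Fin.init j))
  rw [← sub_sub, smul_sub _ _ (sg (deg (Fin.init j)) • S₂), smul_smul _ _ S₂,
    mul_right_comm, this, one_mul]
  module

/-- The coHochschild complex adds one index to an expansion. -/
def cohoch (R : CoExpansion i n Θ Ψ) : CoExpansion i (n + 1) (i.D Θ) Ψ where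
  ev j _ _ hN ha := R.cohochEv j hN ha
  ev_act h f y j _ _ _ _ hN hM hb hc h' := R.cohochEv_act h f y j hN hM hb hc h'
  ev_d h y j _ _ _ hN ha ha' haa := R.cohochEv_d h y j hN ha ha' haa
  inj {m e} y hy := by
    refine CohochGr.ev_ext (Ψ := Θ) (h' := 0) fun p a ha => ?_
    subst ha
    refine (R.inj _ fun j => ?_).trans (map_zero _).symm
    have hi : Fin.init (Fin.snoc (α := fun _ => ℕ) j p) = j := Fin.init_snoc _ _
    have hl : Fin.snoc (α := fun _ => ℕ) j p (Fin.last n) = p := Fin.snoc_last _ _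
    have t := tot_init (Fin.snoc (α := fun _ => ℕ) j p)
    have t' := deg_init (Fin.snoc (α := fun _ => ℕ) j p)
    rw [hi, hl] at t t'
    have h0 : ∀ {J : Fin (n + 1) → ℕ} {N : ℕ} {a : ℤ} (hN : tot J + m = N) (ha : e + deg J = a),
        R.cohochEv J hN ha y = 0 := by
      intro J N a hN ha; subst hN ha; exact hy J
    exact (R.cohochEv_eq hi hl (by omega) (by omega) rfl rfl rfl y).symm.trans (h0 _ _)
  surj {m e} g := by
    have t : ∀ (j : Fin n → ℕ) (p : ℕ), tot (Fin.snoc (α := fun _ => ℕ) j p) = tot j + (p + 1) := by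
      intro j p; rw [tot_init, Fin.init_snoc, Fin.snoc_last]
    have t' : ∀ (j : Fin n → ℕ) (p : ℕ), deg (Fin.snoc (α := fun _ => ℕ) j p) = deg j + p := by
      intro j p; rw [deg_init, Fin.init_snoc, Fin.snoc_last]
    choose y hy using fun p : ℕ => R.surj (m := p + 1 + m) (e := p + e) fun j N a hN ha =>
      g (Fin.snoc j p) N a (by rw [t]; omega) (by rw [t']; omega)
    refine ⟨y, fun j N a hN ha => ?_⟩
    refine (hy (j (Fin.last n)) (Fin.init j) N a _ _).trans ?_
    have : ∀ (J : Fin (n + 1) → ℕ) (hJ : J = j) (h₁ : tot J + m = N) (h₂ : e + deg J = a),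
        g J N a h₁ h₂ = g j N a hN ha := by
      rintro _ rfl _ _; rfl
    exact this _ (Fin.snoc_init_self j) _ _

/-- The iterated coHochschild complex as a product over tuples. -/
def iter (i : AInfMul E) (Ψ : LMod E) : ∀ n, CoExpansion i n (LMod.iter i.D n Ψ) Ψ
  | 0 => refl i Ψ
  | n + 1 => (iter i Ψ n).cohoch

end CoExpansion

/-! ### The iterated Hochschild complex as a direct sum over tuples. -/

/-- The transport along equalities of objects and of degrees. -/
def RMod.castX {E : DGProp.{u}} (Φ : RMod E) {N N' : ℕ} {a a' : ℤ} (hN : N = N') (ha : a = a') :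
    (Φ.X N).X a →+ (Φ.X N').X a' := by
  subst hN ha; exact AddMonoidHom.id _

/-- `Ξ(m)` is identified with the direct sum of the `Φ((k₁ + 1) + ⋯ + (k_n + 1) + m)`, where the action of `E`
and the differential are those of the `n`-fold Hochschild complex. -/
structure Expansion {E : DGProp.{u}} (i : AInfMul E) (n : ℕ) (Ξ Φ : RMod E) where
  lam : ∀ {m : ℕ} {e : ℤ} (k : Fin n → ℕ) {N : ℕ} {a : ℤ}, tot k + m = N → a + deg k = e →
    (Φ.X N).X a →+ (Ξ.X m).X e
  lam_act : ∀ {m m' : ℕ} {e b c : ℤ} (h : e + b = c) (k : Fin n → ℕ) {N M : ℕ} {a a' : ℤ}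
    (hN : tot k + m = N) (hM : tot k + m' = M) (ha : a + deg k = e) (ha' : a' + deg k = c)
    (h' : a + b = a') (x : (Φ.X N).X a) (f : (E.Hom m m').X b),
    Ξ.act h (lam k hN ha x) f = sg (deg k * b) • lam k hM ha' (Φ.act h' x (E.wh (tot k) 0 hN hM f))
  lam_d : ∀ {m : ℕ} {e e' : ℤ} (h : e' + 1 = e) (k : Fin n → ℕ) {N : ℕ} {a a' : ℤ}
    (hN : tot k + m = N) (ha : a + deg k = e) (ha' : a' + deg k = e') (haa : a' + 1 = a)
    (x : (Φ.X N).X a),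
    (Ξ.X m).d h (lam k hN ha x) = lam k hN ha' ((Φ.X N).d haa x) +
      ∑ s : Fin n, ∑ q ∈ Finset.range (k s), (sg a * koszul k s q) •
        lam (Function.update k s q) (a := e' - deg (Function.update k s q)) rfl
          (sub_add_cancel _ _)
          (Φ.act (b := k s - q - 1) (by rw [deg_update]; omega) x
            (E.wh (∑ r ∈ Finset.Iio s, (k r + 1)) (∑ r ∈ Finset.Ioi s, (k r + 1) + m)
              ((tot_split_self k s m).trans hN) (tot_split k s q m) (i.hoch (k s) q (by omega))))
  hom_ext : ∀ {m : ℕ} {e : ℤ} {B : Type u} [AddCommGroup B] {f g : (Ξ.X m).X e →+ B},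
    (∀ (k : Fin n → ℕ) (N : ℕ) (a : ℤ) (hN : tot k + m = N) (ha : a + deg k = e) (x : (Φ.X N).X a),
      f (lam k hN ha x) = g (lam k hN ha x)) → f = g
  lift : ∀ {m : ℕ} {e : ℤ} {B : Type u} [AddCommGroup B] (F : ∀ (k : Fin n → ℕ) (N : ℕ) (a : ℤ),
    tot k + m = N → a + deg k = e → ((Φ.X N).X a →+ B)), ∃ f : (Ξ.X m).X e →+ B,
    ∀ (k : Fin n → ℕ) (N : ℕ) (a : ℤ) (hN : tot k + m = N) (ha : a + deg k = e) (x : (Φ.X N).X a),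
      f (lam k hN ha x) = F k N a hN ha x

namespace Expansion

variable {E : DGProp.{u}} {i : AInfMul E} {n : ℕ} {Ξ Φ : RMod E}

/-- The trivial expansion. -/
def refl (i : AInfMul E) (Φ : RMod E) : Expansion i 0 Φ Φ where
  lam k _ _ hN ha := Φ.castX (by rw [tot_zero] at hN; omega) (by rw [deg_zero] at ha; omega)
  lam_act {m m' e b c} h k N M a a' hN hM ha ha' h' x f := by
    obtain rfl : m = N := by rw [tot_zero] at hN; omega
    obtain rfl : m' = M := by rw [tot_zero] at hM; omega
    obtain rfl : e = a := by rw [deg_zero] at ha; omega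
    obtain rfl : c = a' := by rw [deg_zero] at ha'; omega
    have e : E.wh (tot k) 0 hN hM f = f := by
      rw [E.wh_zero_right _ _ _ hN hM]
      have : ∀ t (ht : t = 0) (hN : t + m = m) (hM : t + m' = m'),
          E.tensor hN hM (zero_add b) (E.id t) f = f := by
        rintro _ rfl hN hM; exact E.id_tensor _ _ _ f
      exact this _ (tot_zero k) _ _
    have hs : sg (deg k * b) = 1 := by rw [deg_zero, zero_mul, sg_zero]
    rw [e, hs, one_smul]
    rfl
  lam_d {m e e'} h k N a a' hN ha ha' haa x := by
    obtain rfl : m = N := by rw [tot_zero] at hN; omega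
    obtain rfl : e = a := by rw [deg_zero] at ha; omega
    obtain rfl : e' = a' := by rw [deg_zero] at ha'; omega
    rw [Fin.sum_univ_zero]
    exact (add_zero _).symm
  hom_ext {m e B _ f g} H := by
    ext x
    exact H Fin.elim0 m e (by rw [tot_zero]; omega) (by rw [deg_zero]; omega) x
  lift {m e B _} F := by
    refine ⟨F Fin.elim0 m e (by rw [tot_zero]; omega) (by rw [deg_zero]; omega),
      fun k N a hN ha x => ?_⟩
    obtain rfl : m = N := by rw [tot_zero] at hN; omega
    obtain rfl : e = a := by rw [deg_zero] at ha; omega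
    obtain rfl : k = Fin.elim0 := Subsingleton.elim _ _
    rfl

/-- The inclusion of the summand of a tuple in the Hochschild complex of `Ξ`. -/
def hochLam (R : Expansion i n Ξ Φ) {m : ℕ} {e : ℤ} (k : Fin (n + 1) → ℕ) {N : ℕ} {a : ℤ}
    (hN : tot k + m = N) (ha : a + deg k = e) : (Φ.X N).X a →+ HochGr Ξ m e :=
  (HochGr.l (a := a + deg (Fin.init k)) (k (Fin.last n)) (by rw [← ha, deg_init]; omega)).comp
    (R.lam (Fin.init k) (by rw [← hN, tot_init]; omega) rfl)

theorem hochLam_eq (R : Expansion i n Ξ Φ) {m : ℕ} {e e₁ : ℤ} {k : Fin (n + 1) → ℕ}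
    {k₁ : Fin n → ℕ} {p : ℕ} (hk : Fin.init k = k₁) (hp : k (Fin.last n) = p) {N : ℕ} {a : ℤ}
    (hN : tot k + m = N) (ha : a + deg k = e) (he : e₁ + p = e) (hN' : tot k₁ + (p + 1 + m) = N)
    (ha' : a + deg k₁ = e₁) (x : (Φ.X N).X a) :
    R.hochLam k hN ha x = HochGr.l p he (R.lam k₁ hN' ha' x) := by
  subst hk hp ha'; rfl

theorem lam_act_wh_congr (R : Expansion i n Ξ Φ) {m : ℕ} {e : ℤ} (k : Fin n → ℕ)
    {A A' B B' N M M' p q : ℕ} {a b b' c : ℤ} (hA : A = A') (hB : B = B')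
    (h₁ : A + p + B = N) (h₂ : A + q + B = M) (h₁' : A' + p + B' = N) (h₂' : A' + q + B' = M')
    (hM : tot k + m = M) (hM' : tot k + m = M') (hb : b + deg k = e) (hb' : b' + deg k = e)
    (hc : a + c = b) (hc' : a + c = b') (x : (Φ.X N).X a) (f : (E.Hom p q).X c) :
    R.lam k hM hb (Φ.act hc x (E.wh A B h₁ h₂ f)) =
      R.lam k hM' hb' (Φ.act hc' x (E.wh A' B' h₁' h₂' f)) := by
  subst hA hB hM hM' hc hc'; rfl

theorem hochLam_act (R : Expansion i n Ξ Φ) {m m' : ℕ} {e b c : ℤ} (h : e + b = c)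
    (k : Fin (n + 1) → ℕ) {N M : ℕ} {a a' : ℤ} (hN : tot k + m = N) (hM : tot k + m' = M)
    (ha : a + deg k = e) (ha' : a' + deg k = c) (h' : a + b = a') (x : (Φ.X N).X a)
    (f : (E.Hom m m').X b) : AInfMul.cAct Ξ h (R.hochLam k hN ha x) f =
      sg (deg k * b) • R.hochLam k hM ha' (Φ.act h' x (E.wh (tot k) 0 hN hM f)) := by
  have t := tot_init k
  have t' := deg_init k
  rw [R.hochLam_eq rfl rfl hN ha (e₁ := a + deg (Fin.init k)) (by omega) (by omega) rfl,
    R.hochLam_eq rfl rfl hM ha' (e₁ := a' + deg (Fin.init k)) (by omega) (by omega) rfl,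
    AInfMul.cAct_l Ξ h _ _ (e' := a' + deg (Fin.init k)) (by omega) (by omega),
    R.lam_act (hM := (by omega : _ = M)) (a' := a') (ha' := rfl) (h' := h'), map_zsmul, smul_smul,
    ← sg_add, DGProp.shiftW,
    E.wh_wh (A := tot k) (B := 0) (hA := t.symm) (hB := rfl) (h₁ := hN) (h₂ := hM)]
  congr 2
  rw [t']; ring

theorem hochLam_castSucc (R : Expansion i n Ξ Φ) {m : ℕ} {e' : ℤ} (k : Fin (n + 1) → ℕ) {N : ℕ}
    {a a' : ℤ} (hN : tot k + m = N) (ha' : a' + deg k = e') (haa : a' + 1 = a) (x : (Φ.X N).X a)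
    (s : Fin n) (q : ℕ) :
    R.hochLam (Function.update k s.castSucc q) (a := e' - deg (Function.update k s.castSucc q)) rfl
      (sub_add_cancel _ _)
      (Φ.act (b := k s.castSucc - q - 1) (by rw [deg_update]; omega) x
        (E.wh (∑ r ∈ Finset.Iio s.castSucc, (k r + 1)) (∑ r ∈ Finset.Ioi s.castSucc, (k r + 1) + m)
          ((tot_split_self k s.castSucc m).trans hN) (tot_split k s.castSucc q m)
          (i.hoch (k s.castSucc) q (by omega)))) =
    HochGr.l (a := a' + deg (Fin.init k)) (k (Fin.last n)) (by rw [← ha', deg_init]; omega)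
      (R.lam (Function.update (Fin.init k) s q)
        (a := a' + deg (Fin.init k) - deg (Function.update (Fin.init k) s q)) rfl
        (sub_add_cancel _ _)
        (Φ.act (b := Fin.init k s - q - 1) (by rw [deg_update]; omega) x
          (E.wh (∑ r ∈ Finset.Iio s, (Fin.init k r + 1))
            (∑ r ∈ Finset.Ioi s, (Fin.init k r + 1) + (k (Fin.last n) + 1 + m))
            ((tot_split_self (Fin.init k) s _).trans (by rw [← hN, tot_init]; omega))
            (tot_split (Fin.init k) s q _) (i.hoch (Fin.init k s) q (by omega))))) := by
  have t := tot_init k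
  have t' := deg_init k
  have u := tot_init (Function.update k s.castSucc q)
  have u' := deg_init (Function.update k s.castSucc q)
  rw [init_update_castSucc, update_castSucc_last] at u u'
  rw [R.hochLam_eq (init_update_castSucc k s q) (update_castSucc_last k s q) rfl
    (sub_add_cancel _ _) (e₁ := a' + deg (Fin.init k)) (by omega) (by omega) (by omega)]
  refine congrArg _ ?_
  exact R.lam_act_wh_congr _ (sum_Iio_castSucc _ s)
    (by rw [sum_Ioi_castSucc]; unfold Fin.init; omega) _ _ _ _ _ _ _ _ _ _ x _

/-- Moving the Hochschild element past the earlier blocks gives the exponent with `p - q - 1`, where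
`p` is the last entry. The Koszul sign has `p - q`, hence the extra factor `sg (deg (Fin.init k))`.
-/
theorem hochLam_last (R : Expansion i n Ξ Φ) {m : ℕ} {e' : ℤ} (k : Fin (n + 1) → ℕ) {N : ℕ}
    {a a' : ℤ} (hN : tot k + m = N) (ha' : a' + deg k = e') (haa : a' + 1 = a) (x : (Φ.X N).X a)
    (q : ℕ) :
    koszul k (Fin.last n) q •
      R.hochLam (Function.update k (Fin.last n) q)
        (a := e' - deg (Function.update k (Fin.last n) q)) rfl (sub_add_cancel _ _)
        (Φ.act (b := k (Fin.last n) - q - 1) (by rw [deg_update]; omega) x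
          (E.wh (∑ r ∈ Finset.Iio (Fin.last n), (k r + 1))
            (∑ r ∈ Finset.Ioi (Fin.last n), (k r + 1) + m)
            ((tot_split_self k (Fin.last n) m).trans hN) (tot_split k (Fin.last n) q m)
            (i.hoch (k (Fin.last n)) q (by omega)))) =
    sg (deg (Fin.init k)) • HochGr.l (a := a + deg (Fin.init k) + (k (Fin.last n) - q - 1)) q
      (by rw [← ha', deg_init]; omega)
      (Ξ.act rfl (R.lam (Fin.init k) (by rw [← hN, tot_init]; omega) rfl x)
        (i.hochW m (k (Fin.last n)) q (by omega))) := by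
  have t := tot_init k
  have t' := deg_init k
  have hi : Fin.init (Function.update k (Fin.last n) q) = Fin.init k := Fin.init_update_last _ _
  have hl : Function.update k (Fin.last n) q (Fin.last n) = q := Function.update_self _ _ _
  have u := tot_init (Function.update k (Fin.last n) q)
  have u' := deg_init (Function.update k (Fin.last n) q)
  rw [hi, hl] at u u'
  rw [koszul_last, R.hochLam_eq hi hl rfl (sub_add_cancel _ _)
      (e₁ := a + deg (Fin.init k) + (k (Fin.last n) - q - 1)) (by omega) (by omega) (by omega),
    R.lam_act (M := tot (Fin.init k) + (q + 1 + m)) (a' := a + (k (Fin.last n) - q - 1))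
      (hM := rfl) (ha' := by omega) (h' := rfl), map_zsmul, smul_smul, ← sg_add, AInfMul.hochW,
    E.wh_wh (A := tot (Fin.init k)) (B := m) (hA := rfl) (hB := rfl) (h₁ := by omega)
      (h₂ := by omega)]
  refine congrArg₂ (· • ·) (sg_congr ⟨0, by ring⟩) (congrArg _ ?_)
  exact R.lam_act_wh_congr _ (sum_Iio_last _) (by rw [sum_Ioi_last, zero_add])
    _ _ _ _ _ _ _ _ _ _ x _

/-- The factor left over in `hochLam_last` is supplied by the sign of the outer differential, since
the element of `Ξ` has degree `a + deg (Fin.init k)` rather than `a`. -/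
theorem hochLam_d (R : Expansion i n Ξ Φ) {m : ℕ} {e e' : ℤ} (h : e' + 1 = e)
    (k : Fin (n + 1) → ℕ) {N : ℕ} {a a' : ℤ} (hN : tot k + m = N) (ha : a + deg k = e)
    (ha' : a' + deg k = e') (haa : a' + 1 = a) (x : (Φ.X N).X a) :
    i.cD Ξ m h (R.hochLam k hN ha x) = R.hochLam k hN ha' ((Φ.X N).d haa x) +
      ∑ s : Fin (n + 1), ∑ q ∈ Finset.range (k s), (sg a * koszul k s q) •
        R.hochLam (Function.update k s q) (a := e' - deg (Function.update k s q)) rfl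
          (sub_add_cancel _ _)
          (Φ.act (b := k s - q - 1) (by rw [deg_update]; omega) x
            (E.wh (∑ r ∈ Finset.Iio s, (k r + 1)) (∑ r ∈ Finset.Ioi s, (k r + 1) + m)
              ((tot_split_self k s m).trans hN) (tot_split k s q m)
              (i.hoch (k s) q (by omega)))) := by
  have t := tot_init k
  have t' := deg_init k
  rw [R.hochLam_eq rfl rfl hN ha (e₁ := a + deg (Fin.init k)) (by omega) (by omega) rfl,
    R.hochLam_eq rfl rfl hN ha' (e₁ := a' + deg (Fin.init k)) (by omega) (by omega) rfl,
    i.cD_l Ξ m h _ _ (a' := a' + deg (Fin.init k)) (by omega) (by omega),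
    R.lam_d (ha' := rfl) (haa := haa), Fin.sum_univ_castSucc, map_add, map_sum, add_assoc]
  refine congrArg (HochGr.l _ _ _ + ·) (congrArg₂ (· + ·) (Finset.sum_congr rfl fun s _ => ?_) ?_)
  · rw [map_sum]
    refine Finset.sum_congr rfl fun q _ => ?_
    rw [koszul_castSucc, map_zsmul, R.hochLam_castSucc k hN ha' haa]
  · rw [Finset.smul_sum]
    refine Finset.sum_congr rfl fun q _ => ?_
    rw [mul_smul, R.hochLam_last k hN ha' haa, smul_smul, sg_add]

/-- The Hochschild complex adds one index to an expansion. -/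
def hoch (R : Expansion i n Ξ Φ) : Expansion i (n + 1) (i.cObj Ξ) Φ where
  lam k _ _ hN ha := R.hochLam k hN ha
  lam_act h k _ _ _ _ hN hM ha ha' h' x f := R.hochLam_act h k hN hM ha ha' h' x f
  lam_d h k _ _ _ hN ha ha' haa x := R.hochLam_d h k hN ha ha' haa x
  hom_ext {m e B _ f g} H := by
    refine HochGr.hom_ext (Φ := Ξ) fun p b hb z => ?_
    have : (f.comp (HochGr.l (Φ := Ξ) p hb)) = g.comp (HochGr.l (Φ := Ξ) p hb) := by
      refine R.hom_ext fun k N a hN ha x => ?_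
      have hi : Fin.init (Fin.snoc (α := fun _ => ℕ) k p) = k := Fin.init_snoc _ _
      have hl : Fin.snoc (α := fun _ => ℕ) k p (Fin.last n) = p := Fin.snoc_last _ _
      have t := tot_init (Fin.snoc (α := fun _ => ℕ) k p)
      have t' := deg_init (Fin.snoc (α := fun _ => ℕ) k p)
      rw [hi, hl] at t t'
      have := H (Fin.snoc (α := fun _ => ℕ) k p) N a (by omega) (by omega) x
      have e := R.hochLam_eq hi hl (by omega) (by omega) hb hN ha x
      exact (congrArg f e).symm.trans (this.trans (congrArg g e))
    exact DFunLike.congr_fun this z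
  lift {m e B _} F := by
    have t : ∀ (k : Fin n → ℕ) (p : ℕ), tot (Fin.snoc (α := fun _ => ℕ) k p) = tot k + (p + 1) := by
      intro k p; rw [tot_init, Fin.init_snoc, Fin.snoc_last]
    have t' : ∀ (k : Fin n → ℕ) (p : ℕ), deg (Fin.snoc (α := fun _ => ℕ) k p) = deg k + p := by
      intro k p; rw [deg_init, Fin.init_snoc, Fin.snoc_last]
    choose f hf using fun (p : ℕ) (b : ℤ) (hb : b + p = e) =>
      R.lift (m := p + 1 + m) (e := b) fun k N a hN ha =>
        F (Fin.snoc k p) N a (by rw [t]; omega) (by rw [t']; omega)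
    refine ⟨HochGr.lift f, fun k N a hN ha x => ?_⟩
    refine (HochGr.lift_l f _ (by rw [← ha, deg_init]; omega) _).trans ((hf _ _ _ (Fin.init k) N a _ _ x).trans ?_)
    have : ∀ (J : Fin (n + 1) → ℕ) (hJ : J = k) (h₁ : tot J + m = N) (h₂ : a + deg J = e),
        F J N a h₁ h₂ x = F k N a hN ha x := by
      rintro _ rfl _ _; rfl
    exact this _ (Fin.snoc_init_self k) _ _

/-- The iterated Hochschild complex as a direct sum over tuples. -/
def iter (i : AInfMul E) (Φ : RMod E) : ∀ n, Expansion i n ((i.C.iter n).obj Φ) Φ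
  | 0 => refl i Φ
  | n + 1 => (iter i Φ n).hoch

/-- Morphisms act on each summand without sign. Applied to left multiplications, this identifies the
left action of `E` on the iterated Hochschild complexes of the representable functors with `rowMul`.
-/
theorem iter_map (i : AInfMul E) {Φ Φ' : RMod E} {t : ℤ} (θ : RHom Φ Φ' t) : ∀ (n : ℕ) {m : ℕ} {e e' : ℤ}
    (h : e + t = e') (k : Fin n → ℕ) {N : ℕ} {a a' : ℤ} (hN : tot k + m = N) (ha : a + deg k = e)
    (ha' : a' + deg k = e') (haa : a + t = a') (x : (Φ.X N).X a),
    ((i.C.iter n).map θ).ap h ((iter i Φ n).lam k hN ha x) =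
      (iter i Φ' n).lam k hN ha' (θ.ap haa x)
  | 0, m, e, e', h, k, N, a, a', hN, ha, ha', haa, x => by
    obtain rfl : m = N := by rw [tot_zero] at hN; omega
    obtain rfl : e = a := by rw [deg_zero] at ha; omega
    obtain rfl : e' = a' := by rw [deg_zero] at ha'; omega
    rfl
  | n + 1, m, e, e', h, k, N, a, a', hN, ha, ha', haa, x => by
    have t := tot_init k
    have t' := deg_init k
    refine (i.cMap_ap _ h _).trans ?_
    refine (AInfMul.cMapGr_l ((i.C.iter n).map θ) m h (k (Fin.last n)) (by omega)
      (by omega : a + deg (Fin.init k) + _ = a' + deg (Fin.init k)) (by omega) _).trans ?_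
    exact congrArg _ (iter_map i θ n _ (Fin.init k) _ _ _ haa x)

/-- The map from the direct sum over all tuples. -/
def ofSum (R : Expansion i n Ξ Φ) (m : ℕ) (e : ℤ) :
    (DirectSum (Fin n → ℕ) fun k => (Φ.X (tot k + m)).X (e - deg k)) →+ (Ξ.X m).X e :=
  DirectSum.toAddMonoid fun k => R.lam k rfl (sub_add_cancel e (deg k))

theorem ofSum_of (R : Expansion i n Ξ Φ) (m : ℕ) (e : ℤ) (k : Fin n → ℕ)
    (x : (Φ.X (tot k + m)).X (e - deg k)) :
    R.ofSum m e (DirectSum.of (fun k : Fin n → ℕ => (Φ.X (tot k + m)).X (e - deg k)) k x) =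
      R.lam k rfl (sub_add_cancel e (deg k)) x :=
  DirectSum.toAddMonoid_of (β := fun k : Fin n → ℕ => (Φ.X (tot k + m)).X (e - deg k)) _ k x

/-- `lift` and `hom_ext` form the universal property of the direct sum, which provides the two-sided
inverse. -/
theorem ofSum_bijective (R : Expansion i n Ξ Φ) (m : ℕ) (e : ℤ) :
    Function.Bijective (R.ofSum m e) := by
  obtain ⟨f, hf⟩ := R.lift (m := m) (e := e) fun k N a hN ha =>
    (DirectSum.of (fun k : Fin n → ℕ => (Φ.X (tot k + m)).X (e - deg k)) k).comp
      (Φ.castX hN.symm (by omega))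
  have h₁ : f.comp (R.ofSum m e) = AddMonoidHom.id _ := by
    refine DirectSum.addHom_ext fun k x => ?_
    rw [AddMonoidHom.comp_apply, R.ofSum_of, hf]
    rfl
  have h₂ : (R.ofSum m e).comp f = AddMonoidHom.id _ := by
    refine R.hom_ext fun k N a hN ha x => ?_
    rw [AddMonoidHom.comp_apply, hf]
    obtain rfl : a = e - deg k := by omega
    subst hN
    exact R.ofSum_of m e k x
  exact ⟨Function.LeftInverse.injective (DFunLike.congr_fun h₁),
    Function.RightInverse.surjective (DFunLike.congr_fun h₂)⟩

end Expansion

/-! ### The explicit complex of formal operations. -/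

namespace AInfMul

variable {E : DGProp.{u}} (i : AInfMul E)

open Expansion in
theorem ofSum_rowD (N n m : ℕ) {a a' : ℤ} (h : a' + 1 = a) (r : Row E N n m a) :
    (iter i (rep E N) n).ofSum m a' (i.rowD N n m h r) =
      (((i.C.iter n).obj (rep E N)).X m).d h ((iter i (rep E N) n).ofSum m a r) := by
  refine DFunLike.congr_fun (?_ : ((iter i (rep E N) n).ofSum m a').comp (i.rowD N n m h) =
    ((((i.C.iter n).obj (rep E N)).X m).d h).comp ((iter i (rep E N) n).ofSum m a)) r
  refine DirectSum.addHom_ext fun k x => ?_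
  rw [AddMonoidHom.comp_apply, AddMonoidHom.comp_apply, ofSum_of,
    (iter i (rep E N) n).lam_d h k rfl _ (sub_add_cancel a' (deg k)) (by omega)]
  unfold rowD
  rw [DirectSum.toAddMonoid_of]
  simp only [AddMonoidHom.add_apply, AddMonoidHom.finsetSum_apply, AddMonoidHom.coe_smul,
    Pi.smul_apply, AddMonoidHom.comp_apply, AddMonoidHom.flip_apply, map_add, map_sum, map_zsmul]
  refine congrArg₂ (· + ·) (ofSum_of _ m a' k _) (Finset.sum_congr rfl fun s _ =>
    Finset.sum_congr rfl fun q _ => congrArg _ (ofSum_of _ m a' _ _))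

open Expansion in
theorem ofSum_rowMul {N' N : ℕ} (n m : ℕ) {a b c : ℤ} (h : a + b = c) (f : (E.Hom N' N).X a)
    (r : Row E N n m b) :
    (iter i (rep E N') n).ofSum m c (rowMul n m h f r) =
      ((i.C.iter n).onRep m).act h f ((iter i (rep E N) n).ofSum m b r) := by
  refine DFunLike.congr_fun (?_ : ((iter i (rep E N') n).ofSum m c).comp (rowMul n m h f) =
    (((i.C.iter n).onRep m).act h f).comp ((iter i (rep E N) n).ofSum m b)) r
  refine DirectSum.addHom_ext fun k x => ?_
  have e : rowMul n m h f (DirectSum.of _ k x) = DirectSum.of (fun k : Fin n → ℕ =>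
      (E.Hom N' (tot k + m)).X (c - deg k)) k (E.comp (by omega) f x) := by
    unfold rowMul
    rw [DirectSum.toAddMonoid_of]
    rfl
  refine (congrArg ((iter i (rep E N') n).ofSum m c) e).trans
    ((ofSum_of (iter i (rep E N') n) m c k _).trans (Eq.trans ?_ (congrArg (((i.C.iter n).onRep m).act h f)
    (ofSum_of (iter i (rep E N) n) m b k x)).symm))
  refine Eq.symm ((iter_map i (EndoFun.leftMul N' N a f) n (by omega) k rfl _
    (sub_add_cancel c (deg k)) (by omega) x).trans ?_)
  exact congrArg _ (EndoFun.leftMul_ap f _ _ x)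

/-- The iterated Hochschild complex of a representable functor is the direct sum over tuples. -/
noncomputable def rowEquiv (N n m : ℕ) (a : ℤ) :
    (((i.C.iter n).onRep m).X N).X a ≃+ Row E N n m a :=
  (AddEquiv.ofBijective _ ((Expansion.iter i (rep E N) n).ofSum_bijective m a)).symm

theorem rowEquiv_d (N n m : ℕ) {a a' : ℤ} (h : a' + 1 = a)
    (x : (((i.C.iter n).onRep m).X N).X a) :
    i.rowEquiv N n m a' ((((i.C.iter n).onRep m).X N).d h x) =
      i.rowD N n m h (i.rowEquiv N n m a x) := by
  obtain ⟨r, rfl⟩ := (i.rowEquiv N n m a).symm.surjective x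
  rw [AddEquiv.apply_symm_apply, ← AddEquiv.eq_symm_apply]
  exact (i.ofSum_rowD N n m h r).symm

theorem rowEquiv_act {N' N : ℕ} (n m : ℕ) {a b c : ℤ} (h : a + b = c) (f : (E.Hom N' N).X a)
    (x : (((i.C.iter n).onRep m).X N).X b) :
    i.rowEquiv N' n m c (((i.C.iter n).onRep m).act h f x) =
      rowMul n m h f (i.rowEquiv N n m b x) := by
  obtain ⟨r, rfl⟩ := (i.rowEquiv N n m b).symm.surjective x
  rw [AddEquiv.apply_symm_apply, ← AddEquiv.eq_symm_apply]
  exact (i.ofSum_rowMul n m h f r).symm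

end AInfMul

/-- The group of an expansion is the product over all tuples. -/
noncomputable def CoExpansion.equiv {E : DGProp.{u}} {i : AInfMul E} {n : ℕ} {Θ Ψ : LMod E}
    (R : CoExpansion i n Θ Ψ) (m : ℕ) (e : ℤ) :
    (Θ.X m).X e ≃+ ∀ j : Fin n → ℕ, (Ψ.X (tot j + m)).X (e + deg j) :=
  AddEquiv.ofBijective (AddMonoidHom.mk' (fun y j => R.ev j rfl rfl y) (by
    intro y y'; funext j; exact map_add _ _ _)) (by
    constructor
    · refine (injective_iff_map_eq_zero _).2 fun y hy => ?_
      exact R.inj y fun j => congrFun hy j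
    · intro g
      obtain ⟨y, hy⟩ := R.surj (m := m) (e := e) fun j N a hN ha => Ψ.castX hN ha (g j)
      exact ⟨y, funext fun j => hy j _ _ rfl rfl⟩)

/-- The explicit description of the complex of formal operations. -/
theorem AInfMul.natOps_explicit {E : DGProp.{u}} (i : AInfMul E) (m₁ n₁ m₂ n₂ : ℕ) :
    ∃ φ : ∀ e : ℤ, (i.NatOps m₁ n₁ m₂ n₂).X e ≃+ ExplGr E m₁ n₁ m₂ n₂ e,
      ∀ {e e' : ℤ} (h : e' + 1 = e) (x : (i.NatOps m₁ n₁ m₂ n₂).X e),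
        φ e' ((i.NatOps m₁ n₁ m₂ n₂).d h x) = i.explD m₁ n₁ m₂ n₂ h (φ e x) := by
  let Ψ := (i.C.iter n₂).onRep m₂
  let R := Represents.iterHoch i (i.C.iter n₂) m₂ n₁
  let S := CoExpansion.iter i Ψ n₁
  -- The coHochschild side is expanded first, as a product over `j`. Each factor is then an iterated
  -- Hochschild complex of a representable functor and becomes a direct sum over `k`.
  let T : ∀ e, ((LMod.iter i.D n₁ Ψ).X m₁).X e ≃+ ExplGr E m₁ n₁ m₂ n₂ e := fun e =>
    (S.equiv m₁ e).trans (AddEquiv.piCongrRight fun j => i.rowEquiv (tot j + m₁) n₂ m₂ (e + deg j))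
  have hT : ∀ {e e' : ℤ} (h : e' + 1 = e) (y : ((LMod.iter i.D n₁ Ψ).X m₁).X e),
      T e' (((LMod.iter i.D n₁ Ψ).X m₁).d h y) = i.explD m₁ n₁ m₂ n₂ h (T e y) := by
    intro e e' h y
    funext j
    -- At a fixed tuple the expanded differential consists of the internal one and left actions of
    -- Hochschild elements. `rowEquiv_d` and `rowEquiv_act` turn these into `rowD` and `rowMul`.
    have key := S.ev_d h y j rfl rfl rfl (by omega)
    refine (congrArg (i.rowEquiv (tot j + m₁) n₂ m₂ (e' + deg j)) key).trans ?_
    rw [map_zsmul, map_sub, map_sum, i.rowEquiv_d]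
    refine congrArg (sg (deg j) • (i.rowD (tot j + m₁) n₂ m₂ _ (T e y j) - ·))
      (Finset.sum_congr rfl fun s _ => ?_)
    rw [map_sum]
    refine Finset.sum_congr rfl fun q _ => ?_
    rw [map_zsmul, i.rowEquiv_act]
    rfl
  exact ⟨fun e => (R.equiv _ _ m₁ m₂ e).trans (T e), fun h x =>
    (congrArg (T _) (R.equiv_d _ _ m₁ m₂ h x)).trans (hT h _)⟩

end FormalOps

theorem theorem2p1 (E : FormalOps.DGProp.{u}) (i : FormalOps.AInfMul E) (m₁ n₁ m₂ n₂ : ℕ) :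
    (i.NatOps m₁ n₁ m₂ n₂).Isomorphic (i.DC m₁ n₁ m₂ n₂) ∧
    (∃ φ : ∀ e : ℤ, (i.NatOps m₁ n₁ m₂ n₂).X e ≃+ FormalOps.AInfMul.ExplGr E m₁ n₁ m₂ n₂ e,
      ∀ {e e' : ℤ} (h : e' + 1 = e) (x : (i.NatOps m₁ n₁ m₂ n₂).X e),
        φ e' ((i.NatOps m₁ n₁ m₂ n₂).d h x) = i.explD m₁ n₁ m₂ n₂ h (φ e x)) ∧
    ∀ η : FormalOps.AInfUnit i,
      (η.NatOps m₁ n₁ m₂ n₂).Isomorphic (η.DC m₁ n₁ m₂ n₂) ∧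
      (η.NatOps m₁ n₁ m₂ n₂).QuasiIsomorphic (i.NatOps m₁ n₁ m₂ n₂) := by
  exact ⟨i.natOps_isomorphic_DC m₁ n₁ m₂ n₂, i.natOps_explicit m₁ n₁ m₂ n₂, fun η =>
    ⟨η.natOps_isomorphic_DC m₁ n₁ m₂ n₂, η.natOps_quasiIsomorphic m₁ n₁ m₂ n₂⟩⟩
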